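/- Let $\alpha=(\alpha_0,\alpha_1,\alpha_2,\dots)$ be a sequence of nonnegative real numbers with finitely many nonzero entries, not all zero, and with $\alpha_0<1$, and let $L$ be the Denjoy weight $$L(s)=e^{\log^{\alpha_0}(s+1)}\prod_{k\ge 1}\log_k^{\alpha_k}\bigl(s+\exp_k(1)\bigr),\qquad s\ge 0,$$ where $\log_k$ and $\exp_k$ are the $k$-th iterates of $\log$ and $\exp$, and $0^0=1$. Let $\gamma(s)=L(s)^s$, extended analytically to the half-plane $\operatorname{Re}s>0$ (the branch which is positive on the positive ray), and let $\varepsilon(\rho)=\rho L'(\rho)/L(\rho)$. Let $I\subseteq\mathbb R$ be an open interval containing $0$. The Beurling class $C_0(L;I)$ consists of all $f\in C^\infty(I)$ (complex valued) such that for every compact interval $J\subset I$ and every $\delta>0$ there is $C>0$ with $\max_J|f^{(n)}|\le C(\delta nL(n))^n$ for all $n\ge0$. For a positive function $M$ defined on $(0,\infty)$ with $M(\rho)\to\infty$ and an interval $I\ni 0$ put $E_M(r)=\sum_{n\ge0}r^n/M(n+1)^{n+1}$; the class $A(M;I)$ consists of all entire functions $F$ such that for every $c_+\in I\cap(0,\infty)$,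 $c_-\in I\cap(-\infty,0)$ and $Y>0$ there is a constant $C$ with $\max_{|v|\le Y}|F(u+iv)|\le C\,E_M(u/c_\pm)$ for all sufficiently large $\pm u$. The singular transform of $f\in C_0(L;I)$ is $$S_Lf(z)=\sum_{n\ge0}\frac{f^{(n)}(0)}{n!\,\gamma(n+1)}z^n,$$ a series which converges for every $z\in\mathbb C$. The regular transform of an entire function $F$ is $R_LF(x)=\int_0^\infty F(xt)K(t)\,dt$, where $K(t)=\frac1{2\pi i}\int_{c-i\infty}^{c+i\infty}t^{-s}\gamma(s)\,ds$, with any $c>0$. Then: 1. If $L(\rho)=O(\log\rho)$ as $\rho\to\infty$, then $S_L$ maps $C_0(L;I)$ bijectively onto $A(L;I)$. Moreover, for every $f\in C_0(L;I)$, every $x\in I$ and every $c>0$, the integral defining $R_LS_Lf(x)$ converges absolutely and $R_LS_Lf(x)=f(x)$. 2. If $\log\rho=o(L(\rho))$ as $\rho\to\infty$, then $S_L$ maps $C_0(L;I)$ into $A(\tfrac1\varepsilon;\mathbb R)$. -/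

import Mathlib

open Set Filter Topology Asymptotics MeasureTheory
open scoped ContDiff

namespace BorelMap

noncomputable section

/-- Admissible multi-indices `α = (α₀, α₁, …)`: nonnegative, finitely many nonzero entries,
`α₀ < 1`, and not identically zero (for `α = 0` the weight below is constant,
whereas weights are required to tend to infinity). -/
def IsDenjoyIndex (α : ℕ →₀ ℝ) : Prop :=
  (∀ k, 0 ≤ α k) ∧ α 0 < 1 ∧ α ≠ 0

/-- The Denjoy weight
`L_α(s) = exp(log^{α₀}(s+1)) * ∏_{k ≥ 1} log_k^{α_k}(s + exp_k(1))` on `[0, ∞)`. -/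
def denjoyWeight (α : ℕ →₀ ℝ) (s : ℝ) : ℝ :=
  Real.exp (Real.log (s + 1) ^ α 0) *
    ∏ k ∈ α.support.erase 0, (Real.log^[k] (s + Real.exp^[k] 1)) ^ α k

/-- The analytic branch in the right half-plane of `log L_α`, real on the positive ray.
(All principal logarithms and powers below are evaluated in the right half-plane when
`0 < re s`.) -/
def denjoyLog (α : ℕ →₀ ℝ) (s : ℂ) : ℂ :=
  Complex.log (s + 1) ^ (α 0 : ℂ) +
    ∑ k ∈ α.support.erase 0,
      (α k : ℂ) * Complex.log (Complex.log^[k] (s + ((Real.exp^[k] 1 : ℝ) : ℂ)))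

/-- `γ(s) = L_α(s)^s` in the right half-plane. -/
def denjoyGamma (α : ℕ →₀ ℝ) (s : ℂ) : ℂ :=
  Complex.exp (s * denjoyLog α s)

/-- `γ(ρ) = L(ρ)^ρ` for a weight on the positive ray. -/
def gam (L : ℝ → ℝ) (ρ : ℝ) : ℝ := L ρ ^ ρ

/-- `E(r) = ∑_{n ≥ 0} r^n / γ(n+1)`. -/
def weightE (L : ℝ → ℝ) (r : ℝ) : ℝ :=
  ∑' n : ℕ, r ^ n / gam L ((n : ℝ) + 1)

/-- `ε(ρ) = ρ L'(ρ) / L(ρ)`. -/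
def eps (L : ℝ → ℝ) (ρ : ℝ) : ℝ := ρ * deriv L ρ / L ρ

/-- The Beurling class `C₀(L; I)` on an open interval `I`. Its elements are functions on `I`:
values outside `I` play no role, and two members are the same when they agree on `I`. -/
def beurlingClass (L : ℝ → ℝ) (I : Set ℝ) : Set (ℝ → ℂ) :=
  {f | ContDiffOn ℝ ∞ f I ∧
    ∀ a b : ℝ, Icc a b ⊆ I → ∀ δ : ℝ, 0 < δ → ∃ C : ℝ, 0 < C ∧
      ∀ n : ℕ, ∀ x ∈ Icc a b, ‖iteratedDeriv n f x‖ ≤ C * (δ * n * L n) ^ n}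

/-- The class `A(L; I)` of entire functions. -/
def entireClass (L : ℝ → ℝ) (I : Set ℝ) : Set (ℂ → ℂ) :=
  {F | Differentiable ℂ F ∧
    (∀ c ∈ I, 0 < c → ∀ Y : ℝ, 0 < Y → ∃ C : ℝ, ∀ᶠ u : ℝ in atTop, ∀ v : ℝ, |v| ≤ Y →
      ‖F (u + v * Complex.I)‖ ≤ C * weightE L (u / c)) ∧
    (∀ c ∈ I, c < 0 → ∀ Y : ℝ, 0 < Y → ∃ C : ℝ, ∀ᶠ u : ℝ in atBot, ∀ v : ℝ, |v| ≤ Y →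
      ‖F (u + v * Complex.I)‖ ≤ C * weightE L (u / c))}

/-- The `n`-th term `(f⁽ⁿ⁾(0) / n!) / γ(n+1) * z^n` of the singular transform. -/
def singularTerm (L : ℝ → ℝ) (f : ℝ → ℂ) (z : ℂ) (n : ℕ) : ℂ :=
  iteratedDeriv n f 0 / (n.factorial : ℂ) / (gam L ((n : ℝ) + 1) : ℂ) * z ^ n

/-- The singular transform `S_L f`. -/
def singularTransform (L : ℝ → ℝ) (f : ℝ → ℂ) (z : ℂ) : ℂ :=
  ∑' n : ℕ, singularTerm L f z n

/-- The kernel `K(t) = (1/2πi) ∫_{c-i∞}^{c+i∞} t^{-s} γ(s) ds`, for an abscissa `c > 0`. -/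
def kernelK (α : ℕ →₀ ℝ) (c t : ℝ) : ℂ := mellinInv c (denjoyGamma α) t

/-- The regular transform `(R_L F)(x) = ∫_0^∞ F(xt) K(t) dt`. -/
def regularTransform (α : ℕ →₀ ℝ) (c : ℝ) (F : ℂ → ℂ) (x : ℝ) : ℂ :=
  ∫ t in Ioi (0 : ℝ), F ((x * t : ℝ) : ℂ) * kernelK α c t

theorem log_iterate_aux (k : ℕ) : ∀ x : ℝ, Real.exp^[k] 1 ≤ x →
    1 ≤ Real.log^[k] x ∧ Complex.log^[k] (x : ℂ) = ((Real.log^[k] x : ℝ) : ℂ) := by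
  induction k with
  | zero => intro x hx; simpa using hx
  | succ k ih =>
    intro x hx
    rw [Function.iterate_succ_apply'] at hx
    have hx0 : 0 < x := (Real.exp_pos _).trans_le hx
    have h := ih (Real.log x) ((Real.le_log_iff_exp_le hx0).2 hx)
    rw [Function.iterate_succ_apply, Function.iterate_succ_apply,
      ← Complex.ofReal_log hx0.le]
    exact h

/-- `denjoyLog` extends `log L_α` from the positive ray. -/
theorem exp_denjoyLog (α : ℕ →₀ ℝ) {s : ℝ} (hs : 0 ≤ s) :
    denjoyLog α (s : ℂ) = ((Real.log (denjoyWeight α s) : ℝ) : ℂ) := by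
  have key : ∀ k : ℕ, 1 ≤ Real.log^[k] (s + Real.exp^[k] 1) ∧
      Complex.log^[k] ((s : ℂ) + ((Real.exp^[k] 1 : ℝ) : ℂ)) =
        ((Real.log^[k] (s + Real.exp^[k] 1) : ℝ) : ℂ) := by
    intro k
    rw [← Complex.ofReal_add]
    exact log_iterate_aux k _ (by linarith)
  have hpos : ∀ k : ℕ, 0 < Real.log^[k] (s + Real.exp^[k] 1) :=
    fun k => lt_of_lt_of_le one_pos (key k).1
  unfold denjoyLog denjoyWeight
  rw [Real.log_mul (Real.exp_pos _).ne'
    (Finset.prod_pos fun k _ => Real.rpow_pos_of_pos (hpos k) _).ne', Real.log_exp,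
    Real.log_prod fun k _ => (Real.rpow_pos_of_pos (hpos k) _).ne']
  push_cast
  congr 1
  · rw [← Complex.ofReal_one, ← Complex.ofReal_add, ← Complex.ofReal_log (by linarith),
      ← Complex.ofReal_cpow (Real.log_nonneg (by linarith))]
  · refine Finset.sum_congr rfl fun k _ => ?_
    rw [(key k).2, ← Complex.ofReal_log (hpos k).le, Real.log_rpow (hpos k)]
    push_cast
    rfl

end

end BorelMap

/-!
# Borel-type transforms of Beurling classes with Denjoy weights

*The singular transform has the right growth.* Bounding the derivatives by `(δ n L(n))^n` for every
`δ > 0` lets `f` be extended from a compact interval to functions on the upper and the lower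
half-plane whose `∂̄`-derivatives `D(x, y)` are very small near the real axis: truncate the Taylor
series at height `y` at the degree `n` with `L(n) ≈ 1/y` (`exists_extensionData`). Green's formula
with the Cauchy kernel then writes the Taylor coefficients of `f` as moments of `D`
(`integral_pow_sub_integral_pow_eq`), so that the singular transform becomes the superposition
`∫ D(ζ) ζ⁻¹ E(z/ζ)` over the two half-planes (`singularTransform_eq`). The entire function `E` is
large only in a thin sector around the positive ray: writing `E` as a Mellin–Barnes integral shows
`|E(w)| ≤ |w|^(-1/2) sectorBound θ` for `|arg w| ≥ θ` (`norm_weightEC_le_sectorBound`). For `z` in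
a horizontal strip the quotient `z/ζ` enters such a sector only when `ζ` is so close to the real
axis that `D` compensates the size of `E(z/ζ)`. The behaviour of `sectorBound θ` as `θ → 0` is
governed by `ε`, because `ε` controls the argument of `L` on vertical lines. When `L = O(log)` one has
`ε = O(1/L)` and the exponent lost in the sector is regained from `D`
(`exists_mul_sectorBound_le`); when `log = o(L)` the sector bound at angle `A/u` is dominated by the
series `E` of the weight `1/ε` (`exists_sectorBound_le_weightE`).

*The inverse.* If `L = O(log)` then `α₀ = 0`, and `γ` decays on vertical lines like
`exp(-c √|im s|)` (`exists_norm_denjoyGamma_le`). Hence the kernel `K` does not depend on the line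
of integration, `|K(t)| ≤ C γ(σ) t^(-σ) e^(ησ)` for all `σ > 0`, and Mellin inversion
gives `∫ tⁿ K(t) dt = γ(n+1)`. By the bound with `σ = m + 3`, `E(qt) |K(t)|` is integrable for
`q < 1`. For `F ∈ A(L; I)` Cauchy's estimates on large circles make all derivatives of
`x ↦ F(xt)` smaller than `(δ n L(n))^n E(qt)`, so that `R F` is in the Beurling class
(`regularTransform_mem_beurlingClass`), and the moments of `K` give `S R F = F`.

*Injectivity.* `S f` determines all derivatives of `f` at `0`, and since `∑ 1/(n L(n)) = ∞` the
class is quasianalytic (`eq_zero_of_flat`, by Bang's degree argument). The identity `R S f = f` is a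
consequence of `S R (S f) = S f`.
-/

namespace BorelMap

noncomputable section

/-! ### Iterated logarithms -/

/-- The tower `exp_k(1)`. -/
def tower (k : ℕ) : ℝ := Real.exp^[k] 1

/-- The real iterated logarithm `log_j (σ + exp_k(1))`; only `j ≤ k` is meaningful. -/
def rlog (k j : ℕ) (σ : ℝ) : ℝ := Real.log^[j] (σ + tower k)

/-- The complex iterated logarithm `log_j (s + exp_k(1))`; only `j ≤ k` is meaningful. -/
def clog (k j : ℕ) (s : ℂ) : ℂ := Complex.log^[j] (s + (tower k : ℂ))

theorem tower_succ (k : ℕ) : tower (k + 1) = Real.exp (tower k) :=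
  Function.iterate_succ_apply' _ _ _

theorem one_le_tower (k : ℕ) : 1 ≤ tower k := by
  induction k with
  | zero => simp [tower]
  | succ k ih =>
    rw [tower_succ]
    linarith [Real.add_one_le_exp (tower k)]

theorem exp_one_le_tower {k : ℕ} (hk : 1 ≤ k) : Real.exp 1 ≤ tower k := by
  obtain ⟨k, rfl⟩ := Nat.exists_eq_add_of_le' hk
  rw [tower_succ]
  exact Real.exp_le_exp.2 (one_le_tower k)

theorem rlog_zero (k : ℕ) (σ : ℝ) : rlog k 0 σ = σ + tower k := rfl

theorem rlog_succ (k j : ℕ) (σ : ℝ) : rlog k (j + 1) σ = Real.log (rlog k j σ) :=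
  Function.iterate_succ_apply' _ _ _

theorem clog_zero (k : ℕ) (s : ℂ) : clog k 0 s = s + (tower k : ℂ) := rfl

theorem clog_succ (k j : ℕ) (s : ℂ) : clog k (j + 1) s = Complex.log (clog k j s) :=
  Function.iterate_succ_apply' _ _ _

theorem tower_le_rlog {k j : ℕ} (hj : j ≤ k) {σ : ℝ} (hσ : 0 ≤ σ) :
    tower (k - j) ≤ rlog k j σ := by
  induction j with
  | zero => simpa [rlog_zero] using hσ
  | succ j ih =>
    have h := ih (by omega)
    rw [rlog_succ, Real.le_log_iff_exp_le ((zero_lt_one.trans_le (one_le_tower _)).trans_le h),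
      ← tower_succ]
    rwa [show k - (j + 1) + 1 = k - j by omega]

theorem one_le_rlog {k j : ℕ} (hj : j ≤ k) {σ : ℝ} (hσ : 0 ≤ σ) : 1 ≤ rlog k j σ :=
  (one_le_tower _).trans (tower_le_rlog hj hσ)

theorem rlog_pos {k j : ℕ} (hj : j ≤ k) {σ : ℝ} (hσ : 0 ≤ σ) : 0 < rlog k j σ :=
  zero_lt_one.trans_le (one_le_rlog hj hσ)

theorem rlog_mono {k j : ℕ} (hj : j ≤ k) {σ τ : ℝ} (hσ : 0 ≤ σ) (h : σ ≤ τ) :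
    rlog k j σ ≤ rlog k j τ := by
  induction j with
  | zero => simpa [rlog_zero] using h
  | succ j ih =>
    rw [rlog_succ, rlog_succ]
    exact Real.log_le_log (rlog_pos (by omega) hσ) (ih (by omega))

theorem tendsto_rlog (k j : ℕ) : Tendsto (rlog k j) atTop atTop := by
  induction j with
  | zero => exact tendsto_atTop_add_const_right _ _ tendsto_id
  | succ j ih =>
    have : rlog k (j + 1) = fun σ => Real.log (rlog k j σ) := funext (rlog_succ k j)
    rw [this]
    exact Real.tendsto_log_atTop.comp ih

theorem rlog_le_re_clog {k j : ℕ} (hj : j ≤ k) {s : ℂ} (hs : 0 ≤ s.re) :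
    rlog k j s.re ≤ (clog k j s).re := by
  induction j with
  | zero => simp [rlog_zero, clog_zero]
  | succ j ih =>
    rw [rlog_succ, clog_succ, Complex.log_re]
    exact Real.log_le_log (rlog_pos (by omega) hs)
      ((ih (by omega)).trans (Complex.re_le_norm _))

theorem one_le_re_clog {k j : ℕ} (hj : j ≤ k) {s : ℂ} (hs : 0 ≤ s.re) : 1 ≤ (clog k j s).re :=
  (one_le_rlog hj hs).trans (rlog_le_re_clog hj hs)

theorem differentiableAt_clog {k j : ℕ} (hj : j ≤ k) {s : ℂ} (hs : 0 ≤ s.re) :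
    DifferentiableAt ℂ (clog k j) s := by
  induction j with
  | zero => exact differentiableAt_id.add_const _
  | succ j ih =>
    have : clog k (j + 1) = fun σ => Complex.log (clog k j σ) := funext (clog_succ k j)
    rw [this]
    exact (ih (by omega)).clog (Or.inl (zero_lt_one.trans_le (one_le_re_clog (by omega) hs)))

theorem clog_conj {k j : ℕ} (hj : j ≤ k) {s : ℂ} (hs : 0 ≤ s.re) :
    clog k j (starRingEnd ℂ s) = starRingEnd ℂ (clog k j s) := by
  induction j with
  | zero => simp [clog_zero]
  | succ j ih =>
    rw [clog_succ, clog_succ, ih (by omega), Complex.log_conj]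
    intro h
    have := one_le_re_clog (show j ≤ k by omega) hs
    rw [Complex.arg_eq_pi_iff] at h
    linarith [h.1]

/-- In the right half-plane `arg z ≤ tan (arg z)`. -/
theorem arg_le_im_div_re {z : ℂ} (hre : 0 < z.re) (him : 0 ≤ z.im) :
    z.arg ≤ z.im / z.re := by
  rw [← Complex.tan_arg]
  have h1 : z.arg < Real.pi / 2 := Complex.arg_lt_pi_div_two_iff.2 (Or.inl hre)
  exact Real.le_tan (Complex.arg_nonneg_iff.2 him) h1

/-- In the right half-plane `sin (arg z) ≤ arg z`. -/
theorem im_div_norm_le_arg {z : ℂ} (him : 0 ≤ z.im) : z.im / ‖z‖ ≤ z.arg := by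
  rw [← Complex.sin_arg]
  exact Real.sin_le (Complex.arg_nonneg_iff.2 him)

theorem im_clog_nonneg {k j : ℕ} {s : ℂ} (hs : 0 ≤ s.im) : 0 ≤ (clog k j s).im := by
  induction j with
  | zero => simpa [clog_zero] using hs
  | succ j ih =>
    rw [clog_succ, Complex.log_im]
    exact Complex.arg_nonneg_iff.2 ih

theorem arg_clog_le_pi_div_two {k j : ℕ} (hj : j ≤ k) {s : ℂ} (hs : 0 ≤ s.re) :
    (clog k j s).arg ≤ Real.pi / 2 :=
  (Complex.arg_lt_pi_div_two_iff.2
    (Or.inl (zero_lt_one.trans_le (one_le_re_clog hj hs)))).le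

/-- The argument of the iterated logarithm decreases at least by the factors `1 / re log_i`. -/
theorem arg_clog_le {k j : ℕ} (hj : j ≤ k) {s : ℂ} (hs : 0 ≤ s.re) (hi : 0 ≤ s.im) :
    (clog k j s).arg ≤ (Real.pi / 2) / ∏ i ∈ Finset.range j, (clog k (i + 1) s).re := by
  induction j with
  | zero => simpa using arg_clog_le_pi_div_two hj hs
  | succ j ih =>
    have h1 := one_le_re_clog hj hs
    have h2 := arg_le_im_div_re (zero_lt_one.trans_le h1) (im_clog_nonneg hi)
    have h3 : (clog k (j + 1) s).im = (clog k j s).arg := by rw [clog_succ, Complex.log_im]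
    rw [h3] at h2
    rw [Finset.prod_range_succ, ← div_div]
    exact h2.trans (by gcongr; exact ih (by omega))

/-- The argument of the iterated logarithm decreases at most by the factors `1 / |log_i|`. -/
theorem le_arg_clog (k j : ℕ) {s : ℂ} (hi : 0 ≤ s.im) :
    (clog k 0 s).arg / ∏ i ∈ Finset.range j, ‖clog k (i + 1) s‖ ≤ (clog k j s).arg := by
  induction j with
  | zero => simp
  | succ j ih =>
    have h2 := im_div_norm_le_arg (z := clog k (j + 1) s) (im_clog_nonneg hi)
    have h3 : (clog k (j + 1) s).im = (clog k j s).arg := by rw [clog_succ, Complex.log_im]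
    rw [h3] at h2
    rw [Finset.prod_range_succ, ← div_div]
    exact le_trans (by gcongr) h2

/-- The logarithm is `1/x`-Lipschitz in the half-plane `re ≥ x`. -/
theorem norm_log_sub_log_le {x : ℝ} (hx : 0 < x) {w : ℂ} (hw : x ≤ w.re) :
    ‖Complex.log w - Complex.log (x : ℂ)‖ ≤ ‖w - x‖ / x := by
  have hconv : Convex ℝ {z : ℂ | x ≤ z.re} := convex_halfSpace_re_ge x
  have h := hconv.norm_image_sub_le_of_norm_hasDerivWithin_le (f := Complex.log)
    (f' := fun z => z⁻¹) (C := x⁻¹) (x := (x : ℂ)) (y := w)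
    (fun z hz => (Complex.hasDerivAt_log (Or.inl (hx.trans_le hz))).hasDerivWithinAt)
    (fun z hz => by
      rw [norm_inv]
      exact inv_anti₀ hx (le_trans hz (Complex.re_le_norm z))) (show x ≤ (x : ℂ).re from le_refl x) hw
  rwa [inv_mul_eq_div] at h

/-- The deviation of the iterated logarithm from its value on the real axis, in terms of the
deviation of the first logarithm. -/
theorem norm_clog_sub_rlog_le {k j : ℕ} (hj : j + 1 ≤ k) {s : ℂ} (hs : 0 ≤ s.re) :
    ‖clog k (j + 1) s - rlog k (j + 1) s.re‖ ≤
      ‖clog k 1 s - rlog k 1 s.re‖ / ∏ i ∈ Finset.range j, rlog k (i + 1) s.re := by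
  induction j with
  | zero => simp
  | succ j ih =>
    have hpos := rlog_pos (show j + 1 ≤ k by omega) hs
    rw [clog_succ, rlog_succ, Complex.ofReal_log hpos.le, Finset.prod_range_succ, ← div_div]
    refine (norm_log_sub_log_le hpos (rlog_le_re_clog (by omega) hs)).trans ?_
    gcongr
    exact ih (by omega)

/-- A lower bound that survives taking logarithms. -/
theorem log_ge_div {c x w : ℝ} (hc : 0 < c) (hc1 : c ≤ 1) (hx : Real.exp 1 ≤ x)
    (hw : Real.exp 1 ≤ w) (h : c * x ≤ w) :
    (1 + Real.log c⁻¹)⁻¹ * Real.log x ≤ Real.log w := by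
  have hx0 : 0 < x := (Real.exp_pos 1).trans_le hx
  have hw0 : 0 < w := (Real.exp_pos 1).trans_le hw
  have h1 : 1 ≤ Real.log w := (Real.le_log_iff_exp_le hw0).2 hw
  have h2 : Real.log c + Real.log x ≤ Real.log w := by
    rw [← Real.log_mul hc.ne' hx0.ne']
    exact Real.log_le_log (by positivity) h
  have ha : 0 ≤ Real.log c⁻¹ := Real.log_nonneg ((one_le_inv₀ hc).2 hc1)
  rw [Real.log_inv] at *
  rw [inv_mul_le_iff₀ (by linarith)]
  nlinarith

/-- High up in the right half-plane the iterated logarithms are comparable with those on the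
real axis. -/
theorem exists_le_re_clog (k : ℕ) {j : ℕ} (hj : j < k) :
    ∃ c : ℝ, 0 < c ∧ ∀ s : ℂ, 0 ≤ s.re → 0 ≤ s.im →
      c * rlog k (j + 1) s.im ≤ (clog k (j + 1) s).re := by
  have key : ∀ j, j < k → ∃ c : ℝ, 0 < c ∧ c ≤ 1 ∧ ∀ s : ℂ, 0 ≤ s.re → 0 ≤ s.im →
      c * rlog k j s.im ≤ ‖clog k j s‖ := by
    intro j
    induction j with
    | zero =>
      intro _
      refine ⟨2⁻¹, by norm_num, by norm_num, fun s hs hi => ?_⟩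
      have h1 := Complex.abs_re_le_norm (clog k 0 s)
      have h2 := Complex.abs_im_le_norm (clog k 0 s)
      have h3 := one_le_tower k
      simp only [clog_zero, rlog_zero, Complex.add_re, Complex.ofReal_re, Complex.add_im,
        Complex.ofReal_im, add_zero] at *
      rw [abs_of_nonneg (by linarith)] at h1
      rw [abs_of_nonneg hi] at h2
      linarith
    | succ j ih =>
      intro hjk
      obtain ⟨c, hc, hc1, h⟩ := ih (by omega)
      have ha : 0 ≤ Real.log c⁻¹ := Real.log_nonneg ((one_le_inv₀ hc).2 hc1)
      refine ⟨(1 + Real.log c⁻¹)⁻¹, by positivity, inv_le_one_of_one_le₀ (by linarith),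
        fun s hs hi => ?_⟩
      have e1 : Real.exp 1 ≤ tower (k - j) := exp_one_le_tower (by omega)
      have := log_ge_div hc hc1 (e1.trans (tower_le_rlog (by omega) hi))
        ((e1.trans (tower_le_rlog (by omega) hs)).trans
          ((rlog_le_re_clog (by omega) hs).trans (Complex.re_le_norm _))) (h s hs hi)
      rw [rlog_succ]
      refine this.trans ?_
      rw [← Complex.log_re, ← clog_succ]
      exact Complex.re_le_norm _
  obtain ⟨c, hc, hc1, h⟩ := key j hj
  have ha : 0 ≤ Real.log c⁻¹ := Real.log_nonneg ((one_le_inv₀ hc).2 hc1)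
  refine ⟨(1 + Real.log c⁻¹)⁻¹, by positivity, fun s hs hi => ?_⟩
  have e1 : Real.exp 1 ≤ tower (k - j) := exp_one_le_tower (by omega)
  have := log_ge_div hc hc1 (e1.trans (tower_le_rlog (by omega) hi))
    ((e1.trans (tower_le_rlog (by omega) hs)).trans
      ((rlog_le_re_clog (by omega) hs).trans (Complex.re_le_norm _))) (h s hs hi)
  rwa [rlog_succ, clog_succ, Complex.log_re]

/-! ### The Denjoy weight on the positive ray -/

/-- The real logarithm of the Denjoy weight. -/
def logWeight (α : ℕ →₀ ℝ) (s : ℝ) : ℝ :=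
  Real.log (s + 1) ^ α 0 + ∑ k ∈ α.support.erase 0, α k * Real.log (rlog k k s)

/-- The function `ρ ↦ ρ (log log_k (ρ + exp_k(1)))'`, the contribution of the `k`-th factor
to `ε`. -/
def epsTerm (k : ℕ) (ρ : ℝ) : ℝ := ρ / ∏ i ∈ Finset.range (k + 1), rlog k i ρ

theorem denjoyWeight_eq_exp (α : ℕ →₀ ℝ) {s : ℝ} (hs : 0 ≤ s) :
    denjoyWeight α s = Real.exp (logWeight α s) := by
  unfold denjoyWeight logWeight
  rw [Real.exp_add, Real.exp_sum]
  congr 1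
  refine Finset.prod_congr rfl fun k _ => ?_
  change rlog k k s ^ α k = _
  rw [Real.rpow_def_of_pos (rlog_pos le_rfl hs), mul_comm]

theorem hasDerivAt_rlog {k j : ℕ} (hj : j ≤ k) {ρ : ℝ} (hρ : 0 ≤ ρ) :
    HasDerivAt (rlog k j) (∏ i ∈ Finset.range j, rlog k i ρ)⁻¹ ρ := by
  induction j with
  | zero =>
    have : rlog k 0 = fun σ => σ + tower k := rfl
    simpa [this] using (hasDerivAt_id ρ).add_const (tower k)
  | succ j ih =>
    have : rlog k (j + 1) = fun σ => Real.log (rlog k j σ) := funext (rlog_succ k j)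
    rw [this, Finset.prod_range_succ, mul_inv, ← div_eq_mul_inv]
    exact (ih (by omega)).log (rlog_pos (by omega) hρ).ne'

theorem hasDerivAt_log_rlog (k : ℕ) {ρ : ℝ} (hρ : 0 < ρ) :
    HasDerivAt (fun σ => Real.log (rlog k k σ)) (epsTerm k ρ / ρ) ρ := by
  convert (hasDerivAt_rlog le_rfl hρ.le).log (rlog_pos le_rfl hρ.le).ne' using 1
  rw [epsTerm, Finset.prod_range_succ]
  have h1 := (rlog_pos (le_refl k) hρ.le).ne'
  have h2 : (∏ i ∈ Finset.range k, rlog k i ρ) ≠ 0 :=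
    Finset.prod_ne_zero_iff.2 fun i hi =>
      (rlog_pos (Finset.mem_range.1 hi).le hρ.le).ne'
  field_simp

/-- The explicit expression for `ε(ρ) = ρ L'(ρ) / L(ρ)`. -/
def epsFormula (α : ℕ →₀ ℝ) (ρ : ℝ) : ℝ :=
  α 0 * (ρ / (ρ + 1) * Real.log (ρ + 1) ^ (α 0 - 1)) +
    ∑ k ∈ α.support.erase 0, α k * epsTerm k ρ

theorem hasDerivAt_logWeight (α : ℕ →₀ ℝ) {ρ : ℝ} (hρ : 0 < ρ) :
    HasDerivAt (logWeight α) (epsFormula α ρ / ρ) ρ := by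
  have h0 : 0 < Real.log (ρ + 1) := Real.log_pos (by linarith)
  have h1 : HasDerivAt (fun s : ℝ => Real.log (s + 1)) (1 / (ρ + 1)) ρ := by
    simpa using ((hasDerivAt_id ρ).add_const (1 : ℝ)).log (by simp; linarith)
  have h2 := h1.rpow_const (p := α 0) (Or.inl h0.ne')
  have h3 : HasDerivAt (fun s => ∑ k ∈ α.support.erase 0, α k * Real.log (rlog k k s))
      (∑ k ∈ α.support.erase 0, α k * (epsTerm k ρ / ρ)) ρ :=
    HasDerivAt.fun_sum fun k _ => (hasDerivAt_log_rlog k hρ).const_mul (α k)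
  refine HasDerivAt.congr_deriv (f := logWeight α) (h2.add h3) ?_
  unfold epsFormula
  rw [add_div, Finset.sum_div]
  congr 1
  · field_simp
  · exact Finset.sum_congr rfl fun k _ => by ring

theorem eps_denjoyWeight (α : ℕ →₀ ℝ) {ρ : ℝ} (hρ : 0 < ρ) :
    eps (denjoyWeight α) ρ = epsFormula α ρ := by
  have h : HasDerivAt (denjoyWeight α) (Real.exp (logWeight α ρ) * (epsFormula α ρ / ρ)) ρ := by
    refine (hasDerivAt_logWeight α hρ).exp.congr_of_eventuallyEq ?_
    filter_upwards [lt_mem_nhds hρ] with s hs using denjoyWeight_eq_exp α hs.le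
  rw [eps, h.deriv, denjoyWeight_eq_exp α hρ.le]
  field_simp

theorem epsTerm_nonneg (k : ℕ) {ρ : ℝ} (hρ : 0 ≤ ρ) : 0 ≤ epsTerm k ρ :=
  div_nonneg hρ (Finset.prod_nonneg fun _ hi =>
    (rlog_pos (Nat.lt_succ_iff.1 (Finset.mem_range.1 hi)) hρ).le)

theorem epsTerm_le_inv {k : ℕ} (hk : 1 ≤ k) {ρ : ℝ} (hρ : 0 ≤ ρ) :
    epsTerm k ρ ≤ (rlog k 1 ρ)⁻¹ := by
  have h0 := rlog_pos (Nat.zero_le k) hρ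
  have h1 := rlog_pos hk hρ
  have h2 : rlog k 0 ρ * rlog k 1 ρ ≤ ∏ i ∈ Finset.range (k + 1), rlog k i ρ := by
    rw [← Finset.prod_range_mul_prod_Ico _ (show 2 ≤ k + 1 by omega)]
    rw [Finset.prod_range_succ, Finset.prod_range_one]
    refine le_mul_of_one_le_right (by positivity) ?_
    calc (1 : ℝ) = ∏ i ∈ Finset.Ico 2 (k + 1), 1 := by simp
      _ ≤ _ := Finset.prod_le_prod (fun _ _ => zero_le_one) fun i hi =>
        one_le_rlog (Nat.lt_succ_iff.1 (Finset.mem_Ico.1 hi).2) hρ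
  rw [epsTerm]
  calc ρ / ∏ i ∈ Finset.range (k + 1), rlog k i ρ
      ≤ rlog k 0 ρ / (rlog k 0 ρ * rlog k 1 ρ) := by
        gcongr
        rw [rlog_zero]
        linarith [one_le_tower k]
    _ = (rlog k 1 ρ)⁻¹ := by field_simp

theorem epsTerm_le_inv_log {k : ℕ} (hk : 1 ≤ k) {ρ : ℝ} (hρ : 0 ≤ ρ) :
    epsTerm k ρ ≤ (Real.log (ρ + Real.exp 1))⁻¹ := by
  refine (epsTerm_le_inv hk hρ).trans ?_
  have he := Real.exp_pos 1
  refine inv_anti₀ (zero_lt_one.trans_le ?_) ?_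
  · rw [Real.le_log_iff_exp_le (by linarith)]; linarith
  · rw [rlog_succ, rlog_zero]
    exact Real.log_le_log (by linarith) (by linarith [exp_one_le_tower hk])

theorem one_le_log_add_exp_one {ρ : ℝ} (hρ : 0 ≤ ρ) : 1 ≤ Real.log (ρ + Real.exp 1) := by
  have he := Real.exp_pos 1
  rw [Real.le_log_iff_exp_le (by linarith)]; linarith

/-- Iterated logarithms grow at most linearly in ratio. -/
theorem rlog_le_mul_rlog {k j : ℕ} (hj : j ≤ k) {a b : ℝ} (ha : 0 < a) (hab : a ≤ b) :
    rlog k j b ≤ (b / a) * rlog k j a := by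
  have hq : 1 ≤ b / a := (one_le_div ha).2 hab
  induction j with
  | zero =>
    rw [rlog_zero, rlog_zero, mul_add, div_mul_cancel₀ _ ha.ne']
    nlinarith [one_le_tower k]
  | succ j ih =>
    have h1 : Real.exp 1 ≤ rlog k j a :=
      (exp_one_le_tower (show 1 ≤ k - j by omega)).trans (tower_le_rlog (by omega) ha.le)
    have h1' := rlog_pos (show j ≤ k by omega) ha.le
    have h2 : 1 ≤ Real.log (rlog k j a) := (Real.le_log_iff_exp_le h1').2 h1
    rw [rlog_succ, rlog_succ]
    calc Real.log (rlog k j b) ≤ Real.log (b / a * rlog k j a) :=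
          Real.log_le_log (rlog_pos (by omega) (ha.le.trans hab)) (ih (by omega))
      _ = Real.log (b / a) + Real.log (rlog k j a) := by
          rw [Real.log_mul (by positivity) h1'.ne']
      _ ≤ (b / a - 1) + Real.log (rlog k j a) := by
          gcongr
          exact Real.log_le_sub_one_of_pos (by positivity)
      _ ≤ _ := by nlinarith

theorem epsTerm_doubling (k : ℕ) {a b : ℝ} (ha : 0 < a) (hab : a ≤ b) (hb : b ≤ 2 * a) :
    (2 ^ (k + 1))⁻¹ * epsTerm k a ≤ epsTerm k b := by
  have hpos : ∀ i ∈ Finset.range (k + 1), 0 < rlog k i a := fun i hi =>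
    rlog_pos (Nat.lt_succ_iff.1 (Finset.mem_range.1 hi)) ha.le
  have hposb : ∀ i ∈ Finset.range (k + 1), 0 < rlog k i b := fun _ hi =>
    rlog_pos (Nat.lt_succ_iff.1 (Finset.mem_range.1 hi)) (ha.le.trans hab)
  have h : ∏ i ∈ Finset.range (k + 1), rlog k i b ≤
      2 ^ (k + 1) * ∏ i ∈ Finset.range (k + 1), rlog k i a := by
    have := Finset.prod_le_prod (fun i hi => (hposb i hi).le)
      (g := fun i => 2 * rlog k i a) (s := Finset.range (k + 1)) (f := fun i => rlog k i b)
      fun i hi => (rlog_le_mul_rlog (Nat.lt_succ_iff.1 (Finset.mem_range.1 hi)) ha hab).trans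
        (by gcongr
            · exact (hpos i hi).le
            · rwa [div_le_iff₀ ha])
    simpa [Finset.prod_mul_distrib] using this
  have hA := Finset.prod_pos hpos
  have hB := Finset.prod_pos hposb
  rw [epsTerm, epsTerm]
  calc (2 ^ (k + 1))⁻¹ * (a / ∏ i ∈ Finset.range (k + 1), rlog k i a)
      = a / (2 ^ (k + 1) * ∏ i ∈ Finset.range (k + 1), rlog k i a) := by field_simp
    _ ≤ b / ∏ i ∈ Finset.range (k + 1), rlog k i b :=
        div_le_div₀ (ha.le.trans hab) hab hB h

theorem epsTerm_le_one {k : ℕ} (hk : 1 ≤ k) {ρ : ℝ} (hρ : 0 ≤ ρ) : epsTerm k ρ ≤ 1 :=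
  (epsTerm_le_inv hk hρ).trans (inv_le_one_of_one_le₀ (one_le_rlog hk hρ))

theorem one_le_of_mem_support_erase {α : ℕ →₀ ℝ} {k : ℕ} (hk : k ∈ α.support.erase 0) : 1 ≤ k :=
  Nat.one_le_iff_ne_zero.2 (Finset.ne_of_mem_erase hk)

theorem epsFormula_sum_nonneg {α : ℕ →₀ ℝ} (hα : IsDenjoyIndex α) {ρ : ℝ} (hρ : 0 ≤ ρ) :
    0 ≤ ∑ k ∈ α.support.erase 0, α k * epsTerm k ρ :=
  Finset.sum_nonneg fun k _ => mul_nonneg (hα.1 k) (epsTerm_nonneg k hρ)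

theorem epsFormula_zero_nonneg {α : ℕ →₀ ℝ} (hα : IsDenjoyIndex α) {ρ : ℝ} (hρ : 0 ≤ ρ) :
    0 ≤ α 0 * (ρ / (ρ + 1) * Real.log (ρ + 1) ^ (α 0 - 1)) :=
  mul_nonneg (hα.1 0) (mul_nonneg (by positivity)
    (Real.rpow_nonneg (Real.log_nonneg (by linarith)) _))

theorem epsFormula_nonneg {α : ℕ →₀ ℝ} (hα : IsDenjoyIndex α) {ρ : ℝ} (hρ : 0 ≤ ρ) :
    0 ≤ epsFormula α ρ :=
  add_nonneg (epsFormula_zero_nonneg hα hρ) (epsFormula_sum_nonneg hα hρ)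

theorem epsFormula_le {α : ℕ →₀ ℝ} (hα : IsDenjoyIndex α) {ρ : ℝ} (hρ : 0 < ρ) :
    epsFormula α ρ ≤ 1 + ∑ k ∈ α.support.erase 0, α k := by
  refine add_le_add ?_ (Finset.sum_le_sum fun k hk =>
    mul_le_of_le_one_right (hα.1 k) (epsTerm_le_one (one_le_of_mem_support_erase hk) hρ.le))
  have hx : 0 < Real.log (ρ + 1) := Real.log_pos (by linarith)
  have h1 : ρ / (ρ + 1) ≤ Real.log (ρ + 1) := by
    have := Real.one_sub_inv_le_log_of_pos (show 0 < ρ + 1 by linarith)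
    refine le_trans (le_of_eq ?_) this
    field_simp
    ring
  have h2 : ρ / (ρ + 1) ≤ 1 := by rw [div_le_one (by linarith)]; linarith
  have h3 : ρ / (ρ + 1) * Real.log (ρ + 1) ^ (α 0 - 1) ≤ 1 := by
    rcases le_total 1 (Real.log (ρ + 1)) with h | h
    · have := Real.rpow_le_one_of_one_le_of_nonpos h (show α 0 - 1 ≤ 0 by linarith [hα.2.1])
      exact mul_le_one₀ h2 (Real.rpow_nonneg hx.le _) this
    · calc ρ / (ρ + 1) * Real.log (ρ + 1) ^ (α 0 - 1)
          ≤ Real.log (ρ + 1) * Real.log (ρ + 1) ^ (α 0 - 1) := by gcongr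
        _ = Real.log (ρ + 1) ^ α 0 := by
            rw [Real.rpow_sub_one hx.ne']; field_simp
        _ ≤ 1 := Real.rpow_le_one hx.le h (hα.1 0)
  have h4 : 0 ≤ ρ / (ρ + 1) * Real.log (ρ + 1) ^ (α 0 - 1) := by positivity
  nlinarith [hα.1 0, hα.2.1]

theorem tendsto_epsFormula {α : ℕ →₀ ℝ} (hα : IsDenjoyIndex α) :
    Tendsto (epsFormula α) atTop (𝓝 0) := by
  have h1 : Tendsto (fun ρ : ℝ => Real.log (ρ + 1)) atTop atTop :=
    Real.tendsto_log_atTop.comp (tendsto_atTop_add_const_right _ _ tendsto_id)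
  have h2 : Tendsto (fun ρ : ℝ => Real.log (ρ + 1) ^ (α 0 - 1)) atTop (𝓝 0) := by
    have := (tendsto_rpow_neg_atTop (show 0 < 1 - α 0 by linarith [hα.2.1])).comp h1
    simpa [Function.comp_def] using this
  have h3 : Tendsto (fun ρ : ℝ => α 0 * (ρ / (ρ + 1) * Real.log (ρ + 1) ^ (α 0 - 1))) atTop
      (𝓝 0) := by
    have h4 : Tendsto (fun ρ : ℝ => ρ / (ρ + 1) * Real.log (ρ + 1) ^ (α 0 - 1)) atTop (𝓝 0) := by
      refine squeeze_zero' ?_ ?_ h2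
      · filter_upwards [eventually_ge_atTop 0] with ρ hρ
        exact mul_nonneg (by positivity) (Real.rpow_nonneg (Real.log_nonneg (by linarith)) _)
      · filter_upwards [eventually_ge_atTop 0] with ρ hρ
        refine mul_le_of_le_one_left (Real.rpow_nonneg (Real.log_nonneg (by linarith)) _) ?_
        rw [div_le_one (by linarith)]; linarith
    simpa using h4.const_mul (α 0)
  have h5 : ∀ k ∈ α.support.erase 0, Tendsto (fun ρ => α k * epsTerm k ρ) atTop (𝓝 0) := by
    intro k hk
    have h6 : Tendsto (epsTerm k) atTop (𝓝 0) := by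
      refine squeeze_zero' ?_ ?_ (tendsto_rlog k 1).inv_tendsto_atTop
      · filter_upwards [eventually_ge_atTop 0] with ρ hρ using epsTerm_nonneg k hρ
      · filter_upwards [eventually_ge_atTop 0] with ρ hρ using
          epsTerm_le_inv (one_le_of_mem_support_erase hk) hρ
    simpa using h6.const_mul (α k)
  have h7 := h3.add (tendsto_finsetSum _ h5)
  rw [Finset.sum_const_zero, add_zero] at h7
  exact h7

theorem epsFormula_doubling {α : ℕ →₀ ℝ} (hα : IsDenjoyIndex α) :
    ∃ c : ℝ, 0 < c ∧ ∀ a b : ℝ, 1 ≤ a → a ≤ b → b ≤ 2 * a →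
    c * epsFormula α a ≤ epsFormula α b := by
  set K := α.support.sup id
  refine ⟨(2 ^ (K + 1))⁻¹, by positivity, fun a b ha hab hb => ?_⟩
  have hc1 : ((2 : ℝ) ^ (K + 1))⁻¹ ≤ 2⁻¹ := by
    refine inv_anti₀ (by norm_num) ?_
    rw [pow_succ]
    nlinarith [one_le_pow₀ (show (1 : ℝ) ≤ 2 by norm_num) (n := K)]
  rw [epsFormula, epsFormula, mul_add]
  refine add_le_add ?_ ?_
  · have hla : 0 < Real.log (a + 1) := Real.log_pos (by linarith)
    have hlb : 0 < Real.log (b + 1) := Real.log_pos (by linarith)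
    have h1 : Real.log (b + 1) ≤ 2 * Real.log (a + 1) := by
      rw [← Real.log_rpow (by linarith)]
      refine Real.log_le_log (by linarith) ?_
      norm_cast
      nlinarith
    have h2 : 2⁻¹ * Real.log (a + 1) ^ (α 0 - 1) ≤ Real.log (b + 1) ^ (α 0 - 1) := by
      calc 2⁻¹ * Real.log (a + 1) ^ (α 0 - 1)
          ≤ 2 ^ (α 0 - 1) * Real.log (a + 1) ^ (α 0 - 1) := by
            gcongr
            rw [← Real.rpow_neg_one]
            exact Real.rpow_le_rpow_of_exponent_le (by norm_num) (by linarith [hα.1 0])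
        _ = (2 * Real.log (a + 1)) ^ (α 0 - 1) := by rw [Real.mul_rpow (by norm_num) hla.le]
        _ ≤ _ := Real.rpow_le_rpow_of_nonpos hlb h1 (by linarith [hα.2.1])
    have h3 : a / (a + 1) ≤ b / (b + 1) := by
      rw [div_le_div_iff₀ (by linarith) (by linarith)]; nlinarith
    calc (2 ^ (K + 1))⁻¹ * (α 0 * (a / (a + 1) * Real.log (a + 1) ^ (α 0 - 1)))
        ≤ 2⁻¹ * (α 0 * (a / (a + 1) * Real.log (a + 1) ^ (α 0 - 1))) := by
          gcongr
          exact epsFormula_zero_nonneg hα (by linarith)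
      _ = α 0 * (a / (a + 1) * (2⁻¹ * Real.log (a + 1) ^ (α 0 - 1))) := by ring
      _ ≤ α 0 * (b / (b + 1) * Real.log (b + 1) ^ (α 0 - 1)) := by
          have h4 := hα.1 0
          have h5 : 0 ≤ b / (b + 1) := div_nonneg (by linarith) (by linarith)
          gcongr
  · rw [Finset.mul_sum]
    refine Finset.sum_le_sum fun k hk => ?_
    have hkK : k ≤ K := Finset.le_sup (f := id) (Finset.mem_of_mem_erase hk)
    calc (2 ^ (K + 1))⁻¹ * (α k * epsTerm k a) = α k * ((2 ^ (K + 1))⁻¹ * epsTerm k a) := by ring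
      _ ≤ α k * ((2 ^ (k + 1))⁻¹ * epsTerm k a) := by
          have h1 := hα.1 k
          have h2 := epsTerm_nonneg k (show 0 ≤ a by linarith)
          gcongr
          norm_num
      _ ≤ α k * epsTerm k b :=
          mul_le_mul_of_nonneg_left (epsTerm_doubling k (by linarith) hab hb) (hα.1 k)

theorem logWeight_nonneg {α : ℕ →₀ ℝ} (hα : IsDenjoyIndex α) {s : ℝ} (hs : 0 ≤ s) :
    0 ≤ logWeight α s :=
  add_nonneg (Real.rpow_nonneg (Real.log_nonneg (by linarith)) _)
    (Finset.sum_nonneg fun k _ => mul_nonneg (hα.1 k) (Real.log_nonneg (one_le_rlog le_rfl hs)))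

theorem one_le_denjoyWeight {α : ℕ →₀ ℝ} (hα : IsDenjoyIndex α) {s : ℝ} (hs : 0 ≤ s) :
    1 ≤ denjoyWeight α s := by
  rw [denjoyWeight_eq_exp α hs]
  exact Real.one_le_exp (logWeight_nonneg hα hs)

theorem logWeight_mono {α : ℕ →₀ ℝ} (hα : IsDenjoyIndex α) {s t : ℝ} (hs : 0 ≤ s) (h : s ≤ t) :
    logWeight α s ≤ logWeight α t := by
  refine add_le_add (Real.rpow_le_rpow (Real.log_nonneg (by linarith))
    (Real.log_le_log (by linarith) (by linarith)) (hα.1 0)) (Finset.sum_le_sum fun k _ => ?_)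
  exact mul_le_mul_of_nonneg_left
    (Real.log_le_log (rlog_pos le_rfl hs) (rlog_mono le_rfl hs h)) (hα.1 k)

theorem denjoyWeight_mono {α : ℕ →₀ ℝ} (hα : IsDenjoyIndex α) {s t : ℝ} (hs : 0 ≤ s) (h : s ≤ t) :
    denjoyWeight α s ≤ denjoyWeight α t := by
  rw [denjoyWeight_eq_exp α hs, denjoyWeight_eq_exp α (hs.trans h)]
  exact Real.exp_le_exp.2 (logWeight_mono hα hs h)

theorem exists_pos_index {α : ℕ →₀ ℝ} (hα : IsDenjoyIndex α) (h0 : α 0 = 0) :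
    ∃ k ∈ α.support.erase 0, 0 < α k := by
  obtain ⟨k, hk⟩ := Finsupp.ne_iff.1 hα.2.2
  have hk' : α k ≠ 0 := by simpa using hk
  refine ⟨k, Finset.mem_erase.2 ⟨?_, Finsupp.mem_support_iff.2 hk'⟩,
    lt_of_le_of_ne (hα.1 k) (Ne.symm hk')⟩
  rintro rfl
  exact hk' h0

theorem tendsto_logWeight {α : ℕ →₀ ℝ} (hα : IsDenjoyIndex α) :
    Tendsto (logWeight α) atTop atTop := by
  have hl : Tendsto (fun ρ : ℝ => Real.log (ρ + 1)) atTop atTop :=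
    Real.tendsto_log_atTop.comp (tendsto_atTop_add_const_right _ _ tendsto_id)
  rcases (hα.1 0).eq_or_lt with h0 | h0
  · obtain ⟨k, hk, hpos⟩ := exists_pos_index hα h0.symm
    have h1 : Tendsto (fun s => α k * Real.log (rlog k k s)) atTop atTop :=
      (Real.tendsto_log_atTop.comp (tendsto_rlog k k)).const_mul_atTop hpos
    refine tendsto_atTop_mono' _ ?_ h1
    filter_upwards [eventually_ge_atTop 0] with s hs
    refine le_add_of_nonneg_of_le (Real.rpow_nonneg (Real.log_nonneg (by linarith)) _) ?_
    exact Finset.single_le_sum (f := fun k => α k * Real.log (rlog k k s))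
      (fun j _ => mul_nonneg (hα.1 j) (Real.log_nonneg (one_le_rlog le_rfl hs))) hk
  · refine tendsto_atTop_mono' _ ?_ ((tendsto_rpow_atTop h0).comp hl)
    filter_upwards [eventually_ge_atTop 0] with s hs
    exact le_add_of_nonneg_right (Finset.sum_nonneg fun j _ =>
      mul_nonneg (hα.1 j) (Real.log_nonneg (one_le_rlog le_rfl hs)))

theorem tendsto_denjoyWeight {α : ℕ →₀ ℝ} (hα : IsDenjoyIndex α) :
    Tendsto (denjoyWeight α) atTop atTop := by
  refine (Real.tendsto_exp_atTop.comp (tendsto_logWeight hα)).congr' ?_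
  filter_upwards [eventually_ge_atTop 0] with s hs using (denjoyWeight_eq_exp α hs).symm

/-- An upper bound for `ε` controls the ratio of the values of the weight. -/
theorem denjoyWeight_le_mul_rpow {α : ℕ →₀ ℝ} {p a b : ℝ} (ha : 0 < a) (hab : a ≤ b)
    (hp : ∀ ρ ∈ Icc a b, epsFormula α ρ ≤ p) :
    denjoyWeight α b ≤ denjoyWeight α a * (b / a) ^ p := by
  have hd : ∀ ρ ∈ Icc a b, HasDerivAt (fun ρ => logWeight α ρ - p * Real.log ρ)
      (epsFormula α ρ / ρ - p * ρ⁻¹) ρ := fun ρ hρ =>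
    (hasDerivAt_logWeight α (ha.trans_le hρ.1)).sub
      ((Real.hasDerivAt_log (ha.trans_le hρ.1).ne').const_mul p)
  have hanti : AntitoneOn (fun ρ => logWeight α ρ - p * Real.log ρ) (Icc a b) := by
    refine antitoneOn_of_deriv_nonpos (convex_Icc a b)
      (fun ρ hρ => (hd ρ hρ).continuousAt.continuousWithinAt)
      (fun ρ hρ => (hd ρ (interior_subset hρ)).differentiableAt.differentiableWithinAt)
      fun ρ hρ => ?_
    rw [(hd ρ (interior_subset hρ)).deriv, div_eq_mul_inv, ← sub_mul]
    have h0 : 0 < ρ := ha.trans_le (interior_subset hρ).1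
    exact mul_nonpos_of_nonpos_of_nonneg (sub_nonpos.2 (hp ρ (interior_subset hρ)))
      (by positivity)
  have h := hanti (left_mem_Icc.2 hab) (right_mem_Icc.2 hab) hab
  have hb : 0 < b := ha.trans_le hab
  rw [denjoyWeight_eq_exp α ha.le, denjoyWeight_eq_exp α hb.le,
    Real.rpow_def_of_pos (by positivity), ← Real.exp_add, Real.exp_le_exp,
    Real.log_div hb.ne' ha.ne']
  simp only at h
  linarith

theorem denjoyWeight_ratio {α : ℕ →₀ ℝ} (hα : IsDenjoyIndex α) :
    ∃ κ : ℝ, 0 < κ ∧ ∀ a b : ℝ, 0 < a → a ≤ b →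
    denjoyWeight α b ≤ denjoyWeight α a * (b / a) ^ κ := by
  refine ⟨1 + ∑ k ∈ α.support.erase 0, α k,
    add_pos_of_pos_of_nonneg one_pos (Finset.sum_nonneg fun k _ => hα.1 k), fun a b ha hab => ?_⟩
  exact denjoyWeight_le_mul_rpow ha hab fun ρ hρ => epsFormula_le hα (ha.trans_le hρ.1)

theorem denjoyWeight_ratio_small {α : ℕ →₀ ℝ} (hα : IsDenjoyIndex α) {p : ℝ} (hp : 0 < p) :
    ∃ C : ℝ, 1 ≤ C ∧ ∀ a b : ℝ, 1 ≤ a →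
    a ≤ b → denjoyWeight α b ≤ C * denjoyWeight α a * (b / a) ^ p := by
  obtain ⟨R, hR⟩ := eventually_atTop.1 ((tendsto_epsFormula hα).eventually_le_const hp)
  set R' := max R 1
  have hR1 : 1 ≤ R' := le_max_right _ _
  have hC := one_le_denjoyWeight hα (show 0 ≤ R' by linarith)
  refine ⟨denjoyWeight α R', hC, fun a b ha hab => ?_⟩
  have ha1 := one_le_denjoyWeight hα (show 0 ≤ a by linarith)
  have hq : 1 ≤ b / a := (one_le_div (by linarith)).2 hab
  have hq1 : 1 ≤ (b / a) ^ p := Real.one_le_rpow hq hp.le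
  rcases le_total R' a with h | h
  · refine (denjoyWeight_le_mul_rpow (by linarith) hab fun ρ hρ =>
      hR ρ ((le_max_left R 1).trans (h.trans hρ.1))).trans ?_
    gcongr
    nlinarith
  rcases le_total b R' with h' | h'
  · calc denjoyWeight α b ≤ denjoyWeight α R' := denjoyWeight_mono hα (by linarith) h'
      _ = denjoyWeight α R' * 1 * 1 := by ring
      _ ≤ _ := by gcongr
  · calc denjoyWeight α b ≤ denjoyWeight α R' * (b / R') ^ p :=
        denjoyWeight_le_mul_rpow (by linarith) h' fun ρ hρ =>
          hR ρ ((le_max_left R 1).trans hρ.1)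
      _ ≤ denjoyWeight α R' * (b / a) ^ p := by
          have hb : 0 ≤ b := by linarith
          gcongr
      _ = denjoyWeight α R' * 1 * (b / a) ^ p := by ring
      _ ≤ _ := by gcongr

theorem exp_rpow_log_le_denjoyWeight {α : ℕ →₀ ℝ} (hα : IsDenjoyIndex α) {s : ℝ} (hs : 0 ≤ s) :
    Real.exp (Real.log (s + 1) ^ α 0) ≤ denjoyWeight α s := by
  rw [denjoyWeight_eq_exp α hs]
  exact Real.exp_le_exp.2 (le_add_of_nonneg_right (Finset.sum_nonneg fun j _ =>
      mul_nonneg (hα.1 j) (Real.log_nonneg (one_le_rlog le_rfl hs))))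

theorem index_zero_of_isBigO_log {α : ℕ →₀ ℝ} (hα : IsDenjoyIndex α)
    (hL : denjoyWeight α =O[atTop] Real.log) : α 0 = 0 := by
  by_contra h0
  have h0 : 0 < α 0 := lt_of_le_of_ne (hα.1 0) (Ne.symm h0)
  obtain ⟨C, hC⟩ := hL.bound
  have h1 : Tendsto (fun s : ℝ => Real.log (s + 1)) atTop atTop :=
    Real.tendsto_log_atTop.comp (tendsto_atTop_add_const_right _ _ tendsto_id)
  have h2 := (tendsto_exp_div_rpow_atTop (1 / α 0)).comp ((tendsto_rpow_atTop h0).comp h1)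
  obtain ⟨s, hs, hs1, hs2⟩ := (hC.and ((eventually_ge_atTop 1).and
    (h2.eventually_gt_atTop (max C 0)))).exists
  have hlog : 0 < Real.log (s + 1) := Real.log_pos (by linarith)
  simp only [Function.comp] at hs2
  rw [← Real.rpow_mul hlog.le, mul_one_div_cancel h0.ne', Real.rpow_one, lt_div_iff₀ hlog] at hs2
  have h3 := exp_rpow_log_le_denjoyWeight hα (show 0 ≤ s by linarith)
  rw [Real.norm_of_nonneg (by linarith [one_le_denjoyWeight hα (show 0 ≤ s by linarith)]),
    Real.norm_of_nonneg (Real.log_nonneg hs1)] at hs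
  have h4 : Real.log s ≤ Real.log (s + 1) := Real.log_le_log (by linarith) (by linarith)
  have h5 : C * Real.log s ≤ max C 0 * Real.log (s + 1) :=
    mul_le_mul (le_max_left _ _) h4 (Real.log_nonneg hs1) (le_max_right _ _)
  linarith

theorem epsFormula_le_inv_log {α : ℕ →₀ ℝ} (hα : IsDenjoyIndex α) (h0 : α 0 = 0) {ρ : ℝ}
    (hρ : 0 ≤ ρ) :
    epsFormula α ρ ≤ (∑ k ∈ α.support.erase 0, α k) * (Real.log (ρ + Real.exp 1))⁻¹ := by
  rw [epsFormula, h0, zero_mul, zero_add, Finset.sum_mul]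
  exact Finset.sum_le_sum fun k hk => mul_le_mul_of_nonneg_left
    (epsTerm_le_inv_log (one_le_of_mem_support_erase hk) hρ) (hα.1 k)

/-- If the weight grows at most logarithmically, then `ε = O(1 / L)`. -/
theorem exists_epsFormula_mul_weight_le {α : ℕ →₀ ℝ} (hα : IsDenjoyIndex α)
    (hL : denjoyWeight α =O[atTop] Real.log) :
    ∃ C : ℝ, 0 < C ∧ ∀ ρ : ℝ, 1 ≤ ρ → epsFormula α ρ * denjoyWeight α ρ ≤ C := by
  have h0 := index_zero_of_isBigO_log hα hL
  obtain ⟨C, hC0, hC⟩ := hL.exists_pos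
  obtain ⟨R, hR⟩ := eventually_atTop.1 hC.bound
  set R' := max R 1
  set κ := 1 + ∑ k ∈ α.support.erase 0, α k
  have hσ : 0 ≤ ∑ k ∈ α.support.erase 0, α k := Finset.sum_nonneg fun k _ => hα.1 k
  have hκ : 0 < κ := by positivity
  have hR'1 : 1 ≤ R' := le_max_right _ _
  have hLR := one_le_denjoyWeight hα (show 0 ≤ R' by linarith)
  refine ⟨κ * denjoyWeight α R' + κ * C, by positivity, fun ρ hρ => ?_⟩
  have hL1 := one_le_denjoyWeight hα (show 0 ≤ ρ by linarith)
  rcases le_total ρ R' with h | h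
  · have h1 := epsFormula_le hα (show 0 < ρ by linarith)
    have h2 := denjoyWeight_mono hα (by linarith) h
    have : epsFormula α ρ * denjoyWeight α ρ ≤ κ * denjoyWeight α R' := by gcongr
    nlinarith [mul_pos hκ hC0]
  · have h1 := hR ρ ((le_max_left _ _).trans h)
    rw [Real.norm_of_nonneg (by linarith), Real.norm_of_nonneg (Real.log_nonneg hρ)] at h1
    have h2 := epsFormula_le_inv_log hα h0 (show 0 ≤ ρ by linarith)
    have h3 := one_le_log_add_exp_one (show 0 ≤ ρ by linarith)
    have h4 : Real.log ρ ≤ Real.log (ρ + Real.exp 1) :=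
      Real.log_le_log (by linarith) (by linarith [Real.exp_pos 1])
    have h5 : denjoyWeight α ρ ≤ C * Real.log (ρ + Real.exp 1) := h1.trans (by gcongr)
    calc epsFormula α ρ * denjoyWeight α ρ
        ≤ (κ * (Real.log (ρ + Real.exp 1))⁻¹) * (C * Real.log (ρ + Real.exp 1)) := by
          gcongr
          exact h2.trans (by gcongr; simp [κ])
      _ = κ * C := by field_simp
      _ ≤ _ := by nlinarith

theorem rlog_le_rlog_two {k : ℕ} (hk : 2 ≤ k) {s : ℝ} (hs : 0 ≤ s) : rlog k k s ≤ rlog k 2 s := by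
  have : ∀ j, 2 ≤ j → j ≤ k → rlog k j s ≤ rlog k 2 s := by
    intro j hj
    induction j, hj using Nat.le_induction with
    | base => intro _; exact le_rfl
    | succ j hj ih =>
      intro hjk
      rw [rlog_succ]
      exact ((Real.log_le_sub_one_of_pos (rlog_pos (by omega) hs)).trans (by linarith)).trans
        (ih (by omega))
  exact this k hk le_rfl

theorem tower_mono {j k : ℕ} (h : j ≤ k) : tower j ≤ tower k :=
  monotone_nat_of_le_succ (f := tower) (fun n => by
    rw [tower_succ]; linarith [Real.add_one_le_exp (tower n)]) h

/-- Without the zeroth and the first factor the Denjoy weight grows at most logarithmically. -/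
theorem denjoyWeight_isBigO_log {α : ℕ →₀ ℝ} (hα : IsDenjoyIndex α) (h0 : α 0 = 0)
    (h1 : α 1 = 0) : denjoyWeight α =O[atTop] Real.log := by
  set κ := ∑ k ∈ α.support.erase 0, α k
  set T := tower (α.support.sup id)
  have hT : 1 ≤ T := one_le_tower _
  have hshift : Tendsto (fun s : ℝ => s + T) atTop atTop :=
    tendsto_atTop_add_const_right _ _ tendsto_id
  have hll : Tendsto (fun s : ℝ => Real.log (s + T)) atTop atTop :=
    Real.tendsto_log_atTop.comp hshift
  have hA : denjoyWeight α =O[atTop] fun s => (Real.log (Real.log (s + T))) ^ κ := by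
    refine IsBigO.of_bound (Real.exp 1) ?_
    filter_upwards [eventually_ge_atTop 0, hll.eventually_ge_atTop (Real.exp 1)] with s hs hs1
    have hl1 : 1 ≤ Real.log (Real.log (s + T)) := by
      rwa [Real.le_log_iff_exp_le ((Real.exp_pos 1).trans_le hs1)]
    rw [Real.norm_of_nonneg (by linarith [one_le_denjoyWeight hα hs]),
      Real.norm_of_nonneg (Real.rpow_nonneg (by linarith) _), denjoyWeight_eq_exp α hs, logWeight,
      h0, Real.rpow_zero, Real.exp_add]
    gcongr
    rw [Real.rpow_def_of_pos (by linarith), Finset.mul_sum, Real.exp_le_exp]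
    refine Finset.sum_le_sum fun k hk => ?_
    rw [mul_comm]
    refine mul_le_mul_of_nonneg_right ?_ (hα.1 k)
    have hk1 := one_le_of_mem_support_erase hk
    have hk2 : 2 ≤ k := by
      rcases hk1.eq_or_lt with h | h
      · subst h
        exact absurd h1 (Finsupp.mem_support_iff.1 (Finset.mem_of_mem_erase hk))
      · exact h
    refine Real.log_le_log (rlog_pos le_rfl hs) ((rlog_le_rlog_two hk2 hs).trans ?_)
    have hp : 0 < rlog k 1 s := rlog_pos hk1 hs
    rw [rlog_succ]
    refine Real.log_le_log hp ?_
    rw [rlog_succ, rlog_zero]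
    refine Real.log_le_log (by linarith [one_le_tower k]) ?_
    have : tower k ≤ T := tower_mono (Finset.le_sup (f := id) (Finset.mem_of_mem_erase hk))
    linarith
  have hB : (fun s => (Real.log (Real.log (s + T))) ^ κ) =O[atTop] fun s => Real.log (s + T) := by
    have := (isLittleO_log_rpow_rpow_atTop κ one_pos).isBigO.comp_tendsto hll
    simpa [Function.comp_def] using this
  have hC : (fun s => Real.log (s + T)) =O[atTop] Real.log := by
    refine IsBigO.of_bound 2 ?_
    filter_upwards [eventually_ge_atTop 2, eventually_ge_atTop T] with s hs hsT
    rw [Real.norm_of_nonneg (Real.log_nonneg (by linarith)),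
      Real.norm_of_nonneg (Real.log_nonneg (by linarith)), ← Real.log_rpow (by linarith)]
    refine Real.log_le_log (by linarith) ?_
    norm_cast
    nlinarith
  exact (hA.trans hB).trans hC

theorem index_of_log_isLittleO {α : ℕ →₀ ℝ} (hα : IsDenjoyIndex α)
    (hL : Real.log =o[atTop] denjoyWeight α) : 0 < α 0 ∨ 0 < α 1 := by
  by_contra! h
  have h0 : α 0 = 0 := le_antisymm h.1 (hα.1 0)
  have h1 : α 1 = 0 := le_antisymm h.2 (hα.1 1)
  have h2 := hL.trans_isBigO (denjoyWeight_isBigO_log hα h0 h1)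
  have h3 := h2.bound (show (0 : ℝ) < 1 / 2 by norm_num)
  obtain ⟨s, hs, hs1⟩ := (h3.and (Real.tendsto_log_atTop.eventually_ge_atTop 1)).exists
  rw [Real.norm_of_nonneg (by linarith)] at hs
  linarith

/-- If the weight grows faster than the logarithm, then `1 / ε = O(log)`. -/
theorem exists_inv_log_le_epsFormula {α : ℕ →₀ ℝ} (hα : IsDenjoyIndex α)
    (hL : Real.log =o[atTop] denjoyWeight α) :
    ∃ c : ℝ, 0 < c ∧ ∀ ρ : ℝ, 1 ≤ ρ → c * (Real.log (ρ + Real.exp 1))⁻¹ ≤ epsFormula α ρ := by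
  have he : 1 ≤ Real.exp 1 := Real.one_le_exp zero_le_one
  rcases index_of_log_isLittleO hα hL with h | h
  · have hl2 : 0 < Real.log 2 := Real.log_pos one_lt_two
    refine ⟨α 0 * (2⁻¹ * Real.log 2 ^ α 0), by positivity, fun ρ hρ => ?_⟩
    have hx : Real.log 2 ≤ Real.log (ρ + 1) := Real.log_le_log (by norm_num) (by linarith)
    have hy : Real.log (ρ + 1) ≤ Real.log (ρ + Real.exp 1) :=
      Real.log_le_log (by linarith) (by linarith)
    have hx0 : 0 < Real.log (ρ + 1) := hl2.trans_le hx
    refine le_trans ?_ (le_add_of_nonneg_right (epsFormula_sum_nonneg hα (by linarith)))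
    rw [mul_assoc, Real.rpow_sub_one hx0.ne', div_eq_mul_inv (Real.log (ρ + 1) ^ α 0), mul_assoc]
    have : (2 : ℝ)⁻¹ ≤ ρ / (ρ + 1) := by
      rw [le_div_iff₀ (by linarith)]; linarith
    have hz : 0 < Real.log (ρ + Real.exp 1) := hx0.trans_le hy
    gcongr
  · have h1 : 1 ∈ α.support.erase 0 :=
      Finset.mem_erase.2 ⟨one_ne_zero, Finsupp.mem_support_iff.2 h.ne'⟩
    refine ⟨α 1 * (1 + Real.exp 1)⁻¹, by positivity, fun ρ hρ => ?_⟩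
    refine le_trans ?_ (le_add_of_nonneg_left (epsFormula_zero_nonneg hα (by linarith)))
    refine le_trans ?_ (Finset.single_le_sum (f := fun k => α k * epsTerm k ρ)
      (fun k _ => mul_nonneg (hα.1 k) (epsTerm_nonneg k (by linarith))) h1)
    rw [mul_assoc]
    refine mul_le_mul_of_nonneg_left ?_ h.le
    have ht : tower 1 = Real.exp 1 := rfl
    have hlog := one_le_log_add_exp_one (show 0 ≤ ρ by linarith)
    rw [epsTerm, Finset.prod_range_succ, Finset.prod_range_one, rlog_succ, rlog_zero, ht,
      ← mul_inv, ← one_div, div_le_div_iff₀ (by positivity) (by positivity)]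
    nlinarith [mul_nonneg (sub_nonneg.2 hρ) (Real.exp_pos 1).le]

theorem tendsto_weight_mul_epsFormula {α : ℕ →₀ ℝ} (hα : IsDenjoyIndex α)
    (hL : Real.log =o[atTop] denjoyWeight α) :
    Tendsto (fun ρ => denjoyWeight α ρ * epsFormula α ρ) atTop atTop := by
  obtain ⟨c, hc, h⟩ := exists_inv_log_le_epsFormula hα hL
  rw [tendsto_atTop]
  intro b
  have hb : 0 < max b 1 := lt_max_of_lt_right one_pos
  filter_upwards [hL.bound (show 0 < c / (2 * max b 1) by positivity),
    eventually_ge_atTop (Real.exp 1), eventually_ge_atTop 2] with ρ h1 h2 h3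
  have h4 := one_le_denjoyWeight hα (show 0 ≤ ρ by linarith)
  have h5 := one_le_log_add_exp_one (show 0 ≤ ρ by linarith)
  have h6 : Real.log (ρ + Real.exp 1) ≤ 2 * Real.log ρ := by
    rw [← Real.log_rpow (by linarith)]
    refine Real.log_le_log (by linarith [Real.exp_pos 1]) ?_
    norm_cast
    nlinarith
  rw [Real.norm_of_nonneg (by linarith), Real.norm_of_nonneg (by linarith)] at h1
  have h7 := h ρ (by linarith)
  calc b ≤ max b 1 := le_max_left _ _
    _ = max b 1 * Real.log (ρ + Real.exp 1) * (Real.log (ρ + Real.exp 1))⁻¹ := by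
        field_simp
    _ ≤ (c * denjoyWeight α ρ) * (Real.log (ρ + Real.exp 1))⁻¹ := by
        refine mul_le_mul_of_nonneg_right ?_ (by positivity)
        calc max b 1 * Real.log (ρ + Real.exp 1)
            ≤ max b 1 * (2 * (c / (2 * max b 1) * denjoyWeight α ρ)) := by gcongr; linarith
          _ = c * denjoyWeight α ρ := by field_simp
    _ = denjoyWeight α ρ * (c * (Real.log (ρ + Real.exp 1))⁻¹) := by ring
    _ ≤ _ := by gcongr

/-! ### Regular weights -/

/-- The properties of a weight used in the real-variable parts of the argument: it is at least
`1`, increasing, unbounded, and `L(ρ) / ρ^κ` is decreasing. -/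
structure RegularWeight (L : ℝ → ℝ) (κ : ℝ) : Prop where
  one_le : ∀ s, 0 ≤ s → 1 ≤ L s
  mono : ∀ s t, 0 ≤ s → s ≤ t → L s ≤ L t
  tendsto : Tendsto L atTop atTop
  exponent_pos : 0 < κ
  ratio : ∀ a b, 0 < a → a ≤ b → L b ≤ L a * (b / a) ^ κ

theorem exists_regularWeight {α : ℕ →₀ ℝ} (hα : IsDenjoyIndex α) :
    ∃ κ, RegularWeight (denjoyWeight α) κ := by
  obtain ⟨κ, hκ, h⟩ := denjoyWeight_ratio hα
  exact ⟨κ, fun s hs => one_le_denjoyWeight hα hs, fun s t hs h => denjoyWeight_mono hα hs h,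
    tendsto_denjoyWeight hα, hκ, h⟩

theorem gam_natCast_add_one (L : ℝ → ℝ) (n : ℕ) :
    gam L ((n : ℝ) + 1) = L ((n : ℝ) + 1) ^ (n + 1) := by
  rw [gam, ← Real.rpow_natCast]
  push_cast
  rfl

theorem tendsto_natCast_add_one : Tendsto (fun n : ℕ => (n : ℝ) + 1) atTop atTop :=
  tendsto_atTop_add_const_right _ _ tendsto_natCast_atTop_atTop

theorem summable_pow_div_gam {M : ℝ → ℝ} (hM : Tendsto M atTop atTop) (r : ℝ) :
    Summable fun n : ℕ => r ^ n / gam M ((n : ℝ) + 1) := by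
  refine Summable.of_norm_bounded_eventually_nat summable_geometric_two ?_
  filter_upwards [(hM.comp tendsto_natCast_add_one).eventually_ge_atTop (2 * |r| + 1)] with n hn
  simp only [Function.comp] at hn
  rw [gam_natCast_add_one, norm_div, norm_pow, norm_pow, Real.norm_eq_abs, Real.norm_eq_abs]
  set m := M ((n : ℝ) + 1)
  have hm : 0 < m := by linarith [abs_nonneg r]
  rw [abs_of_pos hm, div_le_iff₀ (by positivity), pow_succ, ← mul_assoc, ← mul_pow]
  calc |r| ^ n ≤ (1 / 2 * m) ^ n := by gcongr; linarith
    _ ≤ (1 / 2 * m) ^ n * m := le_mul_of_one_le_right (by positivity) (by linarith [abs_nonneg r])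

namespace RegularWeight

theorem pos {L : ℝ → ℝ} {κ : ℝ} (hL : RegularWeight L κ) {s : ℝ} (hs : 0 ≤ s) : 0 < L s :=
  zero_lt_one.trans_le (hL.one_le s hs)

theorem gam_pos {L : ℝ → ℝ} {κ : ℝ} (hL : RegularWeight L κ) {s : ℝ} (hs : 0 ≤ s) :
    0 < gam L s :=
  Real.rpow_pos_of_pos (hL.pos hs) _

theorem weightE_mono {L : ℝ → ℝ} {κ : ℝ} (hL : RegularWeight L κ) {r s : ℝ} (hr : 0 ≤ r)
    (h : r ≤ s) : weightE L r ≤ weightE L s :=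
  (summable_pow_div_gam hL.tendsto r).tsum_le_tsum (fun n => by
    have := hL.gam_pos (show (0 : ℝ) ≤ n + 1 by positivity)
    gcongr) (summable_pow_div_gam hL.tendsto s)

theorem weightE_pos {L : ℝ → ℝ} {κ : ℝ} (hL : RegularWeight L κ) {r : ℝ} (hr : 0 ≤ r) :
    0 < weightE L r := by
  refine (summable_pow_div_gam hL.tendsto r).tsum_pos (fun n => ?_) 0 ?_
  · have := hL.gam_pos (show (0 : ℝ) ≤ n + 1 by positivity)
    positivity
  · have := hL.gam_pos (show (0 : ℝ) ≤ (0 : ℕ) + 1 by positivity)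
    simpa using this

/-- The powers `L(k)^n` and `L(n)^n` differ by an exponential factor only. -/
theorem pow_le {L : ℝ → ℝ} {κ : ℝ} (hL : RegularWeight L κ) {n k : ℕ} (hn : 1 ≤ n) (hk : n ≤ k) :
    L k ^ n ≤ L n ^ n * Real.exp (κ * k) := by
  have hn0 : (0 : ℝ) < n := by exact_mod_cast hn
  have hk' : (n : ℝ) ≤ k := by exact_mod_cast hk
  have h1 := hL.ratio n k hn0 hk'
  calc L k ^ n ≤ (L n * ((k : ℝ) / n) ^ κ) ^ n := by
        gcongr
        exact (hL.pos (by positivity)).le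
    _ = L n ^ n * (((k : ℝ) / n) ^ κ) ^ n := mul_pow _ _ _
    _ ≤ L n ^ n * Real.exp (κ * k) := by
        have := hL.pos (show (0 : ℝ) ≤ n by positivity)
        gcongr
        have hq : 0 < (k : ℝ) / n := div_pos (hn0.trans_le hk') hn0
        rw [Real.rpow_def_of_pos hq, ← Real.exp_nat_mul, Real.exp_le_exp]
        have h2 : Real.log ((k : ℝ) / n) ≤ (k : ℝ) / n := (Real.log_le_sub_one_of_pos hq).trans
          (by linarith)
        calc (n : ℝ) * (Real.log ((k : ℝ) / n) * κ) ≤ n * ((k : ℝ) / n * κ) := by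
              have := hL.exponent_pos
              gcongr
          _ = κ * k := by field_simp

end RegularWeight

theorem natCast_pow_le_exp_mul_factorial (n : ℕ) :
    (n : ℝ) ^ n ≤ Real.exp 1 ^ n * n.factorial := by
  have h := Real.pow_div_factorial_le_exp (n : ℝ) (by positivity) n
  rw [div_le_iff₀ (by positivity)] at h
  rwa [← Real.exp_nat_mul, mul_one]

theorem summable_singularTerm {L : ℝ → ℝ} {κ : ℝ} (hL : RegularWeight L κ) {I : Set ℝ}
    (hI0 : (0 : ℝ) ∈ I) {f : ℝ → ℂ} (hf : f ∈ beurlingClass L I) (z : ℂ) :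
    Summable (singularTerm L f z) := by
  have he := Real.exp_pos 1
  obtain ⟨C, hC, h⟩ := hf.2 0 0 (by simpa using hI0) (1 / (2 * Real.exp 1 * (‖z‖ + 1)))
    (by positivity)
  refine Summable.of_norm_bounded (summable_geometric_two.mul_left C) fun n => ?_
  have h1 := h n 0 (by simp)
  have h2 := hL.pos (show (0 : ℝ) ≤ n by positivity)
  have h3 := hL.mono n (n + 1) (by positivity) (by linarith)
  have h4 := hL.one_le (n + 1) (by positivity)
  rw [singularTerm, gam_natCast_add_one]
  simp only [norm_mul, norm_div, norm_pow, Complex.norm_natCast, Complex.norm_real,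
    Real.norm_eq_abs]
  rw [abs_of_pos (a := L (n + 1)) (by positivity)]
  have h5 : ‖z‖ / (‖z‖ + 1) ≤ 1 := by rw [div_le_one (by positivity)]; linarith
  have h6 : L n ^ n ≤ L (n + 1) ^ (n + 1) :=
    (pow_le_pow_left₀ h2.le h3 n).trans (pow_le_pow_right₀ h4 (Nat.le_succ n))
  calc ‖iteratedDeriv n f 0‖ / n.factorial / L (n + 1) ^ (n + 1) * ‖z‖ ^ n
      ≤ C * (1 / (2 * Real.exp 1 * (‖z‖ + 1)) * n * L n) ^ n / n.factorial /
        L (n + 1) ^ (n + 1) * ‖z‖ ^ n := by gcongr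
    _ = C * (1 / 2) ^ n * ((n : ℝ) ^ n / (Real.exp 1 ^ n * n.factorial)) *
        (L n ^ n / L (n + 1) ^ (n + 1)) * (‖z‖ / (‖z‖ + 1)) ^ n := by
        simp only [div_pow, mul_pow, one_pow]
        field_simp
    _ ≤ C * (1 / 2) ^ n * 1 * 1 * 1 := by
        gcongr
        · rw [div_le_one (by positivity)]
          exact natCast_pow_le_exp_mul_factorial n
        · rw [div_le_one (by positivity)]
          exact h6
        · exact pow_le_one₀ (by positivity) h5
    _ = C * (1 / 2) ^ n := by ring

/-! ### The function `γ` in the right half-plane -/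

theorem denjoyLog_eq (α : ℕ →₀ ℝ) (s : ℂ) :
    denjoyLog α s = Complex.log (s + 1) ^ (α 0 : ℂ) +
      ∑ k ∈ α.support.erase 0, (α k : ℂ) * Complex.log (clog k k s) := rfl

theorem norm_denjoyGamma (α : ℕ →₀ ℝ) (s : ℂ) :
    ‖denjoyGamma α s‖ =
      Real.exp (s.re * (denjoyLog α s).re - s.im * (denjoyLog α s).im) := by
  rw [denjoyGamma, Complex.norm_exp, Complex.mul_re]

theorem log_add_one_re_pos {s : ℂ} (hs : 0 < s.re) : 0 < (Complex.log (s + 1)).re := by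
  rw [Complex.log_re]
  refine Real.log_pos (lt_of_lt_of_le ?_ (Complex.re_le_norm _))
  simpa using hs

theorem differentiableAt_denjoyLog (α : ℕ →₀ ℝ) {s : ℂ} (hs : 0 < s.re) :
    DifferentiableAt ℂ (denjoyLog α) s := by
  have h1 : DifferentiableAt ℂ (fun s : ℂ => Complex.log (s + 1)) s :=
    (differentiableAt_id.add_const (1 : ℂ)).clog (Or.inl (by simp; linarith))
  have h2 : DifferentiableAt ℂ (fun s : ℂ => Complex.log (s + 1) ^ (α 0 : ℂ)) s :=
    h1.cpow_const (Or.inl (log_add_one_re_pos hs))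
  refine h2.add (DifferentiableAt.fun_sum fun k _ => ?_)
  exact ((differentiableAt_clog le_rfl hs.le).clog
    (Or.inl (zero_lt_one.trans_le (one_le_re_clog le_rfl hs.le)))).const_mul (α k : ℂ)

theorem differentiableAt_denjoyGamma (α : ℕ →₀ ℝ) {s : ℂ} (hs : 0 < s.re) :
    DifferentiableAt ℂ (denjoyGamma α) s :=
  (differentiableAt_id.mul (differentiableAt_denjoyLog α hs)).cexp

theorem denjoyGamma_ne_zero (α : ℕ →₀ ℝ) (s : ℂ) : denjoyGamma α s ≠ 0 := Complex.exp_ne_zero _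

theorem denjoyGamma_ofReal (α : ℕ →₀ ℝ) {ρ : ℝ} (hρ : 0 ≤ ρ) :
    denjoyGamma α (ρ : ℂ) = (gam (denjoyWeight α) ρ : ℂ) := by
  rw [denjoyGamma, exp_denjoyLog α hρ, gam, denjoyWeight_eq_exp α hρ, Real.log_exp,
    ← Real.exp_mul]
  push_cast
  rw [mul_comm]

theorem gam_eq_exp (α : ℕ →₀ ℝ) {ρ : ℝ} (hρ : 0 ≤ ρ) :
    gam (denjoyWeight α) ρ = Real.exp (ρ * logWeight α ρ) := by
  rw [gam, denjoyWeight_eq_exp α hρ, ← Real.exp_mul, mul_comm]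

theorem denjoyLog_conj (α : ℕ →₀ ℝ) {s : ℂ} (hs : 0 < s.re) :
    denjoyLog α (starRingEnd ℂ s) = starRingEnd ℂ (denjoyLog α s) := by
  have arg_ne : ∀ z : ℂ, 0 < z.re → z.arg ≠ Real.pi := fun z hz h => by
    rw [Complex.arg_eq_pi_iff] at h
    linarith [h.1]
  rw [denjoyLog_eq, denjoyLog_eq, map_add, map_sum]
  congr 1
  · have h1 : starRingEnd ℂ s + 1 = starRingEnd ℂ (s + 1) := by simp
    rw [h1, Complex.log_conj _ (arg_ne _ (by simp; linarith)),
      Complex.conj_cpow _ _ (arg_ne _ (log_add_one_re_pos hs)), Complex.conj_ofReal]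
  · refine Finset.sum_congr rfl fun k _ => ?_
    rw [map_mul, Complex.conj_ofReal, clog_conj le_rfl hs.le,
      Complex.log_conj _ (arg_ne _ (zero_lt_one.trans_le (one_le_re_clog le_rfl hs.le)))]

theorem norm_denjoyGamma_conj (α : ℕ →₀ ℝ) {s : ℂ} (hs : 0 < s.re) :
    ‖denjoyGamma α (starRingEnd ℂ s)‖ = ‖denjoyGamma α s‖ := by
  rw [norm_denjoyGamma, norm_denjoyGamma, denjoyLog_conj α hs]
  simp

/-- `|L(s)|` is bounded below in terms of `L(re s)`. -/
theorem le_re_denjoyLog {α : ℕ →₀ ℝ} (hα : IsDenjoyIndex α) {s : ℂ} (hs : 0 < s.re) :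
    Real.cos (α 0 * (Real.pi / 2)) * logWeight α s.re ≤ (denjoyLog α s).re := by
  have hpi := Real.pi_pos
  have hz := log_add_one_re_pos hs
  set z := Complex.log (s + 1) with hzdef
  have harg : |z.arg| ≤ Real.pi / 2 := Complex.abs_arg_le_pi_div_two_iff.2 hz.le
  have h0 := hα.1 0
  have h1 := hα.2.1
  have hcos0 : 0 ≤ Real.cos (α 0 * (Real.pi / 2)) :=
    Real.cos_nonneg_of_neg_pi_div_two_le_of_le (by nlinarith) (by nlinarith)
  have hcos : Real.cos (α 0 * (Real.pi / 2)) ≤ Real.cos (z.arg * α 0) := by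
    rw [← Real.cos_abs (z.arg * α 0), abs_mul, abs_of_nonneg h0, mul_comm (α 0)]
    refine Real.cos_le_cos_of_nonneg_of_le_pi (by positivity) (by nlinarith) (by gcongr)
  have hre : Real.log (s.re + 1) ≤ ‖z‖ := by
    refine le_trans ?_ (Complex.re_le_norm z)
    rw [hzdef, Complex.log_re]
    refine Real.log_le_log (by linarith) (le_trans (by simp) (Complex.re_le_norm _))
  rw [denjoyLog_eq, Complex.add_re, Complex.re_sum, Complex.cpow_ofReal_re, logWeight, mul_add,
    mul_comm]
  refine add_le_add ?_ ?_
  · exact mul_le_mul (Real.rpow_le_rpow (Real.log_nonneg (by linarith)) hre h0) hcos hcos0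
      (Real.rpow_nonneg (norm_nonneg _) _)
  · have hsum : 0 ≤ ∑ k ∈ α.support.erase 0, α k * Real.log (rlog k k s.re) :=
      Finset.sum_nonneg fun k _ =>
        mul_nonneg (hα.1 k) (Real.log_nonneg (one_le_rlog le_rfl hs.le))
    refine (mul_le_of_le_one_left hsum (Real.cos_le_one _)).trans ?_
    refine Finset.sum_le_sum fun k _ => ?_
    rw [Complex.re_ofReal_mul, Complex.log_re]
    exact mul_le_mul_of_nonneg_left (Real.log_le_log (rlog_pos le_rfl hs.le)
      ((rlog_le_re_clog le_rfl hs.le).trans (Complex.re_le_norm _))) (hα.1 k)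

theorem re_denjoyLog_nonneg {α : ℕ →₀ ℝ} (hα : IsDenjoyIndex α) {s : ℂ} (hs : 0 < s.re) :
    0 ≤ (denjoyLog α s).re := by
  have hpi := Real.pi_pos
  refine le_trans (mul_nonneg ?_ (logWeight_nonneg hα hs.le)) (le_re_denjoyLog hα hs)
  exact Real.cos_nonneg_of_neg_pi_div_two_le_of_le (by nlinarith [hα.1 0]) (by nlinarith [hα.2.1])

theorem exists_arg_clog_le_epsTerm (k : ℕ) : ∃ C : ℝ, 0 < C ∧ ∀ s : ℂ, 0 ≤ s.re → 1 ≤ s.im →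
    (clog k k s).arg ≤ C * epsTerm k s.im := by
  choose! c hc h using fun j (hj : j < k) => exists_le_re_clog k hj
  have hP : 0 < ∏ i ∈ Finset.range k, c i :=
    Finset.prod_pos fun i hi => hc i (Finset.mem_range.1 hi)
  have ht := one_le_tower k
  have hpi := Real.pi_pos
  refine ⟨Real.pi / 2 * (1 + tower k) / ∏ i ∈ Finset.range k, c i, by positivity,
    fun s hs hi => ?_⟩
  have hi0 : 0 ≤ s.im := by linarith
  have hQ : 0 < ∏ i ∈ Finset.range k, rlog k (i + 1) s.im :=
    Finset.prod_pos fun i hi => rlog_pos (Finset.mem_range.1 hi) hi0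
  have h1 : (∏ i ∈ Finset.range k, c i) * ∏ i ∈ Finset.range k, rlog k (i + 1) s.im ≤
      ∏ i ∈ Finset.range k, (clog k (i + 1) s).re := by
    rw [← Finset.prod_mul_distrib]
    refine Finset.prod_le_prod (fun i hi => ?_) fun i hi => h i (Finset.mem_range.1 hi) s hs hi0
    exact mul_nonneg (hc i (Finset.mem_range.1 hi)).le (rlog_pos (Finset.mem_range.1 hi) hi0).le
  rw [epsTerm, Finset.prod_range_succ', rlog_zero]
  have h2 : 1 ≤ (1 + tower k) * (s.im / (s.im + tower k)) := by
    rw [mul_div_assoc', le_div_iff₀ (by linarith)]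
    nlinarith
  calc (clog k k s).arg ≤ (Real.pi / 2) / ∏ i ∈ Finset.range k, (clog k (i + 1) s).re :=
        arg_clog_le le_rfl hs hi0
    _ ≤ (Real.pi / 2) / ((∏ i ∈ Finset.range k, c i) *
          ∏ i ∈ Finset.range k, rlog k (i + 1) s.im) := by gcongr
    _ ≤ (Real.pi / 2) / ((∏ i ∈ Finset.range k, c i) *
          ∏ i ∈ Finset.range k, rlog k (i + 1) s.im) *
          ((1 + tower k) * (s.im / (s.im + tower k))) :=
        le_mul_of_one_le_right (by positivity) h2
    _ = _ := by
        have : s.im + tower k ≠ 0 := by linarith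
        field_simp

theorem im_cpow_le {a δ : ℝ} (ha : 0 ≤ a) (ha1 : a < 1) (hδ : 0 < δ) {z : ℂ} (hz : δ ≤ z.re)
    (hi : 0 ≤ z.im) (hi2 : z.im ≤ 2) :
    (z ^ (a : ℂ)).im ≤ 2 * (1 + 2 / δ) * (a * z.re ^ (a - 1)) := by
  set M := 1 + 2 / δ
  have hM : 1 ≤ M := le_add_of_nonneg_right (by positivity)
  have hr : 0 < z.re := hδ.trans_le hz
  have hargz : z.arg ≤ 2 / z.re := (arg_le_im_div_re hr hi).trans (by gcongr)
  have hargz0 : 0 ≤ z.arg := Complex.arg_nonneg_iff.2 hi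
  have hnorm : ‖z‖ ≤ M * z.re := by
    refine (Complex.norm_le_abs_re_add_abs_im z).trans ?_
    rw [abs_of_pos hr, abs_of_nonneg hi, add_mul, one_mul]
    gcongr
    calc z.im ≤ 2 := hi2
      _ = 2 / δ * δ := by field_simp
      _ ≤ 2 / δ * z.re := by gcongr
  have hMa : M ^ a ≤ M := by
    conv_rhs => rw [← Real.rpow_one M]
    exact Real.rpow_le_rpow_of_exponent_le hM ha1.le
  rw [Complex.cpow_ofReal_im]
  calc ‖z‖ ^ a * Real.sin (z.arg * a)
      ≤ ‖z‖ ^ a * (z.arg * a) := by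
        gcongr
        exact Real.sin_le (by positivity)
    _ ≤ (M * z.re) ^ a * (2 / z.re * a) := by gcongr
    _ = M ^ a * (z.re ^ a * z.re⁻¹) * (2 * a) := by
        rw [Real.mul_rpow (by linarith) hr.le]; ring
    _ = M ^ a * z.re ^ (a - 1) * (2 * a) := by rw [Real.rpow_sub_one hr.ne', div_eq_mul_inv]
    _ ≤ M * z.re ^ (a - 1) * (2 * a) := by gcongr
    _ = _ := by ring

theorem im_log_add_one_mem {s : ℂ} (hs : 0 ≤ s.re) (hi : 0 ≤ s.im) :
    0 ≤ (Complex.log (s + 1)).im ∧ (Complex.log (s + 1)).im ≤ 2 := by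
  rw [Complex.log_im]
  have hs1 : 0 < (s + 1).re := by simp; linarith
  have hs1i : 0 ≤ (s + 1).im := by simp; linarith
  refine ⟨Complex.arg_nonneg_iff.2 hs1i, ?_⟩
  linarith [(Complex.arg_lt_pi_div_two_iff.2 (Or.inl hs1)).le, Real.pi_lt_four]

theorem exists_im_log_cpow_le {a : ℝ} (ha : 0 ≤ a) (ha1 : a < 1) :
    ∃ C : ℝ, 0 < C ∧ ∀ s : ℂ, 0 ≤ s.re → 1 ≤ s.im →
      (Complex.log (s + 1) ^ (a : ℂ)).im ≤
        C * (a * (s.im / (s.im + 1) * Real.log (s.im + 1) ^ (a - 1))) := by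
  have hl2 : 0 < Real.log 2 := Real.log_pos one_lt_two
  set δ := Real.log 2 / 2
  have hδ : 0 < δ := by positivity
  refine ⟨8 * (1 + 2 / δ), by positivity, fun s hs hi => ?_⟩
  set x := Real.log (s.im + 1) with hxdef
  have hx : Real.log 2 ≤ x := Real.log_le_log (by norm_num) (by linarith)
  have hx0 : 0 < x := hl2.trans_le hx
  have hzr : x / 2 ≤ (Complex.log (s + 1)).re := by
    rw [Complex.log_re, div_le_iff₀ two_pos, mul_comm, ← Real.log_rpow
      (norm_pos_iff.2 (fun h => by
        have h' := congrArg Complex.re h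
        simp at h'
        linarith))]
    refine Real.log_le_log (by linarith) ?_
    norm_cast
    rw [← Complex.normSq_eq_norm_sq, Complex.normSq_apply]
    simp only [Complex.add_re, Complex.one_re, Complex.add_im, Complex.one_im, add_zero]
    nlinarith
  have him := im_log_add_one_mem hs (show 0 ≤ s.im by linarith)
  have h2a : (2 : ℝ)⁻¹ ^ (a - 1) ≤ 2 := by
    rw [Real.inv_rpow (by norm_num), ← Real.rpow_neg (by norm_num)]
    conv_rhs => rw [← Real.rpow_one 2]
    exact Real.rpow_le_rpow_of_exponent_le (by norm_num) (by linarith)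
  have hfrac : (2 : ℝ)⁻¹ ≤ s.im / (s.im + 1) := by
    rw [le_div_iff₀ (by linarith)]; linarith
  have hz2 : (Complex.log (s + 1)).re ^ (a - 1) ≤ (2⁻¹ * x) ^ (a - 1) :=
    Real.rpow_le_rpow_of_nonpos (by positivity) (by linarith) (by linarith)
  calc (Complex.log (s + 1) ^ (a : ℂ)).im
      ≤ 2 * (1 + 2 / δ) * (a * (Complex.log (s + 1)).re ^ (a - 1)) :=
        im_cpow_le ha ha1 hδ (le_trans (by simp only [δ]; linarith) hzr) him.1 him.2
    _ ≤ 2 * (1 + 2 / δ) * (a * (2⁻¹ * x) ^ (a - 1)) := by gcongr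
    _ = 2 * (1 + 2 / δ) * (a * (2⁻¹ ^ (a - 1) * x ^ (a - 1))) := by
        rw [Real.mul_rpow (by norm_num) hx0.le]
    _ ≤ 2 * (1 + 2 / δ) * (a * (2 * x ^ (a - 1))) := by gcongr
    _ = 8 * (1 + 2 / δ) * (a * (2⁻¹ * x ^ (a - 1))) := by ring
    _ ≤ _ := by gcongr

/-- The argument of `L` on vertical lines is controlled by `ε`. -/
theorem exists_im_denjoyLog_le {α : ℕ →₀ ℝ} (hα : IsDenjoyIndex α) :
    ∃ C : ℝ, 0 < C ∧ ∀ s : ℂ, 0 ≤ s.re → 1 ≤ s.im →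
      (denjoyLog α s).im ≤ C * epsFormula α s.im := by
  obtain ⟨C₀, hC₀, h₀⟩ := exists_im_log_cpow_le (hα.1 0) hα.2.1
  choose C hC h using exists_arg_clog_le_epsTerm
  have hS : 0 ≤ ∑ k ∈ α.support.erase 0, C k := Finset.sum_nonneg fun k _ => (hC k).le
  refine ⟨C₀ + ∑ k ∈ α.support.erase 0, C k, by positivity, fun s hs hi => ?_⟩
  rw [denjoyLog_eq, Complex.add_im, Complex.im_sum, epsFormula, mul_add]
  refine add_le_add ((h₀ s hs hi).trans ?_) ?_
  · exact mul_le_mul_of_nonneg_right (le_add_of_nonneg_right hS)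
      (epsFormula_zero_nonneg hα (by linarith))
  · rw [Finset.mul_sum]
    refine Finset.sum_le_sum fun k hk => ?_
    rw [Complex.im_ofReal_mul, Complex.log_im]
    have h1 := epsTerm_nonneg k (show 0 ≤ s.im by linarith)
    calc α k * (clog k k s).arg ≤ α k * (C k * epsTerm k s.im) :=
          mul_le_mul_of_nonneg_left (h k s hs hi) (hα.1 k)
      _ ≤ α k * ((C₀ + ∑ k ∈ α.support.erase 0, C k) * epsTerm k s.im) := by
          have h2 := hα.1 k
          have h3 := Finset.single_le_sum (f := C) (fun k _ => (hC k).le) hk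
          gcongr
          linarith
      _ = _ := by ring

theorem exists_im_denjoyLog_le_const {α : ℕ →₀ ℝ} (hα : IsDenjoyIndex α) :
    ∃ C : ℝ, 0 < C ∧ ∀ s : ℂ, 1 / 2 ≤ s.re → 0 ≤ s.im → (denjoyLog α s).im ≤ C := by
  have hpi := Real.pi_pos
  have h0 := hα.1 0
  set δ := Real.log (3 / 2)
  have hδ : 0 < δ := Real.log_pos (by norm_num)
  have hS : 0 ≤ ∑ k ∈ α.support.erase 0, α k := Finset.sum_nonneg fun k _ => hα.1 k
  refine ⟨1 + 2 * (1 + 2 / δ) * (α 0 * δ ^ (α 0 - 1)) +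
    (∑ k ∈ α.support.erase 0, α k) * (Real.pi / 2), by positivity, fun s hs hi => ?_⟩
  have hs0 : 0 ≤ s.re := by linarith
  rw [denjoyLog_eq, Complex.add_im, Complex.im_sum, Finset.sum_mul]
  refine add_le_add (le_add_of_nonneg_of_le zero_le_one ?_) (Finset.sum_le_sum fun k _ => ?_)
  · have him := im_log_add_one_mem hs0 hi
    have hre : δ ≤ (Complex.log (s + 1)).re := by
      rw [Complex.log_re]
      refine Real.log_le_log (by norm_num) (le_trans ?_ (Complex.re_le_norm _))
      rw [Complex.add_re, Complex.one_re]
      linarith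
    refine (im_cpow_le h0 hα.2.1 hδ hre him.1 him.2).trans ?_
    have := Real.rpow_le_rpow_of_nonpos hδ hre (show α 0 - 1 ≤ 0 by linarith [hα.2.1])
    gcongr
  · rw [Complex.im_ofReal_mul, Complex.log_im]
    exact mul_le_mul_of_nonneg_left (arg_clog_le_pi_div_two le_rfl hs0) (hα.1 k)

/-- A lower bound for `γ` in the half-plane `re s ≥ 1 / 2`. -/
theorem le_norm_denjoyGamma {α : ℕ →₀ ℝ} (hα : IsDenjoyIndex α) {θ : ℝ} (hθ : 0 < θ) :
    ∃ c : ℝ, 0 < c ∧ ∀ s : ℂ, 1 / 2 ≤ s.re →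
      c * Real.exp (s.re * (Real.cos (α 0 * (Real.pi / 2)) * logWeight α s.re) - θ * |s.im|) ≤
        ‖denjoyGamma α s‖ := by
  obtain ⟨C, hC, h⟩ := exists_im_denjoyLog_le hα
  obtain ⟨C', hC', h'⟩ := exists_im_denjoyLog_le_const hα
  obtain ⟨R, hR⟩ := eventually_atTop.1
    ((tendsto_epsFormula hα).eventually_le_const (show 0 < θ / C by positivity))
  set R' := max R 1
  have hR' : 0 < R' := zero_lt_one.trans_le (le_max_right _ _)
  have key : ∀ s : ℂ, 1 / 2 ≤ s.re → 0 ≤ s.im →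
      Real.exp (-(C' * R')) * Real.exp (s.re * (Real.cos (α 0 * (Real.pi / 2)) *
        logWeight α s.re) - θ * s.im) ≤ ‖denjoyGamma α s‖ := by
    intro s hs hi
    have hs0 : 0 < s.re := by linarith
    rw [norm_denjoyGamma, ← Real.exp_add, Real.exp_le_exp]
    have h1 := mul_le_mul_of_nonneg_left (le_re_denjoyLog hα hs0) hs0.le
    have h2 : s.im * (denjoyLog α s).im ≤ C' * R' + θ * s.im := by
      rcases le_total s.im R' with h3 | h3
      · have h4 := h' s hs hi
        calc s.im * (denjoyLog α s).im ≤ s.im * C' := by gcongr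
          _ ≤ C' * R' := by nlinarith
          _ ≤ _ := le_add_of_nonneg_right (by positivity)
      · have h4 := h s hs0.le ((le_max_right _ _).trans h3)
        have h5 := hR s.im ((le_max_left _ _).trans h3)
        calc s.im * (denjoyLog α s).im ≤ s.im * (C * (θ / C)) := by
              gcongr
              exact h4.trans (by gcongr)
          _ = θ * s.im := by field_simp
          _ ≤ _ := le_add_of_nonneg_left (by positivity)
    linarith
  refine ⟨Real.exp (-(C' * R')), Real.exp_pos _, fun s hs => ?_⟩
  rcases le_total 0 s.im with hi | hi
  · rw [abs_of_nonneg hi]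
    exact key s hs hi
  · have := key (starRingEnd ℂ s) (by simpa using hs) (by simpa using hi)
    rw [norm_denjoyGamma_conj α (by linarith)] at this
    simpa [abs_of_nonpos hi] using this

/-- On the line `re s = 1 / 2` the growth of `1 / γ` is governed by `ε`. -/
theorem exists_inv_norm_denjoyGamma_le {α : ℕ →₀ ℝ} (hα : IsDenjoyIndex α) :
    ∃ C : ℝ, 0 < C ∧ ∀ s : ℂ, s.re = 1 / 2 →
      ‖denjoyGamma α s‖⁻¹ ≤ Real.exp (C * (1 + |s.im| * epsFormula α |s.im|)) := by
  obtain ⟨C, hC, h⟩ := exists_im_denjoyLog_le hα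
  obtain ⟨C', hC', h'⟩ := exists_im_denjoyLog_le_const hα
  have key : ∀ s : ℂ, s.re = 1 / 2 → 0 ≤ s.im →
      ‖denjoyGamma α s‖⁻¹ ≤ Real.exp ((C + C') * (1 + s.im * epsFormula α s.im)) := by
    intro s hs hi
    have hs0 : 0 < s.re := by rw [hs]; norm_num
    have hε := epsFormula_nonneg hα hi
    rw [norm_denjoyGamma, ← Real.exp_neg, Real.exp_le_exp]
    have h1 := mul_nonneg hs0.le (re_denjoyLog_nonneg hα hs0)
    have h2 : s.im * (denjoyLog α s).im ≤ (C + C') * (1 + s.im * epsFormula α s.im) := by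
      have h5 : 0 ≤ s.im * epsFormula α s.im := by positivity
      rcases le_total s.im 1 with h3 | h3
      · have h4 := h' s hs.ge hi
        nlinarith
      · have h4 := mul_le_mul_of_nonneg_left (h s hs0.le h3) hi
        nlinarith
    linarith
  refine ⟨C + C', by positivity, fun s hs => ?_⟩
  rcases le_total 0 s.im with hi | hi
  · rw [abs_of_nonneg hi]
    exact key s hs hi
  · have := key (starRingEnd ℂ s) (by simpa using hs) (by simpa using hi)
    rw [norm_denjoyGamma_conj α (by rw [hs]; norm_num)] at this
    simpa [abs_of_nonpos hi] using this

/-- The elementary inequality behind the decay of `γ` on vertical lines. -/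
theorem exists_log_add_sqrt_le (k : ℕ) : ∃ A : ℝ, 0 ≤ A ∧ ∀ r : ℝ, 0 ≤ r →
    Real.log (1 + r) + 2 + √r ≤
      A + r ^ 2 / ((1 + r) * (3 + Real.log (1 + r)) ^ k) := by
  set M : ℝ := (3 + 4 * (k + 1)) ^ k
  have hM : 1 ≤ M := one_le_pow₀ (by linarith [show (0 : ℝ) ≤ k from Nat.cast_nonneg k])
  refine ⟨7 * (28 * M) ^ 2 + 7, by positivity, fun r hr => ?_⟩
  -- With `r = x ^ 4` all the comparisons become polynomial.
  obtain ⟨x, hx, rfl⟩ : ∃ x : ℝ, 0 ≤ x ∧ x ^ 4 = r :=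
    ⟨r ^ (1 / 4 : ℝ), by positivity, by rw [← Real.rpow_natCast, ← Real.rpow_mul hr]; norm_num⟩
  have hsq : √(x ^ 4) = x ^ 2 := by
    rw [show x ^ 4 = (x ^ 2) ^ 2 by ring, Real.sqrt_sq (by positivity)]
  have hle : 1 + x ^ 4 ≤ (1 + x) ^ 4 := by
    nlinarith [pow_nonneg hx 2, pow_nonneg hx 3]
  have hlog1 : Real.log (1 + x ^ 4) ≤ 4 * Real.log (1 + x) := by
    rw [show (4 : ℝ) = ((4 : ℕ) : ℝ) by norm_num, ← Real.log_pow]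
    exact Real.log_le_log (by positivity) hle
  have hlogx : Real.log (1 + x) ≤ x := by
    linarith [Real.log_le_sub_one_of_pos (show 0 < 1 + x by linarith)]
  have hlognn : 0 ≤ Real.log (1 + x ^ 4) := Real.log_nonneg (by nlinarith [pow_nonneg hx 4])
  have hpow : (3 + Real.log (1 + x ^ 4)) ^ k ≤ M * (1 + x) := by
    have h1 : Real.log (1 + x) ≤ (1 + x) ^ ((k + 1 : ℝ)⁻¹) / (k + 1 : ℝ)⁻¹ :=
      Real.log_le_rpow_div (by linarith) (by positivity)
    have h2 : 1 ≤ (1 + x) ^ ((k + 1 : ℝ)⁻¹) := Real.one_le_rpow (by linarith) (by positivity)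
    set y := (1 + x) ^ ((k + 1 : ℝ)⁻¹) with hy
    have h3 : 3 + Real.log (1 + x ^ 4) ≤ (3 + 4 * (k + 1)) * y := by
      rw [div_inv_eq_mul] at h1
      nlinarith
    have h4 : y ^ k ≤ 1 + x := by
      calc y ^ k ≤ y ^ (k + 1) := pow_le_pow_right₀ h2 (Nat.le_succ k)
        _ = 1 + x := by
          rw [hy, ← Real.rpow_natCast, ← Real.rpow_mul (by linarith)]
          push_cast
          rw [inv_mul_cancel₀ (by positivity), Real.rpow_one]
    calc (3 + Real.log (1 + x ^ 4)) ^ k ≤ ((3 + 4 * (k + 1)) * y) ^ k := by gcongr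
      _ = M * y ^ k := mul_pow _ _ _
      _ ≤ M * (1 + x) := by gcongr
  have hφ : (x ^ 4) ^ 2 / ((1 + x ^ 4) * (M * (1 + x))) ≤
      (x ^ 4) ^ 2 / ((1 + x ^ 4) * (3 + Real.log (1 + x ^ 4)) ^ k) := by
    gcongr
  have hφ0 : 0 ≤ (x ^ 4) ^ 2 / ((1 + x ^ 4) * (M * (1 + x))) := by positivity
  rw [hsq]
  have hL : Real.log (1 + x ^ 4) + 2 + x ^ 2 ≤ 4 * x + 2 + x ^ 2 := by linarith
  rcases le_total x 1 with hx1 | hx1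
  · nlinarith [sq_nonneg (28 * M)]
  · have h7 : 4 * x + 2 + x ^ 2 ≤ 7 * x ^ 2 := by nlinarith
    rcases le_total x (28 * M) with h8 | h8
    · have : x ^ 2 ≤ (28 * M) ^ 2 := by gcongr
      linarith
    · have h9 : x ^ 3 / (4 * M) ≤ (x ^ 4) ^ 2 / ((1 + x ^ 4) * (M * (1 + x))) := by
        rw [div_le_div_iff₀ (by positivity) (by positivity)]
        have h10 : (1 + x ^ 4) * (1 + x) ≤ (2 * x ^ 4) * (2 * x) := by
          gcongr <;> nlinarith [one_le_pow₀ hx1 (n := 4)]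
        calc x ^ 3 * ((1 + x ^ 4) * (M * (1 + x))) = x ^ 3 * M * ((1 + x ^ 4) * (1 + x)) := by ring
          _ ≤ x ^ 3 * M * ((2 * x ^ 4) * (2 * x)) := by gcongr
          _ = (x ^ 4) ^ 2 * (4 * M) := by ring
      have h11 : 7 * x ^ 2 ≤ x ^ 3 / (4 * M) := by
        rw [le_div_iff₀ (by positivity)]
        nlinarith [pow_nonneg hx 2]
      nlinarith [sq_nonneg (28 * M)]

/-- The decay on vertical lines of one factor of `γ`. -/
theorem exists_factor_decay (k : ℕ) : ∃ A : ℝ, 0 ≤ A ∧ ∀ s : ℂ, 0 ≤ s.re → 0 ≤ s.im →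
    s.re * Real.log ‖clog (k + 1) (k + 1) s‖ - s.im * (clog (k + 1) (k + 1) s).arg ≤
      s.re * Real.log (rlog (k + 1) (k + 1) s.re) +
        rlog (k + 1) 0 s.re / (∏ i ∈ Finset.range (k + 1), rlog (k + 1) (i + 1) s.re) *
          (A - √(s.im / rlog (k + 1) 0 s.re)) := by
  obtain ⟨A, hA, hAr⟩ := exists_log_add_sqrt_le (k + 1)
  refine ⟨A, hA, fun s hs hi => ?_⟩
  set K := k + 1
  set σ' := rlog K 0 s.re with hσ'def
  set P := ∏ i ∈ Finset.range K, rlog K (i + 1) s.re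
  set T := ‖clog K 1 s - rlog K 1 s.re‖ with hT
  have hK1 : 1 ≤ K := by omega
  have hσ' : 0 < σ' := rlog_pos (Nat.zero_le _) hs
  have hσσ' : s.re ≤ σ' := by
    rw [hσ'def, rlog_zero]
    linarith [one_le_tower K]
  have hP : 0 < P := Finset.prod_pos fun i hi => rlog_pos (Finset.mem_range.1 hi) hs
  set r := s.im / σ' with hr
  have hr0 : 0 ≤ r := by positivity
  have hτ : s.im = σ' * r := by rw [hr]; field_simp
  have hw0im : (clog K 0 s).im = s.im := by simp [clog_zero]
  have hw0re : (clog K 0 s).re = σ' := by simp [clog_zero, hσ'def, rlog_zero]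
  have hw0 : ‖clog K 0 s‖ ≤ σ' * (1 + r) := by
    refine (Complex.norm_le_abs_re_add_abs_im _).trans (le_of_eq ?_)
    rw [hw0im, hw0re, abs_of_pos hσ', abs_of_nonneg hi, hτ]
    ring
  have hw0' : σ' ≤ ‖clog K 0 s‖ := hw0re ▸ Complex.re_le_norm _
  have hTle : T ≤ Real.log (1 + r) + 2 := by
    rw [hT]
    refine (Complex.norm_le_abs_re_add_abs_im _).trans (add_le_add ?_ ?_)
    · rw [Complex.sub_re, Complex.ofReal_re, clog_succ, Complex.log_re, rlog_succ,
        abs_of_nonneg (sub_nonneg.2 (Real.log_le_log hσ' hw0')), sub_le_iff_le_add,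
        ← Real.log_mul (by positivity) hσ'.ne', mul_comm]
      exact Real.log_le_log (hσ'.trans_le hw0') hw0
    · rw [Complex.sub_im, Complex.ofReal_im, sub_zero, clog_succ, Complex.log_im,
        abs_of_nonneg (Complex.arg_nonneg_iff.2 (im_clog_nonneg hi))]
      linarith [arg_clog_le_pi_div_two (Nat.zero_le K) hs, Real.pi_lt_four]
  have hT0 : 0 ≤ T := norm_nonneg _
  have hℓ : 0 < rlog K K s.re := rlog_pos le_rfl hs
  have hwK : 0 < ‖clog K K s‖ :=
    (zero_lt_one.trans_le (one_le_re_clog le_rfl hs)).trans_le (Complex.re_le_norm _)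
  have h1 : s.re * (Real.log ‖clog K K s‖ - Real.log (rlog K K s.re)) ≤ σ' / P * T := by
    have h2 := norm_clog_sub_rlog_le (show k + 1 ≤ K from le_rfl) hs
    have h3 : ‖clog K K s‖ ≤ rlog K K s.re + T / ∏ i ∈ Finset.range k, rlog K (i + 1) s.re := by
      have h4 := norm_sub_norm_le (clog K K s) (rlog K K s.re : ℂ)
      rw [Complex.norm_real, Real.norm_of_nonneg hℓ.le] at h4
      linarith
    have h5 : Real.log ‖clog K K s‖ - Real.log (rlog K K s.re) ≤ T / P := by
      rw [← Real.log_div hwK.ne' hℓ.ne']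
      refine (Real.log_le_sub_one_of_pos (by positivity)).trans ?_
      rw [sub_le_iff_le_add, div_le_iff₀ hℓ]
      refine h3.trans (le_of_eq ?_)
      have h6 : P = (∏ i ∈ Finset.range k, rlog K (i + 1) s.re) * rlog K K s.re :=
        Finset.prod_range_succ _ _
      have h7 : (∏ i ∈ Finset.range k, rlog K (i + 1) s.re) ≠ 0 := fun h => by
        rw [h, zero_mul] at h6
        exact hP.ne' h6
      rw [h6]
      field_simp
      ring
    calc s.re * (Real.log ‖clog K K s‖ - Real.log (rlog K K s.re)) ≤ s.re * (T / P) := by gcongr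
      _ ≤ σ' * (T / P) := by gcongr
      _ = σ' / P * T := by ring
  have h2 : σ' / P * (r ^ 2 / ((1 + r) * (1 + T) ^ K)) ≤ s.im * (clog K K s).arg := by
    have h3 := le_arg_clog K K hi
    have h4 : ∏ i ∈ Finset.range K, ‖clog K (i + 1) s‖ ≤ P * (1 + T) ^ K := by
      have h5 : P * (1 + T) ^ K = ∏ i ∈ Finset.range K, (rlog K (i + 1) s.re * (1 + T)) := by
        rw [Finset.prod_mul_distrib, Finset.prod_const, Finset.card_range]
      rw [h5]
      refine Finset.prod_le_prod (fun _ _ => norm_nonneg _) fun i hi' => ?_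
      have hi'' := Finset.mem_range.1 hi'
      have h6 := norm_clog_sub_rlog_le (show i + 1 ≤ K from hi'') hs
      have h7 : (1 : ℝ) ≤ ∏ j ∈ Finset.range i, rlog K (j + 1) s.re :=
        calc (1 : ℝ) = ∏ j ∈ Finset.range i, 1 := by simp
          _ ≤ _ := Finset.prod_le_prod (fun _ _ => zero_le_one) fun j hj =>
            one_le_rlog (by have := Finset.mem_range.1 hj; omega) hs
      have h8 := h6.trans (div_le_self hT0 h7)
      have h9 := norm_sub_norm_le (clog K (i + 1) s) (rlog K (i + 1) s.re : ℂ)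
      have h10 := one_le_rlog (show i + 1 ≤ K from hi'') hs
      rw [Complex.norm_real, Real.norm_of_nonneg (by linarith)] at h9
      nlinarith
    have h5 : r / (1 + r) ≤ (clog K 0 s).arg := by
      refine le_trans ?_ (im_div_norm_le_arg (by rwa [hw0im]))
      rw [hw0im, div_le_div_iff₀ (by positivity) (hσ'.trans_le hw0')]
      calc r * ‖clog K 0 s‖ ≤ r * (σ' * (1 + r)) := by gcongr
        _ = s.im * (1 + r) := by rw [hτ]; ring
    have h6 : 0 < ∏ i ∈ Finset.range K, ‖clog K (i + 1) s‖ :=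
      Finset.prod_pos fun i hi' => (zero_lt_one.trans_le
        (one_le_re_clog (Finset.mem_range.1 hi') hs)).trans_le (Complex.re_le_norm _)
    calc σ' / P * (r ^ 2 / ((1 + r) * (1 + T) ^ K))
        = s.im * (r / (1 + r) / (P * (1 + T) ^ K)) := by rw [hτ]; field_simp
      _ ≤ s.im * ((clog K 0 s).arg / ∏ i ∈ Finset.range K, ‖clog K (i + 1) s‖) := by
          have h7 : 0 ≤ (clog K 0 s).arg := le_trans (by positivity) h5
          gcongr
      _ ≤ s.im * (clog K K s).arg := by gcongr
  have h3 : T - r ^ 2 / ((1 + r) * (1 + T) ^ K) ≤ A - √r := by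
    have h4 := hAr r hr0
    have h5 : 0 ≤ Real.log (1 + r) := Real.log_nonneg (by linarith)
    have h6 : r ^ 2 / ((1 + r) * (3 + Real.log (1 + r)) ^ K) ≤
        r ^ 2 / ((1 + r) * (1 + T) ^ K) := by
      have h7 : 1 + T ≤ 3 + Real.log (1 + r) := by linarith
      gcongr
    linarith
  have h4 : σ' / P * (T - r ^ 2 / ((1 + r) * (1 + T) ^ K)) ≤ σ' / P * (A - √r) := by gcongr
  linarith

theorem exists_rlog_zero_div_prod_le (k : ℕ) {η : ℝ} (hη : 0 < η) :
    ∃ C : ℝ, 0 ≤ C ∧ ∀ σ : ℝ, 0 ≤ σ →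
      rlog (k + 1) 0 σ / (∏ i ∈ Finset.range (k + 1), rlog (k + 1) (i + 1) σ) ≤ C + η * σ := by
  obtain ⟨R, hR⟩ := eventually_atTop.1 ((tendsto_rlog (k + 1) 1).eventually_ge_atTop η⁻¹)
  have ht := one_le_tower (k + 1)
  refine ⟨(1 + η) * (|R| + tower (k + 1)), by positivity, fun σ hσ => ?_⟩
  have h1 : rlog (k + 1) 1 σ ≤ ∏ i ∈ Finset.range (k + 1), rlog (k + 1) (i + 1) σ := by
    rw [Finset.prod_range_succ', zero_add]
    refine le_mul_of_one_le_left (rlog_pos (by omega) hσ).le ?_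
    calc (1 : ℝ) = ∏ i ∈ Finset.range k, 1 := by simp
      _ ≤ _ := Finset.prod_le_prod (fun _ _ => zero_le_one) fun i hi =>
        one_le_rlog (by have := Finset.mem_range.1 hi; omega) hσ
  have h2 := one_le_rlog (show 1 ≤ k + 1 by omega) hσ
  rw [rlog_zero, div_le_iff₀ (by linarith)]
  rcases le_total R σ with h | h
  · have h3 := hR σ h
    have h4 : 1 ≤ η * ∏ i ∈ Finset.range (k + 1), rlog (k + 1) (i + 1) σ := by
      rw [inv_le_iff_one_le_mul₀ hη] at h3
      nlinarith
    have h5 : 0 ≤ (|R| + tower (k + 1)) * ∏ i ∈ Finset.range (k + 1), rlog (k + 1) (i + 1) σ :=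
      mul_nonneg (by positivity) (by linarith)
    nlinarith [abs_nonneg R]
  · have h3 : σ + tower (k + 1) ≤ |R| + tower (k + 1) := by linarith [le_abs_self R]
    have h4 : |R| + tower (k + 1) ≤ (1 + η) * (|R| + tower (k + 1)) + η * σ := by
      nlinarith [abs_nonneg R, mul_nonneg hη.le hσ]
    calc σ + tower (k + 1) ≤ (1 + η) * (|R| + tower (k + 1)) + η * σ := h3.trans h4
      _ ≤ _ := le_mul_of_one_le_right (by positivity) (h2.trans h1)

theorem exists_prod_rlog_le_sqrt (k : ℕ) : ∃ C : ℝ, 0 < C ∧ ∀ σ : ℝ, 0 ≤ σ →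
    ∏ i ∈ Finset.range (k + 1), rlog (k + 1) (i + 1) σ ≤ C * √(rlog (k + 1) 0 σ) := by
  have hq : (0 : ℝ) < 1 / (2 * (k + 1)) := by positivity
  refine ⟨(2 * (k + 1)) ^ (k + 1), by positivity, fun σ hσ => ?_⟩
  set x := rlog (k + 1) 0 σ
  have hx : 0 < x := rlog_pos (by omega) hσ
  have h1 : ∀ i ∈ Finset.range (k + 1), rlog (k + 1) (i + 1) σ ≤
      2 * (k + 1) * x ^ (1 / (2 * (k + 1) : ℝ)) := by
    intro i hi
    have h2 : rlog (k + 1) (i + 1) σ ≤ Real.log x := by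
      have : ∀ j, j + 1 ≤ k + 1 → rlog (k + 1) (j + 1) σ ≤ Real.log x := by
        intro j
        induction j with
        | zero => intro _; exact (rlog_succ _ _ _).le
        | succ j ih =>
          intro hj
          rw [rlog_succ]
          exact ((Real.log_le_sub_one_of_pos (rlog_pos (by omega) hσ)).trans (by linarith)).trans
            (ih (by omega))
      exact this i (Finset.mem_range.1 hi)
    refine h2.trans ((Real.log_le_rpow_div hx.le hq).trans (le_of_eq ?_))
    field_simp
  calc ∏ i ∈ Finset.range (k + 1), rlog (k + 1) (i + 1) σ
      ≤ ∏ i ∈ Finset.range (k + 1), (2 * (k + 1) * x ^ (1 / (2 * (k + 1) : ℝ))) :=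
        Finset.prod_le_prod (fun i hi => (rlog_pos (Finset.mem_range.1 hi) hσ).le) h1
    _ = (2 * (k + 1)) ^ (k + 1) * √x := by
        rw [Finset.prod_const, Finset.card_range, mul_pow, ← Real.rpow_natCast (x ^ _),
          ← Real.rpow_mul hx.le, Real.sqrt_eq_rpow]
        congr 2
        push_cast
        field_simp

/-- For `α₀ = 0` the function `γ` decays on vertical lines, with constants that grow slower
than any exponential in the real part. -/
theorem exists_norm_denjoyGamma_le {α : ℕ →₀ ℝ} (hα : IsDenjoyIndex α) (h0 : α 0 = 0) :
    ∃ c : ℝ, 0 < c ∧ ∀ η : ℝ, 0 < η → ∃ C : ℝ, 0 < C ∧ ∀ s : ℂ, 0 < s.re →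
      ‖denjoyGamma α s‖ ≤ C * Real.exp (η * s.re) * gam (denjoyWeight α) s.re *
        Real.exp (-c * √|s.im|) := by
  choose A hA hAs using exists_factor_decay
  choose B hB hBs using exists_prod_rlog_le_sqrt
  obtain ⟨k₀, hk₀, hpos⟩ := exists_pos_index hα h0
  refine ⟨α k₀ * (B (k₀ - 1))⁻¹, mul_pos hpos (inv_pos.2 (hB _)), fun η hη => ?_⟩
  set S := ∑ k ∈ α.support.erase 0, α k * A (k - 1)
  have hS : 0 ≤ S := Finset.sum_nonneg fun k _ => mul_nonneg (hα.1 k) (hA _)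
  obtain ⟨ζ, hζ, hSζ⟩ : ∃ ζ : ℝ, 0 < ζ ∧ S * ζ ≤ η := by
    refine ⟨η / (S + 1), by positivity, ?_⟩
    rw [mul_div_assoc', div_le_iff₀ (by positivity)]
    nlinarith
  choose D hD hDs using fun k => exists_rlog_zero_div_prod_le k hζ
  have key : ∀ s : ℂ, 0 < s.re → 0 ≤ s.im → ‖denjoyGamma α s‖ ≤
      Real.exp (∑ k ∈ α.support.erase 0, α k * (A (k - 1) * D (k - 1))) *
        Real.exp (S * ζ * s.re) * gam (denjoyWeight α) s.re *
        Real.exp (-(α k₀ * (B (k₀ - 1))⁻¹) * √s.im) := by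
    intro s hs hi
    rw [norm_denjoyGamma, gam_eq_exp α hs.le, ← Real.exp_add, ← Real.exp_add, ← Real.exp_add,
      Real.exp_le_exp]
    have hre : (denjoyLog α s).re =
        1 + ∑ k ∈ α.support.erase 0, α k * Real.log ‖clog k k s‖ := by
      rw [denjoyLog_eq, h0]
      simp [Complex.log_re]
    have him : (denjoyLog α s).im = ∑ k ∈ α.support.erase 0, α k * (clog k k s).arg := by
      rw [denjoyLog_eq, h0]
      simp [Complex.log_im]
    have hlw : logWeight α s.re =
        1 + ∑ k ∈ α.support.erase 0, α k * Real.log (rlog k k s.re) := by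
      rw [logWeight, h0, Real.rpow_zero]
    have hterm : ∀ k ∈ α.support.erase 0,
        s.re * Real.log ‖clog k k s‖ - s.im * (clog k k s).arg ≤
          s.re * Real.log (rlog k k s.re) + A (k - 1) * (D (k - 1) + ζ * s.re) -
            (B (k - 1))⁻¹ * √s.im := by
      intro k hk
      obtain ⟨j, rfl⟩ := Nat.exists_eq_add_of_le' (one_le_of_mem_support_erase hk)
      rw [Nat.add_sub_cancel]
      have h1 := hAs j s hs.le hi
      have h2 := hDs j s.re hs.le
      have h3 := hBs j s.re hs.le
      set x := rlog (j + 1) 0 s.re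
      set P := ∏ i ∈ Finset.range (j + 1), rlog (j + 1) (i + 1) s.re
      have hx : 0 < x := rlog_pos (by omega) hs.le
      have hP : 0 < P := Finset.prod_pos fun i hi => rlog_pos (Finset.mem_range.1 hi) hs.le
      have h4 : (B j)⁻¹ * √s.im ≤ x / P * √(s.im / x) := by
        rw [Real.sqrt_div hi]
        have hsx : 0 < √x := Real.sqrt_pos.2 hx
        have : (B j)⁻¹ ≤ √x / P := by
          rw [inv_le_iff_one_le_mul₀ (hB j), div_mul_eq_mul_div, one_le_div hP]
          linarith
        calc (B j)⁻¹ * √s.im ≤ √x / P * √s.im := by gcongr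
          _ = (√x * √x) / P * (√s.im / √x) := by field_simp
          _ = _ := by rw [Real.mul_self_sqrt hx.le]
      have h5 : x / P * A j ≤ (D j + ζ * s.re) * A j := by
        have := hA j
        gcongr
      linarith
    have hsum := Finset.sum_le_sum fun k hk => mul_le_mul_of_nonneg_left (hterm k hk) (hα.1 k)
    have hlast : α k₀ * ((B (k₀ - 1))⁻¹ * √s.im) ≤
        ∑ k ∈ α.support.erase 0, α k * ((B (k - 1))⁻¹ * √s.im) :=
      Finset.single_le_sum (f := fun k => α k * ((B (k - 1))⁻¹ * √s.im))
        (fun k _ => mul_nonneg (hα.1 k) (mul_nonneg (inv_pos.2 (hB _)).le (Real.sqrt_nonneg _))) hk₀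
    have e1 : s.re * (denjoyLog α s).re - s.im * (denjoyLog α s).im = s.re +
        ∑ k ∈ α.support.erase 0, α k * (s.re * Real.log ‖clog k k s‖ - s.im * (clog k k s).arg) := by
      rw [hre, him, mul_add, mul_one, Finset.mul_sum, Finset.mul_sum, add_sub_assoc,
        ← Finset.sum_sub_distrib]
      congr 1
      exact Finset.sum_congr rfl fun k _ => by ring
    have e2 : ∑ k ∈ α.support.erase 0, α k * (s.re * Real.log (rlog k k s.re) +
          A (k - 1) * (D (k - 1) + ζ * s.re) - (B (k - 1))⁻¹ * √s.im) =
        s.re * (logWeight α s.re - 1) +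
          ∑ k ∈ α.support.erase 0, α k * (A (k - 1) * D (k - 1)) + S * ζ * s.re -
          ∑ k ∈ α.support.erase 0, α k * ((B (k - 1))⁻¹ * √s.im) := by
      simp only [hlw, S]
      rw [add_sub_cancel_left, Finset.mul_sum, mul_assoc, Finset.sum_mul,
        ← Finset.sum_add_distrib, ← Finset.sum_add_distrib, ← Finset.sum_sub_distrib]
      exact Finset.sum_congr rfl fun k _ => by ring
    rw [e2] at hsum
    rw [e1]
    linarith
  have hle : ∀ x : ℝ, 0 < x → Real.exp (S * ζ * x) ≤ Real.exp (η * x) := fun x hx =>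
    Real.exp_le_exp.2 (mul_le_mul_of_nonneg_right hSζ hx.le)
  refine ⟨_, Real.exp_pos (∑ k ∈ α.support.erase 0, α k * (A (k - 1) * D (k - 1))),
    fun s hs => ?_⟩
  have hg : 0 < gam (denjoyWeight α) s.re := by
    rw [gam_eq_exp α hs.le]
    exact Real.exp_pos _
  have main : ‖denjoyGamma α s‖ ≤
      Real.exp (∑ k ∈ α.support.erase 0, α k * (A (k - 1) * D (k - 1))) *
        Real.exp (S * ζ * s.re) * gam (denjoyWeight α) s.re *
        Real.exp (-(α k₀ * (B (k₀ - 1))⁻¹) * √|s.im|) := by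
    rcases le_total 0 s.im with hi | hi
    · rw [abs_of_nonneg hi]
      exact key s hs hi
    · have := key (starRingEnd ℂ s) (by simpa using hs) (by simpa using hi)
      rw [norm_denjoyGamma_conj α hs] at this
      simpa [abs_of_nonpos hi] using this
  refine main.trans ?_
  have := hle s.re hs
  gcongr

/-! ### Shifting vertical lines of integration -/

theorem integrable_comp_abs_of_integrableOn {g : ℝ → ℝ} (hg : IntegrableOn g (Ioi 0)) :
    Integrable fun x : ℝ => g |x| := by
  have h1 : IntegrableOn (fun x : ℝ => g |x|) (Ioi 0) :=
    hg.congr_fun (fun x hx => by rw [abs_of_pos (mem_Ioi.1 hx)]) measurableSet_Ioi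
  have h2 : IntegrableOn (fun x : ℝ => g |x|) (Iic 0) := by
    rw [integrableOn_Iic_iff_integrableOn_Iio]
    have h3 := (Measure.measurePreserving_neg (volume : Measure ℝ)).integrableOn_comp_preimage
      (Homeomorph.neg ℝ).measurableEmbedding (f := fun x : ℝ => g |x|) (s := Ioi 0)
    have h4 := h3.2 h1
    have h5 : (Neg.neg ⁻¹' Ioi (0 : ℝ)) = Iio 0 := by
      ext x
      simp
    rw [h5] at h4
    simpa [Function.comp_def] using h4
  rw [← integrableOn_univ, ← Iic_union_Ioi (a := (0 : ℝ))]
  exact h2.union h1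

theorem integrable_exp_neg_mul_abs {a : ℝ} (ha : 0 < a) :
    Integrable fun x : ℝ => Real.exp (-a * |x|) :=
  integrable_comp_abs_of_integrableOn (g := fun x => Real.exp (-a * x))
    (integrableOn_exp_mul_Ioi (by linarith) 0)

theorem integrable_exp_neg_mul_sqrt_abs {a : ℝ} (ha : 0 < a) :
    Integrable fun x : ℝ => Real.exp (-a * √|x|) := by
  refine integrable_comp_abs_of_integrableOn (g := fun x => Real.exp (-a * √x)) ?_
  have := integrableOn_rpow_mul_exp_neg_mul_rpow (p := 1 / 2) (s := 0) (b := a) (by norm_num)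
    (by norm_num) ha
  simpa [Real.sqrt_eq_rpow] using this

theorem integral_vertical_line_eq {f : ℂ → ℂ} {a b : ℝ} (hab : a ≤ b)
    (hd : ∀ s : ℂ, a ≤ s.re → s.re ≤ b → DifferentiableAt ℂ f s) {g : ℝ → ℝ}
    (hb : ∀ s : ℂ, a ≤ s.re → s.re ≤ b → 1 ≤ |s.im| → ‖f s‖ ≤ g |s.im|) (hg : Tendsto g atTop (𝓝 0))
    (ha : Integrable fun y : ℝ => f (a + y * Complex.I))
    (hbi : Integrable fun y : ℝ => f (b + y * Complex.I)) :
    ∫ y : ℝ, f (a + y * Complex.I) = ∫ y : ℝ, f (b + y * Complex.I) := by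
  have hrect : ∀ T : ℝ, Complex.I • (∫ y : ℝ in -T..T, f (b + y * Complex.I)) -
      Complex.I • (∫ y : ℝ in -T..T, f (a + y * Complex.I)) =
      (∫ x : ℝ in a..b, f (x + T * Complex.I)) -
        ∫ x : ℝ in a..b, f (x + (-T : ℝ) * Complex.I) := by
    intro T
    have h := Complex.integral_boundary_rect_eq_zero_of_differentiableOn f ⟨a, -T⟩ ⟨b, T⟩
      fun s hs => (hd s (by
        have := hs.1; rw [mem_preimage, uIcc_of_le hab] at this; exact this.1) (by
        have := hs.1; rw [mem_preimage, uIcc_of_le hab] at this; exact this.2)).differentiableWithinAt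
    simp only at h
    linear_combination h
  have hhor : ∀ T : ℝ, 1 ≤ |T| →
      ‖∫ x : ℝ in a..b, f (x + T * Complex.I)‖ ≤ g |T| * |b - a| := fun T hT =>
    intervalIntegral.norm_integral_le_of_norm_le_const fun x hx => by
      rw [uIoc_of_le hab] at hx
      simpa using hb (x + T * Complex.I) (by simpa using hx.1.le) (by simpa using hx.2)
        (by simpa using hT)
  have h1 := (intervalIntegral_tendsto_integral hbi tendsto_neg_atTop_atBot tendsto_id).const_smul
    Complex.I
  have h2 := (intervalIntegral_tendsto_integral ha tendsto_neg_atTop_atBot tendsto_id).const_smul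
    Complex.I
  have h3 := h1.sub h2
  have h4 : Tendsto (fun T : ℝ => (∫ x : ℝ in a..b, f (x + T * Complex.I)) -
        ∫ x : ℝ in a..b, f (x + (-T : ℝ) * Complex.I)) atTop (𝓝 0) := by
    refine squeeze_zero_norm' (a := fun T => 2 * |b - a| * g T) ?_
      (by simpa using hg.const_mul (2 * |b - a|))
    filter_upwards [eventually_ge_atTop 1] with T hT
    have hT' : |T| = T := abs_of_nonneg (by linarith)
    have h5 := hhor T (by rwa [hT'])
    have h6 := hhor (-T) (by rwa [abs_neg, hT'])
    rw [abs_neg] at h6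
    rw [hT'] at h5 h6
    exact (norm_sub_le _ _).trans (by linarith)
  have h5 := tendsto_nhds_unique h3 (h4.congr fun T => (hrect T).symm)
  rw [← smul_sub, smul_eq_zero, or_iff_right Complex.I_ne_zero, sub_eq_zero] at h5
  exact h5.symm

theorem inv_cosh_le (x : ℝ) : (Real.cosh x)⁻¹ ≤ 2 * Real.exp (-|x|) := by
  rw [← Real.cosh_abs, inv_le_iff_one_le_mul₀ (Real.cosh_pos _), Real.cosh_eq]
  have h := Real.exp_pos (-|x|)
  have h2 : Real.exp (-|x|) * Real.exp |x| = 1 := by rw [← Real.exp_add]; simp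
  nlinarith

theorem integrable_pi_div_cosh : Integrable fun y : ℝ => Real.pi / Real.cosh (Real.pi * y) := by
  refine ((integrable_exp_neg_mul_abs Real.pi_pos).const_mul (2 * Real.pi)).mono'
    (Continuous.aestronglyMeasurable ?_) (ae_of_all _ fun y => ?_)
  · exact continuous_const.div (Real.continuous_cosh.comp (continuous_const.mul continuous_id))
      fun y => (Real.cosh_pos _).ne'
  · have h := inv_cosh_le (Real.pi * y)
    rw [abs_mul, abs_of_pos Real.pi_pos] at h
    rw [Real.norm_of_nonneg (div_nonneg Real.pi_pos.le (Real.cosh_pos _).le), div_eq_mul_inv]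
    calc Real.pi * (Real.cosh (Real.pi * y))⁻¹ ≤ Real.pi * (2 * Real.exp (-(Real.pi * |y|))) := by
          gcongr
      _ = _ := by rw [neg_mul]; ring

theorem integral_pi_div_cosh : ∫ y : ℝ, Real.pi / Real.cosh (Real.pi * y) = Real.pi := by
  have hd : ∀ y : ℝ, HasDerivAt (fun y : ℝ => Real.arctan (Real.sinh (Real.pi * y)))
      (Real.pi / Real.cosh (Real.pi * y)) y := by
    intro y
    have h1 : HasDerivAt (fun y : ℝ => Real.pi * y) Real.pi y := by
      simpa using (hasDerivAt_id y).const_mul Real.pi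
    refine h1.sinh.arctan.congr_deriv ?_
    rw [← Real.cosh_sq']
    field_simp
  have hpi := Real.pi_pos
  have htop : Tendsto (fun y : ℝ => Real.pi * y) atTop atTop := tendsto_id.const_mul_atTop hpi
  have hbot : Tendsto (fun y : ℝ => Real.pi * y) atBot atBot := tendsto_id.const_mul_atBot hpi
  have hst : Tendsto Real.sinh atTop atTop :=
    tendsto_atTop_mono' _ ((eventually_ge_atTop 0).mono fun x hx => Real.self_le_sinh_iff.2 hx)
      tendsto_id
  have hsb : Tendsto Real.sinh atBot atBot :=
    tendsto_atBot_mono' _ ((eventually_le_atBot 0).mono fun x hx => Real.sinh_le_self_iff.2 hx)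
      tendsto_id
  rw [integral_of_hasDerivAt_of_tendsto hd integrable_pi_div_cosh
    ((tendsto_nhds_of_tendsto_nhdsWithin Real.tendsto_arctan_atBot).comp (hsb.comp hbot))
    ((tendsto_nhds_of_tendsto_nhdsWithin Real.tendsto_arctan_atTop).comp (hst.comp htop))]
  ring

/-! ### A Mellin–Barnes formula -/

theorem sinh_abs_im_le_norm_sin (z : ℂ) : Real.sinh |z.im| ≤ ‖Complex.sin z‖ := by
  have h1 : ‖Complex.exp (-z * Complex.I)‖ = Real.exp z.im := by
    rw [Complex.norm_exp]; simp
  have h2 : ‖Complex.exp (z * Complex.I)‖ = Real.exp (-z.im) := by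
    rw [Complex.norm_exp]; simp
  have h3 : ‖Complex.sin z‖ =
      ‖Complex.exp (-z * Complex.I) - Complex.exp (z * Complex.I)‖ / 2 := by
    rw [Complex.sin, norm_div, norm_mul, Complex.norm_I, mul_one, Complex.norm_ofNat]
  rw [h3]
  have h4 := abs_norm_sub_norm_le (Complex.exp (-z * Complex.I)) (Complex.exp (z * Complex.I))
  rw [h1, h2] at h4
  rw [Real.sinh_eq]
  rcases le_total 0 z.im with h | h
  · rw [abs_of_nonneg h]
    linarith [le_abs_self (Real.exp z.im - Real.exp (-z.im))]
  · rw [abs_of_nonpos h, neg_neg]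
    linarith [neg_abs_le (Real.exp z.im - Real.exp (-z.im))]

theorem sin_pi_mul_half_line (p : ℕ) (y : ℝ) :
    Complex.sin (Real.pi * ((p : ℂ) + 1 / 2 + y * Complex.I)) =
      (-1) ^ p * (Real.cosh (Real.pi * y) : ℂ) := by
  have h1 : (Real.pi : ℂ) * ((p : ℂ) + 1 / 2 + y * Complex.I) =
      (Real.pi * y : ℝ) * Complex.I + Real.pi / 2 + p * Real.pi := by push_cast; ring
  rw [h1, Complex.sin_antiperiodic.add_nat_mul_eq, Complex.sin_add_pi_div_two, Complex.cos_mul_I,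
    Complex.ofReal_cosh]

/-- The difference of the integrals of `h(s) π / sin (π s)` over the lines `re s = p ± 1 / 2` is
`2 π` times the value `(-1)^p h(p)`. -/
theorem integral_half_line_sub {h : ℂ → ℂ} {B θ : ℝ} (hθ : 0 < θ) (hθπ : θ ≤ Real.pi)
    (hd : ∀ s : ℂ, 0 < s.re → DifferentiableAt ℂ h s) (p : ℕ)
    (hb : ∀ s : ℂ, (p : ℝ) + 1 / 2 ≤ s.re → s.re ≤ p + 3 / 2 →
      ‖h s‖ ≤ B * Real.exp ((Real.pi - θ) * |s.im|)) :
    (-1) ^ (p + 1) * ∫ y : ℝ, h ((p : ℂ) + 3 / 2 + y * Complex.I) *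
        (Real.pi / Real.cosh (Real.pi * y) : ℝ) =
      2 * Real.pi * ((-1) ^ (p + 1) * h ((p : ℂ) + 1)) +
        (-1) ^ p * ∫ y : ℝ, h ((p : ℂ) + 1 / 2 + y * Complex.I) *
          (Real.pi / Real.cosh (Real.pi * y) : ℝ) := by
  have hpi := Real.pi_pos
  set q : ℂ := (p : ℂ) + 1 with hq
  have hqre : q.re = p + 1 := by simp [hq]
  have hqim : q.im = 0 := by simp [hq]
  have hU : IsOpen {s : ℂ | 0 < s.re} := isOpen_lt continuous_const Complex.continuous_re
  have hqU : {s : ℂ | 0 < s.re} ∈ 𝓝 q := hU.mem_nhds (by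
    change 0 < q.re
    rw [hqre]; positivity)
  have hsinq : Complex.sin (Real.pi * q) = 0 := by
    have := Complex.sin_nat_mul_pi (p + 1)
    push_cast at this
    rw [hq, mul_comm]
    exact this
  have hB : 0 ≤ B := by
    have h1 := (norm_nonneg _).trans (hb q (by rw [hqre]; linarith) (by rw [hqre]; linarith))
    exact nonneg_of_mul_nonneg_left h1 (Real.exp_pos _)
  set D1 := dslope h q
  set D2 := dslope (fun s : ℂ => Complex.sin (Real.pi * s)) q
  -- The singularity of `(h(s) - h(q)) π / sin (π s)` at `q` is removable.
  set Φ : ℂ → ℂ := fun s => Real.pi * D1 s / D2 s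
  have hD1 : DifferentiableOn ℂ D1 {s : ℂ | 0 < s.re} :=
    (Complex.differentiableOn_dslope hqU).2 fun s hs => (hd s hs).differentiableWithinAt
  have hsin : Differentiable ℂ (fun s : ℂ => Complex.sin (Real.pi * s)) := by fun_prop
  have hD2 : DifferentiableOn ℂ D2 univ :=
    (Complex.differentiableOn_dslope univ_mem).2 hsin.differentiableOn
  have hD2eq : ∀ s, s ≠ q → D2 s = Complex.sin (Real.pi * s) / (s - q) := fun s hs => by
    simp only [D2]
    rw [dslope_of_ne _ hs, slope_def_field, hsinq, sub_zero]
  have hD1eq : ∀ s, s ≠ q → D1 s = (h s - h q) / (s - q) := fun s hs => by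
    simp only [D1]
    rw [dslope_of_ne _ hs, slope_def_field]
  have hD2ne : ∀ s : ℂ, (p : ℝ) + 1 / 2 ≤ s.re → s.re ≤ p + 3 / 2 → D2 s ≠ 0 := by
    intro s h1 h2
    by_cases hs : s = q
    · rw [hs]
      simp only [D2]
      have hder : HasDerivAt (fun s : ℂ => Complex.sin (Real.pi * s))
          (Complex.cos (Real.pi * q) * Real.pi) q := by
        have h3 : HasDerivAt (fun s : ℂ => (Real.pi : ℂ) * s) Real.pi q := by
          simpa using (hasDerivAt_id q).const_mul (Real.pi : ℂ)
        exact h3.csin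
      rw [dslope_same, hder.deriv]
      refine mul_ne_zero (fun hc => ?_) (by exact_mod_cast hpi.ne')
      have := Complex.sin_sq_add_cos_sq (Real.pi * q)
      rw [hsinq, hc] at this
      norm_num at this
    · rw [hD2eq s hs]
      refine div_ne_zero (fun hc => hs ?_) (sub_ne_zero.2 hs)
      obtain ⟨k, hk⟩ := Complex.sin_eq_zero_iff.1 hc
      have hsk : s = k := by
        have hpi' : (Real.pi : ℂ) ≠ 0 := by exact_mod_cast hpi.ne'
        rw [mul_comm] at hk
        exact mul_right_cancel₀ hpi' hk
      rw [hsk, Complex.intCast_re] at h1 h2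
      have h3 : (p : ℝ) < k := by linarith
      have h4 : (k : ℝ) < p + 2 := by linarith
      have h5 : (p : ℤ) < k := by exact_mod_cast h3
      have h6 : k < p + 2 := by exact_mod_cast h4
      have h7 : k = p + 1 := by omega
      rw [hsk, h7, hq]
      push_cast
      rfl
  have hΦd : ∀ s : ℂ, (p : ℝ) + 1 / 2 ≤ s.re → s.re ≤ p + 3 / 2 → DifferentiableAt ℂ Φ s :=
    fun s h1 h2 => ((hD1.differentiableAt (hU.mem_nhds (by
      have : (0 : ℝ) ≤ p := Nat.cast_nonneg p
      change 0 < s.re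
      linarith))).const_mul _).div (hD2.differentiableAt univ_mem) (hD2ne s h1 h2)
  have hΦeq : ∀ s, s ≠ q → Φ s = Real.pi * (h s - h q) / Complex.sin (Real.pi * s) := by
    intro s hs
    have := sub_ne_zero.2 hs
    simp only [Φ]
    rw [hD1eq s hs, hD2eq s hs, mul_div_assoc', div_div_div_cancel_right₀ this]
  have hΦb : ∀ s : ℂ, (p : ℝ) + 1 / 2 ≤ s.re → s.re ≤ p + 3 / 2 → 1 ≤ |s.im| →
      ‖Φ s‖ ≤ 8 * Real.pi * B * Real.exp (-θ * |s.im|) := by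
    intro s h1 h2 h3
    have hs : s ≠ q := fun h => by rw [h, hqim, abs_zero] at h3; linarith
    have h4 : Real.exp (Real.pi * |s.im|) / 4 ≤ ‖Complex.sin (Real.pi * s)‖ := by
      refine le_trans ?_ (sinh_abs_im_le_norm_sin _)
      have h5 : ((Real.pi : ℂ) * s).im = Real.pi * s.im := by simp
      rw [h5, abs_mul, abs_of_pos hpi, Real.sinh_eq]
      have h6 : 1 ≤ Real.pi * |s.im| := by nlinarith [Real.pi_gt_three]
      have h7 := Real.add_one_le_exp (Real.pi * |s.im|)
      have h8 : Real.exp (-(Real.pi * |s.im|)) ≤ 1 := Real.exp_le_one_iff.2 (by linarith)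
      linarith
    have h5 : ‖h s - h q‖ ≤ 2 * B * Real.exp ((Real.pi - θ) * |s.im|) := by
      have h6 := hb s h1 h2
      have h7 := hb q (by rw [hqre]; linarith) (by rw [hqre]; linarith)
      rw [hqim, abs_zero, mul_zero, Real.exp_zero, mul_one] at h7
      have h8 : 1 ≤ Real.exp ((Real.pi - θ) * |s.im|) :=
        Real.one_le_exp (mul_nonneg (by linarith) (abs_nonneg _))
      have h9 := norm_sub_le (h s) (h q)
      nlinarith
    rw [hΦeq s hs, norm_div, norm_mul, Complex.norm_real, Real.norm_of_nonneg hpi.le,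
      div_le_iff₀ (lt_of_lt_of_le (by positivity) h4)]
    calc Real.pi * ‖h s - h q‖ ≤ Real.pi * (2 * B * Real.exp ((Real.pi - θ) * |s.im|)) := by
          gcongr
      _ = 8 * Real.pi * B * Real.exp (-θ * |s.im|) * (Real.exp (Real.pi * |s.im|) / 4) := by
          rw [show (Real.pi - θ) * |s.im| = -θ * |s.im| + Real.pi * |s.im| by ring, Real.exp_add]
          ring
      _ ≤ _ := by gcongr
  have hline : ∀ a : ℝ, (p : ℝ) + 1 / 2 ≤ a → a ≤ p + 3 / 2 →
      Integrable fun y : ℝ => h (a + y * Complex.I) *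
        (Real.pi / Real.cosh (Real.pi * y) : ℝ) := by
    intro a h1 h2
    have ha0 : 0 < a := lt_of_lt_of_le (by positivity) h1
    refine ((integrable_exp_neg_mul_abs hθ).const_mul (2 * Real.pi * B)).mono'
      (Continuous.aestronglyMeasurable ?_) (ae_of_all _ fun y => ?_)
    · refine Continuous.mul (continuous_iff_continuousAt.2 fun y => ?_)
        (Complex.continuous_ofReal.comp (continuous_const.div
          (Real.continuous_cosh.comp (continuous_const.mul continuous_id))
          fun y => (Real.cosh_pos _).ne'))
      exact ContinuousAt.comp (f := fun y : ℝ => (a : ℂ) + y * Complex.I)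
        (hd _ (by simpa using ha0)).continuousAt (by fun_prop)
    · have h3 := hb (a + y * Complex.I) (by simpa using h1) (by simpa using h2)
      have h4 := inv_cosh_le (Real.pi * y)
      rw [abs_mul, abs_of_pos hpi] at h4
      have h5 : ((a : ℂ) + y * Complex.I).im = y := by simp
      rw [h5] at h3
      rw [norm_mul, Complex.norm_real,
        Real.norm_of_nonneg (div_nonneg hpi.le (Real.cosh_pos _).le), div_eq_mul_inv]
      calc ‖h (a + y * Complex.I)‖ * (Real.pi * (Real.cosh (Real.pi * y))⁻¹)
          ≤ (B * Real.exp ((Real.pi - θ) * |y|)) * (Real.pi * (2 * Real.exp (-(Real.pi * |y|)))) := by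
            have := Real.cosh_pos (Real.pi * y)
            gcongr
        _ = 2 * Real.pi * B * Real.exp (-θ * |y|) := by
            rw [show -θ * |y| = (Real.pi - θ) * |y| + -(Real.pi * |y|) by ring, Real.exp_add]
            ring
  have hcosh : Integrable fun y : ℝ => h q * (Real.pi / Real.cosh (Real.pi * y) : ℝ) :=
    (integrable_pi_div_cosh.ofReal).const_mul _
  have hcoshI : ∫ y : ℝ, h q * (Real.pi / Real.cosh (Real.pi * y) : ℝ) = h q * Real.pi := by
    rw [integral_const_mul, integral_complex_ofReal, integral_pi_div_cosh]
  have hcoshne : ∀ y : ℝ, (Real.cosh (Real.pi * y) : ℂ) ≠ 0 := fun y => by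
    exact_mod_cast (Real.cosh_pos _).ne'
  have hL : ∀ (n : ℕ), p ≤ n → n ≤ p + 1 → ∀ y : ℝ,
      Φ (((n + 1 / 2 : ℝ) : ℂ) + y * Complex.I) =
      (-1) ^ n * (h (((n + 1 / 2 : ℝ) : ℂ) + y * Complex.I) *
        (Real.pi / Real.cosh (Real.pi * y) : ℝ) -
        h q * (Real.pi / Real.cosh (Real.pi * y) : ℝ)) := by
    intro n hn1 hn2 y
    have hne : ((n + 1 / 2 : ℝ) : ℂ) + y * Complex.I ≠ q := fun hh => by
      have h1 := congrArg Complex.re hh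
      rw [hqre] at h1
      simp only [Complex.add_re, Complex.ofReal_re, Complex.mul_re, Complex.I_re, mul_zero,
        Complex.ofReal_im, Complex.I_im, mul_one, sub_self, add_zero] at h1
      have h2 : (2 * n : ℝ) + 1 = 2 * p + 2 := by linarith
      have h3 : 2 * n + 1 = 2 * p + 2 := by exact_mod_cast h2
      omega
    rw [hΦeq _ hne]
    have h1 : ((n + 1 / 2 : ℝ) : ℂ) + y * Complex.I = (n : ℂ) + 1 / 2 + y * Complex.I := by
      push_cast; ring
    have h2 := sin_pi_mul_half_line n y
    rw [← h1] at h2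
    rw [h2, Complex.ofReal_div, ← sub_mul, div_eq_mul_inv, mul_inv, ← inv_pow, inv_neg, inv_one]
    ring
  have hint : ∀ (n : ℕ), p ≤ n → n ≤ p + 1 →
      Integrable (fun y : ℝ => Φ (((n + 1 / 2 : ℝ) : ℂ) + y * Complex.I)) ∧
      ∫ y : ℝ, Φ (((n + 1 / 2 : ℝ) : ℂ) + y * Complex.I) =
      (-1) ^ n * ((∫ y : ℝ, h (((n + 1 / 2 : ℝ) : ℂ) + y * Complex.I) *
        (Real.pi / Real.cosh (Real.pi * y) : ℝ)) - h q * Real.pi) := by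
    intro n hn1 hn2
    have hn1' : (p : ℝ) ≤ n := by exact_mod_cast hn1
    have hn2' : (n : ℝ) ≤ p + 1 := by exact_mod_cast hn2
    have hli := hline (n + 1 / 2) (by linarith) (by linarith)
    simp only [hL n hn1 hn2]
    refine ⟨(hli.sub hcosh).const_mul _, ?_⟩
    rw [integral_const_mul, integral_sub hli hcosh, hcoshI]
  obtain ⟨i1, e1⟩ := hint p le_rfl (Nat.le_succ p)
  obtain ⟨i2, e2⟩ := hint (p + 1) (Nat.le_succ p) le_rfl
  have hp1 : ((p + 1 : ℕ) : ℝ) + 1 / 2 = p + 3 / 2 := by push_cast; ring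
  rw [hp1] at i2 e2
  have hexp : Tendsto (fun T : ℝ => 8 * Real.pi * B * Real.exp (-θ * T)) atTop (𝓝 0) := by
    have h1 : Tendsto (fun T : ℝ => -θ * T) atTop atBot :=
      tendsto_id.const_mul_atTop_of_neg (by linarith)
    simpa using (Real.tendsto_exp_atBot.comp h1).const_mul (8 * Real.pi * B)
  have hshift := integral_vertical_line_eq (by linarith) hΦd hΦb hexp i1 i2
  rw [e1, e2] at hshift
  have c1 : ((p + 1 / 2 : ℝ) : ℂ) = (p : ℂ) + 1 / 2 := by push_cast; ring
  have c2 : ((p + 3 / 2 : ℝ) : ℂ) = (p : ℂ) + 3 / 2 := by push_cast; ring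
  rw [c1, c2] at hshift
  rw [pow_succ] at hshift ⊢
  linear_combination -hshift

theorem tendsto_sum_mellinBarnes {h : ℂ → ℂ} {θ : ℝ} {b : ℝ → ℝ} (hθ : 0 < θ) (hθπ : θ ≤ Real.pi)
    (hd : ∀ s : ℂ, 0 < s.re → DifferentiableAt ℂ h s)
    (hb : ∀ s : ℂ, 1 / 2 ≤ s.re → ‖h s‖ ≤ b s.re * Real.exp ((Real.pi - θ) * |s.im|))
    (hbB : ∀ R : ℝ, ∃ B : ℝ, ∀ σ : ℝ, 1 / 2 ≤ σ → σ ≤ R → b σ ≤ B)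
    (hb0 : Tendsto (fun N : ℕ => b ((N : ℝ) + 1 / 2)) atTop (𝓝 0)) :
    Tendsto (fun N : ℕ => ∑ n ∈ Finset.range N, (-1) ^ n * h ((n : ℂ) + 1)) atTop
      (𝓝 ((2 * Real.pi : ℂ)⁻¹ * ∫ y : ℝ, h (1 / 2 + y * Complex.I) *
        (Real.pi / Real.cosh (Real.pi * y) : ℝ))) := by
  have hpi := Real.pi_pos
  have hpi' : (Real.pi : ℂ) ≠ 0 := by exact_mod_cast hpi.ne'
  set A : ℕ → ℂ := fun N => (-1) ^ N * ∫ y : ℝ, h ((N : ℂ) + 1 / 2 + y * Complex.I) *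
    (Real.pi / Real.cosh (Real.pi * y) : ℝ) with hA
  have hstep : ∀ N, A (N + 1) = 2 * Real.pi * ((-1) ^ (N + 1) * h ((N : ℂ) + 1)) + A N := by
    intro N
    obtain ⟨B, hB⟩ := hbB (N + 3 / 2)
    have h1 := integral_half_line_sub (B := B) hθ hθπ hd N fun s h1 h2 => by
      have hs : 1 / 2 ≤ s.re := le_trans (by simp) h1
      exact (hb s hs).trans (by gcongr; exact hB _ hs h2)
    simp only [hA]
    rw [← h1]
    push_cast
    congr 3
    ext y
    congr 2
    ring
  have hsum : ∀ N, ∑ n ∈ Finset.range N, (-1) ^ n * h ((n : ℂ) + 1) =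
      (2 * Real.pi : ℂ)⁻¹ * (A 0 - A N) := by
    intro N
    induction N with
    | zero => simp
    | succ N ih =>
      rw [Finset.sum_range_succ, ih, hstep N, pow_succ]
      field_simp
      ring
  have hA0 : Tendsto A atTop (𝓝 0) := by
    have hC := (integrable_exp_neg_mul_abs hθ).const_mul (2 * Real.pi)
    refine squeeze_zero_norm (a := fun N : ℕ => b ((N : ℝ) + 1 / 2) *
      ∫ y : ℝ, 2 * Real.pi * Real.exp (-θ * |y|)) (fun N => ?_) (by simpa using hb0.mul_const _)
    simp only [hA]
    rw [norm_mul, norm_pow, norm_neg, norm_one, one_pow, one_mul, ← integral_const_mul]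
    refine norm_integral_le_of_norm_le (hC.const_mul _) (ae_of_all _ fun y => ?_)
    have h3 := hb ((N : ℂ) + 1 / 2 + y * Complex.I) (by simp)
    have h4 := inv_cosh_le (Real.pi * y)
    rw [abs_mul, abs_of_pos hpi] at h4
    have h5 : ((N : ℂ) + 1 / 2 + y * Complex.I).im = y := by simp
    have h6 : ((N : ℂ) + 1 / 2 + y * Complex.I).re = (N : ℝ) + 1 / 2 := by simp
    rw [h5, h6] at h3
    rw [norm_mul, Complex.norm_real,
      Real.norm_of_nonneg (div_nonneg hpi.le (Real.cosh_pos _).le), div_eq_mul_inv]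
    have hcpos := Real.cosh_pos (Real.pi * y)
    calc ‖h ((N : ℂ) + 1 / 2 + y * Complex.I)‖ * (Real.pi * (Real.cosh (Real.pi * y))⁻¹)
        ≤ (b (N + 1 / 2) * Real.exp ((Real.pi - θ) * |y|)) *
            (Real.pi * (2 * Real.exp (-(Real.pi * |y|)))) :=
          mul_le_mul h3 (by gcongr) (by positivity) ((norm_nonneg _).trans h3)
      _ = b (N + 1 / 2) * (2 * Real.pi * Real.exp (-θ * |y|)) := by
          rw [show -θ * |y| = (Real.pi - θ) * |y| + -(Real.pi * |y|) by ring, Real.exp_add]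
          ring
  have h7 := ((tendsto_const_nhds (x := A 0)).sub hA0).const_mul (2 * Real.pi : ℂ)⁻¹
  rw [sub_zero] at h7
  have h8 : A 0 = ∫ y : ℝ, h (1 / 2 + y * Complex.I) *
      (Real.pi / Real.cosh (Real.pi * y) : ℝ) := by simp [hA]
  rw [← h8]
  exact h7.congr fun N => (hsum N).symm

/-- The entire function `E(w) = ∑ wⁿ / γ(n + 1)`. -/
def weightEC (L : ℝ → ℝ) (w : ℂ) : ℂ := ∑' n : ℕ, w ^ n / (gam L ((n : ℝ) + 1) : ℂ)

/-- The integral `∫ e^{-θ|y|} / |γ(1/2 + iy)| dy`, which bounds `E` off the sector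
`|arg w| < θ`. -/
def sectorBound (α : ℕ →₀ ℝ) (θ : ℝ) : ℝ :=
  ∫ y : ℝ, Real.exp (-θ * |y|) * ‖denjoyGamma α (1 / 2 + y * Complex.I)‖⁻¹

theorem continuous_denjoyGamma_line (α : ℕ →₀ ℝ) {c : ℝ} (hc : 0 < c) :
    Continuous fun y : ℝ => denjoyGamma α (c + y * Complex.I) :=
  continuous_iff_continuousAt.2 fun y =>
    ContinuousAt.comp (f := fun y : ℝ => (c : ℂ) + y * Complex.I)
      (differentiableAt_denjoyGamma α (by simpa using hc)).continuousAt (by fun_prop)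

theorem integrable_sectorBound {α : ℕ →₀ ℝ} (hα : IsDenjoyIndex α) {θ : ℝ} (hθ : 0 < θ) :
    Integrable fun y : ℝ =>
      Real.exp (-θ * |y|) * ‖denjoyGamma α (1 / 2 + y * Complex.I)‖⁻¹ := by
  obtain ⟨c, hc, h⟩ := le_norm_denjoyGamma hα (half_pos hθ)
  have hcont := continuous_denjoyGamma_line α (c := 1 / 2) (by norm_num)
  push_cast at hcont
  refine ((integrable_exp_neg_mul_abs (half_pos hθ)).const_mul c⁻¹).mono'
    (Continuous.aestronglyMeasurable ?_) (ae_of_all _ fun y => ?_)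
  · exact (Real.continuous_exp.comp (continuous_const.mul continuous_abs)).mul
      (hcont.norm.inv₀ fun y => norm_ne_zero_iff.2 (denjoyGamma_ne_zero α _))
  · have h1 := h (1 / 2 + y * Complex.I) (by simp)
    have h2 : ((1 : ℂ) / 2 + y * Complex.I).im = y := by simp
    have h3 : ((1 : ℂ) / 2 + y * Complex.I).re = 1 / 2 := by simp
    rw [h2, h3] at h1
    have h4 : c * Real.exp (-(θ / 2) * |y|) ≤ ‖denjoyGamma α (1 / 2 + y * Complex.I)‖ := by
      refine le_trans ?_ h1
      gcongr
      have hcos : 0 ≤ Real.cos (α 0 * (Real.pi / 2)) := by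
        have hpi := Real.pi_pos
        exact Real.cos_nonneg_of_neg_pi_div_two_le_of_le (by nlinarith [hα.1 0])
          (by nlinarith [hα.2.1])
      have := mul_nonneg hcos (logWeight_nonneg hα (show (0 : ℝ) ≤ 1 / 2 by norm_num))
      linarith
    rw [Real.norm_of_nonneg (by positivity)]
    calc Real.exp (-θ * |y|) * ‖denjoyGamma α (1 / 2 + y * Complex.I)‖⁻¹
        ≤ Real.exp (-θ * |y|) * (c * Real.exp (-(θ / 2) * |y|))⁻¹ := by gcongr
      _ = c⁻¹ * Real.exp (-(θ / 2) * |y|) := by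
          rw [mul_inv, ← Real.exp_neg, mul_left_comm, ← Real.exp_add]
          congr 2
          ring

theorem sectorBound_anti {α : ℕ →₀ ℝ} (hα : IsDenjoyIndex α) {θ θ' : ℝ} (hθ : 0 < θ)
    (h : θ ≤ θ') : sectorBound α θ' ≤ sectorBound α θ := by
  refine integral_mono (integrable_sectorBound hα (hθ.trans_le h)) (integrable_sectorBound hα hθ)
    fun y => ?_
  have := abs_nonneg y
  simp only
  gcongr

theorem norm_weightEC_le_sectorBound {α : ℕ →₀ ℝ} (hα : IsDenjoyIndex α) {θ : ℝ} (hθ : 0 < θ)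
    (hθπ : θ ≤ Real.pi) {w : ℂ} (hw0 : w ≠ 0) (hw : |(-w).arg| ≤ Real.pi - θ) :
    ‖weightEC (denjoyWeight α) w‖ ≤ ‖w‖ ^ (-(1 / 2) : ℝ) * sectorBound α θ := by
  have hpi := Real.pi_pos
  have hw0' : -w ≠ 0 := neg_ne_zero.2 hw0
  have hwn : 0 < ‖w‖ := norm_pos_iff.2 hw0
  set h : ℂ → ℂ := fun s => (-w) ^ (s - 1) / denjoyGamma α s
  set Λ : ℝ → ℝ := fun σ => Real.cos (α 0 * (Real.pi / 2)) * logWeight α σ with hΛ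
  have hcos : 0 < Real.cos (α 0 * (Real.pi / 2)) :=
    Real.cos_pos_of_mem_Ioo ⟨by nlinarith [hα.1 0], by nlinarith [hα.2.1]⟩
  have hnum : ∀ s : ℂ, ‖(-w) ^ (s - 1)‖ ≤
      ‖w‖ ^ (s.re - 1) * Real.exp ((Real.pi - θ) * |s.im|) := by
    intro s
    rw [Complex.norm_cpow_of_ne_zero hw0', norm_neg, Complex.sub_re, Complex.one_re,
      Complex.sub_im, Complex.one_im, sub_zero, div_eq_mul_inv, ← Real.exp_neg]
    gcongr
    calc -((-w).arg * s.im) ≤ |(-w).arg * s.im| := neg_le_abs _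
      _ = |(-w).arg| * |s.im| := abs_mul _ _
      _ ≤ _ := by gcongr
  obtain ⟨c, hc, hγ⟩ := le_norm_denjoyGamma hα (half_pos hθ)
  set b : ℝ → ℝ := fun σ => c⁻¹ * Real.exp ((σ - 1) * Real.log ‖w‖ - σ * Λ σ)
  have hd : ∀ s : ℂ, 0 < s.re → DifferentiableAt ℂ h s := fun s hs =>
    ((differentiableAt_id.sub_const (1 : ℂ)).const_cpow (Or.inl hw0')).div
      (differentiableAt_denjoyGamma α hs) (denjoyGamma_ne_zero α s)
  have hb : ∀ s : ℂ, 1 / 2 ≤ s.re →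
      ‖h s‖ ≤ b s.re * Real.exp ((Real.pi - θ / 2) * |s.im|) := by
    intro s hs
    have h1 := hγ s hs
    simp only [h, b]
    rw [norm_div, div_le_iff₀ (norm_pos_iff.2 (denjoyGamma_ne_zero α s))]
    refine (hnum s).trans ?_
    calc ‖w‖ ^ (s.re - 1) * Real.exp ((Real.pi - θ) * |s.im|)
        = c⁻¹ * Real.exp ((s.re - 1) * Real.log ‖w‖ - s.re * Λ s.re) *
            Real.exp ((Real.pi - θ / 2) * |s.im|) *
            (c * Real.exp (s.re * Λ s.re - θ / 2 * |s.im|)) := by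
          rw [Real.rpow_def_of_pos hwn, ← Real.exp_add]
          have : c⁻¹ * Real.exp ((s.re - 1) * Real.log ‖w‖ - s.re * Λ s.re) *
            Real.exp ((Real.pi - θ / 2) * |s.im|) *
            (c * Real.exp (s.re * Λ s.re - θ / 2 * |s.im|)) = (c⁻¹ * c) *
            (Real.exp ((s.re - 1) * Real.log ‖w‖ - s.re * Λ s.re) *
            Real.exp ((Real.pi - θ / 2) * |s.im|) *
            Real.exp (s.re * Λ s.re - θ / 2 * |s.im|)) := by ring
          rw [this, inv_mul_cancel₀ hc.ne', one_mul, ← Real.exp_add, ← Real.exp_add]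
          congr 1
          ring
      _ ≤ _ := by gcongr
  have hΛ0 : ∀ σ, 0 ≤ σ → 0 ≤ Λ σ := fun σ hσ => mul_nonneg hcos.le (logWeight_nonneg hα hσ)
  have hbB : ∀ R : ℝ, ∃ B : ℝ, ∀ σ : ℝ, 1 / 2 ≤ σ → σ ≤ R → b σ ≤ B := by
    refine fun R => ⟨c⁻¹ * Real.exp ((R + 1) * |Real.log ‖w‖|), fun σ h1 h2 => ?_⟩
    simp only [b]
    gcongr
    have h3 := mul_nonneg (show 0 ≤ σ by linarith) (hΛ0 σ (by linarith))
    have h4 : (σ - 1) * Real.log ‖w‖ ≤ |σ - 1| * |Real.log ‖w‖| :=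
      (le_abs_self _).trans (abs_mul _ _).le
    have h5 : |σ - 1| ≤ R + 1 := abs_le.2 ⟨by linarith, by linarith⟩
    have h6 : |σ - 1| * |Real.log ‖w‖| ≤ (R + 1) * |Real.log ‖w‖| := by gcongr
    linarith
  have hb0 : Tendsto (fun N : ℕ => b ((N : ℝ) + 1 / 2)) atTop (𝓝 0) := by
    have h1 : Tendsto (fun N : ℕ => (N : ℝ) + 1 / 2) atTop atTop :=
      tendsto_atTop_add_const_right _ _ tendsto_natCast_atTop_atTop
    have h2 : Tendsto (fun σ : ℝ => Λ σ - Real.log ‖w‖) atTop atTop :=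
      tendsto_atTop_add_const_right _ _ ((tendsto_logWeight hα).const_mul_atTop hcos)
    have h3 : Tendsto (fun σ : ℝ => σ * (Λ σ - Real.log ‖w‖) + Real.log ‖w‖) atTop atTop :=
      tendsto_atTop_add_const_right _ _ (tendsto_id.atTop_mul_atTop₀ h2)
    have h4 := (Real.tendsto_exp_neg_atTop_nhds_zero.comp h3).const_mul c⁻¹
    rw [mul_zero] at h4
    refine (h4.comp h1).congr fun N => ?_
    simp only [b, Function.comp]
    congr 2
    ring
  have hlim := tendsto_sum_mellinBarnes (half_pos hθ) (by linarith) hd hb hbB hb0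
  have hgam : ∀ n : ℕ, denjoyGamma α ((n : ℂ) + 1) =
      (gam (denjoyWeight α) ((n : ℝ) + 1) : ℂ) := fun n => by
    rw [← denjoyGamma_ofReal α (by positivity)]
    push_cast
    rfl
  have hterm : ∀ n : ℕ, (-1) ^ n * h ((n : ℂ) + 1) =
      w ^ n / (gam (denjoyWeight α) ((n : ℝ) + 1) : ℂ) := by
    intro n
    simp only [h]
    rw [hgam, add_sub_cancel_right, Complex.cpow_natCast, mul_div_assoc', ← mul_pow]
    simp
  have hsummable : Summable fun n : ℕ => w ^ n / (gam (denjoyWeight α) ((n : ℝ) + 1) : ℂ) := by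
    refine Summable.of_norm ?_
    refine (summable_pow_div_gam (tendsto_denjoyWeight hα) ‖w‖).congr fun n => ?_
    rw [norm_div, norm_pow, Complex.norm_real, Real.norm_of_nonneg]
    exact Real.rpow_nonneg (zero_le_one.trans (one_le_denjoyWeight hα (by positivity))) _
  simp only [hterm] at hlim
  have heq := tendsto_nhds_unique hsummable.hasSum.tendsto_sum_nat hlim
  rw [weightEC, heq, norm_mul, norm_inv, norm_mul, Complex.norm_ofNat, Complex.norm_real,
    Real.norm_of_nonneg hpi.le, inv_mul_le_iff₀ (by positivity), sectorBound,
    ← integral_const_mul, ← integral_const_mul]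
  refine norm_integral_le_of_norm_le
    (((integrable_sectorBound hα hθ).const_mul _).const_mul _) (ae_of_all _ fun y => ?_)
  have h1 := hnum (1 / 2 + y * Complex.I)
  have h4 := inv_cosh_le (Real.pi * y)
  rw [abs_mul, abs_of_pos hpi] at h4
  have h5 : ((1 : ℂ) / 2 + y * Complex.I).im = y := by simp
  have h6 : ((1 : ℂ) / 2 + y * Complex.I).re = 1 / 2 := by simp
  rw [h5, h6, show (1 / 2 - 1 : ℝ) = -(1 / 2) by norm_num] at h1
  have hcpos := Real.cosh_pos (Real.pi * y)
  simp only [h]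
  rw [norm_mul, norm_div, Complex.norm_real, Real.norm_of_nonneg (by positivity), div_eq_mul_inv,
    div_eq_mul_inv]
  calc ‖(-w) ^ ((1 : ℂ) / 2 + y * Complex.I - 1)‖ * ‖denjoyGamma α (1 / 2 + y * Complex.I)‖⁻¹ *
        (Real.pi * (Real.cosh (Real.pi * y))⁻¹)
      ≤ (‖w‖ ^ (-(1 / 2) : ℝ) * Real.exp ((Real.pi - θ) * |y|)) *
          ‖denjoyGamma α (1 / 2 + y * Complex.I)‖⁻¹ *
          (Real.pi * (2 * Real.exp (-(Real.pi * |y|)))) := by gcongr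
    _ = 2 * Real.pi * (‖w‖ ^ (-(1 / 2) : ℝ) * (Real.exp (-θ * |y|) *
          ‖denjoyGamma α (1 / 2 + y * Complex.I)‖⁻¹)) := by
        rw [show -θ * |y| = (Real.pi - θ) * |y| + -(Real.pi * |y|) by ring, Real.exp_add]
        ring

/-- Off a sector around the positive ray `E` is bounded by the integral `sectorBound`. -/
theorem norm_weightEC_le_of_abs_im {α : ℕ →₀ ℝ} (hα : IsDenjoyIndex α) {θ : ℝ} (hθ : 0 < θ)
    {w : ℂ} (hw : θ * ‖w‖ ≤ |w.im|) (hw0 : w ≠ 0) :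
    ‖weightEC (denjoyWeight α) w‖ ≤ ‖w‖ ^ (-(1 / 2) : ℝ) * sectorBound α θ := by
  have hpi := Real.pi_gt_three
  have hwn : 0 < ‖w‖ := norm_pos_iff.2 hw0
  have hθ1 : θ ≤ 1 := by
    have := Complex.abs_im_le_norm w
    by_contra! h
    nlinarith
  refine norm_weightEC_le_sectorBound hα hθ (by linarith) hw0 ?_
  have h1 : θ ≤ Real.sin |(-w).arg| := by
    rw [← abs_of_nonneg (Real.sin_nonneg_of_nonneg_of_le_pi (abs_nonneg (-w).arg)
      (Complex.abs_arg_le_pi _))]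
    have h2 : abs (Real.sin (abs (-w).arg)) = abs (Real.sin (-w).arg) := by
      rcases abs_choice (-w).arg with h | h <;> rw [h]
      rw [Real.sin_neg, abs_neg]
    rw [h2, Complex.sin_arg, norm_neg, Complex.neg_im, abs_div, abs_neg, abs_of_pos hwn,
      le_div_iff₀ hwn]
    exact hw
  have h3 : Real.sin |(-w).arg| ≤ Real.pi - |(-w).arg| := by
    rw [← Real.sin_pi_sub]
    exact Real.sin_le (by linarith [Complex.abs_arg_le_pi (-w)])
  linarith

theorem norm_weightEC_le_of_re_nonpos {α : ℕ →₀ ℝ} (hα : IsDenjoyIndex α)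
    {w : ℂ} (hw : w.re ≤ 0) (hw0 : w ≠ 0) :
    ‖weightEC (denjoyWeight α) w‖ ≤ ‖w‖ ^ (-(1 / 2) : ℝ) * sectorBound α 1 := by
  have hpi := Real.pi_gt_three
  refine norm_weightEC_le_sectorBound hα one_pos (by linarith) hw0 ?_
  have : |(-w).arg| ≤ Real.pi / 2 := Complex.abs_arg_le_pi_div_two_iff.2 (by simpa using hw)
  linarith

theorem norm_weightEC_le_weightE {L : ℝ → ℝ} {κ : ℝ} (hL : RegularWeight L κ) (w : ℂ) :
    ‖weightEC L w‖ ≤ weightE L ‖w‖ := by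
  have h : ∀ n : ℕ, ‖w ^ n / (gam L ((n : ℝ) + 1) : ℂ)‖ = ‖w‖ ^ n / gam L ((n : ℝ) + 1) :=
    fun n => by
      rw [norm_div, norm_pow, Complex.norm_real, Real.norm_of_nonneg
        (hL.gam_pos (by positivity)).le]
  refine tsum_of_norm_bounded (summable_pow_div_gam hL.tendsto ‖w‖).hasSum fun n => (h n).le

/-! ### Asymptotically holomorphic extensions: the pointwise estimates -/

/-- A smooth cutoff on the half-line: `1` on `[0, 1/2]` and `0` on `[1, ∞)`. -/
def cutoff (t : ℝ) : ℝ := Real.smoothTransition (2 - 2 * t)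

theorem cutoff_of_le {t : ℝ} (h : t ≤ 1 / 2) : cutoff t = 1 :=
  Real.smoothTransition.one_of_one_le (by linarith)

theorem cutoff_of_ge {t : ℝ} (h : 1 ≤ t) : cutoff t = 0 :=
  Real.smoothTransition.zero_of_nonpos (by linarith)

theorem cutoff_nonneg (t : ℝ) : 0 ≤ cutoff t := Real.smoothTransition.nonneg _

theorem cutoff_le_one (t : ℝ) : cutoff t ≤ 1 := Real.smoothTransition.le_one _

theorem contDiff_cutoff : ContDiff ℝ 1 cutoff :=
  Real.smoothTransition.contDiff.comp (by fun_prop)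

theorem continuous_deriv_cutoff : Continuous (deriv cutoff) :=
  contDiff_cutoff.continuous_deriv le_rfl

theorem hasDerivAt_cutoff (t : ℝ) : HasDerivAt cutoff (deriv cutoff t) t :=
  (contDiff_cutoff.differentiable one_ne_zero t).hasDerivAt

theorem deriv_cutoff_of_lt {t : ℝ} (h : t < 1 / 2) : deriv cutoff t = 0 := by
  have : cutoff =ᶠ[𝓝 t] fun _ => (1 : ℝ) := by
    filter_upwards [gt_mem_nhds h] with s hs using cutoff_of_le (le_of_lt hs)
  rw [this.deriv_eq, deriv_const]

theorem deriv_cutoff_of_ge {t : ℝ} (h : 1 ≤ t) : deriv cutoff t = 0 := by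
  refine IsLocalMin.deriv_eq_zero (Filter.Eventually.of_forall fun s => ?_)
  rw [cutoff_of_ge h]
  exact cutoff_nonneg s

theorem exists_abs_deriv_cutoff_le : ∃ B : ℝ, 0 < B ∧ ∀ t, |deriv cutoff t| ≤ B := by
  obtain ⟨B, hB⟩ := (isCompact_Icc (a := (1 / 2 : ℝ)) (b := 1)).exists_bound_of_continuousOn
    continuous_deriv_cutoff.continuousOn
  refine ⟨max B 1, lt_max_of_lt_right one_pos, fun t => ?_⟩
  rcases lt_or_ge t (1 / 2) with h | h
  · rw [deriv_cutoff_of_lt h, abs_zero]; positivity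
  rcases le_or_gt 1 t with h1 | h1
  · rw [deriv_cutoff_of_ge h1, abs_zero]; positivity
  exact (hB t ⟨h, h1.le⟩).trans (le_max_left _ _)

theorem exists_interval_cutoff {a a' b' b : ℝ} (ha : a < a') (hb : b' < b) :
    ∃ φ : ℝ → ℝ, ContDiff ℝ 1 φ ∧ (∀ x, 0 ≤ φ x) ∧ (∀ x, φ x ≤ 1) ∧
      (∀ x ∈ Icc a' b', φ x = 1 ∧ deriv φ x = 0) ∧ φ a = 0 ∧ φ b = 0 := by
  set φ : ℝ → ℝ := fun x => Real.smoothTransition ((x - a) / (a' - a)) *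
    Real.smoothTransition ((b - x) / (b - b'))
  have h1 : ∀ x, φ x ≤ 1 := fun x => mul_le_one₀ (Real.smoothTransition.le_one _)
    (Real.smoothTransition.nonneg _) (Real.smoothTransition.le_one _)
  have h2 : ∀ x ∈ Icc a' b', φ x = 1 := by
    intro x hx
    simp only [φ]
    rw [Real.smoothTransition.one_of_one_le, Real.smoothTransition.one_of_one_le, one_mul]
    · rw [one_le_div (by linarith)]; linarith [hx.2]
    · rw [one_le_div (by linarith)]; linarith [hx.1]
  refine ⟨φ, ?_, fun x => mul_nonneg (Real.smoothTransition.nonneg _)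
    (Real.smoothTransition.nonneg _), h1, fun x hx => ⟨h2 x hx, ?_⟩, ?_, ?_⟩
  · exact (Real.smoothTransition.contDiff.comp (by fun_prop)).mul
      (Real.smoothTransition.contDiff.comp (by fun_prop))
  · refine IsLocalMax.deriv_eq_zero (Filter.Eventually.of_forall fun s => ?_)
    rw [h2 x hx]
    exact h1 s
  · simp [φ]
  · simp [φ]

/-- The `k`-th term of `(∂_y - ι ∂_x) ∑ φ F_k (ιy)^k/k! χ(y ℓ_k)`, after the summation by parts
which combines the terms with `F_{k+1}`. Here `ι = ±i`, and `F_k` stands for the `k`-th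
derivative of a function on the real line. -/
def dbarTerm (ℓ : ℕ → ℝ) (F : ℕ → ℝ → ℂ) (φ : ℝ → ℝ) (ι : ℂ) (k : ℕ) (x y : ℝ) : ℂ :=
  ι * φ x * F (k + 1) x * ((ι * y) ^ k / k.factorial) *
      ((cutoff (y * ℓ (k + 1)) - cutoff (y * ℓ k) : ℝ) : ℂ) -
    ι * (deriv φ x : ℝ) * F k x * ((ι * y) ^ k / k.factorial) * (cutoff (y * ℓ k) : ℝ) +
    φ x * F k x * ((ι * y) ^ k / k.factorial) * ((ℓ k * deriv cutoff (y * ℓ k) : ℝ) : ℂ)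

theorem mul_pow_div_factorial_le {A C δ w y : ℝ} {k : ℕ} (hy : 0 ≤ y) (hC : 0 ≤ C) (hδ : 0 ≤ δ)
    (hw : 0 ≤ w) (hA : A ≤ C * (δ * k * w) ^ k) :
    A * (y ^ k / k.factorial) ≤ C * (Real.exp 1 * δ * (y * w)) ^ k := by
  have h := natCast_pow_le_exp_mul_factorial k
  have hk : (0 : ℝ) < k.factorial := by positivity
  calc A * (y ^ k / k.factorial) ≤ C * (δ * k * w) ^ k * (y ^ k / k.factorial) := by gcongr
    _ = C * (δ * w * y) ^ k * ((k : ℝ) ^ k / k.factorial) := by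
        rw [mul_pow, mul_pow, mul_pow, mul_pow]; ring
    _ ≤ C * (δ * w * y) ^ k * Real.exp 1 ^ k := by
        gcongr
        rwa [div_le_iff₀ hk]
    _ = _ := by rw [mul_assoc, ← mul_pow]; ring

namespace RegularWeight

theorem exists_succ_le {L : ℝ → ℝ} {κ : ℝ} (hL : RegularWeight L κ) :
    ∃ Λ : ℝ, 1 ≤ Λ ∧ ∀ k : ℕ, L (k + 1 : ℕ) ≤ Λ * L k := by
  have h2 : (1 : ℝ) ≤ 2 ^ κ := Real.one_le_rpow one_le_two hL.exponent_pos.le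
  have h1 := hL.one_le 1 zero_le_one
  refine ⟨L 1 * 2 ^ κ, one_le_mul_of_one_le_of_one_le h1 h2, fun k => ?_⟩
  have hk := hL.one_le k (Nat.cast_nonneg k)
  rcases Nat.eq_zero_or_pos k with rfl | hk0
  · rw [zero_add, Nat.cast_one]
    calc L 1 = L 1 * 1 * 1 := by ring
      _ ≤ L 1 * 2 ^ κ * L (0 : ℕ) := by gcongr
  · have hk1 : (1 : ℝ) ≤ k := by exact_mod_cast hk0
    have := hL.ratio k (k + 1 : ℕ) (by linarith) (by push_cast; linarith)
    refine this.trans ?_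
    have h3 : (((k + 1 : ℕ) : ℝ) / k) ≤ 2 := by
      rw [div_le_iff₀ (by linarith)]; push_cast; linarith
    have h4 : (((k + 1 : ℕ) : ℝ) / k) ^ κ ≤ 2 ^ κ :=
      Real.rpow_le_rpow (by positivity) h3 hL.exponent_pos.le
    calc L k * (((k + 1 : ℕ) : ℝ) / k) ^ κ ≤ L k * 2 ^ κ := by gcongr
      _ = 1 * 2 ^ κ * L k := by ring
      _ ≤ _ := by gcongr

/-- If `y` is comparable to `1 / L(m)`, the quantity `(y L(m))^m` is dominated by all
`(y L(n))^n` at once. -/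
theorem pow_le_of_mem_range {L : ℝ → ℝ} {κ : ℝ} (hL : RegularWeight L κ) {t lam Λ δ' y : ℝ}
    {m : ℕ} (ht : 0 ≤ t) (hlam : 0 < lam) (hΛ : 1 ≤ Λ) (hδ : δ' * lam = 2) (hy : 0 < y)
    (h1 : y * L m ≤ Λ * lam) (h2 : lam / 2 ≤ y * L m) (n : ℕ) :
    (t * (y * L m)) ^ m ≤ (Real.exp κ * (t * (Λ * lam))) ^ m * (δ' * (y * L n)) ^ n := by
  have hm := hL.pos (Nat.cast_nonneg (α := ℝ) m)
  have hn := hL.pos (Nat.cast_nonneg (α := ℝ) n)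
  have hδ' : 0 < δ' := pos_of_mul_pos_left (by rw [hδ]; norm_num) hlam.le
  have hκ : 1 ≤ Real.exp κ := Real.one_le_exp hL.exponent_pos.le
  have hbase : (t * (y * L m)) ^ m ≤ (Real.exp κ * (t * (Λ * lam))) ^ m := by
    refine pow_le_pow_left₀ (by positivity) ?_ m
    calc t * (y * L m) ≤ 1 * (t * (Λ * lam)) := by rw [one_mul]; gcongr
      _ ≤ _ := by gcongr
  rcases Nat.eq_zero_or_pos n with rfl | hn0
  · simpa using hbase
  rcases le_or_gt n m with hnm | hnm
  · have h3 := hL.pow_le hn0 hnm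
    have h4 : 1 ≤ (Λ * lam * δ') ^ n := by
      refine one_le_pow₀ ?_
      rw [mul_assoc, mul_comm lam, hδ]
      linarith
    obtain ⟨j, rfl⟩ := Nat.exists_eq_add_of_le hnm
    rw [Real.exp_mul, Real.rpow_natCast] at h3
    calc (t * (y * L (n + j : ℕ))) ^ (n + j)
        = t ^ (n + j) * y ^ n * (y * L (n + j : ℕ)) ^ j * L (n + j : ℕ) ^ n := by
          rw [mul_pow, pow_add (y * _), mul_pow y _ n]; ring
      _ ≤ t ^ (n + j) * y ^ n * (Λ * lam) ^ j * (L n ^ n * Real.exp κ ^ (n + j)) := by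
          gcongr
      _ ≤ t ^ (n + j) * y ^ n * (Λ * lam) ^ j * (L n ^ n * Real.exp κ ^ (n + j)) *
            (Λ * lam * δ') ^ n := le_mul_of_one_le_right (by positivity) h4
      _ = _ := by
          rw [mul_pow (Real.exp κ), mul_pow t (Λ * lam), pow_add (Λ * lam), mul_pow δ', mul_pow y,
            mul_pow (Λ * lam) δ']
          ring
  · refine hbase.trans (le_mul_of_one_le_right (by positivity) (one_le_pow₀ ?_))
    have : L m ≤ L n := hL.mono _ _ (by positivity) (by exact_mod_cast hnm.le)
    calc (1 : ℝ) = δ' * (lam / 2) := by rw [mul_div_assoc', hδ]; norm_num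
      _ ≤ δ' * (y * L m) := by gcongr
      _ ≤ _ := by gcongr

theorem _root_.BorelMap.le_mul_pow_of_succ_le {L : ℝ → ℝ} {Λ : ℝ} (hΛ : 1 ≤ Λ)
    (h : ∀ k : ℕ, L (k + 1 : ℕ) ≤ Λ * L k) (k : ℕ) : L k ≤ L 0 * Λ ^ k := by
  induction k with
  | zero => simp
  | succ k ih =>
    calc L (k + 1 : ℕ) ≤ Λ * L k := h k
      _ ≤ Λ * (L 0 * Λ ^ k) := by gcongr
      _ = _ := by ring

/-- The terms `e_k = dbarTerm … k` decay geometrically; where `φ = 1` they are moreover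
`O((δ' y L(n))^n)` for each `n`, uniformly in `n`. -/
theorem norm_dbarTerm_le {L : ℝ → ℝ} {κ Λ : ℝ} (hL : RegularWeight L κ) (hΛ : 1 ≤ Λ)
    (hsucc : ∀ k : ℕ, L (k + 1 : ℕ) ≤ Λ * L k) {lam δ δ' C B : ℝ} (hlam : 0 < lam)
    (hδ' : δ' * lam = 2) (hδ : 0 < δ) (hC : 0 < C) (hB : 0 < B)
    (hq : Real.exp κ * (Real.exp 1 * δ * (Λ * lam)) * Λ ≤ 1 / 4)
    (hcut : ∀ t, |deriv cutoff t| ≤ B) {F : ℕ → ℝ → ℂ} {φ : ℝ → ℝ} {x : ℝ} (hφ0 : 0 ≤ φ x)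
    (hφ1 : φ x ≤ 1) (hφB : |deriv φ x| ≤ B)
    (hF : ∀ k, ‖F k x‖ ≤ C * (δ * k * L k) ^ k) {ι : ℂ} (hι : ‖ι‖ = 1) {y : ℝ} (hy : 0 < y)
    (k n : ℕ) (hn : n = 0 ∨ deriv φ x = 0) :
    ‖dbarTerm (fun k => L k / lam) F φ ι k x y‖ ≤
      (2 * C * L 0 / lam + B * C + C * L 0 / lam * B) * (1 / 2) ^ k * (δ' * (y * L n)) ^ n := by
  set q := Real.exp κ * (Real.exp 1 * δ * (Λ * lam))
  have hδ'0 : 0 < δ' := pos_of_mul_pos_left (by rw [hδ']; norm_num) hlam.le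
  have hpos : ∀ m : ℕ, 0 < L m := fun m => hL.pos (Nat.cast_nonneg m)
  have hL0 : 0 < L 0 := hL.pos le_rfl
  have hq0 : 0 ≤ q := by positivity
  set X := (δ' * (y * L n)) ^ n
  have hX : 0 ≤ X := by have := hpos n; positivity
  have hqL : ∀ m : ℕ, q ^ m * L m ≤ L 0 * (1 / 4) ^ m := fun m => by
    calc q ^ m * L m ≤ q ^ m * (L 0 * Λ ^ m) := by gcongr; exact le_mul_pow_of_succ_le hΛ hsucc m
      _ = L 0 * (q * Λ) ^ m := by rw [mul_pow]; ring
      _ ≤ _ := by gcongr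
  have hκ : 1 ≤ Real.exp κ := Real.one_le_exp hL.exponent_pos.le
  have hFP : ∀ m, ‖F m x‖ * (y ^ m / m.factorial) ≤ C * (Real.exp 1 * δ * (y * L m)) ^ m :=
    fun m => mul_pow_div_factorial_le hy.le hC.le hδ.le (hpos m).le (hF m)
  have hpow : ‖((ι * y) ^ k / (k.factorial : ℂ))‖ = y ^ k / k.factorial := by
    rw [norm_div, norm_pow, norm_mul, hι, one_mul, Complex.norm_real, Real.norm_of_nonneg hy.le,
      Complex.norm_natCast]
  have hφn : ‖(φ x : ℂ)‖ ≤ 1 := by rwa [Complex.norm_real, Real.norm_of_nonneg hφ0]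
  -- the term with the difference of two cutoffs
  have t1 : ‖ι * φ x * F (k + 1) x * ((ι * y) ^ k / k.factorial) *
      ((cutoff (y * (L (k + 1 : ℕ) / lam)) - cutoff (y * (L k / lam)) : ℝ) : ℂ)‖ ≤
      2 * C * L 0 / lam * (1 / 2) ^ k * X := by
    by_cases hc : cutoff (y * (L (k + 1 : ℕ) / lam)) - cutoff (y * (L k / lam)) = 0
    · rw [hc]; simp only [Complex.ofReal_zero, mul_zero, norm_zero]; positivity
    have hmono : L k ≤ L (k + 1 : ℕ) := hL.mono _ _ (by positivity) (by push_cast; linarith)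
    have hu : y * L (k + 1 : ℕ) ≤ Λ * lam := by
      by_contra! hcon
      apply hc
      have h1 : 1 ≤ y * (L k / lam) := by
        rw [mul_div_assoc', one_le_div hlam]
        have h2 := hsucc k
        by_contra! h3
        nlinarith
      rw [cutoff_of_ge h1, cutoff_of_ge (h1.trans (by gcongr)), sub_zero]
    have hl : lam / 2 ≤ y * L (k + 1 : ℕ) := by
      by_contra! hcon
      apply hc
      have h1 : y * (L (k + 1 : ℕ) / lam) ≤ 1 / 2 := by
        rw [mul_div_assoc', div_le_iff₀ hlam]; linarith
      rw [cutoff_of_le h1, cutoff_of_le ((show _ ≤ _ by gcongr).trans h1), sub_self]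
    have hdiff : ‖((cutoff (y * (L (k + 1 : ℕ) / lam)) - cutoff (y * (L k / lam)) : ℝ) : ℂ)‖ ≤
        1 := by
      rw [Complex.norm_real, Real.norm_eq_abs, abs_le]
      constructor <;> linarith [cutoff_nonneg (y * (L k / lam)), cutoff_le_one (y * (L k / lam)),
        cutoff_nonneg (y * (L (k + 1 : ℕ) / lam)), cutoff_le_one (y * (L (k + 1 : ℕ) / lam))]
    have h3 := hL.pow_le_of_mem_range (t := Real.exp 1 * δ) (by positivity) hlam hΛ hδ' hy hu hl n
    have hyinv : 1 / y ≤ 2 * L (k + 1 : ℕ) / lam := by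
      rw [div_le_div_iff₀ hy hlam]; linarith
    have hk4 : ((k + 1 : ℕ) : ℝ) * (1 / 4) ^ (k + 1) ≤ (1 / 2) ^ k := by
      have h5 : ((k + 1 : ℕ) : ℝ) ≤ 2 ^ k := by exact_mod_cast Nat.lt_two_pow_self
      calc ((k + 1 : ℕ) : ℝ) * (1 / 4) ^ (k + 1) ≤ 2 ^ k * ((1 / 4) ^ k * (1 / 4)) := by
            rw [pow_succ]; gcongr
        _ = (1 / 2) ^ k * (1 / 4) := by rw [← mul_assoc, ← mul_pow]; norm_num
        _ ≤ _ := mul_le_of_le_one_right (by positivity) (by norm_num)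
    calc _ = ‖(φ x : ℂ)‖ * (‖F (k + 1) x‖ * (y ^ k / k.factorial)) *
          ‖((cutoff (y * (L (k + 1 : ℕ) / lam)) - cutoff (y * (L k / lam)) : ℝ) : ℂ)‖ := by
          rw [norm_mul, norm_mul, norm_mul, norm_mul, hι, hpow]; ring
      _ ≤ 1 * (‖F (k + 1) x‖ * (y ^ k / k.factorial)) * 1 := by gcongr
      _ = ‖F (k + 1) x‖ * (y ^ (k + 1) / (k + 1).factorial) * ((k + 1 : ℕ) * (1 / y)) := by
          rw [Nat.factorial_succ, pow_succ]
          push_cast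
          field_simp
      _ ≤ C * (q ^ (k + 1) * X) * ((k + 1 : ℕ) * (2 * L (k + 1 : ℕ) / lam)) := by
          refine mul_le_mul ((hFP (k + 1)).trans ?_) (by gcongr) (by positivity) (by positivity)
          gcongr
      _ = 2 * C / lam * X * ((k + 1 : ℕ) * (q ^ (k + 1) * L (k + 1 : ℕ))) := by ring
      _ ≤ 2 * C / lam * X * ((k + 1 : ℕ) * (L 0 * (1 / 4) ^ (k + 1))) := by
          exact mul_le_mul_of_nonneg_left
            (mul_le_mul_of_nonneg_left (hqL (k + 1)) (by positivity)) (by positivity)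
      _ = 2 * C * L 0 / lam * X * ((k + 1 : ℕ) * (1 / 4) ^ (k + 1)) := by ring
      _ ≤ 2 * C * L 0 / lam * X * (1 / 2) ^ k := by gcongr
      _ = _ := by ring
  have h42 : ((1 : ℝ) / 4) ^ k ≤ (1 / 2) ^ k := by gcongr; norm_num
  have hΛ' : lam ≤ Λ * lam := le_mul_of_one_le_left hlam.le hΛ
  -- the term with the derivative of `φ`
  have t2 : ‖ι * (deriv φ x : ℝ) * F k x * ((ι * y) ^ k / k.factorial) *
      (cutoff (y * (L k / lam)) : ℝ)‖ ≤ B * C * (1 / 2) ^ k * X := by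
    rcases hn with rfl | hn
    swap
    · rw [hn]; simp only [Complex.ofReal_zero, mul_zero, zero_mul, norm_zero]; positivity
    by_cases hc : cutoff (y * (L k / lam)) = 0
    · rw [hc]; simp only [Complex.ofReal_zero, mul_zero, norm_zero]; positivity
    have hu : y * L k ≤ Λ * lam := by
      by_contra! hcon
      refine hc (cutoff_of_ge ?_)
      rw [mul_div_assoc', one_le_div hlam]; linarith
    have hX1 : X = 1 := by simp [X]
    have hq1 : q ≤ 1 / 4 := by nlinarith
    have hk := hpos k
    calc _ = |deriv φ x| * (‖F k x‖ * (y ^ k / k.factorial)) * |cutoff (y * (L k / lam))| := by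
          rw [norm_mul, norm_mul, norm_mul, norm_mul, hι, hpow, Complex.norm_real,
            Complex.norm_real, Real.norm_eq_abs, Real.norm_eq_abs]; ring
      _ ≤ B * (C * (1 * (Real.exp 1 * δ * (y * L k))) ^ k) * 1 := by
          rw [one_mul (Real.exp 1 * δ * _)]
          refine mul_le_mul (mul_le_mul hφB (hFP k) (by positivity) hB.le) ?_ (abs_nonneg _)
            (by positivity)
          rw [abs_of_nonneg (cutoff_nonneg _)]
          exact cutoff_le_one _
      _ ≤ B * (C * (Real.exp κ * (Real.exp 1 * δ * (Λ * lam))) ^ k) * 1 := by gcongr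
      _ ≤ B * (C * (1 / 4) ^ k) * 1 := by gcongr
      _ ≤ B * (C * (1 / 2) ^ k) * 1 := by gcongr
      _ = _ := by rw [hX1]; ring
  -- the term with the derivative of the cutoff
  have t3 : ‖φ x * F k x * ((ι * y) ^ k / k.factorial) *
      ((L k / lam * deriv cutoff (y * (L k / lam)) : ℝ) : ℂ)‖ ≤
      C * L 0 / lam * B * (1 / 2) ^ k * X := by
    by_cases hc : deriv cutoff (y * (L k / lam)) = 0
    · rw [hc]; simp only [Complex.ofReal_zero, mul_zero, norm_zero]; positivity
    have hk := hpos k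
    have hu : y * L k ≤ Λ * lam := by
      by_contra! hcon
      refine hc (deriv_cutoff_of_ge ?_)
      rw [mul_div_assoc', one_le_div hlam]; linarith
    have hl : lam / 2 ≤ y * L k := by
      by_contra! hcon
      refine hc (deriv_cutoff_of_lt ?_)
      rw [mul_div_assoc', div_lt_iff₀ hlam]; linarith
    have h3 := hL.pow_le_of_mem_range (t := Real.exp 1 * δ) (by positivity) hlam hΛ hδ' hy hu hl n
    calc _ = ‖(φ x : ℂ)‖ * (‖F k x‖ * (y ^ k / k.factorial)) *
          (L k / lam * |deriv cutoff (y * (L k / lam))|) := by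
          rw [norm_mul, norm_mul, norm_mul, hpow, Complex.norm_real (_ * _), norm_mul,
            Real.norm_of_nonneg (show 0 ≤ L k / lam by positivity), Real.norm_eq_abs]; ring
      _ ≤ 1 * (C * (q ^ k * X)) * (L k / lam * B) := by
          refine mul_le_mul (mul_le_mul hφn ((hFP k).trans ?_) (by positivity) zero_le_one) ?_
            (by positivity) (by positivity)
          · gcongr
          · exact mul_le_mul_of_nonneg_left (hcut _) (by positivity)
      _ = C / lam * B * X * (q ^ k * L k) := by ring
      _ ≤ C / lam * B * X * (L 0 * (1 / 4) ^ k) := 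
          mul_le_mul_of_nonneg_left (hqL k) (by positivity)
      _ ≤ C / lam * B * X * (L 0 * (1 / 2) ^ k) := by gcongr
      _ = _ := by ring
  have hfin := (norm_add_le _ _).trans (add_le_add ((norm_sub_le _ _).trans (add_le_add t1 t2)) t3)
  refine hfin.trans (le_of_eq (by ring))

end RegularWeight

/-! ### Green's formula for the extension and the representation of the Taylor coefficients -/

section Line

theorem norm_sq_line {ι : ℂ} (hι : ι = Complex.I ∨ ι = -Complex.I) (x y : ℝ) :
    ‖(x : ℂ) + ι * y‖ ^ 2 = x ^ 2 + y ^ 2 := by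
  rw [Complex.sq_norm, Complex.normSq_apply]
  rcases hι with rfl | rfl <;> simp <;> ring

theorem abs_le_norm_line {ι : ℂ} (hι : ι = Complex.I ∨ ι = -Complex.I) (x y : ℝ) :
    |y| ≤ ‖(x : ℂ) + ι * y‖ :=
  (sq_le_sq.1 (by rw [norm_sq_line hι]; nlinarith)).trans_eq (abs_norm _)

theorem abs_fst_le_norm_line {ι : ℂ} (hι : ι = Complex.I ∨ ι = -Complex.I) (x y : ℝ) :
    |x| ≤ ‖(x : ℂ) + ι * y‖ :=
  (sq_le_sq.1 (by rw [norm_sq_line hι]; nlinarith)).trans_eq (abs_norm _)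

theorem line_ne_zero {ι : ℂ} (hι : ι = Complex.I ∨ ι = -Complex.I) (x : ℝ) {y : ℝ} (hy : 0 < y) :
    (x : ℂ) + ι * y ≠ 0 := fun h => by
  have := abs_le_norm_line hι x y
  rw [h, norm_zero, abs_of_pos hy] at this
  linarith

theorem norm_of_eq_I_or {ι : ℂ} (hι : ι = Complex.I ∨ ι = -Complex.I) : ‖ι‖ = 1 := by
  rcases hι with rfl | rfl <;> simp

end Line

/-- The reciprocal of `x - t + ιy`. -/
def cauchyKernel (ι : ℂ) (t x y : ℝ) : ℂ := (((x - t : ℝ) : ℂ) + ι * y)⁻¹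

theorem continuousOn_cauchyKernel {ι : ℂ} (hι : ι = Complex.I ∨ ι = -Complex.I) (t : ℝ) :
    ContinuousOn (fun p : ℝ × ℝ => cauchyKernel ι t p.1 p.2) (univ ×ˢ Ioi 0) :=
  ContinuousOn.inv₀ (by fun_prop) fun p hp => line_ne_zero hι _ hp.2

theorem hasDerivAt_cauchyKernel_fst {ι : ℂ} (hι : ι = Complex.I ∨ ι = -Complex.I) (t x : ℝ)
    {y : ℝ} (hy : 0 < y) :
    HasDerivAt (fun x => cauchyKernel ι t x y) (-(cauchyKernel ι t x y) ^ 2) x := by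
  have h1 : HasDerivAt (fun x : ℝ => (((x - t : ℝ) : ℂ) + ι * y)) 1 x := by
    simpa using (((hasDerivAt_id x).sub_const t).ofReal_comp).add_const (ι * y)
  refine (h1.inv (line_ne_zero hι (x - t) hy)).congr_deriv ?_
  simp only [cauchyKernel, inv_pow]
  field_simp

theorem hasDerivAt_cauchyKernel_snd {ι : ℂ} (hι : ι = Complex.I ∨ ι = -Complex.I) (t x : ℝ)
    {y : ℝ} (hy : 0 < y) :
    HasDerivAt (fun y => cauchyKernel ι t x y) (-(ι * (cauchyKernel ι t x y) ^ 2)) y := by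
  have h1 : HasDerivAt (fun y : ℝ => (((x - t : ℝ) : ℂ) + ι * y)) ι y := by
    simpa using (((hasDerivAt_id y).ofReal_comp).const_mul ι).const_add ((x - t : ℝ) : ℂ)
  refine (h1.inv (line_ne_zero hι (x - t) hy)).congr_deriv ?_
  simp only [cauchyKernel, inv_pow]
  field_simp

/-- Green's formula for a product `A(x) B(y)` on a rectangle, against the Cauchy kernel. -/
theorem setIntegral_dbar_mul_cauchyKernel {A A' B B' : ℝ → ℂ} {a b η T t : ℝ} {ι : ℂ}
    (hι : ι = Complex.I ∨ ι = -Complex.I) (hab : a ≤ b) (hη : 0 < η) (hT : η ≤ T)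
    (hA : ∀ x ∈ Icc a b, HasDerivAt A (A' x) x) (hA' : ContinuousOn A' (Icc a b))
    (hB : ∀ y ∈ Icc η T, HasDerivAt B (B' y) y) (hB' : ContinuousOn B' (Icc η T))
    (ha : A a = 0) (hb : A b = 0) (hBT : B T = 0) :
    IntegrableOn (fun p : ℝ × ℝ => (A p.1 * B' p.2 - ι * A' p.1 * B p.2) *
      cauchyKernel ι t p.1 p.2) (Ioc a b ×ˢ Ioc η T) ∧
    ∫ p in Ioc a b ×ˢ Ioc η T, (A p.1 * B' p.2 - ι * A' p.1 * B p.2) *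
      cauchyKernel ι t p.1 p.2 = -∫ x in a..b, A x * B η * cauchyKernel ι t x η := by
  set k := cauchyKernel ι t
  have hAc : ContinuousOn A (Icc a b) := fun x hx => (hA x hx).continuousAt.continuousWithinAt
  have hBc : ContinuousOn B (Icc η T) := fun x hx => (hB x hx).continuousAt.continuousWithinAt
  have hsub : Icc a b ×ˢ Icc η T ⊆ univ ×ˢ Ioi (0 : ℝ) :=
    prod_mono (subset_univ _) fun y hy => hη.trans_le hy.1
  have hkc : ContinuousOn (fun p : ℝ × ℝ => k p.1 p.2) (Icc a b ×ˢ Icc η T) :=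
    (continuousOn_cauchyKernel hι t).mono hsub
  have hf : ∀ {G : ℝ → ℂ}, ContinuousOn G (Icc a b) →
      ContinuousOn (fun p : ℝ × ℝ => G p.1) (Icc a b ×ˢ Icc η T) := fun h =>
    h.comp continuousOn_fst fun p hp => hp.1
  have hs : ∀ {G : ℝ → ℂ}, ContinuousOn G (Icc η T) →
      ContinuousOn (fun p : ℝ × ℝ => G p.2) (Icc a b ×ˢ Icc η T) := fun h =>
    h.comp continuousOn_snd fun p hp => hp.2
  have hint : ∀ {G : ℝ × ℝ → ℂ}, ContinuousOn G (Icc a b ×ˢ Icc η T) →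
      IntegrableOn G (Ioc a b ×ˢ Ioc η T) := fun h =>
    (h.integrableOn_compact (isCompact_Icc.prod isCompact_Icc)).mono_set
      (prod_mono Ioc_subset_Icc_self Ioc_subset_Icc_self)
  have i1 : IntegrableOn (fun p : ℝ × ℝ => A p.1 * B' p.2 * k p.1 p.2) (Ioc a b ×ˢ Ioc η T) :=
    hint (((hf hAc).mul (hs hB')).mul hkc)
  have i2 : IntegrableOn (fun p : ℝ × ℝ => ι * A' p.1 * B p.2 * k p.1 p.2)
      (Ioc a b ×ˢ Ioc η T) :=
    hint (((continuousOn_const.mul (hf hA')).mul (hs hBc)).mul hkc)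
  have i3 : IntegrableOn (fun p : ℝ × ℝ => A p.1 * B p.2 * (ι * k p.1 p.2 ^ 2))
      (Ioc a b ×ˢ Ioc η T) :=
    hint (((hf hAc).mul (hs hBc)).mul (continuousOn_const.mul (hkc.pow 2)))
  have hkx : ∀ y ∈ Icc η T, ContinuousOn (fun x => k x y) (Icc a b) := fun y hy =>
    hkc.comp (f := fun x => (x, y)) (by fun_prop) fun x hx => ⟨hx, hy⟩
  have hky : ∀ x ∈ Icc a b, ContinuousOn (fun y => k x y) (Icc η T) := fun x hx =>
    hkc.comp (f := fun y => (x, y)) (by fun_prop) fun y hy => ⟨hx, hy⟩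
  have hηm : η ∈ Icc η T := left_mem_Icc.2 hT
  -- integration by parts in `y`
  have e1 : ∀ x ∈ Ioc a b, ∫ y in Ioc η T, A x * B' y * k x y =
      -(A x * B η * k x η) + ∫ y in Ioc η T, A x * B y * (ι * k x y ^ 2) := by
    intro x hx
    have hx' := Ioc_subset_Icc_self hx
    have h := intervalIntegral.integral_mul_deriv_eq_deriv_mul (a := η) (b := T)
      (u := fun y => k x y) (u' := fun y => -(ι * k x y ^ 2)) (v := B) (v' := B')
      (fun y hy => hasDerivAt_cauchyKernel_snd hι t x
        (hη.trans_le (by rw [uIcc_of_le hT] at hy; exact hy.1)))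
      (fun y hy => hB y (by rwa [uIcc_of_le hT] at hy))
      (ContinuousOn.intervalIntegrable (by
        rw [uIcc_of_le hT]; exact (continuousOn_const.mul ((hky x hx').pow 2)).neg))
      (ContinuousOn.intervalIntegrable (by rwa [uIcc_of_le hT]))
    rw [intervalIntegral.integral_of_le hT, intervalIntegral.integral_of_le hT, hBT, mul_zero,
      zero_sub] at h
    calc ∫ y in Ioc η T, A x * B' y * k x y = A x * ∫ y in Ioc η T, k x y * B' y := by
          rw [← integral_const_mul]; congr 1; ext y; ring
      _ = -(A x * B η * k x η) + A x * ∫ y in Ioc η T, B y * (ι * k x y ^ 2) := by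
          rw [h]
          simp only [neg_mul]
          rw [integral_neg]
          have : ∫ y in Ioc η T, ι * k x y ^ 2 * B y = ∫ y in Ioc η T, B y * (ι * k x y ^ 2) := by
            congr 1; ext y; ring
          rw [this]; ring
      _ = _ := by
          rw [← integral_const_mul]; congr 2; ext y; ring
  -- integration by parts in `x`
  have e2 : ∀ y ∈ Ioc η T, ∫ x in Ioc a b, ι * A' x * B y * k x y =
      ∫ x in Ioc a b, A x * B y * (ι * k x y ^ 2) := by
    intro y hy
    have hy' := Ioc_subset_Icc_self hy
    have h := intervalIntegral.integral_mul_deriv_eq_deriv_mul (a := a) (b := b)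
      (u := fun x => k x y) (u' := fun x => -(k x y ^ 2)) (v := A) (v' := A')
      (fun x hx => hasDerivAt_cauchyKernel_fst hι t x (hη.trans hy.1))
      (fun x hx => hA x (by rwa [uIcc_of_le hab] at hx))
      (ContinuousOn.intervalIntegrable (by
        rw [uIcc_of_le hab]; exact ((hkx y hy').pow 2).neg))
      (ContinuousOn.intervalIntegrable (by rwa [uIcc_of_le hab]))
    rw [intervalIntegral.integral_of_le hab, intervalIntegral.integral_of_le hab, ha, hb, mul_zero,
      mul_zero, sub_zero, zero_sub] at h
    calc ∫ x in Ioc a b, ι * A' x * B y * k x y = ι * B y * ∫ x in Ioc a b, k x y * A' x := by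
          rw [← integral_const_mul]; congr 1; ext x; ring
      _ = _ := by
          rw [h, ← integral_neg, ← integral_const_mul]; congr 1; ext x; ring
  have hfin : ∫ p in Ioc a b ×ˢ Ioc η T, A p.1 * B' p.2 * k p.1 p.2 =
      -(∫ x in a..b, A x * B η * k x η) +
        ∫ p in Ioc a b ×ˢ Ioc η T, ι * A' p.1 * B p.2 * k p.1 p.2 := by
    have hsym : ∀ {G : ℝ × ℝ → ℂ}, IntegrableOn G (Ioc a b ×ˢ Ioc η T) →
        ∫ p in Ioc a b ×ˢ Ioc η T, G p = ∫ y in Ioc η T, ∫ x in Ioc a b, G (x, y) := fun h => by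
      rw [Measure.volume_eq_prod, ← Measure.prod_restrict]
      refine integral_prod_symm _ ?_
      rwa [Measure.prod_restrict]
    rw [hsym i2, setIntegral_congr_fun measurableSet_Ioc e2, ← hsym i3,
      Measure.volume_eq_prod, setIntegral_prod _ i1, setIntegral_prod _ i3,
      setIntegral_congr_fun measurableSet_Ioc e1, integral_add, integral_neg,
      intervalIntegral.integral_of_le hab]
    · have : ContinuousOn (fun x => A x * B η * k x η) (Icc a b) :=
        (hAc.mul continuousOn_const).mul (hkx η hηm)
      exact ((this.integrableOn_compact isCompact_Icc).mono_set Ioc_subset_Icc_self).neg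
    · rw [IntegrableOn, Measure.volume_eq_prod, ← Measure.prod_restrict] at i3
      exact i3.integral_prod_left
  refine ⟨(i1.sub i2).congr (ae_of_all _ fun p => by simp only [Pi.sub_apply]; ring), ?_⟩
  have h4 : ∀ p : ℝ × ℝ, (A p.1 * B' p.2 - ι * A' p.1 * B p.2) * k p.1 p.2 =
      A p.1 * B' p.2 * k p.1 p.2 - ι * A' p.1 * B p.2 * k p.1 p.2 := fun p => by ring
  simp only [h4]
  rw [integral_sub i1 i2, hfin]
  ring

/-- The data entering the construction of the extension of a function with derivatives `F k`,
localized to `(a, b)` by the cutoff `φ`, which is `1` on `[a', b']`. The last three fields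
record the estimates that the regularity of the function gives. -/
structure ExtensionData (ℓ : ℕ → ℝ) (F : ℕ → ℝ → ℂ) (φ : ℝ → ℝ) (a a' b' b M : ℝ)
    (w : ℕ → ℝ) : Prop where
  mono : Monotone ℓ
  tendsto : Tendsto ℓ atTop atTop
  pos : 0 < ℓ 0
  hasDerivAt : ∀ k, ∀ x ∈ Icc a b, HasDerivAt (F k) (F (k + 1) x) x
  contDiff : ContDiff ℝ 1 φ
  abs_le : ∀ x, |φ x| ≤ 1
  eq_one : ∀ x ∈ Icc a' b', φ x = 1
  left : φ a = 0
  right : φ b = 0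
  lt_left : a < a'
  lt_right : b' < b
  M_nonneg : 0 ≤ M
  w_nonneg : ∀ n, 0 ≤ w n
  bound : ∀ ι : ℂ, ‖ι‖ = 1 → ∀ x ∈ Icc a b, ∀ y, 0 < y → ∀ k,
    ‖dbarTerm ℓ F φ ι k x y‖ ≤ M * (1 / 2) ^ k
  bound_pow : ∀ ι : ℂ, ‖ι‖ = 1 → ∀ x ∈ Icc a' b', ∀ y, 0 < y → ∀ k n,
    ‖dbarTerm ℓ F φ ι k x y‖ ≤ M * (1 / 2) ^ k * (w n * y) ^ n
  tail : ∀ x ∈ Icc a b, ∀ y, 0 < y → ∀ k, 1 ≤ k →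
    ‖F k x‖ * (y ^ k / k.factorial) * cutoff (y * ℓ k) ≤ M * (1 / 2) ^ k * y

/-- The function `(∂_y - ι ∂_x) ∑ φ F_k (ιy)^k/k! χ(y ℓ_k)` on the half-plane `y > 0`. -/
def dbarSum (ℓ : ℕ → ℝ) (F : ℕ → ℝ → ℂ) (φ : ℝ → ℝ) (ι : ℂ) (x y : ℝ) : ℂ :=
  ∑' k, dbarTerm ℓ F φ ι k x y

/-- The telescoping identity behind the definition of `dbarTerm`. -/
theorem sum_dbar_eq (ℓ : ℕ → ℝ) (F : ℕ → ℝ → ℂ) (φ : ℝ → ℝ) (ι : ℂ) (x y : ℝ) (K : ℕ) :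
    ∑ k ∈ Finset.range K, (φ x * F k x * ((k : ℂ) * (ι * y) ^ (k - 1) * ι / k.factorial *
        (cutoff (y * ℓ k) : ℝ) + (ι * y) ^ k / k.factorial *
        ((ℓ k * deriv cutoff (y * ℓ k) : ℝ) : ℂ)) -
      ι * ((deriv φ x : ℝ) * F k x + φ x * F (k + 1) x) *
        ((ι * y) ^ k / k.factorial * (cutoff (y * ℓ k) : ℝ))) =
    ∑ k ∈ Finset.range K, dbarTerm ℓ F φ ι k x y -
      φ x * F K x * ((K : ℂ) * (ι * y) ^ (K - 1) * ι / K.factorial) *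
        (cutoff (y * ℓ K) : ℝ) := by
  induction K with
  | zero => simp
  | succ K ih =>
    rw [Finset.sum_range_succ, ih, Finset.sum_range_succ, dbarTerm, Nat.add_sub_cancel,
      Nat.factorial_succ]
    have h1 : (K.factorial : ℂ) ≠ 0 := by exact_mod_cast K.factorial_ne_zero
    have h2 : ((K : ℂ) + 1) ≠ 0 := by exact_mod_cast K.succ_ne_zero
    push_cast
    field_simp
    ring

namespace ExtensionData

theorem dbarTerm_eq_zero {ℓ : ℕ → ℝ} {F : ℕ → ℝ → ℂ} {φ : ℝ → ℝ} {a a' b' b M : ℝ}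
    {w : ℕ → ℝ} (h : ExtensionData ℓ F φ a a' b' b M w) {ι : ℂ} {x y : ℝ} (hy : 0 < y) {K k : ℕ}
    (hK : 1 ≤ y * ℓ K) (hk : K ≤ k) : dbarTerm ℓ F φ ι k x y = 0 := by
  have h1 : 1 ≤ y * ℓ k := hK.trans (mul_le_mul_of_nonneg_left (h.mono hk) hy.le)
  have h2 : 1 ≤ y * ℓ (k + 1) := h1.trans (mul_le_mul_of_nonneg_left (h.mono k.le_succ) hy.le)
  rw [dbarTerm, cutoff_of_ge h1, cutoff_of_ge h2, deriv_cutoff_of_ge h1]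
  simp

theorem dbarSum_eq {ℓ : ℕ → ℝ} {F : ℕ → ℝ → ℂ} {φ : ℝ → ℝ} {a a' b' b M : ℝ}
    {w : ℕ → ℝ} (h : ExtensionData ℓ F φ a a' b' b M w) {ι : ℂ} {x y : ℝ} (hy : 0 < y) {K : ℕ}
    (hK : 1 ≤ y * ℓ K) :
    dbarSum ℓ F φ ι x y = ∑ k ∈ Finset.range K, dbarTerm ℓ F φ ι k x y :=
  tsum_eq_sum fun k hk => h.dbarTerm_eq_zero hy hK (by simpa using hk)

theorem norm_dbarSum_le {ℓ : ℕ → ℝ} {F : ℕ → ℝ → ℂ} {φ : ℝ → ℝ} {a a' b' b M : ℝ}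
    {w : ℕ → ℝ} (h : ExtensionData ℓ F φ a a' b' b M w) {ι : ℂ} (hι : ‖ι‖ = 1) {x y : ℝ}
    (hx : x ∈ Icc a b) (hy : 0 < y) : ‖dbarSum ℓ F φ ι x y‖ ≤ 2 * M := by
  have := tsum_of_norm_bounded (hasSum_geometric_two.mul_left M) (h.bound ι hι x hx y hy)
  rwa [mul_comm] at this

theorem norm_dbarSum_le_pow {ℓ : ℕ → ℝ} {F : ℕ → ℝ → ℂ} {φ : ℝ → ℝ} {a a' b' b M : ℝ}
    {w : ℕ → ℝ} (h : ExtensionData ℓ F φ a a' b' b M w) {ι : ℂ} (hι : ‖ι‖ = 1) {x y : ℝ}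
    (hx : x ∈ Icc a' b') (hy : 0 < y) (n : ℕ) :
    ‖dbarSum ℓ F φ ι x y‖ ≤ 2 * M * (w n * y) ^ n := by
  have := tsum_of_norm_bounded ((hasSum_geometric_two.mul_left M).mul_right ((w n * y) ^ n))
    (fun k => h.bound_pow ι hι x hx y hy k n)
  rwa [mul_comm M] at this

theorem continuousOn_dbarTerm {ℓ : ℕ → ℝ} {F : ℕ → ℝ → ℂ} {φ : ℝ → ℝ} {a a' b' b M : ℝ}
    {w : ℕ → ℝ} (h : ExtensionData ℓ F φ a a' b' b M w) (ι : ℂ) (k : ℕ) :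
    ContinuousOn (fun p : ℝ × ℝ => dbarTerm ℓ F φ ι k p.1 p.2) (Icc a b ×ˢ Ioi 0) := by
  have hF : ∀ k, ContinuousOn (fun p : ℝ × ℝ => F k p.1) (Icc a b ×ˢ Ioi (0 : ℝ)) := fun k =>
    ContinuousOn.comp (g := F k) (t := Icc a b)
      (fun x hx => (h.hasDerivAt k x hx).continuousAt.continuousWithinAt) continuousOn_fst
      fun p hp => hp.1
  have h1 := hF k
  have h2 := hF (k + 1)
  have h3 := contDiff_cutoff.continuous
  have h4 := continuous_deriv_cutoff
  have h5 := h.contDiff.continuous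
  have h6 := h.contDiff.continuous_deriv le_rfl
  have c1 : Continuous fun p : ℝ × ℝ => ((φ p.1 : ℝ) : ℂ) :=
    Complex.continuous_ofReal.comp (h5.comp continuous_fst)
  have c2 : Continuous fun p : ℝ × ℝ => ((deriv φ p.1 : ℝ) : ℂ) :=
    Complex.continuous_ofReal.comp (h6.comp continuous_fst)
  have c3 : Continuous fun p : ℝ × ℝ => ((cutoff (p.2 * ℓ k) : ℝ) : ℂ) :=
    Complex.continuous_ofReal.comp (h3.comp (continuous_snd.mul continuous_const))
  have c4 : Continuous fun p : ℝ × ℝ =>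
      ((cutoff (p.2 * ℓ (k + 1)) - cutoff (p.2 * ℓ k) : ℝ) : ℂ) :=
    Complex.continuous_ofReal.comp ((h3.comp (continuous_snd.mul continuous_const)).sub
      (h3.comp (continuous_snd.mul continuous_const)))
  have c5 : Continuous fun p : ℝ × ℝ => ((ℓ k * deriv cutoff (p.2 * ℓ k) : ℝ) : ℂ) :=
    Complex.continuous_ofReal.comp (continuous_const.mul
      (h4.comp (continuous_snd.mul continuous_const)))
  have c6 : Continuous fun p : ℝ × ℝ => (ι * (p.2 : ℂ)) ^ k / (k.factorial : ℂ) := by fun_prop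
  exact (((((continuous_const.mul c1).continuousOn.mul h2).mul c6.continuousOn).mul
    c4.continuousOn).sub ((((continuous_const.mul c2).continuousOn.mul h1).mul
    c6.continuousOn).mul c3.continuousOn)).add (((c1.continuousOn.mul h1).mul
    c6.continuousOn).mul c5.continuousOn)

theorem continuousOn_dbarSum {ℓ : ℕ → ℝ} {F : ℕ → ℝ → ℂ} {φ : ℝ → ℝ} {a a' b' b M : ℝ}
    {w : ℕ → ℝ} (h : ExtensionData ℓ F φ a a' b' b M w) (ι : ℂ) :
    ContinuousOn (fun p : ℝ × ℝ => dbarSum ℓ F φ ι p.1 p.2) (Icc a b ×ˢ Ioi 0) := by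
  rintro ⟨x, y⟩ ⟨hx, hy⟩
  have hy : 0 < y := hy
  obtain ⟨K, hK⟩ := (h.tendsto.eventually_ge_atTop (2 / y)).exists
  have hev : ∀ᶠ p : ℝ × ℝ in 𝓝[Icc a b ×ˢ Ioi 0] (x, y), y / 2 < p.2 :=
    mem_nhdsWithin_of_mem_nhds ((continuous_snd.tendsto (x, y)).eventually
      (lt_mem_nhds (show y / 2 < y by linarith)))
  have hsum : ContinuousWithinAt (fun p : ℝ × ℝ => ∑ k ∈ Finset.range K,
      dbarTerm ℓ F φ ι k p.1 p.2) (Icc a b ×ˢ Ioi 0) (x, y) :=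
    tendsto_finsetSum _ fun k _ => h.continuousOn_dbarTerm ι k _ ⟨hx, hy⟩
  have hK' : ∀ y', y / 2 < y' → 1 ≤ y' * ℓ K := fun y' hy' => by
    calc (1 : ℝ) = y / 2 * (2 / y) := by field_simp
      _ ≤ y' * ℓ K := by
          have : 0 ≤ y' := by linarith
          gcongr
  refine hsum.congr_of_eventuallyEq ?_ (h.dbarSum_eq hy (hK' y (by linarith)))
  filter_upwards [hev] with p hp
  exact h.dbarSum_eq (by linarith) (hK' _ hp)

/-- Green's formula for the extension on `[a, b] × [η, T]`. -/
theorem setIntegral_dbarSum {ℓ : ℕ → ℝ} {F : ℕ → ℝ → ℂ} {φ : ℝ → ℝ} {a a' b' b M : ℝ}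
    {w : ℕ → ℝ} (h : ExtensionData ℓ F φ a a' b' b M w) {ι : ℂ}
    (hι : ι = Complex.I ∨ ι = -Complex.I) (hab : a ≤ b) {η T t : ℝ} (hη : 0 < η) (hηT : η ≤ T)
    (hT : 1 ≤ T * ℓ 0) {K : ℕ} (hK : 1 ≤ η * ℓ K) :
    ∫ p in Ioc a b ×ˢ Ioc η T, dbarSum ℓ F φ ι p.1 p.2 * cauchyKernel ι t p.1 p.2 =
      ∑ k ∈ Finset.range K, -∫ x in a..b, φ x * F k x *
        ((ι * η) ^ k / k.factorial * (cutoff (η * ℓ k) : ℝ)) * cauchyKernel ι t x η := by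
  have hstep := fun k => setIntegral_dbar_mul_cauchyKernel (t := t) hι hab hη hηT
    (A := fun x => φ x * F k x)
    (A' := fun x => (deriv φ x : ℝ) * F k x + φ x * F (k + 1) x)
    (B := fun y => (ι * y) ^ k / k.factorial * (cutoff (y * ℓ k) : ℝ))
    (B' := fun y => (k : ℂ) * (ι * y) ^ (k - 1) * ι / k.factorial * (cutoff (y * ℓ k) : ℝ) +
      (ι * y) ^ k / k.factorial * ((ℓ k * deriv cutoff (y * ℓ k) : ℝ) : ℂ))
    (fun x hx => by
      have h1 := ((h.contDiff.differentiable one_ne_zero x).hasDerivAt).ofReal_comp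
      exact h1.mul (h.hasDerivAt k x hx))
    (by
      have h1 : ContinuousOn (F k) (Icc a b) := fun x hx =>
        (h.hasDerivAt k x hx).continuousAt.continuousWithinAt
      have h2 : ContinuousOn (F (k + 1)) (Icc a b) := fun x hx =>
        (h.hasDerivAt (k + 1) x hx).continuousAt.continuousWithinAt
      have h5 := h.contDiff.continuous
      have h6 := h.contDiff.continuous_deriv le_rfl
      fun_prop)
    (fun y hy => by
      have h1 : HasDerivAt (fun y : ℝ => (ι * y)) ι y := by
        simpa using ((hasDerivAt_id y).ofReal_comp).const_mul ι
      have h2 : HasDerivAt (fun y : ℝ => cutoff (y * ℓ k)) (ℓ k * deriv cutoff (y * ℓ k)) y := by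
        have := (hasDerivAt_cutoff (y * ℓ k)).comp y ((hasDerivAt_id y).mul_const (ℓ k))
        exact HasDerivAt.congr_deriv this (by ring)
      exact ((h1.pow k).div_const _).mul h2.ofReal_comp)
    (by
      have h3 := contDiff_cutoff.continuous
      have h4 := continuous_deriv_cutoff
      fun_prop)
    (by simp [h.left]) (by simp [h.right])
    (by
      have h0 : 1 ≤ T * ℓ k :=
        hT.trans (mul_le_mul_of_nonneg_left (h.mono k.zero_le) (hη.le.trans hηT))
      simp [cutoff_of_ge h0])
  rw [← Finset.sum_congr rfl fun k _ => (hstep k).2, ← integral_finsetSum _ fun k _ => (hstep k).1]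
  refine setIntegral_congr_fun (measurableSet_Ioc.prod measurableSet_Ioc) fun p hp => ?_
  have hpy : 0 < p.2 := hη.trans hp.2.1
  have hK' : 1 ≤ p.2 * ℓ K := hK.trans (mul_le_mul_of_nonneg_right hp.2.1.le
    (h.pos.le.trans (h.mono K.zero_le)))
  rw [h.dbarSum_eq hpy hK', ← Finset.sum_mul, sum_dbar_eq ℓ F φ ι p.1 p.2 K, cutoff_of_ge hK']
  simp

theorem norm_setIntegral_add_le {ℓ : ℕ → ℝ} {F : ℕ → ℝ → ℂ} {φ : ℝ → ℝ} {a a' b' b M : ℝ}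
    {w : ℕ → ℝ} (h : ExtensionData ℓ F φ a a' b' b M w) {ι : ℂ}
    (hι : ι = Complex.I ∨ ι = -Complex.I) (hab : a ≤ b) {η T t : ℝ} (hη : 0 < η) (hηT : η ≤ T)
    (hT : 1 ≤ T * ℓ 0) (hη0 : η * ℓ 0 ≤ 1 / 2) :
    ‖(∫ p in Ioc a b ×ˢ Ioc η T, dbarSum ℓ F φ ι p.1 p.2 * cauchyKernel ι t p.1 p.2) +
      ∫ x in a..b, φ x * F 0 x * cauchyKernel ι t x η‖ ≤
      M * ∫ x in a..b, η * ‖cauchyKernel ι t x η‖ := by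
  obtain ⟨K, hK1, hK⟩ := ((eventually_ge_atTop 1).and
    (h.tendsto.eventually_ge_atTop (1 / η))).exists
  have hK' : 1 ≤ η * ℓ K := by
    rw [div_le_iff₀ hη] at hK; linarith
  obtain ⟨K, rfl⟩ := Nat.exists_eq_add_of_le' hK1
  rw [h.setIntegral_dbarSum hι hab hη hηT hT hK', Finset.sum_range_succ', cutoff_of_le hη0]
  have hkc : ContinuousOn (fun x => cauchyKernel ι t x η) (Icc a b) :=
    (continuousOn_cauchyKernel hι t).comp (f := fun x => (x, η)) (by fun_prop)
      fun x _ => ⟨mem_univ _, hη⟩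
  have hJ : 0 ≤ ∫ x in a..b, η * ‖cauchyKernel ι t x η‖ :=
    intervalIntegral.integral_nonneg hab fun x _ => by positivity
  have hterm : ∀ k ∈ Finset.range K, ‖-∫ x in a..b, φ x * F (k + 1) x *
        ((ι * η) ^ (k + 1) / (k + 1).factorial * (cutoff (η * ℓ (k + 1)) : ℝ)) *
          cauchyKernel ι t x η‖ ≤
      (1 / 2) ^ (k + 1) * (M * ∫ x in a..b, η * ‖cauchyKernel ι t x η‖) := by
    intro k _
    rw [norm_neg, ← intervalIntegral.integral_const_mul, ← intervalIntegral.integral_const_mul]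
    refine intervalIntegral.norm_integral_le_of_norm_le hab (ae_of_all _ fun x hx => ?_) ?_
    · have h1 := h.tail x (Ioc_subset_Icc_self hx) η hη (k + 1) (by omega)
      have h2 := h.abs_le x
      rw [norm_mul, norm_mul, norm_mul, norm_mul, norm_div, norm_pow, norm_mul,
        norm_of_eq_I_or hι, one_mul, Complex.norm_real, Complex.norm_real, Complex.norm_real,
        Complex.norm_natCast, Real.norm_eq_abs, Real.norm_of_nonneg hη.le,
        Real.norm_of_nonneg (cutoff_nonneg _)]
      have h3 := cutoff_nonneg (η * ℓ (k + 1))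
      calc _ ≤ 1 * (‖F (k + 1) x‖ * (η ^ (k + 1) / (k + 1).factorial) *
            cutoff (η * ℓ (k + 1))) * ‖cauchyKernel ι t x η‖ := by
            rw [mul_assoc |φ x|, ← mul_assoc ‖F (k + 1) x‖]
            gcongr
        _ ≤ 1 * (M * (1 / 2) ^ (k + 1) * η) * ‖cauchyKernel ι t x η‖ := by gcongr
        _ = _ := by ring
    · exact ContinuousOn.intervalIntegrable (by
        rw [uIcc_of_le hab]
        exact continuousOn_const.mul (continuousOn_const.mul (continuousOn_const.mul hkc.norm)))
  have h0 : (∑ k ∈ Finset.range K, ((1 : ℝ) / 2) ^ (k + 1)) ≤ 1 := by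
    have h1 := (summable_geometric_two.mul_right (1 / 2)).sum_le_tsum (Finset.range K)
      (fun i _ => by positivity)
    rw [tsum_mul_right, tsum_geometric_two] at h1
    simpa [pow_succ] using h1
  calc _ = ‖∑ k ∈ Finset.range K, -∫ x in a..b, φ x * F (k + 1) x *
        ((ι * η) ^ (k + 1) / (k + 1).factorial * (cutoff (η * ℓ (k + 1)) : ℝ)) *
          cauchyKernel ι t x η‖ := by
        congr 1
        simp
    _ ≤ ∑ k ∈ Finset.range K, (1 / 2) ^ (k + 1) *
        (M * ∫ x in a..b, η * ‖cauchyKernel ι t x η‖) := norm_sum_le_of_le _ hterm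
    _ ≤ 1 * (M * ∫ x in a..b, η * ‖cauchyKernel ι t x η‖) := by
        rw [← Finset.sum_mul]
        have := h.M_nonneg
        gcongr
    _ = _ := one_mul _

end ExtensionData

theorem tendsto_integral_mul_norm_cauchyKernel {ι : ℂ} (hι : ι = Complex.I ∨ ι = -Complex.I)
    (a b t : ℝ) : Tendsto (fun η : ℝ => ∫ x in a..b, η * ‖cauchyKernel ι t x η‖) (𝓝[>] 0)
      (𝓝 0) := by
  have hle : ∀ x η : ℝ, 0 < η → η * ‖cauchyKernel ι t x η‖ ≤ 1 := fun x η hη => by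
    rw [cauchyKernel, norm_inv, ← div_eq_mul_inv]
    have := abs_le_norm_line hι (x - t) η
    rw [abs_of_pos hη] at this
    rw [div_le_one (hη.trans_le this)]
    exact this
  have h := intervalIntegral.tendsto_integral_filter_of_dominated_convergence (μ := volume)
    (a := a) (b := b) (l := 𝓝[>] (0 : ℝ)) (F := fun η x => η * ‖cauchyKernel ι t x η‖)
    (f := fun _ => 0) (fun _ => 1) ?_ ?_ ?_ ?_
  · simpa using h
  · filter_upwards [self_mem_nhdsWithin] with η hη
    have hkc : Continuous (fun x => cauchyKernel ι t x η) := continuousOn_univ.1 <|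
      (continuousOn_cauchyKernel hι t).comp (f := fun x => (x, η)) (by fun_prop)
        fun x _ => ⟨mem_univ _, hη⟩
    exact (continuous_const.mul hkc.norm).aestronglyMeasurable
  · filter_upwards [self_mem_nhdsWithin] with η hη
    refine ae_of_all _ fun x _ => ?_
    have : 0 < η := hη
    rw [Real.norm_of_nonneg (by positivity)]
    exact hle x η hη
  · exact intervalIntegrable_const
  · have hne : ∀ᵐ x : ℝ, x ≠ t := by simp [ae_iff, measure_singleton]
    filter_upwards [hne] with x hx _
    have hpos : 0 < |x - t| := abs_pos.2 (sub_ne_zero.2 hx)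
    have h1 : Tendsto (fun η : ℝ => η * |x - t|⁻¹) (𝓝[>] 0) (𝓝 0) := by
      have : Tendsto (fun η : ℝ => η * |x - t|⁻¹) (𝓝 0) (𝓝 (0 * |x - t|⁻¹)) :=
        tendsto_id.mul_const _
      rw [zero_mul] at this
      exact this.mono_left nhdsWithin_le_nhds
    refine tendsto_of_tendsto_of_tendsto_of_le_of_le' tendsto_const_nhds h1 ?_ ?_
    · filter_upwards [self_mem_nhdsWithin] with η hη
      have : 0 < η := hη
      positivity
    · filter_upwards [self_mem_nhdsWithin] with η hη
      have : 0 < η := hη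
      rw [cauchyKernel, norm_inv]
      gcongr
      exact abs_fst_le_norm_line hι _ _

/-- The jump of the Cauchy integral across the real line, through the Poisson kernel. -/
theorem tendsto_integral_mul_cauchyKernel_sub {g : ℝ → ℂ} {a b t : ℝ} (ht : t ∈ Ioo a b)
    (hg : ContinuousOn g (Icc a b)) :
    Tendsto (fun η : ℝ => ∫ x in a..b, g x *
      (cauchyKernel (-Complex.I) t x η - cauchyKernel Complex.I t x η)) (𝓝[>] 0)
      (𝓝 (2 * Real.pi * Complex.I * g t)) := by
  have hab : a ≤ b := (ht.1.trans ht.2).le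
  have hpi := Real.pi_pos
  set P : ℝ → ℝ := fun x => Real.pi⁻¹ * (1 + x ^ 2)⁻¹
  have hP0 : ∀ x, 0 ≤ P x := fun x => by positivity
  have hP1 : ∫ x, P x = 1 := by
    rw [integral_const_mul, integral_univ_inv_one_add_sq, inv_mul_cancel₀ hpi.ne']
  have hP2 : Tendsto (fun x => ‖x‖ ^ Module.finrank ℝ ℝ * P x) (Bornology.cobounded ℝ) (𝓝 0) := by
    have h1 : Tendsto (fun x : ℝ => Real.pi⁻¹ * ‖x‖⁻¹) (Bornology.cobounded ℝ) (𝓝 (Real.pi⁻¹ * 0)) :=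
      (tendsto_inv_atTop_zero.comp tendsto_norm_cobounded_atTop).const_mul _
    rw [mul_zero] at h1
    refine tendsto_of_tendsto_of_tendsto_of_le_of_le tendsto_const_nhds h1
      (fun x => mul_nonneg (by positivity) (hP0 x)) fun x => ?_
    simp only [P, Module.finrank_self, pow_one]
    rw [mul_left_comm]
    refine mul_le_mul_of_nonneg_left ?_ (by positivity)
    rw [Real.norm_eq_abs]
    rcases eq_or_ne x 0 with rfl | hx
    · simp
    have hx0 : 0 < |x| := abs_pos.2 hx
    rw [← sq_abs x, ← div_eq_mul_inv, div_le_iff₀ (by positivity)]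
    field_simp
    linarith
  have hgi : Integrable ((Ioc a b).indicator g) :=
    ((hg.integrableOn_compact isCompact_Icc).mono_set Ioc_subset_Icc_self).integrable_indicator
      measurableSet_Ioc
  have hgc : ContinuousAt ((Ioc a b).indicator g) t := by
    have h1 : ContinuousAt g t := hg.continuousAt (Icc_mem_nhds ht.1 ht.2)
    refine h1.congr ?_
    filter_upwards [Ioo_mem_nhds ht.1 ht.2] with x hx
    rw [indicator_of_mem (Ioo_subset_Ioc_self hx)]
  have hmain := (tendsto_integral_comp_smul_smul_of_integrable' (μ := volume) hP0 hP1 hP2 hgi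
    hgc).comp tendsto_inv_nhdsGT_zero
  rw [indicator_of_mem (Ioo_subset_Ioc_self ht)] at hmain
  refine (hmain.const_mul (2 * Real.pi * Complex.I)).congr' ?_
  filter_upwards [self_mem_nhdsWithin] with η hη
  have hη : 0 < η := hη
  simp only [Function.comp, Module.finrank_self, pow_one, P]
  rw [intervalIntegral.integral_of_le hab, ← integral_indicator measurableSet_Ioc,
    ← integral_const_mul]
  congr 1
  ext x
  by_cases hx : x ∈ Ioc a b
  swap
  · rw [indicator_of_notMem hx, indicator_of_notMem hx]; simp
  rw [indicator_of_mem hx, indicator_of_mem hx]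
  have h1 : ((x - t : ℝ) : ℂ) + Complex.I * η ≠ 0 := line_ne_zero (Or.inl rfl) _ hη
  have h2 : ((x - t : ℝ) : ℂ) + -Complex.I * η ≠ 0 := line_ne_zero (Or.inr rfl) _ hη
  have h3 : (((x - t : ℝ) : ℂ) + Complex.I * η) * (((x - t : ℝ) : ℂ) + -Complex.I * η) =
      ((η ^ 2 + (t - x) ^ 2 : ℝ) : ℂ) := by
    push_cast
    linear_combination (-(η : ℂ) ^ 2) * Complex.I_sq
  have h4 : (η ^ 2 + (t - x) ^ 2 : ℝ) ≠ 0 := by positivity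
  have h5 : cauchyKernel (-Complex.I) t x η - cauchyKernel Complex.I t x η =
      2 * Complex.I * η / ((η ^ 2 + (t - x) ^ 2 : ℝ) : ℂ) := by
    rw [cauchyKernel, cauchyKernel, inv_sub_inv h2 h1, mul_comm, ← h3]
    congr 1
    · ring
    · ring
  rw [h5]
  have h6 : η⁻¹ * (Real.pi⁻¹ * (1 + (η⁻¹ • (t - x)) ^ 2)⁻¹) =
      Real.pi⁻¹ * (η / (η ^ 2 + (t - x) ^ 2)) := by
    rw [smul_eq_mul]
    field_simp
  rw [h6, Complex.real_smul]
  have h7 : (Real.pi : ℂ) ≠ 0 := by exact_mod_cast hpi.ne'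
  have h8 : ((η ^ 2 + (t - x) ^ 2 : ℝ) : ℂ) ≠ 0 := by exact_mod_cast h4
  push_cast at h8 ⊢
  field_simp

namespace ExtensionData

/-- Near a point of `(a', b')` the density is small enough to absorb any power of the Cauchy
kernel. -/
theorem exists_bound_mul_pow {ℓ : ℕ → ℝ} {F : ℕ → ℝ → ℂ} {φ : ℝ → ℝ} {a a' b' b M : ℝ}
    {w : ℕ → ℝ} (h : ExtensionData ℓ F φ a a' b' b M w) {ι : ℂ}
    (hι : ι = Complex.I ∨ ι = -Complex.I) {t₀ : ℝ} (ht : t₀ ∈ Ioo a' b') (n : ℕ) :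
    ∃ ε > 0, ∃ C, ∀ t ∈ Metric.ball t₀ ε, ∀ x ∈ Icc a b, ∀ y, 0 < y →
      ‖dbarSum ℓ F φ ι x y * cauchyKernel ι t x y ^ n‖ ≤ C := by
  have hε : 0 < min (t₀ - a') (b' - t₀) / 2 := half_pos (lt_min (by linarith [ht.1])
    (by linarith [ht.2]))
  set ε := min (t₀ - a') (b' - t₀) / 2
  have h1 : 2 * ε ≤ t₀ - a' := by simp only [ε]; linarith [min_le_left (t₀ - a') (b' - t₀)]
  have h2 : 2 * ε ≤ b' - t₀ := by simp only [ε]; linarith [min_le_right (t₀ - a') (b' - t₀)]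
  have hM := h.M_nonneg
  have hw := h.w_nonneg n
  refine ⟨ε, hε, 2 * M * w n ^ n + 2 * M * (ε⁻¹) ^ n, fun t htε x hx y hy => ?_⟩
  rw [Metric.mem_ball, Real.dist_eq, abs_lt] at htε
  rw [norm_mul, norm_pow]
  by_cases hx' : x ∈ Icc a' b'
  · have h3 : ‖cauchyKernel ι t x y‖ ≤ y⁻¹ := by
      rw [cauchyKernel, norm_inv]
      gcongr
      exact (le_abs_self y).trans (abs_le_norm_line hι _ _)
    calc _ ≤ 2 * M * (w n * y) ^ n * (y⁻¹) ^ n := by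
          gcongr
          exact h.norm_dbarSum_le_pow (norm_of_eq_I_or hι) hx' hy n
      _ = 2 * M * w n ^ n := by
          rw [mul_assoc, ← mul_pow, mul_assoc (w n), mul_inv_cancel₀ hy.ne', mul_one]
      _ ≤ _ := le_add_of_nonneg_right (by positivity)
  · have h3 : ε ≤ |x - t| := by
      rw [mem_Icc, not_and_or, not_le, not_le] at hx'
      rcases hx' with h4 | h4
      · rw [abs_of_neg (by linarith)]; linarith
      · rw [abs_of_pos (by linarith)]; linarith
    have h4 : ‖cauchyKernel ι t x y‖ ≤ ε⁻¹ := by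
      rw [cauchyKernel, norm_inv]
      gcongr
      exact h3.trans (abs_fst_le_norm_line hι _ _)
    calc _ ≤ 2 * M * (ε⁻¹) ^ n := by
          gcongr
          exact h.norm_dbarSum_le (norm_of_eq_I_or hι) hx hy
      _ ≤ _ := le_add_of_nonneg_left (by positivity)

theorem aestronglyMeasurable_mul {ℓ : ℕ → ℝ} {F : ℕ → ℝ → ℂ} {φ : ℝ → ℝ} {a a' b' b M : ℝ}
    {w : ℕ → ℝ} (h : ExtensionData ℓ F φ a a' b' b M w) {ι : ℂ}
    {G : ℝ × ℝ → ℂ} (hG : ContinuousOn G (univ ×ˢ Ioi 0)) (T : ℝ) :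
    AEStronglyMeasurable (fun p : ℝ × ℝ => dbarSum ℓ F φ ι p.1 p.2 * G p)
      (volume.restrict (Ioc a b ×ˢ Ioc 0 T)) := by
  refine ContinuousOn.aestronglyMeasurable ?_ (measurableSet_Ioc.prod measurableSet_Ioc)
  refine ContinuousOn.mul ((h.continuousOn_dbarSum ι).mono ?_) (hG.mono ?_)
  · exact prod_mono Ioc_subset_Icc_self fun y hy => hy.1
  · exact prod_mono (subset_univ _) fun y hy => hy.1

theorem integrable_const_prod (a b T C : ℝ) :
    Integrable (fun _ : ℝ × ℝ => C) (volume.restrict (Ioc a b ×ˢ Ioc 0 T)) := by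
  refine integrableOn_const (ne_of_lt ?_)
  rw [Measure.volume_eq_prod, Measure.prod_prod]
  exact ENNReal.mul_lt_top measure_Ioc_lt_top measure_Ioc_lt_top

theorem integrableOn_mul_pow {ℓ : ℕ → ℝ} {F : ℕ → ℝ → ℂ} {φ : ℝ → ℝ} {a a' b' b M : ℝ}
    {w : ℕ → ℝ} (h : ExtensionData ℓ F φ a a' b' b M w) {ι : ℂ}
    (hι : ι = Complex.I ∨ ι = -Complex.I) {t : ℝ} (ht : t ∈ Ioo a' b') (n : ℕ) (T : ℝ) :
    IntegrableOn (fun p : ℝ × ℝ => dbarSum ℓ F φ ι p.1 p.2 * cauchyKernel ι t p.1 p.2 ^ n)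
      (Ioc a b ×ˢ Ioc 0 T) := by
  obtain ⟨ε, hε, C, hC⟩ := h.exists_bound_mul_pow hι ht n
  refine Integrable.mono' (integrable_const_prod a b T C)
    (h.aestronglyMeasurable_mul ((continuousOn_cauchyKernel hι t).pow n) T) ?_
  filter_upwards [ae_restrict_mem (measurableSet_Ioc.prod measurableSet_Ioc)] with p hp
  exact hC t (Metric.mem_ball_self hε) p.1 (Ioc_subset_Icc_self hp.1) p.2 hp.2.1

/-- The function is recovered from the densities on both sides of the real line. -/
theorem integral_sub_integral_eq {ℓ : ℕ → ℝ} {F : ℕ → ℝ → ℂ} {φ : ℝ → ℝ} {a a' b' b M : ℝ}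
    {w : ℕ → ℝ} (h : ExtensionData ℓ F φ a a' b' b M w) {t : ℝ} (ht : t ∈ Ioo a' b') :
    (∫ p in Ioc a b ×ˢ Ioc 0 (1 / ℓ 0), dbarSum ℓ F φ Complex.I p.1 p.2 *
        cauchyKernel Complex.I t p.1 p.2) -
      ∫ p in Ioc a b ×ˢ Ioc 0 (1 / ℓ 0), dbarSum ℓ F φ (-Complex.I) p.1 p.2 *
        cauchyKernel (-Complex.I) t p.1 p.2 = 2 * Real.pi * Complex.I * F 0 t := by
  have hpos := h.pos
  have hl := h.lt_left
  have hr := h.lt_right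
  have hab : a ≤ b := by linarith [ht.1, ht.2]
  set T := 1 / ℓ 0
  have hT : 0 < T := by positivity
  set η : ℕ → ℝ := fun n => T / (n + 2)
  have hη : ∀ n, 0 < η n := fun n => by positivity
  have hηT : ∀ n, η n ≤ T := fun n => div_le_self hT.le (by linarith [Nat.cast_nonneg (α := ℝ) n])
  have hη2 : ∀ n, η n * ℓ 0 ≤ 1 / 2 := fun n => by
    simp only [η, T]
    rw [div_div, div_mul_eq_mul_div, one_mul, div_mul_cancel_left₀ hpos.ne', one_div]
    exact inv_anti₀ two_pos (by linarith [Nat.cast_nonneg (α := ℝ) n])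
  have hη0 : Tendsto η atTop (𝓝[>] 0) := by
    refine tendsto_nhdsWithin_iff.2 ⟨?_, Filter.Eventually.of_forall hη⟩
    exact tendsto_const_nhds.div_atTop
      (tendsto_atTop_add_const_right _ _ tendsto_natCast_atTop_atTop)
  have hkc : ∀ {ι : ℂ}, (ι = Complex.I ∨ ι = -Complex.I) → ∀ n,
      ContinuousOn (fun x => cauchyKernel ι t x (η n)) (Icc a b) := fun hι n =>
    (continuousOn_cauchyKernel hι t).comp (f := fun x => (x, η n)) (by fun_prop)
      fun x _ => ⟨mem_univ _, hη n⟩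
  have hside : ∀ {ι : ℂ}, (ι = Complex.I ∨ ι = -Complex.I) →
      Tendsto (fun n => ∫ x in a..b, φ x * F 0 x * cauchyKernel ι t x (η n)) atTop
        (𝓝 (-∫ p in Ioc a b ×ˢ Ioc 0 T, dbarSum ℓ F φ ι p.1 p.2 *
          cauchyKernel ι t p.1 p.2)) := by
    intro ι hι
    have hunion : ⋃ n, Ioc a b ×ˢ Ioc (η n) T = Ioc a b ×ˢ Ioc 0 T := by
      rw [← prod_iUnion]
      congr 1
      ext y
      simp only [mem_iUnion, mem_Ioc]
      constructor
      · rintro ⟨n, h1, h2⟩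
        exact ⟨(hη n).trans h1, h2⟩
      · rintro ⟨h1, h2⟩
        obtain ⟨n, hn⟩ := ((tendsto_nhdsWithin_iff.1 hη0).1.eventually (gt_mem_nhds h1)).exists
        exact ⟨n, hn, h2⟩
    have hmono : Monotone fun n => Ioc a b ×ˢ Ioc (η n) T := fun m n hmn =>
      prod_mono subset_rfl (Ioc_subset_Ioc_left (by
        simp only [η]
        gcongr))
    have hint := h.integrableOn_mul_pow hι ht 1 T
    simp only [pow_one] at hint
    have h1 := tendsto_setIntegral_of_monotone (μ := volume)
      (fun n => measurableSet_Ioc.prod measurableSet_Ioc) hmono (by rw [hunion]; exact hint)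
    rw [hunion] at h1
    have h2 : Tendsto (fun n => (∫ p in Ioc a b ×ˢ Ioc (η n) T, dbarSum ℓ F φ ι p.1 p.2 *
        cauchyKernel ι t p.1 p.2) + ∫ x in a..b, φ x * F 0 x * cauchyKernel ι t x (η n)) atTop
        (𝓝 0) := by
      refine squeeze_zero_norm (fun n => h.norm_setIntegral_add_le hι hab (hη n) (hηT n)
        (by simp only [T]; field_simp; exact le_rfl) (hη2 n)) ?_
      have := ((tendsto_integral_mul_norm_cauchyKernel hι a b t).comp hη0).const_mul M
      rwa [mul_zero] at this
    have h3 := h2.sub h1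
    rw [zero_sub] at h3
    refine h3.congr fun n => by ring
  have hg : ContinuousOn (fun x => (φ x : ℂ) * F 0 x) (Icc a b) :=
    ContinuousOn.mul (Complex.continuous_ofReal.comp h.contDiff.continuous).continuousOn
      fun x hx => (h.hasDerivAt 0 x hx).continuousAt.continuousWithinAt
  have hP := (tendsto_integral_mul_cauchyKernel_sub ⟨hl.trans ht.1, ht.2.trans hr⟩ hg).comp hη0
  have hD := (hside (Or.inr rfl)).sub (hside (Or.inl rfl))
  have hlim := tendsto_nhds_unique hD (hP.congr fun n => by
    simp only [Function.comp, mul_sub]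
    have hii : ∀ {ι : ℂ}, (ι = Complex.I ∨ ι = -Complex.I) →
        IntervalIntegrable (fun x => φ x * F 0 x * cauchyKernel ι t x (η n)) volume a b :=
      fun hι => ContinuousOn.intervalIntegrable (by
        rw [uIcc_of_le hab]; exact hg.mul (hkc hι n))
    exact intervalIntegral.integral_sub (hii (Or.inr rfl)) (hii (Or.inl rfl)))
  rw [h.eq_one t ⟨ht.1.le, ht.2.le⟩, Complex.ofReal_one, one_mul] at hlim
  rw [← hlim]
  ring

theorem hasDerivAt_integral_pow {ℓ : ℕ → ℝ} {F : ℕ → ℝ → ℂ} {φ : ℝ → ℝ} {a a' b' b M : ℝ}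
    {w : ℕ → ℝ} (h : ExtensionData ℓ F φ a a' b' b M w) {ι : ℂ}
    (hι : ι = Complex.I ∨ ι = -Complex.I) {t : ℝ} (ht : t ∈ Ioo a' b') (n : ℕ) (T : ℝ) :
    HasDerivAt (fun t => ∫ p in Ioc a b ×ˢ Ioc 0 T, dbarSum ℓ F φ ι p.1 p.2 *
        cauchyKernel ι t p.1 p.2 ^ (n + 1))
      ((n + 1) * ∫ p in Ioc a b ×ˢ Ioc 0 T, dbarSum ℓ F φ ι p.1 p.2 *
        cauchyKernel ι t p.1 p.2 ^ (n + 2)) t := by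
  obtain ⟨ε, hε, C, hC⟩ := h.exists_bound_mul_pow hι ht (n + 2)
  have hm := ae_restrict_mem (μ := (volume : Measure (ℝ × ℝ)))
    ((measurableSet_Ioc (a := a) (b := b)).prod (measurableSet_Ioc (a := 0) (b := T)))
  have := (hasDerivAt_integral_of_dominated_loc_of_deriv_le (Metric.ball_mem_nhds t hε)
    (μ := volume.restrict (Ioc a b ×ˢ Ioc 0 T))
    (F := fun t p => dbarSum ℓ F φ ι p.1 p.2 * cauchyKernel ι t p.1 p.2 ^ (n + 1))
    (F' := fun t p => (n + 1) * (dbarSum ℓ F φ ι p.1 p.2 * cauchyKernel ι t p.1 p.2 ^ (n + 2)))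
    (bound := fun _ => (n + 1) * C)
    (Filter.Eventually.of_forall fun s =>
      h.aestronglyMeasurable_mul ((continuousOn_cauchyKernel hι s).pow _) T)
    (h.integrableOn_mul_pow hι ht (n + 1) T)
    ((h.aestronglyMeasurable_mul ((continuousOn_cauchyKernel hι t).pow _) T).const_mul _)
    (by
      filter_upwards [hm] with p hp s hs
      have h1 := hC s hs p.1 (Ioc_subset_Icc_self hp.1) p.2 hp.2.1
      rw [norm_mul]
      refine mul_le_mul (le_of_eq ?_) h1 (norm_nonneg _) (by positivity)
      exact_mod_cast Complex.norm_natCast (n + 1))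
    (integrable_const_prod a b T _)
    (by
      filter_upwards [hm] with p hp s hs
      have h1 : HasDerivAt (fun s => cauchyKernel ι s p.1 p.2) (cauchyKernel ι s p.1 p.2 ^ 2)
          s := by
        have h2 : HasDerivAt (fun s : ℝ => (((p.1 - s : ℝ) : ℂ) + ι * p.2)) (-1) s := by
          simpa using (((hasDerivAt_id s).const_sub p.1).ofReal_comp).add_const (ι * (p.2 : ℂ))
        refine (h2.inv (line_ne_zero hι _ hp.2.1)).congr_deriv ?_
        simp only [cauchyKernel, inv_pow, neg_neg, one_div]
      refine ((h1.pow (n + 1)).const_mul _).congr_deriv ?_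
      push_cast
      ring)).2
  rwa [integral_const_mul] at this

/-- The derivatives of the function in terms of the densities on both sides of the line. -/
theorem integral_pow_sub_integral_pow_eq {ℓ : ℕ → ℝ} {F : ℕ → ℝ → ℂ} {φ : ℝ → ℝ}
    {a a' b' b M : ℝ} {w : ℕ → ℝ} (h : ExtensionData ℓ F φ a a' b' b M w) (n : ℕ) :
    ∀ t ∈ Ioo a' b', F n t / n.factorial = (2 * Real.pi * Complex.I)⁻¹ *
      ((∫ p in Ioc a b ×ˢ Ioc 0 (1 / ℓ 0), dbarSum ℓ F φ Complex.I p.1 p.2 *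
        cauchyKernel Complex.I t p.1 p.2 ^ (n + 1)) -
      ∫ p in Ioc a b ×ˢ Ioc 0 (1 / ℓ 0), dbarSum ℓ F φ (-Complex.I) p.1 p.2 *
        cauchyKernel (-Complex.I) t p.1 p.2 ^ (n + 1)) := by
  have hl := h.lt_left
  have hr := h.lt_right
  induction n with
  | zero =>
    intro t ht
    have := h.integral_sub_integral_eq ht
    simp only [zero_add, pow_one]
    rw [this, inv_mul_cancel_left₀ Complex.two_pi_I_ne_zero]
    simp
  | succ n ih =>
    intro t ht
    have h1 := ((h.hasDerivAt_integral_pow (Or.inl rfl) ht n (1 / ℓ 0)).sub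
      (h.hasDerivAt_integral_pow (Or.inr rfl) ht n (1 / ℓ 0))).const_mul
      (2 * Real.pi * Complex.I)⁻¹
    have h2 := (h.hasDerivAt n t ⟨by linarith [ht.1], by linarith [ht.2]⟩).div_const
      (n.factorial : ℂ)
    have h3 := h2.unique (h1.congr_of_eventuallyEq (by
      filter_upwards [Ioo_mem_nhds ht.1 ht.2] with s hs using ih s hs))
    have h4 : ((n : ℂ) + 1) ≠ 0 := by exact_mod_cast n.succ_ne_zero
    rw [Nat.factorial_succ, mul_comm, Nat.cast_mul, ← div_div, h3]
    push_cast
    field_simp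

end ExtensionData

theorem hasDerivAt_iteratedDeriv_of_contDiffOn {f : ℝ → ℂ} {I : Set ℝ} (hI : IsOpen I)
    (hf : ContDiffOn ℝ ∞ f I) (k : ℕ) {x : ℝ} (hx : x ∈ I) :
    HasDerivAt (iteratedDeriv k f) (iteratedDeriv (k + 1) f x) x := by
  have h1 : DifferentiableOn ℝ (iteratedDerivWithin k f I) I :=
    hf.differentiableOn_iteratedDerivWithin (by exact_mod_cast WithTop.coe_lt_top k)
      hI.uniqueDiffOn
  have h2 : DifferentiableAt ℝ (iteratedDeriv k f) x := by
    refine (h1.differentiableAt (hI.mem_nhds hx)).congr_of_eventuallyEq ?_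
    filter_upwards [hI.mem_nhds hx] with y hy
    exact (iteratedDerivWithin_of_isOpen hI hy).symm
  rw [iteratedDeriv_succ]
  exact h2.hasDerivAt

/-- Every member of the Beurling class has the extension data, with an arbitrarily small
constant `δ` in the decay of the density. -/
theorem exists_extensionData {L : ℝ → ℝ} {κ : ℝ} (hL : RegularWeight L κ) {I : Set ℝ}
    (hI : IsOpen I) {f : ℝ → ℂ} (hf : f ∈ beurlingClass L I) {a a' b' b : ℝ} (ha : a < a')
    (hb : b' < b) (hI' : Icc a b ⊆ I) {δ' : ℝ} (hδ' : 0 < δ') :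
    ∃ ℓ φ M, ExtensionData ℓ (fun k => iteratedDeriv k f) φ a a' b' b M
      (fun n => δ' * L n) := by
  obtain ⟨Λ, hΛ, hsucc⟩ := hL.exists_succ_le
  obtain ⟨B₁, hB₁, hcut⟩ := exists_abs_deriv_cutoff_le
  obtain ⟨φ, hφ, hφ0, hφ1, hφI, hφa, hφb⟩ := exists_interval_cutoff ha hb
  obtain ⟨B₂, hB₂⟩ := (isCompact_Icc (a := a) (b := b)).exists_bound_of_continuousOn
    (hφ.continuous_deriv le_rfl).continuousOn
  set B := max B₁ B₂
  have hB : 0 < B := lt_max_of_lt_left hB₁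
  set lam := 2 / δ'
  have hlam : 0 < lam := by positivity
  have hδlam : δ' * lam = 2 := by simp only [lam]; field_simp
  set δ := 1 / (4 * (Real.exp κ * (Real.exp 1 * (Λ * lam)) * Λ))
  have he := Real.exp_pos 1
  have heκ := Real.exp_pos κ
  have hΛ0 : 0 < Λ := by linarith
  have hδ : 0 < δ := by positivity
  have hq : Real.exp κ * (Real.exp 1 * δ * (Λ * lam)) * Λ = 1 / 4 := by
    simp only [δ]; field_simp
  obtain ⟨C, hC, hfC⟩ := hf.2 a b hI' δ hδ
  have hFx : ∀ x ∈ Icc a b, ∀ k : ℕ, ‖iteratedDeriv k f x‖ ≤ C * (δ * k * L k) ^ k :=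
    fun x hx k => hfC k x hx
  have hL0 : 0 < L 0 := hL.pos le_rfl
  have hpos : ∀ k : ℕ, 0 < L k := fun k => hL.pos (Nat.cast_nonneg k)
  set M₁ := 2 * C * L 0 / lam + B * C + C * L 0 / lam * B
  set M₂ := C * (Real.exp 1 * δ) * L 0 * Λ
  have hM₁ : 0 ≤ M₁ := by positivity
  have hM₂ : 0 ≤ M₂ := by positivity
  have hbd : ∀ ι : ℂ, ‖ι‖ = 1 → ∀ x ∈ Icc a b, ∀ y, 0 < y → ∀ k n : ℕ,
      n = 0 ∨ deriv φ x = 0 →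
      ‖dbarTerm (fun k => L k / lam) (fun k => iteratedDeriv k f) φ ι k x y‖ ≤
        M₁ * (1 / 2) ^ k * (δ' * (y * L n)) ^ n := fun ι hι x hx y hy k n hn =>
    hL.norm_dbarTerm_le hΛ hsucc hlam hδlam hδ hC hB hq.le
      (fun t => (hcut t).trans (le_max_left _ _)) (hφ0 x) (hφ1 x)
      ((hB₂ x hx).trans (le_max_right _ _)) (hFx x hx) hι hy k n hn
  have hM : ∀ k : ℕ, M₁ * (1 / 2 : ℝ) ^ k ≤ (M₁ + 2 * M₂) * (1 / 2) ^ k := fun k => by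
    gcongr; linarith
  refine ⟨fun k => L k / lam, φ, M₁ + 2 * M₂, ?_⟩
  refine
    { mono := fun m n hmn => by
        have := hL.mono m n (Nat.cast_nonneg m) (by exact_mod_cast hmn)
        simp only
        gcongr
      tendsto := (hL.tendsto.comp tendsto_natCast_atTop_atTop).atTop_div_const hlam
      pos := div_pos (by simpa using hL0) hlam
      hasDerivAt := fun k x hx => hasDerivAt_iteratedDeriv_of_contDiffOn hI hf.1 k (hI' hx)
      contDiff := hφ
      abs_le := fun x => by rw [abs_of_nonneg (hφ0 x)]; exact hφ1 x
      eq_one := fun x hx => (hφI x hx).1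
      left := hφa
      right := hφb
      lt_left := ha
      lt_right := hb
      M_nonneg := by positivity
      w_nonneg := fun n => mul_nonneg hδ'.le (hpos n).le
      bound := fun ι hι x hx y hy k => ?_
      bound_pow := fun ι hι x hx y hy k n => ?_
      tail := fun x hx y hy k hk => ?_ }
  · have := hbd ι hι x hx y hy k 0 (Or.inl rfl)
    rw [pow_zero, mul_one] at this
    exact this.trans (hM k)
  · have h1 := hbd ι hι x ⟨ha.le.trans hx.1, hx.2.trans hb.le⟩ y hy k n (Or.inr (hφI x hx).2)
    have h2 : 0 ≤ (δ' * (y * L n)) ^ n := by have := hpos n; positivity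
    calc _ ≤ (M₁ + 2 * M₂) * (1 / 2) ^ k * (δ' * (y * L n)) ^ n :=
          h1.trans (mul_le_mul_of_nonneg_right (hM k) h2)
      _ = _ := by ring
  · have hk0 := hpos k
    by_cases hc : cutoff (y * (L k / lam)) = 0
    · rw [hc, mul_zero]; positivity
    have hu : y * L k ≤ lam := by
      by_contra! hcon
      refine hc (cutoff_of_ge ?_)
      rw [mul_div_assoc', one_le_div hlam]; exact hcon.le
    have h1 := mul_pow_div_factorial_le hy.le hC.le hδ.le hk0.le (hFx x hx k)
    obtain ⟨j, rfl⟩ := Nat.exists_eq_add_of_le' hk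
    have h2 : Real.exp 1 * δ * lam * Λ ≤ 1 / 4 := by
      rw [← hq]
      have hκ : 1 ≤ Real.exp κ := Real.one_le_exp hL.exponent_pos.le
      calc Real.exp 1 * δ * lam * Λ = 1 * (Real.exp 1 * δ * (1 * lam)) * Λ := by ring
        _ ≤ _ := by gcongr
    calc _ ≤ C * (Real.exp 1 * δ * (y * L (j + 1 : ℕ))) ^ (j + 1) * 1 :=
          mul_le_mul h1 (cutoff_le_one _) (cutoff_nonneg _) (by positivity)
      _ = C * (Real.exp 1 * δ) * y * (L (j + 1 : ℕ) *
          (Real.exp 1 * δ * (y * L (j + 1 : ℕ))) ^ j) := by ring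
      _ ≤ C * (Real.exp 1 * δ) * y * (L 0 * Λ ^ (j + 1) * (Real.exp 1 * δ * lam) ^ j) := by
          gcongr
          exact le_mul_pow_of_succ_le hΛ hsucc _
      _ = M₂ * (Real.exp 1 * δ * lam * Λ) ^ j * y := by
          simp only [M₂]; rw [mul_pow _ Λ]; ring
      _ ≤ M₂ * (1 / 4) ^ j * y := by gcongr
      _ ≤ (M₁ + 2 * M₂) * (1 / 2) ^ (j + 1) * y := by
          have h42 : ((1 : ℝ) / 4) ^ j ≤ (1 / 2) ^ j := by gcongr; norm_num
          have h5 : M₂ * (1 / 4) ^ j ≤ (M₁ + 2 * M₂) * (1 / 2) ^ (j + 1) := by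
            rw [pow_succ]
            have := mul_nonneg hM₁ (show (0 : ℝ) ≤ (1 / 2) ^ j by positivity)
            nlinarith
          gcongr

/-! ### The singular transform as an integral over the complex plane -/

theorem differentiable_tsum_mul_pow {a : ℕ → ℂ}
    (h : ∀ r : ℝ, 0 ≤ r → Summable fun n => ‖a n‖ * r ^ n) :
    Differentiable ℂ fun z => ∑' n, a n * z ^ n := by
  intro z
  have h1 : DifferentiableOn ℂ (fun z => ∑' n, a n * z ^ n) (Metric.ball 0 (‖z‖ + 1)) :=
    Complex.differentiableOn_tsum_of_summable_norm (h (‖z‖ + 1) (by positivity))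
      (fun n => by fun_prop) Metric.isOpen_ball fun n w hw => by
        rw [norm_mul, norm_pow]
        have : ‖w‖ ≤ ‖z‖ + 1 := by simpa using (mem_ball_zero_iff.1 hw).le
        gcongr
  exact h1.differentiableAt (Metric.isOpen_ball.mem_nhds (by simp))

theorem weightEC_eq_tsum_mul (L : ℝ → ℝ) :
    weightEC L = fun w => ∑' n : ℕ, ((gam L ((n : ℝ) + 1) : ℂ))⁻¹ * w ^ n := by
  ext w
  exact tsum_congr fun n => by rw [div_eq_mul_inv, mul_comm]

theorem RegularWeight.differentiable_weightEC {L : ℝ → ℝ} {κ : ℝ} (hL : RegularWeight L κ) :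
    Differentiable ℂ (weightEC L) := by
  rw [weightEC_eq_tsum_mul]
  refine differentiable_tsum_mul_pow fun r hr => ?_
  refine (summable_pow_div_gam hL.tendsto r).congr fun n => ?_
  rw [norm_inv, Complex.norm_real, Real.norm_of_nonneg (hL.gam_pos (by positivity)).le,
    div_eq_mul_inv, mul_comm]

theorem RegularWeight.differentiable_singularTransform {L : ℝ → ℝ} {κ : ℝ}
    (hL : RegularWeight L κ) {I : Set ℝ} (hI0 : (0 : ℝ) ∈ I) {f : ℝ → ℂ}
    (hf : f ∈ beurlingClass L I) : Differentiable ℂ (singularTransform L f) := by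
  refine differentiable_tsum_mul_pow fun r hr => ?_
  refine (summable_singularTerm hL hI0 hf r).norm.congr fun n => ?_
  rw [singularTerm, norm_mul, norm_pow, Complex.norm_real, Real.norm_of_nonneg hr]

/-- The integrand `D(ζ) ζ⁻¹ E(z/ζ)` with `ζ = x + ιy`. -/
def sideIntegrand (ℓ : ℕ → ℝ) (F : ℕ → ℝ → ℂ) (φ : ℝ → ℝ) (ι : ℂ) (L : ℝ → ℝ) (z : ℂ)
    (p : ℝ × ℝ) : ℂ :=
  dbarSum ℓ F φ ι p.1 p.2 *
    (cauchyKernel ι 0 p.1 p.2 * weightEC L (z * cauchyKernel ι 0 p.1 p.2))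

/-- The contribution of one side of the real line to the singular transform. -/
def sideTransform (ℓ : ℕ → ℝ) (F : ℕ → ℝ → ℂ) (φ : ℝ → ℝ) (a b : ℝ) (ι : ℂ) (L : ℝ → ℝ)
    (z : ℂ) : ℂ :=
  ∫ p in Ioc a b ×ˢ Ioc 0 (1 / ℓ 0), sideIntegrand ℓ F φ ι L z p

theorem norm_cauchyKernel_zero_le_inv_snd {ι : ℂ} (hι : ι = Complex.I ∨ ι = -Complex.I) (x : ℝ)
    {y : ℝ} (hy : 0 < y) :
    ‖cauchyKernel ι 0 x y‖ ≤ y⁻¹ := by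
  rw [cauchyKernel, norm_inv]
  gcongr
  exact (le_abs_self y).trans (abs_le_norm_line hι _ _)

theorem norm_cauchyKernel_zero_le_inv_fst {ι : ℂ} (hι : ι = Complex.I ∨ ι = -Complex.I)
    {x r : ℝ} (y : ℝ) (hr : 0 < r)
    (hx : r ≤ |x|) : ‖cauchyKernel ι 0 x y‖ ≤ r⁻¹ := by
  rw [cauchyKernel, norm_inv, sub_zero]
  gcongr
  exact hx.trans (abs_fst_le_norm_line hι _ _)

theorem cauchyKernel_zero (ι : ℂ) (x y : ℝ) : cauchyKernel ι 0 x y = ((x : ℂ) + ι * y)⁻¹ := by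
  rw [cauchyKernel, sub_zero]

/-- Away from a thin sector around the real axis, `z / ζ` is not close to the positive ray. -/
theorem le_abs_im_mul_cauchyKernel {ι : ℂ} (hι : ι = Complex.I ∨ ι = -Complex.I) {z : ℂ}
    {A Y x y : ℝ} (hY : 0 < Y) (hA : 4 * Y ≤ A) (hz : |z.im| ≤ Y) (hy : 0 < y)
    (h : A * ‖(x : ℂ) + ι * y‖ < ‖z‖ * y) :
    y / (2 * ‖(x : ℂ) + ι * y‖) * ‖z * cauchyKernel ι 0 x y‖ ≤
      |(z * cauchyKernel ι 0 x y).im| := by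
  set ζ := (x : ℂ) + ι * y
  have hζ0 : ζ ≠ 0 := line_ne_zero hι x hy
  have hζ : 0 < ‖ζ‖ := norm_pos_iff.2 hζ0
  have hyζ : y ≤ ‖ζ‖ := (le_abs_self y).trans (abs_le_norm_line hι x y)
  have hxζ : |x| ≤ ‖ζ‖ := abs_fst_le_norm_line hι x y
  have him : (z * cauchyKernel ι 0 x y).im * ‖ζ‖ ^ 2 = z.im * x - z.re * (ι * y).im := by
    rw [cauchyKernel_zero, Complex.mul_im, Complex.inv_re, Complex.inv_im, Complex.normSq_eq_norm_sq]
    have h1 : ζ.re = x := by rcases hι with rfl | rfl <;> simp [ζ]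
    have h2 : ζ.im = (ι * y).im := by simp [ζ]
    rw [← h2]
    change (z.re * (-ζ.im / ‖ζ‖ ^ 2) + z.im * (ζ.re / ‖ζ‖ ^ 2)) * ‖ζ‖ ^ 2 = _
    rw [h1]
    field_simp
    ring
  have hιy : |(ι * y).im| = y := by
    rcases hι with rfl | rfl <;> simp [abs_of_pos hy]
  have hA0 : 0 < A := by linarith
  have hzA : A < ‖z‖ := by
    by_contra! hcon
    have : ‖z‖ * y ≤ A * ‖ζ‖ := by gcongr
    linarith
  have hre : ‖z‖ - Y ≤ |z.re| := by
    have := Complex.norm_le_abs_re_add_abs_im z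
    linarith
  have h3 : |z.re| * y - Y * ‖ζ‖ ≤ |(z * cauchyKernel ι 0 x y).im| * ‖ζ‖ ^ 2 := by
    rw [← abs_of_nonneg (show 0 ≤ ‖ζ‖ ^ 2 by positivity), ← abs_mul, him]
    have h4 := abs_sub_abs_le_abs_sub (z.re * (ι * y).im) (z.im * x)
    rw [abs_sub_comm, abs_mul, abs_mul, hιy] at h4
    have h5 : |z.im| * |x| ≤ Y * ‖ζ‖ := by gcongr
    linarith
  rw [norm_mul, cauchyKernel_zero, norm_inv]
  change y / (2 * ‖ζ‖) * (‖z‖ * ‖ζ‖⁻¹) ≤ _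
  rw [← mul_le_mul_iff_left₀ (show 0 < ‖ζ‖ ^ 2 by positivity)]
  refine le_trans (le_of_eq ?_) ((?_ : y * ‖z‖ / 2 ≤ |z.re| * y - Y * ‖ζ‖).trans (by
    rw [← cauchyKernel_zero]; exact h3))
  · field_simp
  · have h6 : Y * ‖ζ‖ ≤ ‖z‖ * y / 4 := by nlinarith
    have h7 : Y * y ≤ ‖z‖ * y / 4 := by nlinarith
    nlinarith

namespace ExtensionData

theorem norm_mul_weightE_le {ℓ : ℕ → ℝ} {F : ℕ → ℝ → ℂ} {φ : ℝ → ℝ} {a a' b' b M δ κ : ℝ}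
    {L : ℝ → ℝ} (h : ExtensionData ℓ F φ a a' b' b M (fun n => δ * L n)) (hL : RegularWeight L κ)
    {ι : ℂ} (hι : ‖ι‖ = 1) {A x y : ℝ} (hA : 0 ≤ A) (hδ : 0 < δ) (hδA : δ * A ≤ 1 / 2)
    (hx : x ∈ Icc a' b') (hy : 0 < y) :
    ‖dbarSum ℓ F φ ι x y‖ * y⁻¹ * weightE L (A / y) ≤ 4 * M * δ := by
  have hM := h.M_nonneg
  rw [weightE, ← tsum_mul_left]
  have hs := (hasSum_geometric_two.mul_left (2 * M * δ))
  refine (Summable.tsum_le_tsum (fun n => ?_) ((summable_pow_div_gam hL.tendsto _).mul_left _)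
    hs.summable).trans (le_of_eq (hs.tsum_eq.trans (by ring)))
  have hp := hL.pos (show (0 : ℝ) ≤ (n : ℝ) + 1 by positivity)
  have h1 := h.norm_dbarSum_le_pow hι hx hy (n + 1)
  push_cast at h1
  rw [gam_natCast_add_one]
  calc _ ≤ 2 * M * (δ * L (n + 1) * y) ^ (n + 1) * y⁻¹ * ((A / y) ^ n / L (n + 1) ^ (n + 1)) := by
        gcongr
    _ = 2 * M * δ * (δ * A) ^ n := by
        rw [mul_pow, mul_pow, div_pow]
        field_simp
        ring
    _ ≤ 2 * M * δ * (1 / 2) ^ n := by gcongr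

/-- The basic bound: in a horizontal strip the integrand is bounded except where `z / ζ` stays
off a sector around the positive ray. -/
theorem norm_sideIntegrand_le {ℓ : ℕ → ℝ} {F : ℕ → ℝ → ℂ} {φ : ℝ → ℝ} {a a' b' b M δ : ℝ}
    {α : ℕ →₀ ℝ} (hα : IsDenjoyIndex α)
    (h : ExtensionData ℓ F φ a a' b' b M (fun n => δ * denjoyWeight α n))
    {ι : ℂ} (hι : ι = Complex.I ∨ ι = -Complex.I) {A Y x y : ℝ} (hY : 0 < Y) (hA : 4 * Y ≤ A)
    (hδ : 0 < δ) (hδA : δ * A ≤ 1 / 2) {z : ℂ} (hz : |z.im| ≤ Y)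
    (hx : x ∈ Icc a' b') (hy : 0 < y) :
    ‖sideIntegrand ℓ F φ ι (denjoyWeight α) z (x, y)‖ ≤ 4 * M * δ ∨
      A < ‖z‖ ∧ A / (2 * ‖z‖) ≤ y / (2 * ‖(x : ℂ) + ι * y‖) ∧
        ‖sideIntegrand ℓ F φ ι (denjoyWeight α) z (x, y)‖ ≤
          ‖dbarSum ℓ F φ ι x y‖ * y⁻¹ * ((‖(x : ℂ) + ι * y‖ / A) ^ (1 / 2 : ℝ) *
            sectorBound α (y / (2 * ‖(x : ℂ) + ι * y‖))) := by
  obtain ⟨κ, hL⟩ := exists_regularWeight hα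
  have hA0 : 0 < A := by linarith
  have hζ0 := line_ne_zero hι x hy
  have hζ : 0 < ‖(x : ℂ) + ι * y‖ := norm_pos_iff.2 hζ0
  have hyζ : y ≤ ‖(x : ℂ) + ι * y‖ := (le_abs_self y).trans (abs_le_norm_line hι x y)
  rcases le_or_gt (‖z‖ * y) (A * ‖(x : ℂ) + ι * y‖) with hc | hc
  · left
    refine le_trans ?_ (h.norm_mul_weightE_le hL (norm_of_eq_I_or hι) hA0.le hδ hδA hx hy)
    rw [sideIntegrand, norm_mul, norm_mul, ← mul_assoc]
    have h1 := norm_cauchyKernel_zero_le_inv_snd hι x hy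
    have h2 : ‖z * cauchyKernel ι 0 x y‖ ≤ A / y := by
      rw [norm_mul, cauchyKernel_zero, norm_inv, ← div_eq_mul_inv, div_le_div_iff₀ hζ hy]
      exact hc
    gcongr
    exact (norm_weightEC_le_weightE hL _).trans (hL.weightE_mono (norm_nonneg _) h2)
  · right
    have hzA : A < ‖z‖ := by
      by_contra! hcon
      have : ‖z‖ * y ≤ A * ‖(x : ℂ) + ι * y‖ := by gcongr
      linarith
    have hz0 : 0 < ‖z‖ := hA0.trans hzA
    refine ⟨hzA, ?_, ?_⟩
    · rw [div_le_div_iff₀ (by positivity) (by positivity)]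
      nlinarith
    · have hw0 : z * cauchyKernel ι 0 x y ≠ 0 := by
        rw [cauchyKernel_zero]
        exact mul_ne_zero (norm_pos_iff.1 hz0) (inv_ne_zero hζ0)
      have h3 := norm_weightEC_le_of_abs_im hα (by positivity)
        (le_abs_im_mul_cauchyKernel hι hY hA hz hy hc) hw0
      have h1 := norm_cauchyKernel_zero_le_inv_snd hι x hy
      have hsb : 0 ≤ sectorBound α (y / (2 * ‖(x : ℂ) + ι * y‖)) :=
        integral_nonneg fun _ => by positivity
      have h4 : ‖z * cauchyKernel ι 0 x y‖ ^ (-(1 / 2) : ℝ) ≤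
          (‖(x : ℂ) + ι * y‖ / A) ^ (1 / 2 : ℝ) := by
        rw [Real.rpow_neg (norm_nonneg _), ← Real.inv_rpow (norm_nonneg _)]
        refine Real.rpow_le_rpow (by positivity) ?_ (by norm_num)
        rw [norm_mul, cauchyKernel_zero, norm_inv, mul_inv, inv_inv, mul_comm, ← div_eq_mul_inv]
        gcongr
      rw [sideIntegrand, norm_mul, norm_mul, ← mul_assoc]
      refine mul_le_mul (mul_le_mul_of_nonneg_left h1 (norm_nonneg _))
        (h3.trans (mul_le_mul_of_nonneg_right h4 hsb)) (norm_nonneg _) (by positivity)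

theorem norm_sideIntegrand_le_of_notMem {ℓ : ℕ → ℝ} {F : ℕ → ℝ → ℂ} {φ : ℝ → ℝ}
    {a a' b' b M κ : ℝ} {L : ℝ → ℝ} {w : ℕ → ℝ} (h : ExtensionData ℓ F φ a a' b' b M w)
    (hL : RegularWeight L κ) {ι : ℂ} (hι : ι = Complex.I ∨ ι = -Complex.I) (z : ℂ) {r x y : ℝ}
    (hr : 0 < r) (hrx : r ≤ |x|) (hx : x ∈ Icc a b) (hy : 0 < y) :
    ‖sideIntegrand ℓ F φ ι L z (x, y)‖ ≤ 2 * M * r⁻¹ * weightE L (‖z‖ / r) := by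
  have hM := h.M_nonneg
  have h1 := norm_cauchyKernel_zero_le_inv_fst hι y hr hrx
  rw [sideIntegrand, norm_mul, norm_mul, ← mul_assoc]
  have h2 : ‖z * cauchyKernel ι 0 x y‖ ≤ ‖z‖ / r := by
    rw [norm_mul, div_eq_mul_inv]; gcongr
  have h3 := (norm_weightEC_le_weightE hL (z * cauchyKernel ι 0 x y)).trans
    (hL.weightE_mono (norm_nonneg _) h2)
  have h4 := h.norm_dbarSum_le (norm_of_eq_I_or hι) hx hy
  gcongr

end ExtensionData

namespace ExtensionData

theorem norm_line_le {ι : ℂ} (hι : ι = Complex.I ∨ ι = -Complex.I) {a b T x y : ℝ}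
    (hx : x ∈ Icc a b) (hy : 0 < y) (hyT : y ≤ T) : ‖(x : ℂ) + ι * y‖ ≤ |a| + |b| + T := by
  refine (norm_add_le _ _).trans ?_
  rw [norm_mul, norm_of_eq_I_or hι, one_mul, Complex.norm_real, Complex.norm_real,
    Real.norm_of_nonneg hy.le, Real.norm_eq_abs]
  have : |x| ≤ |a| + |b| := (abs_le_max_abs_abs hx.1 hx.2).trans
    (max_le_add_of_nonneg (abs_nonneg _) (abs_nonneg _))
  linarith

theorem norm_dbarSum_mul_inv_le {ℓ : ℕ → ℝ} {F : ℕ → ℝ → ℂ} {φ : ℝ → ℝ} {a a' b' b M : ℝ}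
    {w : ℕ → ℝ} (h : ExtensionData ℓ F φ a a' b' b M w) {ι : ℂ} (hι : ‖ι‖ = 1) {x y : ℝ}
    (hx : x ∈ Icc a' b') (hy : 0 < y) : ‖dbarSum ℓ F φ ι x y‖ * y⁻¹ ≤ 2 * M * w 1 := by
  have := h.norm_dbarSum_le_pow hι hx hy 1
  rw [pow_one] at this
  rw [← div_eq_mul_inv, div_le_iff₀ hy]
  linarith

theorem exists_bound_sideIntegrand {ℓ : ℕ → ℝ} {F : ℕ → ℝ → ℂ} {φ : ℝ → ℝ}
    {a a' b' b M δ : ℝ} {α : ℕ →₀ ℝ} (hα : IsDenjoyIndex α)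
    (h : ExtensionData ℓ F φ a a' b' b M (fun n => δ * denjoyWeight α n))
    {ι : ℂ} (hι : ι = Complex.I ∨ ι = -Complex.I) (ha' : a' < 0) (hb' : 0 < b') {Y : ℝ}
    (hY : 0 < Y) (hδ : 0 < δ) (hδA : δ * (4 * Y) ≤ 1 / 2) (R : ℝ) :
    ∃ C, ∀ z : ℂ, |z.im| ≤ Y → ‖z‖ ≤ R → ∀ p ∈ Ioc a b ×ˢ Ioc 0 (1 / ℓ 0),
      ‖sideIntegrand ℓ F φ ι (denjoyWeight α) z p‖ ≤ C := by
  obtain ⟨κ, hL⟩ := exists_regularWeight hα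
  have hM := h.M_nonneg
  have hsbn : ∀ θ, 0 ≤ sectorBound α θ := fun θ => integral_nonneg fun _ => by positivity
  set r := min (-a') b'
  have hr : 0 < r := lt_min (by linarith) hb'
  set A := 4 * Y
  have hA : 0 < A := by positivity
  set ρ := |a| + |b| + 1 / ℓ 0
  have hw1 := h.w_nonneg 1
  refine ⟨max (4 * M * δ + 2 * M * (δ * denjoyWeight α (1 : ℕ)) * ((ρ / A) ^ (1 / 2 : ℝ) *
    sectorBound α (A / (2 * max R A)))) (2 * M * r⁻¹ * weightE (denjoyWeight α) (R / r)), ?_⟩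
  rintro z hz hzR ⟨x, y⟩ ⟨hx, hy⟩
  have hx : x ∈ Ioc a b := hx
  have hy : y ∈ Ioc 0 (1 / ℓ 0) := hy
  have hxI := Ioc_subset_Icc_self hx
  have hρ : ‖(x : ℂ) + ι * y‖ ≤ ρ := norm_line_le hι hxI hy.1 hy.2
  by_cases hx' : x ∈ Icc a' b'
  · refine le_trans ?_ (le_max_left _ _)
    rcases h.norm_sideIntegrand_le hα hι hY le_rfl hδ hδA hz hx' hy.1 with h1 | ⟨hzA, hθ, h1⟩
    · refine h1.trans (le_add_of_nonneg_right (mul_nonneg (by positivity)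
        (mul_nonneg (Real.rpow_nonneg (div_nonneg ((norm_nonneg _).trans hρ) hA.le) _) (hsbn _))))
    · refine h1.trans (le_trans ?_ (le_add_of_nonneg_left (by positivity)))
      have h2 := h.norm_dbarSum_mul_inv_le (norm_of_eq_I_or hι) hx' hy.1
      have h3 : A / (2 * max R A) ≤ y / (2 * ‖(x : ℂ) + ι * y‖) := by
        refine le_trans ?_ hθ
        have : 0 < ‖z‖ := hA.trans hzA
        have := hzR.trans (le_max_left R A)
        gcongr
      have h4 := sectorBound_anti hα (div_pos hA (mul_pos two_pos (lt_max_of_lt_right hA))) h3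
      have h5 : (‖(x : ℂ) + ι * y‖ / A) ^ (1 / 2 : ℝ) ≤ (ρ / A) ^ (1 / 2 : ℝ) := by gcongr
      have h6 := hsbn (y / (2 * ‖(x : ℂ) + ι * y‖))
      have h7 : 0 ≤ (ρ / A) ^ (1 / 2 : ℝ) :=
        Real.rpow_nonneg (div_nonneg ((norm_nonneg _).trans hρ) hA.le) _
      refine mul_le_mul h2 (mul_le_mul h5 h4 h6 h7) (mul_nonneg (by positivity) h6) (by positivity)
  · refine le_trans ?_ (le_max_right _ _)
    have hrx : r ≤ |x| := by
      rw [mem_Icc, not_and_or, not_le, not_le] at hx'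
      rcases hx' with h4 | h4
      · rw [abs_of_neg (by linarith)]; exact (min_le_left _ _).trans (by linarith)
      · rw [abs_of_pos (by linarith)]; exact (min_le_right _ _).trans (by linarith)
    refine (h.norm_sideIntegrand_le_of_notMem hL hι z hr hrx hxI hy.1).trans ?_
    have := hL.weightE_mono (show 0 ≤ ‖z‖ / r by positivity) (show ‖z‖ / r ≤ R / r by gcongr)
    gcongr

theorem aestronglyMeasurable_sideIntegrand {ℓ : ℕ → ℝ} {F : ℕ → ℝ → ℂ} {φ : ℝ → ℝ}
    {a a' b' b M κ : ℝ} {L : ℝ → ℝ} {w : ℕ → ℝ} (h : ExtensionData ℓ F φ a a' b' b M w)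
    (hL : RegularWeight L κ) {ι : ℂ} (hι : ι = Complex.I ∨ ι = -Complex.I) (z : ℂ) (T : ℝ) :
    AEStronglyMeasurable (sideIntegrand ℓ F φ ι L z) (volume.restrict (Ioc a b ×ˢ Ioc 0 T)) := by
  have hk := continuousOn_cauchyKernel hι 0
  exact h.aestronglyMeasurable_mul (G := fun p => cauchyKernel ι 0 p.1 p.2 *
    weightEC L (z * cauchyKernel ι 0 p.1 p.2))
    (hk.mul (hL.differentiable_weightEC.continuous.comp_continuousOn (continuousOn_const.mul hk))) T

theorem differentiableOn_sideTransform {ℓ : ℕ → ℝ} {F : ℕ → ℝ → ℂ} {φ : ℝ → ℝ}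
    {a a' b' b M δ : ℝ} {α : ℕ →₀ ℝ} (hα : IsDenjoyIndex α)
    (h : ExtensionData ℓ F φ a a' b' b M (fun n => δ * denjoyWeight α n))
    {ι : ℂ} (hι : ι = Complex.I ∨ ι = -Complex.I) (ha' : a' < 0) (hb' : 0 < b') {Y : ℝ}
    (hY : 0 < Y) (hδ : 0 < δ) (hδA : δ * (4 * Y) ≤ 1 / 2) :
    DifferentiableOn ℂ (sideTransform ℓ F φ a b ι (denjoyWeight α)) {z | |z.im| < Y} := by
  obtain ⟨κ, hL⟩ := exists_regularWeight hα
  intro z₀ hz₀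
  have hz₀ : |z₀.im| < Y := hz₀
  set r := (Y - |z₀.im|) / 2
  have hr : 0 < r := by simp only [r]; linarith
  obtain ⟨C, hC⟩ := h.exists_bound_sideIntegrand hα hι ha' hb' hY hδ hδA (‖z₀‖ + 2 * r)
  have hE := hL.differentiable_weightEC
  have hE' : Continuous (deriv (weightEC (denjoyWeight α))) :=
    (hE.contDiff (n := 1)).continuous_deriv le_rfl
  have hd : ∀ p z, HasDerivAt (fun z => sideIntegrand ℓ F φ ι (denjoyWeight α) z p)
      (dbarSum ℓ F φ ι p.1 p.2 * (cauchyKernel ι 0 p.1 p.2 *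
        (deriv (weightEC (denjoyWeight α)) (z * cauchyKernel ι 0 p.1 p.2) *
          cauchyKernel ι 0 p.1 p.2))) z := by
    intro p z
    have h1 := (hE (z * cauchyKernel ι 0 p.1 p.2)).hasDerivAt.comp z
      ((hasDerivAt_id z).mul_const (cauchyKernel ι 0 p.1 p.2))
    rw [one_mul] at h1
    exact (h1.const_mul _).const_mul _
  have hm := ae_restrict_mem (μ := (volume : Measure (ℝ × ℝ)))
    ((measurableSet_Ioc (a := a) (b := b)).prod (measurableSet_Ioc (a := 0) (b := 1 / ℓ 0)))
  have hball : ∀ z ∈ Metric.closedBall z₀ (2 * r), |z.im| ≤ Y ∧ ‖z‖ ≤ ‖z₀‖ + 2 * r := by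
    intro z hz
    rw [mem_closedBall_iff_norm] at hz
    constructor
    · have h1 := Complex.abs_im_le_norm (z - z₀)
      rw [Complex.sub_im] at h1
      have h2 := abs_sub_abs_le_abs_sub z.im z₀.im
      simp only [r] at hz
      linarith
    · have := norm_sub_norm_le z z₀
      linarith
  refine (hasDerivAt_integral_of_dominated_loc_of_deriv_le (Metric.ball_mem_nhds z₀ hr)
    (μ := volume.restrict (Ioc a b ×ˢ Ioc 0 (1 / ℓ 0)))
    (F := fun z p => sideIntegrand ℓ F φ ι (denjoyWeight α) z p)
    (F' := fun z p => dbarSum ℓ F φ ι p.1 p.2 * (cauchyKernel ι 0 p.1 p.2 *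
        (deriv (weightEC (denjoyWeight α)) (z * cauchyKernel ι 0 p.1 p.2) *
          cauchyKernel ι 0 p.1 p.2)))
    (bound := fun _ => C / r)
    (Filter.Eventually.of_forall fun z => h.aestronglyMeasurable_sideIntegrand hL hι z _)
    ?_ ?_ ?_ (integrable_const_prod a b _ _)
    (ae_of_all _ fun p z _ => hd p z)).2.differentiableAt.differentiableWithinAt
  · refine Integrable.mono' (integrable_const_prod a b _ C)
      (h.aestronglyMeasurable_sideIntegrand hL hι z₀ _) ?_
    filter_upwards [hm] with p hp
    exact hC z₀ hz₀.le (by linarith) p hp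
  · have hk := continuousOn_cauchyKernel hι 0
    exact h.aestronglyMeasurable_mul (G := fun p => cauchyKernel ι 0 p.1 p.2 *
      (deriv (weightEC (denjoyWeight α)) (z₀ * cauchyKernel ι 0 p.1 p.2) *
          cauchyKernel ι 0 p.1 p.2))
      (hk.mul ((hE'.comp_continuousOn (continuousOn_const.mul hk)).mul hk)) _
  · -- Cauchy's estimate turns the bound of the integrand into one of its derivative
    filter_upwards [hm] with p hp z hz
    rw [← (hd p z).deriv]
    refine Complex.norm_deriv_le_of_forall_mem_sphere_norm_le hr
      (Differentiable.diffContOnCl fun z => (hd p z).differentiableAt) fun w hw => ?_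
    have hw2 : w ∈ Metric.closedBall z₀ (2 * r) := by
      rw [Metric.mem_closedBall]
      rw [mem_sphere_iff_norm, ← dist_eq_norm] at hw
      have := dist_triangle w z z₀
      rw [Metric.mem_ball] at hz
      linarith
    exact hC w (hball w hw2).1 (hball w hw2).2 p hp

/-- Near the origin the transform of a density is the power series of its moments. -/
theorem hasSum_sideTransform {ℓ : ℕ → ℝ} {F : ℕ → ℝ → ℂ} {φ : ℝ → ℝ}
    {a a' b' b M δ κ : ℝ} {L : ℝ → ℝ}
    (h : ExtensionData ℓ F φ a a' b' b M (fun n => δ * L n)) (hL : RegularWeight L κ)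
    {ι : ℂ} (hι : ι = Complex.I ∨ ι = -Complex.I) (ha' : a' < 0) (hb' : 0 < b')
    (hδ : 0 < δ) {z : ℂ} (hz : δ * ‖z‖ ≤ 1 / 2) :
    HasSum (fun n : ℕ => (∫ p in Ioc a b ×ˢ Ioc 0 (1 / ℓ 0), dbarSum ℓ F φ ι p.1 p.2 *
        cauchyKernel ι 0 p.1 p.2 ^ (n + 1)) * (z ^ n / (gam L ((n : ℝ) + 1) : ℂ)))
      (sideTransform ℓ F φ a b ι L z) := by
  have hM := h.M_nonneg
  set r := min (-a') b'
  have hr : 0 < r := lt_min (by linarith) hb'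
  set R := Ioc a b ×ˢ Ioc 0 (1 / ℓ 0)
  have hm := ae_restrict_mem (μ := (volume : Measure (ℝ × ℝ)))
    ((measurableSet_Ioc (a := a) (b := b)).prod (measurableSet_Ioc (a := 0) (b := 1 / ℓ 0)))
  have hgam : ∀ n : ℕ, 0 < gam L ((n : ℝ) + 1) := fun n => hL.gam_pos (by positivity)
  set G : ℕ → ℝ × ℝ → ℂ := fun n p => dbarSum ℓ F φ ι p.1 p.2 *
        cauchyKernel ι 0 p.1 p.2 ^ (n + 1) * (z ^ n / (gam L ((n : ℝ) + 1) : ℂ))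
  have hGi : ∀ n, IntegrableOn (G n) R := fun n =>
    (h.integrableOn_mul_pow hι ⟨ha', hb'⟩ (n + 1) _).mul_const _
  set c : ℕ → ℝ := fun n => 2 * M * δ * (1 / 2) ^ n +
    2 * M * r⁻¹ * ((‖z‖ / r) ^ n / gam L ((n : ℝ) + 1))
  have hGn : ∀ n, ∀ p ∈ R, ‖G n p‖ ≤ c n := by
    rintro n ⟨x, y⟩ ⟨hx, hy⟩
    have hx : x ∈ Ioc a b := hx
    have hy : y ∈ Ioc 0 (1 / ℓ 0) := hy
    have hp := hL.pos (show (0 : ℝ) ≤ (n : ℝ) + 1 by positivity)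
    have hg := hgam n
    simp only [G, c]
    rw [norm_mul, norm_mul, norm_pow, norm_div, norm_pow, Complex.norm_real,
      Real.norm_of_nonneg hg.le]
    by_cases hx' : x ∈ Icc a' b'
    · refine le_trans ?_ (le_add_of_nonneg_right (by positivity))
      have h1 := h.norm_dbarSum_le_pow (norm_of_eq_I_or hι) hx' hy.1 (n + 1)
      push_cast at h1
      have hy0 := hy.1
      calc _ ≤ 2 * M * (δ * L (n + 1) * y) ^ (n + 1) * (y⁻¹) ^ (n + 1) *
            (‖z‖ ^ n / gam L ((n : ℝ) + 1)) := by
            gcongr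
            exact norm_cauchyKernel_zero_le_inv_snd hι x hy.1
        _ = 2 * M * δ * (δ * ‖z‖) ^ n := by
            rw [gam_natCast_add_one, mul_pow, mul_pow, inv_pow]
            field_simp
            ring
        _ ≤ _ := by gcongr
    · refine le_trans ?_ (le_add_of_nonneg_left (by positivity))
      have hrx : r ≤ |x| := by
        rw [mem_Icc, not_and_or, not_le, not_le] at hx'
        rcases hx' with h4 | h4
        · rw [abs_of_neg (by linarith)]; exact (min_le_left _ _).trans (by linarith)
        · rw [abs_of_pos (by linarith)]; exact (min_le_right _ _).trans (by linarith)
      have h1 := h.norm_dbarSum_le (norm_of_eq_I_or hι) (Ioc_subset_Icc_self hx) hy.1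
      calc _ ≤ 2 * M * (r⁻¹) ^ (n + 1) * (‖z‖ ^ n / gam L ((n : ℝ) + 1)) := by
            gcongr
            exact norm_cauchyKernel_zero_le_inv_fst hι y hr hrx
        _ = _ := by rw [pow_succ, div_pow, inv_pow]; field_simp
  have hcs : Summable c := (summable_geometric_two.mul_left _).add
    ((summable_pow_div_gam hL.tendsto _).mul_left _)
  have hsum : Summable fun n => ∫ p in R, ‖G n p‖ := by
    refine Summable.of_nonneg_of_le (fun n => integral_nonneg fun _ => norm_nonneg _)
      (fun n => ?_) (hcs.mul_left ((volume.restrict R).real univ))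
    have := integral_mono_ae (hGi n).norm (integrable_const_prod a b _ (c n)) (by
      filter_upwards [hm] with p hp using hGn n p hp)
    rwa [integral_const, smul_eq_mul] at this
  have := hasSum_integral_of_summable_integral_norm hGi hsum
  have hlim : sideTransform ℓ F φ a b ι L z = ∫ p in R, ∑' n, G n p := by
    refine integral_congr_ae (ae_of_all _ fun p => ?_)
    simp only [sideIntegrand, G, weightEC]
    rw [← tsum_mul_left, ← tsum_mul_left]
    refine tsum_congr fun n => ?_
    rw [mul_pow, pow_succ]
    ring
  rw [hlim]
  refine this.congr_fun fun n => ?_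
  simp only [G]
  rw [integral_mul_const]

/-- The singular transform is the sum of the transforms of the two densities. -/
theorem singularTransform_eq {ℓ : ℕ → ℝ} {f : ℝ → ℂ} {φ : ℝ → ℝ}
    {a a' b' b M δ : ℝ} {α : ℕ →₀ ℝ} (hα : IsDenjoyIndex α)
    (h : ExtensionData ℓ (fun k => iteratedDeriv k f) φ a a' b' b M
      (fun n => δ * denjoyWeight α n)) {I : Set ℝ} (hI0 : (0 : ℝ) ∈ I)
    (hf : f ∈ beurlingClass (denjoyWeight α) I) (ha' : a' < 0) (hb' : 0 < b') {Y : ℝ}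
    (hY : 0 < Y) (hδ : 0 < δ) (hδA : δ * (4 * Y) ≤ 1 / 2) {z : ℂ} (hz : |z.im| < Y) :
    singularTransform (denjoyWeight α) f z = (2 * Real.pi * Complex.I)⁻¹ *
      (sideTransform ℓ (fun k => iteratedDeriv k f) φ a b Complex.I (denjoyWeight α) z -
        sideTransform ℓ (fun k => iteratedDeriv k f) φ a b (-Complex.I) (denjoyWeight α) z) := by
  obtain ⟨κ, hL⟩ := exists_regularWeight hα
  set U : Set ℂ := {z | |z.im| < Y}
  have hU : IsOpen U := isOpen_lt (by fun_prop) continuous_const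
  have hUc : Convex ℝ U := by
    have : U = Complex.imLm ⁻¹' Metric.ball 0 Y := by
      ext z; simp [U, Complex.imLm]
    rw [this]
    exact (convex_ball 0 Y).linear_preimage _
  have h1 : AnalyticOnNhd ℂ (singularTransform (denjoyWeight α) f) U :=
    (hL.differentiable_singularTransform hI0 hf).differentiableOn.analyticOnNhd hU
  have h2 : AnalyticOnNhd ℂ (fun z => (2 * Real.pi * Complex.I)⁻¹ *
      (sideTransform ℓ (fun k => iteratedDeriv k f) φ a b Complex.I (denjoyWeight α) z -
        sideTransform ℓ (fun k => iteratedDeriv k f) φ a b (-Complex.I) (denjoyWeight α) z)) U :=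
    DifferentiableOn.analyticOnNhd (((h.differentiableOn_sideTransform hα (Or.inl rfl) ha' hb' hY
      hδ hδA).sub (h.differentiableOn_sideTransform hα (Or.inr rfl) ha' hb' hY hδ hδA)).const_mul
        _) hU
  have h0U : (0 : ℂ) ∈ U := by simpa [U] using hY
  refine h1.eqOn_of_preconnected_of_eventuallyEq h2 hUc.isPreconnected h0U ?_ hz
  filter_upwards [Metric.ball_mem_nhds (0 : ℂ) (show 0 < 1 / (2 * δ) by positivity)] with w hw
  have hw' : δ * ‖w‖ ≤ 1 / 2 := by
    rw [mem_ball_zero_iff, lt_div_iff₀ (by positivity)] at hw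
    linarith
  have h3 := ((h.hasSum_sideTransform hL (Or.inl rfl) ha' hb' hδ hw').sub
    (h.hasSum_sideTransform hL (Or.inr rfl) ha' hb' hδ hw')).mul_left (2 * Real.pi * Complex.I)⁻¹
  rw [← h3.tsum_eq]
  refine tsum_congr fun n => ?_
  rw [singularTerm, h.integral_pow_sub_integral_pow_eq n 0 ⟨ha', hb'⟩]
  ring

end ExtensionData

/-! ### Growth of the singular transform -/

theorem sectorBound_nonneg (α : ℕ →₀ ℝ) (θ : ℝ) : 0 ≤ sectorBound α θ :=
  integral_nonneg fun _ => by positivity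

namespace ExtensionData

/-- The contributions of the parts of the densities away from the origin. -/
theorem exists_norm_singularTransform_le {ℓ : ℕ → ℝ} {f : ℝ → ℂ} {φ : ℝ → ℝ}
    {a a' b' b M δ : ℝ} {α : ℕ →₀ ℝ} (hα : IsDenjoyIndex α)
    (h : ExtensionData ℓ (fun k => iteratedDeriv k f) φ a a' b' b M
      (fun n => δ * denjoyWeight α n)) {I : Set ℝ} (hI0 : (0 : ℝ) ∈ I)
    (hf : f ∈ beurlingClass (denjoyWeight α) I) (ha' : a' < 0) (hb' : 0 < b') {Y : ℝ}
    (hY : 0 < Y) (hδ : 0 < δ) (hδA : δ * (4 * Y) ≤ 1 / 2) :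
    ∃ C U, 0 < C ∧ ∀ z : ℂ, |z.im| < Y → U ≤ z.re → ∀ m, 0 ≤ m →
      (∀ ι, (ι = Complex.I ∨ ι = -Complex.I) → ∀ x ∈ Icc a' b', ∀ y ∈ Ioc 0 (1 / ℓ 0),
        ‖sideIntegrand ℓ (fun k => iteratedDeriv k f) φ ι (denjoyWeight α) z (x, y)‖ ≤ m) →
      ‖singularTransform (denjoyWeight α) f z‖ ≤
        C * (m + 1 + weightE (denjoyWeight α) ((z.re + Y) / b')) := by
  obtain ⟨κ, hL⟩ := exists_regularWeight hα
  have hM := h.M_nonneg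
  have hpos := h.pos
  set T := 1 / ℓ 0
  have hT : 0 < T := by positivity
  set ρ := |a| + |b| + T
  have hρ : 0 < ρ := by positivity
  have hsb := sectorBound_nonneg α 1
  set C₁ := 2 * M * (-a')⁻¹ * (ρ ^ (1 / 2 : ℝ) * sectorBound α 1)
  have hna' : 0 < -a' := by linarith
  have hC₁ : 0 ≤ C₁ := by positivity
  set C₂ := 2 * M * b'⁻¹
  have hC₂ : 0 ≤ C₂ := by positivity
  set V := (volume.restrict (Ioc a b ×ˢ Ioc 0 T)).real univ
  have hV : 0 ≤ V := measureReal_nonneg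
  have hpi := Real.pi_pos
  refine ⟨V * (1 + C₁ + C₂) + 1, max 1 (Y * T / (-a')), by positivity,
    fun z hz hzU m hm hmid => ?_⟩
  have hz1 : 1 ≤ z.re := (le_max_left _ _).trans hzU
  have hzT : Y * T ≤ z.re * (-a') := by
    have := (le_max_right _ _).trans hzU
    rwa [div_le_iff₀ hna'] at this
  have hzn : 1 ≤ ‖z‖ := hz1.trans (Complex.re_le_norm z)
  have hzn' : ‖z‖ ≤ z.re + Y := by
    have := Complex.norm_le_abs_re_add_abs_im z
    rw [abs_of_nonneg (by linarith : 0 ≤ z.re)] at this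
    linarith
  have hz0 : z ≠ 0 := norm_pos_iff.1 (by linarith)
  set E := weightE (denjoyWeight α) ((z.re + Y) / b')
  have hE : 0 < E := hL.weightE_pos (by positivity)
  set m' := m + C₁ + C₂ * E
  have hall : ∀ ι, (ι = Complex.I ∨ ι = -Complex.I) → ∀ p ∈ Ioc a b ×ˢ Ioc 0 T,
      ‖sideIntegrand ℓ (fun k => iteratedDeriv k f) φ ι (denjoyWeight α) z p‖ ≤ m' := by
    rintro ι hι ⟨x, y⟩ ⟨hx, hy⟩
    have hx : x ∈ Ioc a b := hx
    have hy : y ∈ Ioc 0 T := hy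
    have hxI := Ioc_subset_Icc_self hx
    have hCE : 0 ≤ C₂ * E := by positivity
    rcases lt_or_ge x a' with h1 | h1
    · have hk0 : cauchyKernel ι 0 x y ≠ 0 := by
        rw [cauchyKernel_zero]; exact inv_ne_zero (line_ne_zero hι x hy.1)
      have hζ : 0 < ‖(x : ℂ) + ι * y‖ := norm_pos_iff.2 (line_ne_zero hι x hy.1)
      have hre : (z * cauchyKernel ι 0 x y).re ≤ 0 := by
        rw [cauchyKernel_zero, Complex.mul_re, Complex.inv_re, Complex.inv_im, mul_div_assoc',
          mul_div_assoc', ← sub_div]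
        refine div_nonpos_of_nonpos_of_nonneg ?_ (Complex.normSq_nonneg _)
        have h2 : ((x : ℂ) + ι * y).re = x := by rcases hι with rfl | rfl <;> simp
        have h3 : |((x : ℂ) + ι * y).im| = y := by
          rcases hι with rfl | rfl <;> simp [abs_of_pos hy.1]
        have h4 : |z.im * ((x : ℂ) + ι * y).im| ≤ Y * T := by
          rw [abs_mul, h3]
          have := hy.2
          have := hy.1
          gcongr
        rw [h2]
        have h5 := (_root_.abs_le.1 h4).1
        have h6 := (_root_.abs_le.1 h4).2
        nlinarith
      have h2 := norm_weightEC_le_of_re_nonpos hα hre (mul_ne_zero hz0 hk0)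
      have h3 := norm_cauchyKernel_zero_le_inv_fst hι (x := x) y hna'
        (by rw [abs_of_neg (by linarith)]; linarith)
      have h4 := h.norm_dbarSum_le (norm_of_eq_I_or hι) hxI hy.1
      have h5 : ‖z * cauchyKernel ι 0 x y‖ ^ (-(1 / 2) : ℝ) ≤ ρ ^ (1 / 2 : ℝ) := by
        rw [Real.rpow_neg (norm_nonneg _), ← Real.inv_rpow (norm_nonneg _)]
        refine Real.rpow_le_rpow (by positivity) ?_ (by norm_num)
        rw [norm_mul, cauchyKernel_zero, norm_inv, mul_inv, inv_inv]
        calc _ ≤ 1 * ‖(x : ℂ) + ι * y‖ := by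
              gcongr
              exact inv_le_one_of_one_le₀ hzn
          _ ≤ ρ := by rw [one_mul]; exact norm_line_le hι hxI hy.1 hy.2
      have h6 : ‖sideIntegrand ℓ (fun k => iteratedDeriv k f) φ ι (denjoyWeight α) z (x, y)‖ ≤
          C₁ := by
        rw [sideIntegrand, norm_mul, norm_mul, ← mul_assoc]
        refine mul_le_mul (mul_le_mul h4 h3 (norm_nonneg _) (by positivity))
          (h2.trans (mul_le_mul_of_nonneg_right h5 hsb)) (norm_nonneg _) (by positivity)
      simp only [m']
      linarith
    rcases le_or_gt x b' with h2 | h2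
    · have := hmid ι hι x ⟨h1, h2⟩ y hy
      simp only [m']
      linarith
    · have h3 := h.norm_sideIntegrand_le_of_notMem hL hι z hb'
        (by rw [abs_of_pos (by linarith)]; exact h2.le) hxI hy.1
      have h4 := hL.weightE_mono (show 0 ≤ ‖z‖ / b' by positivity)
        (show ‖z‖ / b' ≤ (z.re + Y) / b' by gcongr)
      have h5 : ‖sideIntegrand ℓ (fun k => iteratedDeriv k f) φ ι (denjoyWeight α) z (x, y)‖ ≤
          C₂ * E := h3.trans (mul_le_mul_of_nonneg_left h4 hC₂)
      simp only [m']
      linarith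
  have hmeas := ae_restrict_mem (μ := (volume : Measure (ℝ × ℝ)))
    ((measurableSet_Ioc (a := a) (b := b)).prod (measurableSet_Ioc (a := 0) (b := T)))
  have hside : ∀ ι, (ι = Complex.I ∨ ι = -Complex.I) →
      ‖sideTransform ℓ (fun k => iteratedDeriv k f) φ a b ι (denjoyWeight α) z‖ ≤ V * m' := by
    intro ι hι
    have := norm_integral_le_of_norm_le (integrable_const_prod a b T m') (by
      filter_upwards [hmeas] with p hp using hall ι hι p hp)
    rwa [integral_const, smul_eq_mul] at this
  rw [h.singularTransform_eq hα hI0 hf ha' hb' hY hδ hδA hz, norm_mul, norm_inv, norm_mul,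
    norm_mul, Complex.norm_I, mul_one, Complex.norm_real, Real.norm_of_nonneg hpi.le]
  have h2π : ‖(2 : ℂ)‖ * Real.pi ≥ 2 := by
    rw [Complex.norm_ofNat]; linarith [Real.pi_gt_three]
  have hm' : 0 ≤ m' := by positivity
  calc _ ≤ (2 : ℝ)⁻¹ * (V * m' + V * m') := by
        gcongr
        exact (norm_sub_le _ _).trans (add_le_add (hside _ (Or.inl rfl)) (hside _ (Or.inr rfl)))
    _ = V * (m + C₁ + C₂ * E) := by simp only [m']; ring
    _ ≤ V * ((1 + C₁ + C₂) * (m + 1 + E)) := by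
        have : 0 ≤ C₁ * (m + E) + C₂ * (m + 1) + 1 + E := by positivity
        gcongr
        nlinarith
    _ ≤ _ := by
        have : 0 ≤ m + 1 + E := by positivity
        nlinarith

end ExtensionData

theorem integral_exp_neg_mul_abs {a : ℝ} (ha : 0 < a) :
    ∫ x : ℝ, Real.exp (-a * |x|) = 2 / a := by
  rw [integral_comp_abs (f := fun x => Real.exp (-a * x)), integral_exp_mul_Ioi (by linarith) 0]
  simp
  field_simp

theorem natFloor_bounds {τ : ℝ} (hτ : 1 ≤ τ) :
    1 ≤ ⌊τ⌋₊ ∧ (⌊τ⌋₊ : ℝ) ≤ τ ∧ τ ≤ (⌊τ⌋₊ : ℝ) + 1 ∧ (⌊τ⌋₊ : ℝ) + 1 ≤ 2 * τ := by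
  have h1 : 1 ≤ ⌊τ⌋₊ := (Nat.one_le_floor_iff τ).2 hτ
  have h2 := Nat.floor_le (zero_le_one.trans hτ)
  have h3 := Nat.lt_floor_add_one τ
  exact ⟨h1, h2, h3.le, by linarith⟩

theorem exists_epsFormula_le {α : ℕ →₀ ℝ} (hα : IsDenjoyIndex α) :
    ∃ K : ℝ, 0 < K ∧ ∀ ρ, 0 ≤ ρ → ρ ≤ 1 → ρ * epsFormula α ρ ≤ K := by
  refine ⟨1 + ∑ k ∈ α.support.erase 0, α k, add_pos_of_pos_of_nonneg one_pos
    (Finset.sum_nonneg fun k _ => hα.1 k), fun ρ hρ hρ1 => ?_⟩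
  rcases hρ.eq_or_lt with rfl | hρ0
  · rw [zero_mul]
    exact add_nonneg one_pos.le (Finset.sum_nonneg fun k _ => hα.1 k)
  · exact (mul_le_of_le_one_left (epsFormula_nonneg hα hρ) hρ1).trans (epsFormula_le hα hρ0)

/-- For weights of at most logarithmic growth, the decay of the density near the real axis
compensates the growth of the sector bound. -/
theorem exists_mul_sectorBound_le {α : ℕ →₀ ℝ} (hα : IsDenjoyIndex α)
    (hO : denjoyWeight α =O[atTop] Real.log) {θ : ℝ} (hθ : 0 < θ) :
    ∃ δ₀ > 0, ∀ δ, 0 < δ → δ ≤ δ₀ → ∃ C, ∀ y, 0 < y → y ≤ 1 → ∀ d, 0 ≤ d →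
      (∀ n : ℕ, d ≤ (δ * denjoyWeight α n * y) ^ n) →
        d * y⁻¹ * sectorBound α (θ * y) ≤ C := by
  obtain ⟨κ, hL⟩ := exists_regularWeight hα
  obtain ⟨C₁, hC₁, hγ⟩ := exists_inv_norm_denjoyGamma_le hα
  obtain ⟨C₂, hC₂, hε⟩ := exists_epsFormula_mul_weight_le hα hO
  obtain ⟨K, hK, hεK⟩ := exists_epsFormula_le hα
  set B := C₁ * C₂ + 1
  set Q := 2 ^ κ * (2 * C₁ * C₂ / θ)
  have hB : 0 < B := by positivity
  have hQ : 0 < Q := by positivity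
  have hw1 := hL.pos (show (0 : ℝ) ≤ (1 : ℕ) by positivity)
  have hw2 := hL.pos (show (0 : ℝ) ≤ (2 : ℕ) by positivity)
  refine ⟨Real.exp (-(2 * B)) / Q, by positivity, fun δ hδ hδ0 => ?_⟩
  set W := δ * denjoyWeight α (2 : ℕ)
  set W₁ := δ * denjoyWeight α (1 : ℕ)
  have hW : 0 < W := by positivity
  have hW₁ : 0 < W₁ := by positivity
  set D := W₁ * Real.exp (C₁ * (1 + K)) * Real.exp 1 + W * Real.exp C₁
  set D' := W ^ 2 * Real.exp C₁
  refine ⟨D * 2 + D' * (4 / θ), fun y hy hy1 d hd hdn => ?_⟩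
  have hd1 : d ≤ W₁ * y := by simpa [W₁] using hdn 1
  have hd2 : d ≤ (W * y) ^ 2 := hdn 2
  have hθy : 0 < θ * y := by positivity
  -- the pointwise bound of the integrand
  have hpt : ∀ t : ℝ, d * y⁻¹ * (Real.exp (-(θ * y) * |t|) *
      ‖denjoyGamma α (1 / 2 + t * Complex.I)‖⁻¹) ≤
      D * Real.exp (-1 * |t|) + D' * (y * Real.exp (-(θ * y / 2) * |t|)) := by
    intro t
    have hre : (1 / 2 + t * Complex.I : ℂ).re = 1 / 2 := by simp
    have him : (1 / 2 + t * Complex.I : ℂ).im = t := by simp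
    have hg := hγ _ hre
    rw [him] at hg
    set τ := |t|
    have hτ0 : 0 ≤ τ := abs_nonneg t
    rcases le_or_gt τ 1 with h1 | h1
    · calc _ ≤ W₁ * (1 * Real.exp (C₁ * (1 + K))) := by
            have h2 : d * y⁻¹ ≤ W₁ := by rwa [← div_eq_mul_inv, div_le_iff₀ hy]
            have h3 : Real.exp (-(θ * y) * τ) ≤ 1 := Real.exp_le_one_iff.2 (by nlinarith)
            gcongr
            exact hg.trans (Real.exp_le_exp.2 (by
              have := hεK τ hτ0 h1
              gcongr))
        _ = W₁ * Real.exp (C₁ * (1 + K)) * 1 := by ring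
        _ ≤ W₁ * Real.exp (C₁ * (1 + K)) * (Real.exp 1 * Real.exp (-1 * τ)) := by
            gcongr
            rw [← Real.exp_add]
            exact Real.one_le_exp (by linarith)
        _ = W₁ * Real.exp (C₁ * (1 + K)) * Real.exp 1 * Real.exp (-1 * τ) := by ring
        _ ≤ D * Real.exp (-1 * τ) := by
            simp only [D]
            gcongr
            exact le_add_of_nonneg_right (by positivity)
        _ ≤ _ := le_add_of_nonneg_right (by positivity)
    have hLτ := hL.one_le τ hτ0
    have hLpos : 0 < denjoyWeight α τ := by linarith
    have hετ : epsFormula α τ ≤ C₂ / denjoyWeight α τ := by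
      rw [le_div_iff₀ hLpos]; exact hε τ h1.le
    rcases le_or_gt (2 * C₁ * C₂ / θ) (y * denjoyWeight α τ) with h2 | h2
    · -- here `C₁ ε(τ) ≤ θ y / 2`
      have h3 : C₁ * (1 + τ * epsFormula α τ) ≤ C₁ + θ * y / 2 * τ := by
        have h4 : C₁ * (C₂ / denjoyWeight α τ) ≤ θ * y / 2 := by
          rw [div_le_iff₀ hθ] at h2
          rw [mul_div_assoc', div_le_iff₀ hLpos]
          nlinarith
        calc C₁ * (1 + τ * epsFormula α τ) = C₁ + C₁ * epsFormula α τ * τ := by ring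
          _ ≤ C₁ + C₁ * (C₂ / denjoyWeight α τ) * τ := by gcongr
          _ ≤ _ := by gcongr
      calc _ ≤ (W * y) ^ 2 * y⁻¹ * (Real.exp (-(θ * y) * τ) *
            Real.exp (C₁ + θ * y / 2 * τ)) := by
            gcongr
            exact hg.trans (Real.exp_le_exp.2 h3)
        _ = D' * (y * Real.exp (-(θ * y / 2) * τ)) := by
            rw [← Real.exp_add]
            have : Real.exp (-(θ * y) * τ + (C₁ + θ * y / 2 * τ)) =
                Real.exp C₁ * Real.exp (-(θ * y / 2) * τ) := by
              rw [← Real.exp_add]; congr 1; ring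
            rw [this]
            simp only [D']
            field_simp
        _ ≤ _ := le_add_of_nonneg_left (by positivity)
    · -- here the order `n = ⌊τ⌋ + 1` makes `d` smaller than `exp (-B τ)`
      obtain ⟨-, hn2, hn3, hn4⟩ := natFloor_bounds h1.le
      set n := ⌊τ⌋₊ + 1
      have hnc : ((n : ℕ) : ℝ) = (⌊τ⌋₊ : ℝ) + 1 := by simp [n]
      have hLn : denjoyWeight α n ≤ 2 ^ κ * denjoyWeight α τ := by
        have h3 := hL.ratio τ n (by linarith) (by rw [hnc]; exact hn3)
        refine h3.trans ?_
        rw [mul_comm]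
        gcongr
        · exact hL.exponent_pos.le
        · rw [div_le_iff₀ (by linarith), hnc]; exact hn4
      have h4 : δ * denjoyWeight α n * y ≤ Real.exp (-(2 * B)) := by
        calc δ * denjoyWeight α n * y ≤ δ * (2 ^ κ * denjoyWeight α τ) * y := by gcongr
          _ = δ * (2 ^ κ * (y * denjoyWeight α τ)) := by ring
          _ ≤ δ * Q := by simp only [Q]; gcongr
          _ ≤ Real.exp (-(2 * B)) / Q * Q := by gcongr
          _ = _ := by field_simp
      have h5 : d ≤ Real.exp (-(B * τ)) ^ 2 := by
        have hw := hL.pos (Nat.cast_nonneg (α := ℝ) n)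
        calc d ≤ (δ * denjoyWeight α n * y) ^ n := hdn n
          _ ≤ Real.exp (-(2 * B)) ^ n := by gcongr
          _ = Real.exp (-(2 * B) * n) := by rw [← Real.exp_nat_mul]; congr 1; ring
          _ ≤ Real.exp (-(2 * B) * τ) := by
              refine Real.exp_le_exp.2 ?_
              rw [hnc]
              nlinarith
          _ = _ := by rw [← Real.exp_nat_mul]; congr 1; push_cast; ring
      -- geometric mean of the bounds of order `2` and `n`
      have h6 : d ≤ W * y * Real.exp (-(B * τ)) := by
        rcases hd.eq_or_lt with h0 | h0
        · rw [← h0]; positivity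
        refine (pow_le_pow_iff_left₀ hd (by positivity) two_ne_zero).1 ?_
        calc d ^ 2 = d * d := sq d
          _ ≤ (W * y) ^ 2 * Real.exp (-(B * τ)) ^ 2 := by gcongr
          _ = _ := by ring
      have h7 : C₁ * (1 + τ * epsFormula α τ) ≤ C₁ + C₁ * C₂ * τ := by
        have : epsFormula α τ ≤ C₂ := hετ.trans (div_le_self hC₂.le hLτ)
        calc C₁ * (1 + τ * epsFormula α τ) = C₁ + C₁ * epsFormula α τ * τ := by ring
          _ ≤ _ := by gcongr
      calc _ ≤ (W * y * Real.exp (-(B * τ))) * y⁻¹ * (1 * Real.exp (C₁ + C₁ * C₂ * τ)) := by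
            have h3 : Real.exp (-(θ * y) * τ) ≤ 1 := Real.exp_le_one_iff.2 (by nlinarith)
            gcongr
            exact hg.trans (Real.exp_le_exp.2 h7)
        _ = W * Real.exp C₁ * Real.exp (-1 * τ) := by
            have : Real.exp (C₁ + C₁ * C₂ * τ) = Real.exp C₁ * (Real.exp (B * τ) *
                Real.exp (-1 * τ)) := by
              rw [← Real.exp_add, ← Real.exp_add]; congr 1; simp only [B]; ring
            rw [this, Real.exp_neg]
            field_simp
        _ ≤ D * Real.exp (-1 * τ) := by
            simp only [D]
            gcongr
            exact le_add_of_nonneg_left (by positivity)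
        _ ≤ _ := le_add_of_nonneg_right (by positivity)
  have hI1 := integrable_exp_neg_mul_abs one_pos
  have hI2 := integrable_exp_neg_mul_abs (half_pos hθy)
  have hI := integrable_sectorBound hα hθy
  have hle := integral_mono (hI.const_mul (d * y⁻¹))
    ((hI1.const_mul D).add ((hI2.const_mul y).const_mul D')) hpt
  have hsum : ∫ t : ℝ, (D * Real.exp (-1 * |t|) + D' * (y * Real.exp (-(θ * y / 2) * |t|))) =
      D * (2 / 1) + D' * (y * (2 / (θ * y / 2))) := by
    rw [integral_add (hI1.const_mul D) ((hI2.const_mul y).const_mul D'), integral_const_mul,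
      integral_const_mul, integral_const_mul, integral_exp_neg_mul_abs one_pos,
      integral_exp_neg_mul_abs (half_pos hθy)]
  rw [integral_const_mul] at hle
  refine (hle.trans (le_of_eq hsum)).trans (le_of_eq ?_)
  field_simp
  ring

theorem epsFormula_pos {α : ℕ →₀ ℝ} (hα : IsDenjoyIndex α)
    (ho : Real.log =o[atTop] denjoyWeight α) {ρ : ℝ} (hρ : 1 ≤ ρ) : 0 < epsFormula α ρ := by
  obtain ⟨c, hc, h⟩ := exists_inv_log_le_epsFormula hα ho
  have := one_le_log_add_exp_one (zero_le_one.trans hρ)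
  exact lt_of_lt_of_le (by positivity) (h ρ hρ)

theorem gam_inv_eps (α : ℕ →₀ ℝ) (n : ℕ) :
    gam (fun ρ => 1 / eps (denjoyWeight α) ρ) ((n : ℝ) + 1) =
      (epsFormula α ((n : ℝ) + 1) ^ (n + 1))⁻¹ := by
  rw [gam_natCast_add_one, eps_denjoyWeight α (by positivity), one_div, inv_pow]

theorem summable_pow_div_gam_inv_eps {α : ℕ →₀ ℝ} (hα : IsDenjoyIndex α)
    (ho : Real.log =o[atTop] denjoyWeight α) (r : ℝ) :
    Summable fun n : ℕ =>
      r ^ n / gam (fun ρ => 1 / eps (denjoyWeight α) ρ) ((n : ℝ) + 1) := by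
  refine summable_pow_div_gam ?_ r
  have h : Tendsto (epsFormula α) atTop (𝓝[>] 0) :=
    tendsto_nhdsWithin_iff.2 ⟨tendsto_epsFormula hα, by
      filter_upwards [eventually_ge_atTop 1] with ρ hρ using epsFormula_pos hα ho hρ⟩
  refine (tendsto_inv_nhdsGT_zero.comp h).congr' ?_
  filter_upwards [eventually_gt_atTop 0] with ρ hρ
  rw [Function.comp, eps_denjoyWeight α hρ, one_div]

/-- Each term of the series `E` of the weight `1/ε` is a lower bound of the sum. -/
theorem le_weightE_inv_eps {α : ℕ →₀ ℝ} (hα : IsDenjoyIndex α)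
    (ho : Real.log =o[atTop] denjoyWeight α) {r : ℝ} (hr : 0 ≤ r) (n : ℕ) :
    r ^ n * epsFormula α ((n : ℝ) + 1) ^ (n + 1) ≤
      weightE (fun ρ => 1 / eps (denjoyWeight α) ρ) r := by
  have h := (summable_pow_div_gam_inv_eps hα ho r).le_tsum n (fun j _ => by
    rw [gam_inv_eps, div_inv_eq_mul]
    have := epsFormula_nonneg hα (show (0 : ℝ) ≤ (j : ℝ) + 1 by positivity)
    positivity)
  rwa [gam_inv_eps, div_inv_eq_mul] at h

/-- For weights of super-logarithmic growth, the sector bound at angle `A / u` is dominated by the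
series `E` of the weight `1/ε`. -/
theorem exists_sectorBound_le_weightE {α : ℕ →₀ ℝ} (hα : IsDenjoyIndex α)
    (ho : Real.log =o[atTop] denjoyWeight α) {c : ℝ} (hc : 0 < c) :
    ∃ A₀ : ℝ, 0 < A₀ ∧ ∀ A, A₀ ≤ A → ∃ C, ∀ u, 1 ≤ u →
      sectorBound α (A / u) ≤
        C * weightE (fun ρ => 1 / eps (denjoyWeight α) ρ) (u / c) := by
  obtain ⟨C₁, hC₁, hγ⟩ := exists_inv_norm_denjoyGamma_le hα
  obtain ⟨K, hK, hεK⟩ := exists_epsFormula_le hα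
  obtain ⟨c₀, hc₀, hlog⟩ := exists_inv_log_le_epsFormula hα ho
  obtain ⟨c₁, hc₁, hdbl⟩ := epsFormula_doubling hα
  set κ := 1 + ∑ k ∈ α.support.erase 0, α k
  have hκ : 0 < κ := add_pos_of_pos_of_nonneg one_pos (Finset.sum_nonneg fun k _ => hα.1 k)
  set B := C₁ * κ + 2
  have hB : 0 < B := by positivity
  have he := Real.exp_pos 1
  refine ⟨Real.exp B * (2 * C₁ * c / c₁), by positivity, fun A hA => ?_⟩
  have hA0 : 0 < A := lt_of_lt_of_le (by positivity) hA
  have hε1 : 0 < epsFormula α 1 := epsFormula_pos hα ho le_rfl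
  have hε2 : 0 < epsFormula α 2 := epsFormula_pos hα ho one_le_two
  set D := Real.exp (C₁ * (1 + K)) * Real.exp 1 * (epsFormula α 1)⁻¹
  set D' := Real.exp C₁ * (c₀ * Real.exp (-(1 + Real.exp 1) - (B - 1)))⁻¹
  set D'' := Real.exp C₁ * (4 / A) * (c / epsFormula α 2 ^ 2)
  refine ⟨(D + D') * 2 + D'', fun u hu => ?_⟩
  have hu0 : 0 < u := by linarith
  set E := weightE (fun ρ => 1 / eps (denjoyWeight α) ρ) (u / c)
  have huc : 0 ≤ u / c := by positivity
  have hE1 : epsFormula α 1 ≤ E := by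
    have h := le_weightE_inv_eps hα ho huc 0
    rw [Nat.cast_zero, zero_add, pow_zero, one_mul, zero_add, pow_one] at h
    exact h
  have hE2 : u / c * epsFormula α 2 ^ 2 ≤ E := by
    have h := le_weightE_inv_eps hα ho huc 1
    rw [Nat.cast_one, pow_one, one_add_one_eq_two (R := ℝ)] at h
    exact h
  have hE0 : 0 < E := hε1.trans_le hE1
  set θ := A / u
  have hθ : 0 < θ := by positivity
  have hD : 0 < D := by positivity
  have hD' : 0 < D' := by positivity
  have hpt : ∀ t : ℝ, Real.exp (-θ * |t|) * ‖denjoyGamma α (1 / 2 + t * Complex.I)‖⁻¹ ≤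
      (D + D') * E * Real.exp (-1 * |t|) + Real.exp C₁ * Real.exp (-(θ / 2) * |t|) := by
    intro t
    have hre : (1 / 2 + t * Complex.I : ℂ).re = 1 / 2 := by simp
    have him : (1 / 2 + t * Complex.I : ℂ).im = t := by simp
    have hg := hγ _ hre
    rw [him] at hg
    set τ := |t|
    have hτ0 : 0 ≤ τ := abs_nonneg t
    have h3 : Real.exp (-θ * τ) ≤ 1 := Real.exp_le_one_iff.2 (by nlinarith)
    rcases le_or_gt τ 1 with h1 | h1
    · calc _ ≤ 1 * Real.exp (C₁ * (1 + K)) := by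
            gcongr
            exact hg.trans (Real.exp_le_exp.2 (by
              have := hεK τ hτ0 h1
              gcongr))
        _ = Real.exp (C₁ * (1 + K)) * 1 * 1 := by ring
        _ ≤ Real.exp (C₁ * (1 + K)) * (Real.exp 1 * Real.exp (-1 * τ)) *
            ((epsFormula α 1)⁻¹ * E) := by
            gcongr
            · rw [← Real.exp_add]
              exact Real.one_le_exp (by linarith)
            · rw [mul_comm, ← div_eq_mul_inv, one_le_div hε1]
              exact hE1
        _ = D * E * Real.exp (-1 * τ) := by simp only [D]; ring
        _ ≤ (D + D') * E * Real.exp (-1 * τ) := by gcongr; linarith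
        _ ≤ _ := le_add_of_nonneg_right (by positivity)
    rcases le_or_gt (C₁ * epsFormula α τ) (θ / 2) with h2 | h2
    · calc _ ≤ Real.exp (-θ * τ) * Real.exp (C₁ + θ / 2 * τ) := by
            gcongr
            refine hg.trans (Real.exp_le_exp.2 ?_)
            calc C₁ * (1 + τ * epsFormula α τ) = C₁ + C₁ * epsFormula α τ * τ := by ring
              _ ≤ _ := by gcongr
        _ = Real.exp C₁ * Real.exp (-(θ / 2) * τ) := by
            rw [← Real.exp_add, ← Real.exp_add]; congr 1; ring
        _ ≤ _ := le_add_of_nonneg_left (by positivity)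
    · -- the term of order `n = ⌊τ⌋` of `E` outweighs `exp (B τ)`
      obtain ⟨hn1, hn2, hn3, hn4⟩ := natFloor_bounds h1.le
      set n := ⌊τ⌋₊
      have hεn : c₁ * epsFormula α τ ≤ epsFormula α ((n : ℝ) + 1) := hdbl τ _ h1.le hn3 hn4
      have hn0 : (1 : ℝ) ≤ (n : ℝ) + 1 := by linarith [Nat.cast_nonneg (α := ℝ) n]
      have h4 : Real.exp B ≤ u / c * epsFormula α ((n : ℝ) + 1) := by
        have h5 : A / u / (2 * C₁) ≤ epsFormula α τ := by
          rw [div_le_iff₀ (by positivity)]; simp only [θ] at h2; linarith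
        calc Real.exp B = Real.exp B * (2 * C₁ * c / c₁) * (c₁ / (2 * C₁ * c)) := by field_simp
          _ ≤ A * (c₁ / (2 * C₁ * c)) := by gcongr
          _ = u / c * (c₁ * (A / u / (2 * C₁))) := by field_simp
          _ ≤ u / c * (c₁ * epsFormula α τ) := by gcongr
          _ ≤ _ := by gcongr
      have h6 : c₀ * Real.exp (-((n : ℝ) + 1 + Real.exp 1)) ≤ epsFormula α ((n : ℝ) + 1) := by
        refine le_trans ?_ (hlog _ hn0)
        rw [Real.exp_neg]
        have h7 := one_le_log_add_exp_one (zero_le_one.trans hn0)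
        gcongr
        exact (Real.log_le_self (by positivity)).trans (by
          linarith [Real.add_one_le_exp ((n : ℝ) + 1 + Real.exp 1)])
      have h8 : c₀ * Real.exp (-(1 + Real.exp 1) - (B - 1)) * Real.exp ((B - 1) * τ) ≤ E := by
        refine le_trans ?_ (le_weightE_inv_eps hα ho huc n)
        have h9 : Real.exp (B * n) * (c₀ * Real.exp (-((n : ℝ) + 1 + Real.exp 1))) ≤
            (u / c) ^ n * epsFormula α ((n : ℝ) + 1) ^ (n + 1) := by
          have h0 := (Real.exp_pos B).le.trans h4
          calc _ = Real.exp B ^ n * (c₀ * Real.exp (-((n : ℝ) + 1 + Real.exp 1))) := by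
                rw [← Real.exp_nat_mul, mul_comm B]
            _ ≤ (u / c * epsFormula α ((n : ℝ) + 1)) ^ n * epsFormula α ((n : ℝ) + 1) := by gcongr
            _ = _ := by rw [mul_pow, pow_succ, mul_assoc]
        refine le_trans ?_ h9
        have hB1 : 0 ≤ B - 1 := by
          have : 0 ≤ C₁ * κ := by positivity
          simp only [B]; linarith
        have h11 : (B - 1) * τ ≤ (B - 1) * ((n : ℝ) + 1) := mul_le_mul_of_nonneg_left hn3 hB1
        rw [mul_left_comm, mul_assoc, ← Real.exp_add, ← Real.exp_add]
        refine mul_le_mul_of_nonneg_left (Real.exp_le_exp.2 ?_) hc₀.le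
        linarith
      have h10 : C₁ * (1 + τ * epsFormula α τ) ≤ C₁ + C₁ * κ * τ := by
        have : epsFormula α τ ≤ κ := epsFormula_le hα (by linarith)
        calc C₁ * (1 + τ * epsFormula α τ) = C₁ + C₁ * epsFormula α τ * τ := by ring
          _ ≤ _ := by gcongr
      calc _ ≤ 1 * Real.exp (C₁ + C₁ * κ * τ) := by
            gcongr
            exact hg.trans (Real.exp_le_exp.2 h10)
        _ = Real.exp C₁ * (Real.exp ((B - 1) * τ) * Real.exp (-1 * τ)) := by
            rw [← Real.exp_add, ← Real.exp_add, one_mul]; congr 1; simp only [B]; ring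
        _ = D' * (c₀ * Real.exp (-(1 + Real.exp 1) - (B - 1)) * Real.exp ((B - 1) * τ)) *
            Real.exp (-1 * τ) := by
            simp only [D']
            field_simp
        _ ≤ D' * E * Real.exp (-1 * τ) := by gcongr
        _ ≤ (D + D') * E * Real.exp (-1 * τ) := by gcongr; linarith
        _ ≤ _ := le_add_of_nonneg_right (by positivity)
  have hI1 := integrable_exp_neg_mul_abs one_pos
  have hI2 := integrable_exp_neg_mul_abs (half_pos hθ)
  have hI := integrable_sectorBound hα hθ
  have hle := integral_mono hI ((hI1.const_mul ((D + D') * E)).add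
    (hI2.const_mul (Real.exp C₁))) hpt
  have hsum : ∫ t : ℝ, ((D + D') * E * Real.exp (-1 * |t|) +
      Real.exp C₁ * Real.exp (-(θ / 2) * |t|)) =
      (D + D') * E * (2 / 1) + Real.exp C₁ * (2 / (θ / 2)) := by
    rw [integral_add (hI1.const_mul _) (hI2.const_mul _), integral_const_mul,
      integral_const_mul, integral_exp_neg_mul_abs one_pos,
      integral_exp_neg_mul_abs (half_pos hθ)]
  refine (hle.trans (le_of_eq hsum)).trans ?_
  have h1 : Real.exp C₁ * (2 / (θ / 2)) ≤ D'' * E := by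
    calc Real.exp C₁ * (2 / (θ / 2)) = D'' * (u / c * epsFormula α 2 ^ 2) := by
          simp only [D'', θ]
          field_simp
          norm_num
      _ ≤ D'' * E := by gcongr
  calc _ ≤ (D + D') * E * (2 / 1) + D'' * E := by gcongr
    _ = _ := by ring

/-- For weights of super-logarithmic growth the series `E` of the weight `1/ε` dominates the one
of the weight itself, at any scale. -/
theorem exists_weightE_le_weightE_inv_eps {α : ℕ →₀ ℝ} (hα : IsDenjoyIndex α)
    (ho : Real.log =o[atTop] denjoyWeight α) {c b : ℝ} (hc : 0 < c) (hb : 0 < b) :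
    ∃ C, ∀ u, 0 ≤ u → weightE (denjoyWeight α) (u / b) ≤
      C * weightE (fun ρ => 1 / eps (denjoyWeight α) ρ) (u / c) := by
  set q : ℕ → ℝ := fun n => denjoyWeight α ((n : ℝ) + 1) * epsFormula α ((n : ℝ) + 1)
  have hL : ∀ n : ℕ, 0 < denjoyWeight α ((n : ℝ) + 1) := fun n =>
    zero_lt_one.trans_le (one_le_denjoyWeight hα (by positivity))
  have hε : ∀ n : ℕ, 0 < epsFormula α ((n : ℝ) + 1) := fun n =>
    epsFormula_pos hα ho (by linarith [Nat.cast_nonneg (α := ℝ) n])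
  have hq0 : ∀ n, 0 < q n := fun n => mul_pos (hL n) (hε n)
  have hq : Tendsto q atTop atTop :=
    (tendsto_weight_mul_epsFormula hα ho).comp tendsto_natCast_add_one
  have hbdd : BddAbove (range fun n => (c / b) ^ n / q n ^ (n + 1)) := by
    refine Filter.IsBoundedUnder.bddAbove_range ⟨1, ?_⟩
    rw [eventually_map]
    filter_upwards [hq.eventually_ge_atTop (max (c / b) 1)] with n hn
    have h1 := (le_max_left _ _).trans hn
    have h2 := (le_max_right _ _).trans hn
    rw [div_le_one (pow_pos (hq0 n) _), pow_succ]
    calc (c / b) ^ n ≤ q n ^ n := by gcongr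
      _ ≤ q n ^ n * q n := le_mul_of_one_le_right (pow_nonneg (hq0 n).le _) h2
  obtain ⟨C, hC⟩ := hbdd
  refine ⟨C, fun u hu => ?_⟩
  rw [weightE, weightE, ← tsum_mul_left]
  refine (summable_pow_div_gam (tendsto_denjoyWeight hα) _).tsum_le_tsum (fun n => ?_)
    ((summable_pow_div_gam_inv_eps hα ho _).mul_left C)
  have h1 : (c / b) ^ n / q n ^ (n + 1) ≤ C := hC (mem_range_self n)
  rw [gam_natCast_add_one, gam_inv_eps, div_inv_eq_mul]
  have := hL n
  have := hε n
  calc _ = (c / b) ^ n / q n ^ (n + 1) *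
        ((u / c) ^ n * epsFormula α ((n : ℝ) + 1) ^ (n + 1)) := by
        simp only [q]
        rw [mul_pow, div_pow, div_pow, div_pow]
        field_simp
    _ ≤ _ := by gcongr

theorem exists_interval_subset {I : Set ℝ} (hIo : IsOpen I) (hIc : I.OrdConnected)
    (hI0 : (0 : ℝ) ∈ I) {c : ℝ} (hc : c ∈ I) :
    ∃ a a' b' b : ℝ, a < a' ∧ a' < 0 ∧ c < b' ∧ b' < b ∧ Icc a b ⊆ I := by
  obtain ⟨e₁, he₁, h1⟩ := Metric.isOpen_iff.1 hIo 0 hI0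
  obtain ⟨e₂, he₂, h2⟩ := Metric.isOpen_iff.1 hIo c hc
  refine ⟨-(e₁ / 2), -(e₁ / 3), c + e₂ / 3, c + e₂ / 2, by linarith, by linarith, by linarith,
    by linarith, hIc.out (h1 ?_) (h2 ?_)⟩
  · rw [Metric.mem_ball, Real.dist_eq, sub_zero, abs_neg, abs_of_pos (by linarith)]; linarith
  · rw [Metric.mem_ball, Real.dist_eq, add_sub_cancel_left, abs_of_pos (by linarith)]; linarith

/-- Growth along the positive axis for weights of at most logarithmic growth. -/
theorem exists_norm_singularTransform_le_weightE {α : ℕ →₀ ℝ} (hα : IsDenjoyIndex α)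
    (hO : denjoyWeight α =O[atTop] Real.log) {I : Set ℝ} (hIo : IsOpen I)
    (hIc : I.OrdConnected) (hI0 : (0 : ℝ) ∈ I) {f : ℝ → ℂ}
    (hf : f ∈ beurlingClass (denjoyWeight α) I) {c : ℝ} (hc : c ∈ I) (hc0 : 0 < c) {Y : ℝ}
    (hY : 0 < Y) : ∃ C, ∀ᶠ u : ℝ in atTop, ∀ z : ℂ, z.re = u → |z.im| ≤ Y →
      ‖singularTransform (denjoyWeight α) f z‖ ≤ C * weightE (denjoyWeight α) (u / c) := by
  obtain ⟨κ, hL⟩ := exists_regularWeight hα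
  obtain ⟨a, a', b', b, ha, ha', hcb, hb, hab⟩ := exists_interval_subset hIo hIc hI0 hc
  have hb' : 0 < b' := hc0.trans hcb
  set ρ := |a| + |b| + 1
  have hρ : 0 < ρ := by positivity
  set θ := 1 / (2 * ρ)
  have hθ : 0 < θ := by positivity
  obtain ⟨δ₀, hδ₀, hSB⟩ := exists_mul_sectorBound_le hα hO hθ
  set A := 4 * (2 * Y)
  have hA : 0 < A := by positivity
  set δ := min δ₀ (1 / (2 * A))
  have hδ : 0 < δ := lt_min hδ₀ (by positivity)
  have hδA : δ * A ≤ 1 / 2 := by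
    calc δ * A ≤ 1 / (2 * A) * A := by gcongr; exact min_le_right _ _
      _ = 1 / 2 := by field_simp
  obtain ⟨C₁, hC₁⟩ := hSB δ hδ (min_le_left _ _)
  obtain ⟨ℓ, φ, M, h⟩ := exists_extensionData hL hIo hf ha hb hab hδ
  have hM := h.M_nonneg
  obtain ⟨C, U, hC, hS⟩ := h.exists_norm_singularTransform_le hα hI0 hf ha' hb'
    (show 0 < 2 * Y by positivity) hδ hδA
  have hw1 := h.w_nonneg 1
  set T := 1 / ℓ 0
  set R := (|a| + |b| + T) / A
  set m := 4 * M * δ + (2 * (M + 1) * |C₁| + 2 * M * (δ * denjoyWeight α (1 : ℕ)) *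
    sectorBound α θ) * R ^ (1 / 2 : ℝ)
  have hT : 0 < T := one_div_pos.2 h.pos
  have hR : 0 ≤ R := by positivity
  have hsb := sectorBound_nonneg α θ
  have hm : 0 ≤ m := by positivity
  have hmid : ∀ z : ℂ, |z.im| ≤ 2 * Y → ∀ ι, (ι = Complex.I ∨ ι = -Complex.I) →
      ∀ x ∈ Icc a' b', ∀ y ∈ Ioc 0 T,
      ‖sideIntegrand ℓ (fun k => iteratedDeriv k f) φ ι (denjoyWeight α) z (x, y)‖ ≤ m := by
    intro z hz ι hι x hx y hy
    have hxI : x ∈ Icc a b := ⟨ha.le.trans hx.1, hx.2.trans hb.le⟩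
    have hy0 := hy.1
    have hζ : 0 < ‖(x : ℂ) + ι * y‖ := norm_pos_iff.2 (line_ne_zero hι x hy.1)
    rcases h.norm_sideIntegrand_le hα hι (show 0 < 2 * Y by positivity) le_rfl hδ hδA hz hx hy.1
      with h1 | ⟨-, -, h1⟩
    · exact h1.trans (le_add_of_nonneg_right (by positivity))
    refine h1.trans (le_trans ?_ (le_add_of_nonneg_left (by positivity)))
    have h2 : (‖(x : ℂ) + ι * y‖ / A) ^ (1 / 2 : ℝ) ≤ R ^ (1 / 2 : ℝ) := by
      simp only [R]
      gcongr
      exact ExtensionData.norm_line_le hι hxI hy.1 hy.2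
    have h3 : ‖dbarSum ℓ (fun k => iteratedDeriv k f) φ ι x y‖ * y⁻¹ *
        sectorBound α (y / (2 * ‖(x : ℂ) + ι * y‖)) ≤ 2 * (M + 1) * |C₁| +
          2 * M * (δ * denjoyWeight α (1 : ℕ)) * sectorBound α θ := by
      rcases le_or_gt y 1 with hy1 | hy1
      · refine le_trans ?_ (le_add_of_nonneg_right (by positivity))
        have h4 : θ * y ≤ y / (2 * ‖(x : ℂ) + ι * y‖) := by
          simp only [θ]
          rw [div_mul_eq_mul_div, one_mul]
          gcongr
          exact ExtensionData.norm_line_le hι hxI hy.1 hy1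
        have h5 := hC₁ y hy.1 hy1
          (‖dbarSum ℓ (fun k => iteratedDeriv k f) φ ι x y‖ / (2 * (M + 1))) (by positivity)
          (fun n => by
            have hp := h.norm_dbarSum_le_pow (norm_of_eq_I_or hι) hx hy.1 n
            have hwn := h.w_nonneg n
            rw [div_le_iff₀ (by positivity)]
            have : 0 ≤ (δ * denjoyWeight α n * y) ^ n := by positivity
            nlinarith)
        have h6 := sectorBound_anti hα (show 0 < θ * y by positivity) h4
        calc _ ≤ ‖dbarSum ℓ (fun k => iteratedDeriv k f) φ ι x y‖ * y⁻¹ *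
              sectorBound α (θ * y) := by gcongr
          _ = 2 * (M + 1) * (‖dbarSum ℓ (fun k => iteratedDeriv k f) φ ι x y‖ / (2 * (M + 1)) *
              y⁻¹ * sectorBound α (θ * y)) := by field_simp
          _ ≤ 2 * (M + 1) * |C₁| := by
              gcongr
              exact h5.trans (le_abs_self _)
      · refine le_trans ?_ (le_add_of_nonneg_left (by positivity))
        have h4 : θ ≤ y / (2 * ‖(x : ℂ) + ι * y‖) := by
          simp only [θ]
          rw [div_le_div_iff₀ (by positivity) (by positivity), one_mul]
          have h5 := ExtensionData.norm_line_le hι hxI hy.1 le_rfl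
          have h6 : |a| + |b| + y ≤ ρ * y := by
            simp only [ρ]
            nlinarith [abs_nonneg a, abs_nonneg b]
          nlinarith
        have h6 := sectorBound_anti hα hθ h4
        have h7 := h.norm_dbarSum_mul_inv_le (norm_of_eq_I_or hι) hx hy.1
        have h8 := sectorBound_nonneg α (y / (2 * ‖(x : ℂ) + ι * y‖))
        gcongr
    have h9 : 0 ≤ 2 * (M + 1) * |C₁| +
          2 * M * (δ * denjoyWeight α (1 : ℕ)) * sectorBound α θ := by positivity
    calc _ = ‖dbarSum ℓ (fun k => iteratedDeriv k f) φ ι x y‖ * y⁻¹ *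
        sectorBound α (y / (2 * ‖(x : ℂ) + ι * y‖)) * (‖(x : ℂ) + ι * y‖ / A) ^ (1 / 2 : ℝ) := by
          ring
      _ ≤ _ := by gcongr
  have hE0 : 0 < weightE (denjoyWeight α) 0 := hL.weightE_pos le_rfl
  refine ⟨C * ((m + 1) / weightE (denjoyWeight α) 0 + 1), ?_⟩
  filter_upwards [eventually_ge_atTop U, eventually_ge_atTop 0,
    eventually_ge_atTop (2 * Y * c / (b' - c))] with u hu hu0 huY z hzu hzY
  rw [div_le_iff₀ (by linarith)] at huY
  have h1 := hS z (by linarith) (by rwa [hzu]) m hm (hmid z (by linarith))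
  rw [hzu] at h1
  have h2 : weightE (denjoyWeight α) ((u + 2 * Y) / b') ≤ weightE (denjoyWeight α) (u / c) := by
    refine hL.weightE_mono (by positivity) ?_
    rw [div_le_div_iff₀ hb' hc0]
    linarith
  have h3 : weightE (denjoyWeight α) 0 ≤ weightE (denjoyWeight α) (u / c) :=
    hL.weightE_mono le_rfl (by positivity)
  refine h1.trans ?_
  rw [mul_assoc C]
  refine mul_le_mul_of_nonneg_left ?_ hC.le
  rw [add_mul, one_mul]
  refine add_le_add ?_ h2
  calc m + 1 = (m + 1) / weightE (denjoyWeight α) 0 * weightE (denjoyWeight α) 0 := by field_simp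
    _ ≤ _ := by gcongr

/-- Growth along the positive axis for weights of super-logarithmic growth. -/
theorem exists_norm_singularTransform_le_weightE_inv_eps {α : ℕ →₀ ℝ} (hα : IsDenjoyIndex α)
    (ho : Real.log =o[atTop] denjoyWeight α) {I : Set ℝ} (hIo : IsOpen I)
    (hIc : I.OrdConnected) (hI0 : (0 : ℝ) ∈ I) {f : ℝ → ℂ}
    (hf : f ∈ beurlingClass (denjoyWeight α) I) {c : ℝ} (hc0 : 0 < c) {Y : ℝ}
    (hY : 0 < Y) : ∃ C, ∀ᶠ u : ℝ in atTop, ∀ z : ℂ, z.re = u → |z.im| ≤ Y →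
      ‖singularTransform (denjoyWeight α) f z‖ ≤
        C * weightE (fun ρ => 1 / eps (denjoyWeight α) ρ) (u / c) := by
  obtain ⟨κ, hL⟩ := exists_regularWeight hα
  obtain ⟨a, a', b', b, ha, ha', hb', hb, hab⟩ := exists_interval_subset hIo hIc hI0 hI0
  obtain ⟨A₀, hA₀, hSB⟩ := exists_sectorBound_le_weightE hα ho hc0
  set A := max (4 * (2 * Y)) (4 * A₀)
  have hA : 0 < A := lt_max_of_lt_left (by positivity)
  obtain ⟨C₁, hC₁⟩ := hSB (A / 4) (by
    rw [le_div_iff₀ (by norm_num)]; linarith [le_max_right (4 * (2 * Y)) (4 * A₀)])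
  set δ := 1 / (2 * A)
  have hδ : 0 < δ := by positivity
  have hδA : δ * A ≤ 1 / 2 := le_of_eq (by simp only [δ]; field_simp)
  have hδA' : δ * (4 * (2 * Y)) ≤ 1 / 2 := by
    refine le_trans ?_ hδA
    gcongr
    exact le_max_left _ _
  obtain ⟨ℓ, φ, M, h⟩ := exists_extensionData hL hIo hf ha hb hab hδ
  have hM := h.M_nonneg
  obtain ⟨C, U, hC, hS⟩ := h.exists_norm_singularTransform_le hα hI0 hf ha' hb'
    (show 0 < 2 * Y by positivity) hδ hδA'
  obtain ⟨C₂, hC₂⟩ := exists_weightE_le_weightE_inv_eps hα ho hc0 (half_pos hb')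
  have hw1 := h.w_nonneg 1
  set T := 1 / ℓ 0
  have hT : 0 < T := one_div_pos.2 h.pos
  set R := (|a| + |b| + T) / A
  have hR : 0 ≤ R := by positivity
  set W := 2 * M * (δ * denjoyWeight α (1 : ℕ))
  have hW : 0 ≤ W := by positivity
  have hmid : ∀ z : ℂ, |z.im| ≤ 2 * Y → ∀ u, 0 < u → ‖z‖ ≤ 2 * u →
      ∀ ι, (ι = Complex.I ∨ ι = -Complex.I) → ∀ x ∈ Icc a' b', ∀ y ∈ Ioc 0 T,
      ‖sideIntegrand ℓ (fun k => iteratedDeriv k f) φ ι (denjoyWeight α) z (x, y)‖ ≤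
        4 * M * δ + W * (R ^ (1 / 2 : ℝ) * sectorBound α (A / 4 / u)) := by
    intro z hz u hu hzu ι hι x hx y hy
    have hxI : x ∈ Icc a b := ⟨ha.le.trans hx.1, hx.2.trans hb.le⟩
    have hsb := sectorBound_nonneg α (A / 4 / u)
    rcases h.norm_sideIntegrand_le hα hι (show 0 < 2 * Y by positivity) (le_max_left _ _) hδ hδA hz
      hx hy.1 with h1 | ⟨hzA, hθ, h1⟩
    · exact h1.trans (le_add_of_nonneg_right (by positivity))
    refine h1.trans (le_trans ?_ (le_add_of_nonneg_left (by positivity)))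
    have h2 : (‖(x : ℂ) + ι * y‖ / A) ^ (1 / 2 : ℝ) ≤ R ^ (1 / 2 : ℝ) := by
      simp only [R]
      gcongr
      exact ExtensionData.norm_line_le hι hxI hy.1 hy.2
    have hz0 : 0 < ‖z‖ := hA.trans hzA
    have h3 : A / 4 / u ≤ y / (2 * ‖(x : ℂ) + ι * y‖) := by
      refine le_trans (?_ : A / 4 / u ≤ A / (2 * ‖z‖)) hθ
      rw [div_div]
      exact div_le_div_of_nonneg_left hA.le (by positivity) (by linarith)
    have h4 := sectorBound_anti hα (show 0 < A / 4 / u by positivity) h3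
    have h5 := h.norm_dbarSum_mul_inv_le (norm_of_eq_I_or hι) hx hy.1
    have h6 := sectorBound_nonneg α (y / (2 * ‖(x : ℂ) + ι * y‖))
    refine mul_le_mul h5 (mul_le_mul h2 h4 h6 (by positivity)) (by positivity) hW
  have hε1 : 0 < epsFormula α 1 := epsFormula_pos hα ho le_rfl
  refine ⟨C * ((4 * M * δ + 1) / epsFormula α 1 + W * (R ^ (1 / 2 : ℝ) * C₁) + C₂), ?_⟩
  filter_upwards [eventually_ge_atTop U, eventually_ge_atTop 1,
    eventually_ge_atTop (2 * Y)] with u hu hu1 huY z hzu hzY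
  have hu0 : 0 < u := by linarith
  have hzn : ‖z‖ ≤ 2 * u := by
    have := Complex.norm_le_abs_re_add_abs_im z
    rw [hzu, abs_of_pos hu0] at this
    linarith
  have hsb := sectorBound_nonneg α (A / 4 / u)
  have h1 := hS z (by linarith) (by rwa [hzu]) _ (by positivity)
    (hmid z (by linarith) u hu0 hzn)
  rw [hzu] at h1
  set E := weightE (fun ρ => 1 / eps (denjoyWeight α) ρ) (u / c)
  have h2 : weightE (denjoyWeight α) ((u + 2 * Y) / b') ≤ C₂ * E := by
    refine le_trans (hL.weightE_mono (by positivity) ?_) (hC₂ u hu0.le)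
    rw [div_le_div_iff₀ hb' (by positivity)]
    nlinarith
  have h3 : epsFormula α 1 ≤ E := by
    have h := le_weightE_inv_eps hα ho (show 0 ≤ u / c by positivity) 0
    rw [Nat.cast_zero, zero_add, pow_zero, one_mul, zero_add, pow_one] at h
    exact h
  have h4 : sectorBound α (A / 4 / u) ≤ C₁ * E := hC₁ u hu1
  have h5 : 4 * M * δ + 1 ≤ (4 * M * δ + 1) / epsFormula α 1 * E := by
    calc 4 * M * δ + 1 = (4 * M * δ + 1) / epsFormula α 1 * epsFormula α 1 := by field_simp
      _ ≤ _ := by gcongr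
  refine h1.trans ?_
  rw [mul_assoc C]
  refine mul_le_mul_of_nonneg_left ?_ hC.le
  have h6 : W * (R ^ (1 / 2 : ℝ) * sectorBound α (A / 4 / u)) ≤
      W * (R ^ (1 / 2 : ℝ) * (C₁ * E)) := by gcongr
  calc _ = (4 * M * δ + 1) + W * (R ^ (1 / 2 : ℝ) * sectorBound α (A / 4 / u)) +
        weightE (denjoyWeight α) ((u + 2 * Y) / b') := by ring
    _ ≤ (4 * M * δ + 1) / epsFormula α 1 * E + W * (R ^ (1 / 2 : ℝ) * (C₁ * E)) + C₂ * E := by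
        linarith
    _ = _ := by ring

theorem comp_neg_mem_beurlingClass {L : ℝ → ℝ} {I : Set ℝ} {f : ℝ → ℂ}
    (hf : f ∈ beurlingClass L I) : (fun x => f (-x)) ∈ beurlingClass L (-I) := by
  refine ⟨hf.1.comp contDiff_neg.contDiffOn fun x hx => hx, fun a b hab δ hδ => ?_⟩
  obtain ⟨C, hC, h⟩ := hf.2 (-b) (-a) (fun x hx => by
    have := hab (show -x ∈ Icc a b from ⟨by linarith [hx.2], by linarith [hx.1]⟩)
    simpa using this) δ hδ
  refine ⟨C, hC, fun n x hx => ?_⟩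
  rw [iteratedDeriv_comp_neg, norm_smul, norm_pow, norm_neg, norm_one, one_pow, one_mul]
  exact h n (-x) ⟨by linarith [hx.2], by linarith [hx.1]⟩

theorem singularTransform_comp_neg (L : ℝ → ℝ) (f : ℝ → ℂ) (z : ℂ) :
    singularTransform L (fun x => f (-x)) z = singularTransform L f (-z) := by
  refine tsum_congr fun n => ?_
  rw [singularTerm, singularTerm, iteratedDeriv_comp_neg, neg_zero, neg_pow z]
  simp only [Complex.real_smul]
  push_cast
  ring

theorem ordConnected_neg {I : Set ℝ} (hI : I.OrdConnected) : (-I).OrdConnected :=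
  ⟨fun x hx y hy z hz => hI.out hy hx ⟨by simpa using hz.2, by simpa using hz.1⟩⟩

theorem singularTransform_mem_entireClass {α : ℕ →₀ ℝ} (hα : IsDenjoyIndex α)
    (hO : denjoyWeight α =O[atTop] Real.log) {I : Set ℝ} (hIo : IsOpen I)
    (hIc : I.OrdConnected) (hI0 : (0 : ℝ) ∈ I) {f : ℝ → ℂ}
    (hf : f ∈ beurlingClass (denjoyWeight α) I) :
    singularTransform (denjoyWeight α) f ∈ entireClass (denjoyWeight α) I := by
  obtain ⟨κ, hL⟩ := exists_regularWeight hα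
  refine ⟨hL.differentiable_singularTransform hI0 hf, fun c hc hc0 Y hY => ?_,
    fun c hc hc0 Y hY => ?_⟩
  · obtain ⟨C, hC⟩ := exists_norm_singularTransform_le_weightE hα hO hIo hIc hI0 hf hc hc0 hY
    exact ⟨C, hC.mono fun u hu v hv => hu _ (by simp) (by simpa using hv)⟩
  · obtain ⟨C, hC⟩ := exists_norm_singularTransform_le_weightE hα hO hIo.neg
      (ordConnected_neg hIc) (by simpa using hI0) (comp_neg_mem_beurlingClass hf) (c := -c)
      (by simpa using hc) (by linarith) hY
    refine ⟨C, (tendsto_neg_atBot_atTop.eventually hC).mono fun u hu v hv => ?_⟩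
    have := hu (-(u + v * Complex.I)) (by simp) (by simpa using hv)
    rwa [singularTransform_comp_neg, neg_neg, neg_div_neg_eq] at this

theorem singularTransform_mem_entireClass_inv_eps {α : ℕ →₀ ℝ} (hα : IsDenjoyIndex α)
    (ho : Real.log =o[atTop] denjoyWeight α) {I : Set ℝ} (hIo : IsOpen I)
    (hIc : I.OrdConnected) (hI0 : (0 : ℝ) ∈ I) {f : ℝ → ℂ}
    (hf : f ∈ beurlingClass (denjoyWeight α) I) :
    singularTransform (denjoyWeight α) f ∈
      entireClass (fun ρ => 1 / eps (denjoyWeight α) ρ) univ := by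
  obtain ⟨κ, hL⟩ := exists_regularWeight hα
  refine ⟨hL.differentiable_singularTransform hI0 hf, fun c _ hc0 Y hY => ?_,
    fun c _ hc0 Y hY => ?_⟩
  · obtain ⟨C, hC⟩ := exists_norm_singularTransform_le_weightE_inv_eps hα ho hIo hIc hI0 hf hc0 hY
    exact ⟨C, hC.mono fun u hu v hv => hu _ (by simp) (by simpa using hv)⟩
  · obtain ⟨C, hC⟩ := exists_norm_singularTransform_le_weightE_inv_eps hα ho hIo.neg
      (ordConnected_neg hIc) (by simpa using hI0) (comp_neg_mem_beurlingClass hf) (c := -c)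
      (by linarith) hY
    refine ⟨C, (tendsto_neg_atBot_atTop.eventually hC).mono fun u hu v hv => ?_⟩
    have := hu (-(u + v * Complex.I)) (by simp) (by simpa using hv)
    rwa [singularTransform_comp_neg, neg_neg, neg_div_neg_eq] at this

/-! ### Quasianalyticity: the Denjoy–Carleman theorem by Bang's method -/

/-- The regularized majorant `M_n = ∏_{1 ≤ j ≤ n} j L(j)` of the sequence `(n L(n))^n`. -/
def bangWeight (L : ℝ → ℝ) (n : ℕ) : ℝ := ∏ j ∈ Finset.range n, ((j + 1 : ℕ) : ℝ) * L (j + 1 : ℕ)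

theorem bangWeight_succ (L : ℝ → ℝ) (n : ℕ) :
    bangWeight L (n + 1) = bangWeight L n * (((n + 1 : ℕ) : ℝ) * L (n + 1 : ℕ)) :=
  Finset.prod_range_succ _ _

namespace RegularWeight

theorem bangWeight_pos {L : ℝ → ℝ} {κ : ℝ} (hL : RegularWeight L κ) (n : ℕ) :
    0 < bangWeight L n :=
  Finset.prod_pos fun j _ => mul_pos (by positivity) (hL.pos (by positivity))

theorem mul_mono {L : ℝ → ℝ} {κ : ℝ} (hL : RegularWeight L κ) {m n : ℕ} (h : m ≤ n) :
    (m : ℝ) * L m ≤ n * L n := by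
  have h1 : (m : ℝ) ≤ n := by exact_mod_cast h
  have h2 := hL.mono m n (by positivity) h1
  have h3 := hL.pos (Nat.cast_nonneg (α := ℝ) m)
  gcongr

theorem pow_le_bangWeight {L : ℝ → ℝ} {κ : ℝ} (hL : RegularWeight L κ) (n : ℕ) :
    ((n : ℝ) * L n) ^ n ≤ Real.exp (1 + κ) ^ n * bangWeight L n := by
  have hn : ∏ j ∈ Finset.range n, (n : ℝ) = (n : ℝ) ^ n := by simp
  have hfac : ∏ j ∈ Finset.range n, ((j + 1 : ℕ) : ℝ) = n.factorial := by
    rw [← Finset.prod_range_add_one_eq_factorial]; push_cast; rfl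
  have h1 : ∏ j ∈ Finset.range n, ((n : ℝ) / (j + 1 : ℕ)) ≤ Real.exp 1 ^ n := by
    rw [Finset.prod_div_distrib, hn, hfac, div_le_iff₀ (by positivity)]
    exact natCast_pow_le_exp_mul_factorial n
  have h2 : ∀ j ∈ Finset.range n, (n : ℝ) * L n ≤
      (n / (j + 1 : ℕ)) * ((n : ℝ) / (j + 1 : ℕ)) ^ κ * (((j + 1 : ℕ) : ℝ) * L (j + 1 : ℕ)) := by
    intro j hj
    have hj' : ((j + 1 : ℕ) : ℝ) ≤ n := by exact_mod_cast Finset.mem_range.1 hj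
    have hj0 : (0 : ℝ) < (j + 1 : ℕ) := by positivity
    have := hL.ratio (j + 1 : ℕ) n hj0 hj'
    calc (n : ℝ) * L n ≤ n * (L (j + 1 : ℕ) * ((n : ℝ) / (j + 1 : ℕ)) ^ κ) := by gcongr
      _ = _ := by field_simp
  have hpos : ∀ j : ℕ, 0 < L (j + 1 : ℕ) := fun j => hL.pos (by positivity)
  calc ((n : ℝ) * L n) ^ n = ∏ j ∈ Finset.range n, ((n : ℝ) * L n) := by simp
    _ ≤ ∏ j ∈ Finset.range n, ((n / (j + 1 : ℕ)) * ((n : ℝ) / (j + 1 : ℕ)) ^ κ *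
        (((j + 1 : ℕ) : ℝ) * L (j + 1 : ℕ))) :=
        Finset.prod_le_prod (fun j _ => mul_nonneg (by positivity)
          (hL.pos (by positivity)).le) h2
    _ = (∏ j ∈ Finset.range n, ((n : ℝ) / (j + 1 : ℕ))) *
        (∏ j ∈ Finset.range n, ((n : ℝ) / (j + 1 : ℕ))) ^ κ * bangWeight L n := by
        rw [Finset.prod_mul_distrib, Finset.prod_mul_distrib,
          Real.finsetProd_rpow _ _ fun j _ => by positivity]
        rfl
    _ ≤ Real.exp 1 ^ n * (Real.exp 1 ^ n) ^ κ * bangWeight L n := by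
        have := (hL.bangWeight_pos n).le
        have := hL.exponent_pos.le
        have h3 : (0 : ℝ) ≤ ∏ j ∈ Finset.range n, ((n : ℝ) / (j + 1 : ℕ)) :=
          Finset.prod_nonneg fun j _ => by positivity
        gcongr
    _ = _ := by
        rw [← Real.exp_nat_mul, ← Real.exp_nat_mul, ← Real.exp_mul, ← Real.exp_add]
        congr 2
        ring

end RegularWeight

/-- One step of Bang's argument: moving by `s ≤ 1 / (e m_N)` costs one unit of the degree of
flatness. -/
theorem bang_step {L : ℝ → ℝ} {κ : ℝ} (hL : RegularWeight L κ) {H : ℕ → ℝ → ℂ} {x s : ℝ} {N : ℕ}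
    (hs : 0 ≤ s) (hd : ∀ n, ∀ y ∈ Icc x (x + s), HasDerivAt (H n) (H (n + 1) y) y)
    (hb : ∀ n, ∀ y ∈ Icc x (x + s), ‖H n y‖ ≤ bangWeight L n)
    (hN : ∀ n, n ≤ N + 1 → ‖H n x‖ ≤ Real.exp ((n : ℝ) - (N + 1 : ℕ)) * bangWeight L n)
    (hsN : s * (Real.exp 1 * (((N + 1 : ℕ) : ℝ) * L (N + 1 : ℕ))) ≤ 1) :
    ∀ n, n ≤ N → ‖H n (x + s)‖ ≤ Real.exp ((n : ℝ) - N) * bangWeight L n := by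
  set m := Real.exp 1 * (((N + 1 : ℕ) : ℝ) * L (N + 1 : ℕ))
  have hm : 0 ≤ m := mul_nonneg (Real.exp_pos _).le
    (mul_nonneg (by positivity) (hL.pos (by positivity)).le)
  have key : ∀ k, ∀ n, n + k = N + 1 → ∀ y ∈ Icc x (x + s),
      ‖H n y‖ ≤ Real.exp ((n : ℝ) - (N + 1 : ℕ)) * bangWeight L n * Real.exp (m * (y - x)) := by
    intro k
    induction k with
    | zero =>
      intro n hn y hy
      rw [add_zero] at hn
      subst hn
      rw [sub_self, Real.exp_zero, one_mul]
      exact (hb _ y hy).trans (le_mul_of_one_le_right (hL.bangWeight_pos _).le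
        (Real.one_le_exp (mul_nonneg hm (by linarith [hy.1]))))
    | succ k ih =>
      intro n hn
      have ih' := ih (n + 1) (by omega)
      refine image_norm_le_of_norm_deriv_right_le_deriv_boundary
        (f' := fun y => H (n + 1) y)
        (B' := fun y => Real.exp ((n : ℝ) - (N + 1 : ℕ)) * bangWeight L n *
          (Real.exp (m * (y - x)) * m))
        (fun y hy => (hd n y hy).continuousAt.continuousWithinAt)
        (fun y hy => (hd n y (Ico_subset_Icc_self hy)).hasDerivWithinAt) ?_ ?_ ?_
      · rw [sub_self, mul_zero, Real.exp_zero, mul_one]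
        exact hN n (by omega)
      · intro y
        have h1 : HasDerivAt (fun y => m * (y - x)) m y := by
          simpa using ((hasDerivAt_id y).sub_const x).const_mul m
        exact h1.exp.const_mul _
      · intro y hy
        refine (ih' y (Ico_subset_Icc_self hy)).trans ?_
        have h2 : ((n + 1 : ℕ) : ℝ) * L (n + 1 : ℕ) ≤ ((N + 1 : ℕ) : ℝ) * L (N + 1 : ℕ) :=
          hL.mul_mono (by omega)
        have h3 := (hL.bangWeight_pos n).le
        have h4 : Real.exp (((n + 1 : ℕ) : ℝ) - (N + 1 : ℕ)) =
            Real.exp ((n : ℝ) - (N + 1 : ℕ)) * Real.exp 1 := by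
          rw [← Real.exp_add]; congr 1; push_cast; ring
        rw [bangWeight_succ, h4]
        calc _ = Real.exp ((n : ℝ) - (N + 1 : ℕ)) * bangWeight L n * Real.exp (m * (y - x)) *
              (Real.exp 1 * (((n + 1 : ℕ) : ℝ) * L (n + 1 : ℕ))) := by ring
          _ ≤ Real.exp ((n : ℝ) - (N + 1 : ℕ)) * bangWeight L n * Real.exp (m * (y - x)) * m := by
              simp only [m]; gcongr
          _ = _ := by ring
  intro n hn
  have h1 := key (N + 1 - n) n (by omega) (x + s) (right_mem_Icc.2 (by linarith))
  rw [add_sub_cancel_left] at h1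
  have h3 := (hL.bangWeight_pos n).le
  calc _ ≤ Real.exp ((n : ℝ) - (N + 1 : ℕ)) * bangWeight L n * Real.exp 1 := by
        refine h1.trans ?_
        gcongr
        linarith
    _ = Real.exp ((n : ℝ) - (N + 1 : ℕ)) * Real.exp 1 * bangWeight L n := by ring
    _ = _ := by rw [← Real.exp_add]; congr 2; push_cast; ring

/-- A function which is flat at `0` and belongs to a quasianalytic class on `[0, b]` vanishes. -/
theorem eq_zero_of_flat {L : ℝ → ℝ} {κ : ℝ} (hL : RegularWeight L κ)
    (hdiv : ¬ Summable fun n : ℕ => (((n + 1 : ℕ) : ℝ) * L (n + 1 : ℕ))⁻¹)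
    {H : ℕ → ℝ → ℂ} {b : ℝ}
    (hd : ∀ n, ∀ y ∈ Icc 0 b, HasDerivAt (H n) (H (n + 1) y) y)
    (hb : ∀ n, ∀ y ∈ Icc 0 b, ‖H n y‖ ≤ bangWeight L n) (h0 : ∀ n, H n 0 = 0)
    {x : ℝ} (hx : x ∈ Icc 0 b) : H 0 x = 0 := by
  set q : ℕ → ℝ := fun n => (Real.exp 1 * (((n + 1 : ℕ) : ℝ) * L (n + 1 : ℕ)))⁻¹
  have hq : ∀ n, 0 < q n := fun n => inv_pos.2 (mul_pos (Real.exp_pos _)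
    (mul_pos (by positivity) (hL.pos (by positivity))))
  have hqdiv : ¬ Summable q := by
    intro h
    refine hdiv ((h.mul_left (Real.exp 1)).congr fun n => ?_)
    simp only [q]
    rw [mul_inv, mul_inv_cancel_left₀ (Real.exp_pos 1).ne']
  have htend := (not_summable_iff_tendsto_nat_atTop_of_nonneg fun n => (hq n).le).1 hqdiv
  -- after `k` steps, starting from the flatness of order `K + k`
  have key : ∀ K k : ℕ, ∀ y ∈ Icc 0 b,
      y ≤ ∑ j ∈ Finset.range (K + k), q j - ∑ j ∈ Finset.range K, q j →
      ∀ n, n ≤ K → ‖H n y‖ ≤ Real.exp ((n : ℝ) - K) * bangWeight L n := by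
    intro K k
    induction k generalizing K with
    | zero =>
      intro y hy hyk n _
      have : y = 0 := le_antisymm (by simpa using hyk) hy.1
      rw [this, h0, norm_zero]
      exact mul_nonneg (Real.exp_pos _).le (hL.bangWeight_pos n).le
    | succ k ih =>
      intro y hy hyk
      set s := min y (q K)
      have hs0 : 0 ≤ s := le_min hy.1 (hq K).le
      have hys : y - s ∈ Icc 0 b := ⟨by linarith [min_le_left y (q K)], by linarith [hy.2]⟩
      have hsub : Icc (y - s) (y - s + s) ⊆ Icc 0 b := by
        rw [sub_add_cancel]
        exact Icc_subset_Icc hys.1 hy.2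
      have hprev := ih (K + 1) (y - s) hys (by
        rw [Finset.sum_range_succ, show K + 1 + k = K + (k + 1) by omega]
        rcases min_choice y (q K) with h | h
        · have h2 : ∑ j ∈ Finset.range (K + 1), q j ≤ ∑ j ∈ Finset.range (K + (k + 1)), q j :=
            Finset.sum_le_sum_of_subset_of_nonneg (Finset.range_mono (by omega))
              fun j _ _ => (hq j).le
          rw [Finset.sum_range_succ] at h2
          simp only [s]
          rw [h]
          linarith
        · simp only [s]
          rw [h]
          linarith)
      have := bang_step hL hs0 (fun n z hz => hd n z (hsub hz)) (fun n z hz => hb n z (hsub hz))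
        hprev (by
          calc s * (Real.exp 1 * (((K + 1 : ℕ) : ℝ) * L (K + 1 : ℕ))) ≤
              q K * (Real.exp 1 * (((K + 1 : ℕ) : ℝ) * L (K + 1 : ℕ))) := by
                refine mul_le_mul_of_nonneg_right (min_le_right _ _) (inv_pos.1 (hq K)).le
            _ = 1 := inv_mul_cancel₀ (inv_pos.1 (hq K)).ne')
      rwa [sub_add_cancel] at this
  have hle : ∀ K : ℕ, ‖H 0 x‖ ≤ Real.exp (-(K : ℝ)) := by
    intro K
    obtain ⟨N, hN, hNK⟩ := ((htend.eventually_ge_atTop (x + ∑ j ∈ Finset.range K, q j)).and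
      (eventually_ge_atTop K)).exists
    obtain ⟨k, rfl⟩ := Nat.exists_eq_add_of_le hNK
    have := key K k x hx (by linarith) 0 (Nat.zero_le _)
    simpa [bangWeight] using this
  have hlim : Tendsto (fun K : ℕ => Real.exp (-(K : ℝ))) atTop (𝓝 0) :=
    Real.tendsto_exp_neg_atTop_nhds_zero.comp tendsto_natCast_atTop_atTop
  exact norm_le_zero_iff.1 (ge_of_tendsto' hlim hle)

/-- For weights of at most logarithmic growth, `∑ 1/(n L(n))` diverges. -/
theorem not_summable_inv_mul {L : ℝ → ℝ} {κ : ℝ} (hL : RegularWeight L κ)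
    (hO : L =O[atTop] Real.log) :
    ¬ Summable fun n : ℕ => (((n + 1 : ℕ) : ℝ) * L (n + 1 : ℕ))⁻¹ := by
  intro hsum
  have hpos : ∀ n : ℕ, 0 < L n := fun n => hL.pos (Nat.cast_nonneg n)
  have h1 : Summable fun n : ℕ => ((n : ℝ) * L n)⁻¹ :=
    (summable_nat_add_iff (f := fun n : ℕ => ((n : ℝ) * L n)⁻¹) 1).1 hsum
  have h2 := (summable_condensed_iff_of_nonneg (f := fun n : ℕ => ((n : ℝ) * L n)⁻¹)
    (fun n => inv_nonneg.2 (mul_nonneg (Nat.cast_nonneg n) (hpos n).le))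
    (fun m n hm hmn => inv_anti₀ (mul_pos (by exact_mod_cast hm) (hpos m))
      (hL.mul_mono hmn))).2 h1
  have h3 : Summable fun k : ℕ => (L ((2 : ℝ) ^ k))⁻¹ := by
    refine h2.congr fun k => ?_
    push_cast
    rw [mul_inv, mul_inv_cancel_left₀ (by positivity)]
  obtain ⟨C, hC0, hC⟩ := hO.exists_pos
  have hpow : Tendsto (fun k : ℕ => (2 : ℝ) ^ k) atTop atTop :=
    tendsto_pow_atTop_atTop_of_one_lt one_lt_two
  have h4 : (fun k : ℕ => ((k : ℝ))⁻¹) =O[atTop] fun k : ℕ => (L ((2 : ℝ) ^ k))⁻¹ := by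
    refine IsBigO.of_bound (C * Real.log 2) ?_
    filter_upwards [hpow.eventually hC.bound, eventually_ge_atTop 1] with k hk hk1
    have hk0 : (0 : ℝ) < k := by exact_mod_cast hk1
    have hl2 : 0 < Real.log 2 := Real.log_pos one_lt_two
    have hLk : 0 < L ((2 : ℝ) ^ k) := hL.pos (by positivity)
    rw [Real.log_pow, Real.norm_of_nonneg hLk.le, Real.norm_of_nonneg (by positivity)] at hk
    rw [norm_inv, norm_inv, Real.norm_of_nonneg hk0.le, Real.norm_of_nonneg hLk.le,
      ← div_eq_mul_inv, le_div_iff₀ hLk, inv_mul_le_iff₀ hk0]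
    linarith
  exact Real.not_summable_natCast_inv (summable_of_isBigO_nat h3 h4)

/-! ### The kernel of the regular transform -/

namespace RegularWeight

/-- The quotient of `γ(m + n + 1)` by `γ(m + 1)`; the exponential factor does not depend on
`m`. -/
theorem gam_add_le {L : ℝ → ℝ} {κ : ℝ} (hL : RegularWeight L κ) (m n : ℕ) :
    gam L ((m : ℝ) + n + 1) ≤ Real.exp (κ * n) * L ((m : ℝ) + n + 1) ^ n * gam L ((m : ℝ) + 1) := by
  have hm : (0 : ℝ) < (m : ℝ) + 1 := by positivity
  have hmn : (m : ℝ) + 1 ≤ (m : ℝ) + n + 1 := by linarith [Nat.cast_nonneg (α := ℝ) n]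
  have h1 : gam L ((m : ℝ) + n + 1) = L ((m : ℝ) + n + 1) ^ n * L ((m : ℝ) + n + 1) ^ (m + 1) := by
    rw [← pow_add, show (m : ℝ) + n + 1 = ((m + n : ℕ) : ℝ) + 1 by push_cast; ring,
      gam_natCast_add_one]
    congr 1
    ring
  have h2 : L ((m : ℝ) + n + 1) ≤ L ((m : ℝ) + 1) * Real.exp (κ * (n / ((m : ℝ) + 1))) := by
    refine (hL.ratio _ _ hm hmn).trans (mul_le_mul_of_nonneg_left ?_ (hL.pos hm.le).le)
    rw [show ((m : ℝ) + n + 1) / (m + 1) = n / (m + 1) + 1 by field_simp; ring, mul_comm κ,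
      Real.exp_mul]
    exact Real.rpow_le_rpow (by positivity) (Real.add_one_le_exp _) hL.exponent_pos.le
  have h3 : L ((m : ℝ) + n + 1) ^ (m + 1) ≤ Real.exp (κ * n) * gam L ((m : ℝ) + 1) := by
    refine (pow_le_pow_left₀ (hL.pos (by positivity)).le h2 _).trans_eq ?_
    rw [mul_pow, ← Real.exp_nat_mul, gam_natCast_add_one, mul_comm]
    congr 2
    push_cast
    field_simp
  rw [h1]
  calc _ ≤ L ((m : ℝ) + n + 1) ^ n * (Real.exp (κ * n) * gam L ((m : ℝ) + 1)) :=
        mul_le_mul_of_nonneg_left h3 (pow_nonneg (hL.pos (by positivity)).le _)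
    _ = _ := by ring

theorem exists_le_mul_exp {L : ℝ → ℝ} {κ : ℝ} (hL : RegularWeight L κ) {η : ℝ} (hη : 0 < η) :
    ∃ C : ℝ, 0 < C ∧ ∀ x, 1 ≤ x → L x ≤ C * Real.exp (η * x) := by
  have hκ := hL.exponent_pos
  refine ⟨L 1 * Real.exp (κ * Real.log (κ / η)), mul_pos (hL.pos zero_le_one) (Real.exp_pos _),
    fun x hx => ?_⟩
  have hx0 : 0 < x := by linarith
  have h := hL.ratio 1 x one_pos hx
  rw [div_one] at h
  refine h.trans ?_
  rw [mul_assoc, ← Real.exp_add, Real.rpow_def_of_pos hx0]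
  refine mul_le_mul_of_nonneg_left (Real.exp_le_exp.2 ?_) (hL.pos zero_le_one).le
  have h1 : Real.log x = Real.log (κ / η) + Real.log (η * x / κ) := by
    rw [← Real.log_mul (by positivity) (by positivity)]
    congr 1
    field_simp
  have h2 := Real.log_le_sub_one_of_pos (show 0 < η * x / κ by positivity)
  have h3 : κ * (η * x / κ) = η * x := by field_simp
  rw [h1]
  nlinarith

end RegularWeight

theorem norm_ofReal_cpow_neg {t : ℝ} (ht : 0 < t) (s : ℂ) : ‖(t : ℂ) ^ (-s)‖ = t ^ (-s.re) := by
  rw [Complex.norm_cpow_eq_rpow_re_of_pos ht, Complex.neg_re]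

/-- The abscissa of the vertical line in the definition of the kernel is irrelevant. -/
theorem kernelK_eq {α : ℕ →₀ ℝ} (hα : IsDenjoyIndex α) (h0 : α 0 = 0) {a b t : ℝ} (ha : 0 < a)
    (hb : 0 < b) (ht : 0 < t) : kernelK α a t = kernelK α b t := by
  wlog hab : a ≤ b generalizing a b
  · exact (this hb ha (le_of_not_ge hab)).symm
  obtain ⟨κ, hL⟩ := exists_regularWeight hα
  obtain ⟨c, hc, h⟩ := exists_norm_denjoyGamma_le hα h0
  obtain ⟨C, hC, h⟩ := h 1 one_pos
  have ht0 : (t : ℂ) ≠ 0 := Complex.ofReal_ne_zero.2 ht.ne'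
  have hdiff : ∀ s : ℂ, a ≤ s.re →
      DifferentiableAt ℂ (fun s => (t : ℂ) ^ (-s) • denjoyGamma α s) s := fun s hs =>
    ((differentiableAt_id.neg).const_cpow (Or.inl ht0)).mul
      (differentiableAt_denjoyGamma α (ha.trans_le hs))
  have hbound : ∀ s : ℂ, a ≤ s.re → s.re ≤ b →
      ‖(t : ℂ) ^ (-s) • denjoyGamma α s‖ ≤ (max t⁻¹ 1) ^ b *
        (C * Real.exp (1 * b) * denjoyWeight α b ^ b) * Real.exp (-c * √|s.im|) := by
    intro s hs hs'
    have hs0 : 0 < s.re := ha.trans_le hs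
    rw [norm_smul, norm_ofReal_cpow_neg ht, mul_assoc]
    refine mul_le_mul ?_ ((h s hs0).trans ?_) (norm_nonneg _) (by positivity)
    · rw [Real.rpow_neg ht.le, ← Real.inv_rpow ht.le]
      exact (Real.rpow_le_rpow (by positivity) (le_max_left _ _) hs0.le).trans
        (Real.rpow_le_rpow_of_exponent_le (le_max_right _ _) hs')
    · refine mul_le_mul_of_nonneg_right ?_ (Real.exp_pos _).le
      refine mul_le_mul ?_ ?_ (hL.gam_pos hs0.le).le (by positivity)
      · gcongr
      · exact (Real.rpow_le_rpow (hL.pos hs0.le).le (hL.mono _ _ hs0.le hs') hs0.le).trans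
          (Real.rpow_le_rpow_of_exponent_le (hL.one_le _ (by linarith)) hs')
  set D := (max t⁻¹ 1) ^ b * (C * Real.exp (1 * b) * denjoyWeight α b ^ b)
  have hint : ∀ σ, a ≤ σ → σ ≤ b →
      Integrable fun y : ℝ => (t : ℂ) ^ (-((σ : ℂ) + y * Complex.I)) •
        denjoyGamma α (σ + y * Complex.I) := by
    intro σ h1 h2
    refine ((integrable_exp_neg_mul_sqrt_abs hc).const_mul D).mono'
      (Continuous.aestronglyMeasurable ?_) (ae_of_all _ fun y => ?_)
    · refine continuous_iff_continuousAt.2 fun y => ?_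
      exact ContinuousAt.comp (f := fun y : ℝ => (σ : ℂ) + y * Complex.I)
        (g := fun s => (t : ℂ) ^ (-s) • denjoyGamma α s)
        (hdiff _ (by simpa using h1)).continuousAt (by fun_prop)
    · have := hbound (σ + y * Complex.I) (by simpa using h1) (by simpa using h2)
      simpa using this
  unfold kernelK mellinInv
  congr 1
  refine integral_vertical_line_eq (f := fun s => (t : ℂ) ^ (-s) • denjoyGamma α s) hab
    (fun s hs _ => hdiff s hs) (g := fun y => D * Real.exp (-c * √y))
    (fun s h1 h2 _ => hbound s h1 h2) ?_ (hint a le_rfl hab) (hint b hab le_rfl)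
  have h1 : Tendsto (fun y : ℝ => c * √y) atTop atTop :=
    Real.tendsto_sqrt_atTop.const_mul_atTop hc
  have h2 := (Real.tendsto_exp_neg_atTop_nhds_zero.comp h1).const_mul D
  simpa [Function.comp_def] using h2

/-- Shifting the line of integration to the abscissa `σ` bounds the kernel by `γ(σ) t ^ (-σ)`,
up to a factor of small exponential growth in `σ`. -/
theorem exists_norm_kernelK_le {α : ℕ →₀ ℝ} (hα : IsDenjoyIndex α) (h0 : α 0 = 0) {c η : ℝ}
    (hc : 0 < c) (hη : 0 < η) :
    ∃ C : ℝ, 0 < C ∧ ∀ σ t : ℝ, 0 < σ → 0 < t →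
      ‖kernelK α c t‖ ≤ C * (t ^ (-σ) * gam (denjoyWeight α) σ * Real.exp (η * σ)) := by
  obtain ⟨κ, hL⟩ := exists_regularWeight hα
  obtain ⟨d, hd, h⟩ := exists_norm_denjoyGamma_le hα h0
  obtain ⟨C, hC, h⟩ := h η hη
  have hJ := integrable_exp_neg_mul_sqrt_abs hd
  set J := ∫ y : ℝ, Real.exp (-d * √|y|)
  have hJ0 : 0 ≤ J := integral_nonneg fun y => (Real.exp_pos _).le
  refine ⟨C * (J + 1), by positivity, fun σ t hσ ht => ?_⟩
  have hg := hL.gam_pos hσ.le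
  rw [kernelK_eq hα h0 hc hσ ht, kernelK, mellinInv, norm_smul]
  have h1 : ‖(1 / (2 * Real.pi) : ℝ)‖ ≤ 1 := by
    rw [Real.norm_of_nonneg (by positivity), div_le_one (by positivity)]
    linarith [Real.pi_gt_three]
  set A := C * (t ^ (-σ) * gam (denjoyWeight α) σ * Real.exp (η * σ))
  have hA : 0 ≤ A := by positivity
  have h2 : ‖∫ y : ℝ, (t : ℂ) ^ (-((σ : ℂ) + y * Complex.I)) •
      denjoyGamma α (σ + y * Complex.I)‖ ≤ A * J := by
    rw [← integral_const_mul]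
    refine norm_integral_le_of_norm_le (hJ.const_mul A) (ae_of_all _ fun y => ?_)
    have h3 := h (σ + y * Complex.I) (by simpa using hσ)
    rw [norm_smul, norm_ofReal_cpow_neg ht]
    simp only [Complex.add_re, Complex.ofReal_re, Complex.mul_re, Complex.I_re, Complex.I_im,
      Complex.ofReal_im, Complex.add_im, Complex.mul_im, mul_zero, mul_one, sub_zero,
      zero_add, add_zero] at h3 ⊢
    calc _ ≤ t ^ (-σ) * _ := mul_le_mul_of_nonneg_left h3 (by positivity)
      _ = _ := by simp only [A]; ring
  calc _ ≤ 1 * (A * J) := by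
        refine mul_le_mul ?_ h2 (norm_nonneg _) zero_le_one
        simpa using h1
    _ ≤ C * (J + 1) * (t ^ (-σ) * gam (denjoyWeight α) σ * Real.exp (η * σ)) := by
        rw [show C * (J + 1) * (t ^ (-σ) * gam (denjoyWeight α) σ * Real.exp (η * σ)) =
          A * (J + 1) by simp only [A]; ring]
        nlinarith

open scoped FourierTransform in
theorem continuous_fourierInv_of_integrable {g : ℝ → ℂ} (hg : Integrable g) :
    Continuous (𝓕⁻ g) := by
  have h : Continuous (𝓕 g) :=
    VectorFourier.fourierIntegral_continuous Real.continuous_fourierChar (by fun_prop) hg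
  have h2 : 𝓕⁻ g = fun x => 𝓕 g (-x) := by
    ext x
    exact Real.fourierInv_eq_fourier_neg g x
  rw [h2]
  exact h.comp continuous_neg

/-- The restriction of `γ` to a vertical line, with the normalisation of the Fourier transform. -/
def gammaLine (α : ℕ →₀ ℝ) (σ y : ℝ) : ℂ := denjoyGamma α (σ + 2 * Real.pi * y * Complex.I)

theorem continuous_gammaLine (α : ℕ →₀ ℝ) {σ : ℝ} (hσ : 0 < σ) : Continuous (gammaLine α σ) := by
  have h := (continuous_denjoyGamma_line α hσ).comp (continuous_const_mul (2 * Real.pi))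
  refine h.congr fun y => ?_
  simp [gammaLine]

theorem integrable_gammaLine {α : ℕ →₀ ℝ} (hα : IsDenjoyIndex α) (h0 : α 0 = 0) {σ : ℝ}
    (hσ : 0 < σ) : Integrable (gammaLine α σ) := by
  obtain ⟨d, hd, h⟩ := exists_norm_denjoyGamma_le hα h0
  obtain ⟨C, hC, h⟩ := h 1 one_pos
  have hJ := (integrable_exp_neg_mul_sqrt_abs hd).comp_mul_left' (R := 2 * Real.pi) (by positivity)
  refine (hJ.const_mul (C * Real.exp (1 * σ) * gam (denjoyWeight α) σ)).mono'
    (continuous_gammaLine α hσ).aestronglyMeasurable (ae_of_all _ fun y => ?_)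
  have h1 := h (σ + 2 * Real.pi * y * Complex.I) (by simpa using hσ)
  simpa [gammaLine] using h1

open scoped FourierTransform in
theorem kernelK_eq_fourierInv {α : ℕ →₀ ℝ} (σ : ℝ) {t : ℝ} (ht : 0 < t) :
    kernelK α σ t = ((t ^ (-σ) : ℝ) : ℂ) * 𝓕⁻ (gammaLine α σ) (-Real.log t) := by
  rw [kernelK, mellinInv_eq_fourierInv _ _ ht, smul_eq_mul, Complex.ofReal_cpow ht.le]
  push_cast
  rfl

theorem continuousOn_kernelK {α : ℕ →₀ ℝ} (hα : IsDenjoyIndex α) (h0 : α 0 = 0) {c : ℝ}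
    (hc : 0 < c) : ContinuousOn (kernelK α c) (Ioi 0) := by
  have h := continuous_fourierInv_of_integrable (integrable_gammaLine hα h0 hc)
  refine ContinuousOn.congr ?_ fun t ht => kernelK_eq_fourierInv c ht
  refine ContinuousOn.mul (Complex.continuous_ofReal.comp_continuousOn
    (continuousOn_id.rpow_const fun t ht => Or.inl (ne_of_gt ht))) ?_
  exact h.comp_continuousOn (Real.continuousOn_log.mono fun t ht => ne_of_gt ht).neg

open scoped FourierTransform in
/-- The moments of the kernel, by Mellin inversion. -/
theorem integral_pow_mul_kernelK {α : ℕ →₀ ℝ} (hα : IsDenjoyIndex α) (h0 : α 0 = 0) {c : ℝ}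
    (hc : 0 < c) (n : ℕ) :
    ∫ t in Ioi (0 : ℝ), (t : ℂ) ^ n * kernelK α c t = (gam (denjoyWeight α) ((n : ℝ) + 1) : ℂ) := by
  set σ : ℝ := (n : ℝ) + 1
  have hσ : 0 < σ := by positivity
  have hint := integrable_gammaLine hα h0 hσ
  have hcont := continuous_fourierInv_of_integrable hint
  have hrepr : ∀ u : ℝ, Real.exp (-σ * u) • kernelK α σ (Real.exp (-u)) =
      𝓕⁻ (gammaLine α σ) u := by
    intro u
    rw [kernelK_eq_fourierInv σ (Real.exp_pos _), Complex.real_smul, ← mul_assoc,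
      ← Complex.ofReal_mul, ← Real.exp_mul, ← Real.exp_add, Real.log_exp, neg_neg,
      show -σ * u + -u * -σ = 0 by ring, Real.exp_zero, Complex.ofReal_one, one_mul]
  have hinv : Integrable (𝓕⁻ (gammaLine α σ)) := by
    obtain ⟨C, hC, hK⟩ := exists_norm_kernelK_le hα h0 hσ one_pos
    -- The abscissas `σ ± σ/2` give decay at both ends.
    set A := C * (gam (denjoyWeight α) (σ / 2) * Real.exp (1 * (σ / 2))) +
      C * (gam (denjoyWeight α) (3 * σ / 2) * Real.exp (1 * (3 * σ / 2)))
    obtain ⟨κ, hL⟩ := exists_regularWeight hα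
    have hg1 := hL.gam_pos (show 0 ≤ σ / 2 by positivity)
    have hg2 := hL.gam_pos (show 0 ≤ 3 * σ / 2 by positivity)
    refine ((integrable_exp_neg_mul_abs (half_pos hσ)).const_mul A).mono'
      hcont.aestronglyMeasurable (ae_of_all _ fun u => ?_)
    rw [← hrepr u, norm_smul, Real.norm_of_nonneg (Real.exp_pos _).le]
    have key : ∀ τ, 0 < τ → -σ * u + u * τ = -(σ / 2) * |u| →
        C * (gam (denjoyWeight α) τ * Real.exp (1 * τ)) ≤ A →
        Real.exp (-σ * u) * ‖kernelK α σ (Real.exp (-u))‖ ≤ A * Real.exp (-(σ / 2) * |u|) := by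
      intro τ hτ he hA
      have h1 := hK τ (Real.exp (-u)) hτ (Real.exp_pos _)
      rw [← Real.exp_mul, neg_mul_neg] at h1
      calc _ ≤ Real.exp (-σ * u) * (C * (Real.exp (u * τ) * gam (denjoyWeight α) τ *
            Real.exp (1 * τ))) := mul_le_mul_of_nonneg_left h1 (Real.exp_pos _).le
        _ = C * (gam (denjoyWeight α) τ * Real.exp (1 * τ)) * Real.exp (-(σ / 2) * |u|) := by
          rw [← he, Real.exp_add]
          ring
        _ ≤ _ := mul_le_mul_of_nonneg_right hA (Real.exp_pos _).le
    rcases le_total 0 u with hu | hu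
    · exact key (σ / 2) (by positivity) (by rw [abs_of_nonneg hu]; ring)
        (le_add_of_nonneg_right (by positivity))
    · exact key (3 * σ / 2) (by positivity) (by rw [abs_of_nonpos hu]; ring)
        (le_add_of_nonneg_left (by positivity))
  have h1 : mellin (kernelK α σ) (σ : ℂ) = gammaLine α σ 0 := by
    rw [mellin_eq_fourier]
    simp only [Complex.ofReal_re, Complex.ofReal_im, zero_div]
    rw [funext hrepr, hint.fourier_fourierInv_eq
      ?_ (continuous_gammaLine α hσ).continuousAt]
    have h2 : 𝓕 (gammaLine α σ) = fun x => 𝓕⁻ (gammaLine α σ) (-x) := by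
      ext x
      rw [Real.fourierInv_eq_fourier_neg, neg_neg]
    rw [h2]
    exact hinv.comp_neg
  have h3 : gammaLine α σ 0 = (gam (denjoyWeight α) σ : ℂ) := by
    rw [gammaLine, Complex.ofReal_zero, mul_zero, zero_mul, add_zero, denjoyGamma_ofReal α hσ.le]
  rw [← h3, ← h1, mellin]
  refine setIntegral_congr_fun measurableSet_Ioi fun t ht => ?_
  simp only [σ]
  rw [kernelK_eq hα h0 hc hσ ht, smul_eq_mul]
  push_cast
  rw [add_sub_cancel_right, Complex.cpow_natCast]

/-- The kernel decays fast enough to be integrable against the growth of functions in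
`A(L; I)`. -/
theorem integrableOn_weightE_mul_kernelK {α : ℕ →₀ ℝ} (hα : IsDenjoyIndex α) (h0 : α 0 = 0)
    {c q : ℝ} (hc : 0 < c) (hq : 0 < q) (hq1 : q < 1) :
    IntegrableOn (fun t => weightE (denjoyWeight α) (q * t) * ‖kernelK α c t‖) (Ioi 0) := by
  obtain ⟨κ, hL⟩ := exists_regularWeight hα
  set L := denjoyWeight α
  have hE : ∀ r : ℝ, weightE L r = (weightEC L (r : ℂ)).re := by
    intro r
    have h : weightEC L (r : ℂ) = ((weightE L r : ℝ) : ℂ) := by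
      rw [weightEC, weightE, Complex.ofReal_tsum]
      push_cast
      rfl
    rw [h, Complex.ofReal_re]
  have hEc : Continuous (weightE L) := by
    rw [funext hE]
    exact Complex.continuous_re.comp
      (hL.differentiable_weightEC.continuous.comp Complex.continuous_ofReal)
  have hmeas : ContinuousOn (fun t => weightE L (q * t) * ‖kernelK α c t‖) (Ioi 0) :=
    (hEc.comp (continuous_const_mul q)).continuousOn.mul (continuousOn_kernelK hα h0 hc).norm
  have hη : 0 < -Real.log q / 4 := by have := Real.log_neg hq hq1; linarith
  set η := -Real.log q / 4
  obtain ⟨C, hC, hK⟩ := exists_norm_kernelK_le hα h0 hc hη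
  obtain ⟨B, hB, hLB⟩ := hL.exists_le_mul_exp hη
  rw [← Ioc_union_Ioi_eq_Ioi (zero_le_one (α := ℝ))]
  refine IntegrableOn.union ?_ ?_
  · have h1 : IntegrableOn (fun t : ℝ => t ^ (-(1 / 2) : ℝ)) (Ioc 0 1) :=
      (intervalIntegrable_iff_integrableOn_Ioc_of_le zero_le_one).1
        (intervalIntegral.intervalIntegrable_rpow' (by norm_num))
    refine Integrable.mono' (h1.const_mul (weightE L 1 * (C * (gam L (1 / 2) *
      Real.exp (η * (1 / 2))))))
      ((hmeas.mono Ioc_subset_Ioi_self).aestronglyMeasurable measurableSet_Ioc) ?_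
    refine (ae_restrict_mem measurableSet_Ioc).mono fun t ht => ?_
    have hg := hL.gam_pos (show (0 : ℝ) ≤ 1 / 2 by norm_num)
    have hqt : 0 ≤ q * t := mul_nonneg hq.le ht.1.le
    rw [Real.norm_of_nonneg (mul_nonneg (hL.weightE_pos hqt).le (norm_nonneg _))]
    have h2 := hK (1 / 2) t (by norm_num) ht.1
    calc _ ≤ weightE L 1 * (C * (t ^ (-(1 / 2) : ℝ) * gam L (1 / 2) * Real.exp (η * (1 / 2)))) :=
          mul_le_mul (hL.weightE_mono hqt (mul_le_one₀ hq1.le ht.1.le ht.2)) h2 (norm_nonneg _)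
            (hL.weightE_pos zero_le_one).le
      _ = _ := by ring
  · have h1 : IntegrableOn (fun t : ℝ => t ^ (-3 : ℝ)) (Ioi 1) :=
      integrableOn_Ioi_rpow_of_lt (by norm_num) one_pos
    -- The `m`-th term of `E` is estimated with the abscissa `m + 3`.
    set D := C * Real.exp (κ * 2) * B ^ 2 * Real.exp (9 * η)
    have hD : 0 < D := by positivity
    have hr : q * Real.exp (3 * η) < 1 := by
      rw [← Real.exp_log hq, ← Real.exp_add, Real.exp_lt_one_iff]
      have h4 : Real.log q = -(4 * η) := by simp only [η]; ring
      rw [h4]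
      linarith
    have hsum := (summable_geometric_of_lt_one (by positivity) hr).mul_left D
    refine Integrable.mono' (h1.const_mul (∑' m : ℕ, D * (q * Real.exp (3 * η)) ^ m))
      ((hmeas.mono (Ioi_subset_Ioi zero_le_one)).aestronglyMeasurable measurableSet_Ioi) ?_
    refine (ae_restrict_mem measurableSet_Ioi).mono fun t ht => ?_
    have ht1 : 1 < t := ht
    have ht0 : 0 < t := by linarith
    have hqt : 0 ≤ q * t := mul_nonneg hq.le ht0.le
    rw [Real.norm_of_nonneg (mul_nonneg (hL.weightE_pos hqt).le (norm_nonneg _)), weightE,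
      ← tsum_mul_right, ← tsum_mul_right]
    refine Summable.tsum_le_tsum (fun m => ?_)
      ((summable_pow_div_gam hL.tendsto (q * t)).mul_right _) (hsum.mul_right _)
    have hg := hL.gam_pos (show (0 : ℝ) ≤ m + 1 by positivity)
    have h2 := hK ((m : ℝ) + 2 + 1) t (by positivity) ht0
    have h3 := hL.gam_add_le m 2
    push_cast at h3
    have h4 := hLB ((m : ℝ) + 2 + 1) (by linarith [Nat.cast_nonneg (α := ℝ) m])
    have h5 : L ((m : ℝ) + 2 + 1) ^ 2 ≤ B ^ 2 * Real.exp (2 * (η * ((m : ℝ) + 2 + 1))) := by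
      refine (pow_le_pow_left₀ (hL.pos (by positivity)).le h4 2).trans_eq ?_
      rw [mul_pow, ← Real.exp_nat_mul]
      norm_num
    have h6 : ‖kernelK α c t‖ ≤ C * (t ^ (-((m : ℝ) + 2 + 1)) * (Real.exp (κ * 2) *
        (B ^ 2 * Real.exp (2 * (η * ((m : ℝ) + 2 + 1)))) * gam L ((m : ℝ) + 1)) *
        Real.exp (η * ((m : ℝ) + 2 + 1))) := by
      refine h2.trans ?_
      have := hL.gam_pos (show (0 : ℝ) ≤ (m : ℝ) + 2 + 1 by positivity)
      gcongr
      exact h3.trans (by gcongr)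
    have h7 : t ^ (-((m : ℝ) + 2 + 1)) = t ^ (-3 : ℝ) / t ^ m := by
      rw [← Real.rpow_natCast, ← Real.rpow_sub ht0]
      congr 1
      ring
    have h8 : Real.exp (2 * (η * ((m : ℝ) + 2 + 1))) * Real.exp (η * ((m : ℝ) + 2 + 1)) =
        Real.exp (9 * η) * Real.exp (3 * η) ^ m := by
      rw [← Real.exp_nat_mul, ← Real.exp_add, ← Real.exp_add]
      congr 1
      ring
    calc _ ≤ (q * t) ^ m / gam L ((m : ℝ) + 1) * (C * (t ^ (-((m : ℝ) + 2 + 1)) *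
          (Real.exp (κ * 2) * (B ^ 2 * Real.exp (2 * (η * ((m : ℝ) + 2 + 1)))) *
          gam L ((m : ℝ) + 1)) * Real.exp (η * ((m : ℝ) + 2 + 1)))) :=
          mul_le_mul_of_nonneg_left h6 (by positivity)
      _ = q ^ m * C * Real.exp (κ * 2) * B ^ 2 * t ^ (-3 : ℝ) *
          (Real.exp (2 * (η * ((m : ℝ) + 2 + 1))) * Real.exp (η * ((m : ℝ) + 2 + 1))) := by
          rw [h7, mul_pow]
          field_simp
      _ = _ := by
          rw [h8, mul_pow]
          simp only [D]
          ring

/-! ### The regular transform -/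

/-- For `β / c < q` the argument `(βt + Y) / c` of `E` is at most `qt` when `t` is large; bounded
`t` and bounded `z` only affect the constant. -/
theorem exists_norm_le_weightE_of_eventually {L : ℝ → ℝ} {κ : ℝ} (hL : RegularWeight L κ)
    {F : ℂ → ℂ} (hF : Continuous F) {β c q Y : ℝ} (hβ : 0 ≤ β) (hc : 0 < c) (hq : 0 < q)
    (hβq : β < q * c) (hY : 0 < Y)
    (h : ∃ C : ℝ, ∀ᶠ u : ℝ in atTop, ∀ v : ℝ, |v| ≤ Y →
      ‖F (u + v * Complex.I)‖ ≤ C * weightE L (u / c)) :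
    ∃ C : ℝ, 0 < C ∧ ∀ t : ℝ, 0 < t → ∀ z : ℂ, 0 ≤ z.re → z.re ≤ β * t + Y → |z.im| ≤ Y →
      ‖F z‖ ≤ C * weightE L (q * t) := by
  obtain ⟨C, hC⟩ := h
  obtain ⟨U, hU⟩ := eventually_atTop.1 hC
  obtain ⟨M, hM⟩ := (isCompact_closedBall (0 : ℂ) (|U| + Y)).exists_bound_of_continuousOn
    hF.continuousOn
  have hM0 : 0 ≤ M := (norm_nonneg _).trans (hM 0 (Metric.mem_closedBall_self (by positivity)))
  have hE0 := hL.weightE_pos le_rfl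
  have hgap : 0 < q * c - β := by linarith
  set T := Y / (q * c - β)
  have hT : 0 ≤ (β * T + Y) / c := by positivity
  have hET := hL.weightE_pos hT
  refine ⟨M / weightE L 0 + |C| * (1 + weightE L ((β * T + Y) / c) / weightE L 0) + 1,
    by positivity, fun t ht z hz0 hz1 hz2 => ?_⟩
  have hqt : 0 ≤ q * t := by positivity
  have hEt : weightE L 0 ≤ weightE L (q * t) := hL.weightE_mono le_rfl hqt
  have hEt0 : 0 < weightE L (q * t) := hE0.trans_le hEt
  have hdiv : ∀ A : ℝ, 0 ≤ A → A ≤ A / weightE L 0 * weightE L (q * t) := fun A hA => by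
    rw [div_mul_eq_mul_div, le_div_iff₀ hE0]
    exact mul_le_mul_of_nonneg_left hEt hA
  rcases le_total z.re U with hzU | hzU
  · have h1 : ‖F z‖ ≤ M := by
      refine hM z (mem_closedBall_zero_iff.2 ((Complex.norm_le_abs_re_add_abs_im z).trans ?_))
      rw [abs_of_nonneg hz0]
      linarith [le_abs_self U]
    have h2 := hdiv M hM0
    have h3 : 0 ≤ (|C| * (1 + weightE L ((β * T + Y) / c) / weightE L 0) + 1) *
        weightE L (q * t) := by positivity
    calc ‖F z‖ ≤ M / weightE L 0 * weightE L (q * t) := h1.trans h2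
      _ ≤ M / weightE L 0 * weightE L (q * t) + _ := le_add_of_nonneg_right h3
      _ = _ := by ring
  · have h1 : ‖F z‖ ≤ |C| * weightE L ((β * t + Y) / c) := by
      have h2 := hU z.re hzU z.im hz2
      rw [Complex.re_add_im] at h2
      refine h2.trans (mul_le_mul (le_abs_self C) (hL.weightE_mono (by positivity) ?_)
        (hL.weightE_pos (by positivity)).le (abs_nonneg _))
      gcongr
    have h2 : weightE L ((β * t + Y) / c) ≤
        weightE L (q * t) + weightE L ((β * T + Y) / c) := by
      rcases le_total t T with htT | htT
      · have : weightE L ((β * t + Y) / c) ≤ weightE L ((β * T + Y) / c) :=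
          hL.weightE_mono (by positivity) (by gcongr)
        linarith
      · have : weightE L ((β * t + Y) / c) ≤ weightE L (q * t) := by
          refine hL.weightE_mono (by positivity) ?_
          rw [div_le_iff₀ hc]
          have := (div_le_iff₀ hgap).1 htT
          linarith
        linarith
    have h3 := hdiv _ hET.le
    have h4 : 0 ≤ (M / weightE L 0 + 1) * weightE L (q * t) := by positivity
    calc ‖F z‖ ≤ |C| * (weightE L (q * t) +
          weightE L ((β * T + Y) / c) / weightE L 0 * weightE L (q * t)) :=
          h1.trans (mul_le_mul_of_nonneg_left (by linarith) (abs_nonneg _))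
      _ ≤ |C| * (weightE L (q * t) +
          weightE L ((β * T + Y) / c) / weightE L 0 * weightE L (q * t)) + _ :=
          le_add_of_nonneg_right h4
      _ = _ := by ring

/-- On strips around the rays through a compact subinterval of `I`, functions in `A(L; I)` are
dominated by `E(qt)` with some `q < 1` independent of the width of the strip. -/
theorem exists_norm_le_weightE {L : ℝ → ℝ} {κ : ℝ} (hL : RegularWeight L κ) {I : Set ℝ}
    (hIo : IsOpen I) (hI0 : (0 : ℝ) ∈ I) {F : ℂ → ℂ}
    (hF : F ∈ entireClass L I) {a b : ℝ} (hab : Icc a b ⊆ I) :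
    ∃ q : ℝ, 0 < q ∧ q < 1 ∧ ∀ Y : ℝ, 0 < Y → ∃ C : ℝ, 0 < C ∧ ∀ x ∈ Icc a b, ∀ t : ℝ, 0 < t →
      ∀ w : ℂ, ‖w‖ ≤ Y → ‖F (((x * t : ℝ) : ℂ) + w)‖ ≤ C * weightE L (q * t) := by
  rcases lt_or_ge b a with h | h
  · refine ⟨1 / 2, by norm_num, by norm_num, fun Y _ => ⟨1, one_pos, fun x hx => ?_⟩⟩
    exact absurd (hx.1.trans hx.2) (not_le.2 h)
  have exists_beyond : ∀ y ∈ I, ∃ u ∈ I, ∃ v ∈ I, u < y ∧ y < v := fun y hy => by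
    obtain ⟨u, v, huv, hsub⟩ := mem_nhds_iff_exists_Ioo_subset.1 (hIo.mem_nhds hy)
    exact ⟨(u + y) / 2, hsub ⟨by linarith [huv.1], by linarith [huv.1, huv.2]⟩, (y + v) / 2,
      hsub ⟨by linarith [huv.1, huv.2], by linarith [huv.2]⟩, by linarith [huv.1],
      by linarith [huv.2]⟩
  have hb0 : max b 0 ∈ I := by
    rcases max_choice b 0 with h1 | h1 <;> rw [h1]
    exacts [hab ⟨h, le_rfl⟩, hI0]
  have ha0 : min a 0 ∈ I := by
    rcases min_choice a 0 with h1 | h1 <;> rw [h1]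
    exacts [hab ⟨le_rfl, h⟩, hI0]
  obtain ⟨_, _, c, hc, _, hbc⟩ := exists_beyond _ hb0
  obtain ⟨d, hd, _, _, hda, _⟩ := exists_beyond _ ha0
  have hb1 : 0 ≤ max b 0 := le_max_right _ _
  have ha1 : min a 0 ≤ 0 := min_le_right _ _
  have hc0 : 0 < c := hb1.trans_lt hbc
  have hd0 : d < 0 := hda.trans_le ha1
  have hq1 : max b 0 / c < 1 := (div_lt_one hc0).2 hbc
  have hq2 : (-min a 0) / (-d) < 1 := (div_lt_one (by linarith)).2 (by linarith)
  set r := max (max b 0 / c) ((-min a 0) / (-d))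
  have hr : r < 1 := max_lt hq1 hq2
  have hr0 : 0 ≤ r := (div_nonneg hb1 hc0.le).trans (le_max_left _ _)
  have hrq : r < (1 + r) / 2 := by linarith
  refine ⟨(1 + r) / 2, by linarith, by linarith, fun Y hY => ?_⟩
  obtain ⟨C₁, hC₁, h₁⟩ := exists_norm_le_weightE_of_eventually hL hF.1.continuous hb1 hc0
    (by linarith) ((div_lt_iff₀ hc0).1 ((le_max_left _ _).trans_lt hrq)) hY (hF.2.1 c hc hc0 Y hY)
  have hneg : ∃ C : ℝ, ∀ᶠ u : ℝ in atTop, ∀ v : ℝ, |v| ≤ Y →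
      ‖(fun z => F (-z)) (u + v * Complex.I)‖ ≤ C * weightE L (u / -d) := by
    obtain ⟨C, hC⟩ := hF.2.2 d hd hd0 Y hY
    refine ⟨C, (tendsto_neg_atTop_atBot.eventually hC).mono fun u hu v hv => ?_⟩
    have h2 := hu (-v) (by rwa [abs_neg])
    rw [neg_div, ← div_neg] at h2
    convert h2 using 3
    push_cast
    ring
  obtain ⟨C₂, hC₂, h₂⟩ := exists_norm_le_weightE_of_eventually hL
    (hF.1.continuous.comp continuous_neg) (neg_nonneg.2 ha1) (neg_pos.2 hd0)
    (by linarith) ((div_lt_iff₀ (by linarith)).1 ((le_max_right _ _).trans_lt hrq)) hY hneg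
  refine ⟨C₁ + C₂, by positivity, fun x hx t ht w hw => ?_⟩
  have hE := hL.weightE_pos (show 0 ≤ (1 + r) / 2 * t by positivity)
  have hre := (Complex.abs_re_le_norm w).trans hw
  have him := (Complex.abs_im_le_norm w).trans hw
  rcases le_total 0 (((x * t : ℝ) : ℂ) + w).re with hz | hz
  · refine (h₁ t ht _ hz ?_ (by simpa using him)).trans ?_
    · have : x * t ≤ max b 0 * t :=
        mul_le_mul_of_nonneg_right (hx.2.trans (le_max_left _ _)) ht.le
      rw [Complex.add_re, Complex.ofReal_re]
      linarith [le_abs_self w.re]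
    · gcongr
      linarith
  · have h3 := h₂ t ht (-(((x * t : ℝ) : ℂ) + w)) (by rw [Complex.neg_re]; linarith) ?_
      (by rw [Complex.neg_im, abs_neg]; simpa using him)
    · rw [Function.comp_apply, neg_neg] at h3
      refine h3.trans ?_
      gcongr
      linarith
    · have : min a 0 * t ≤ x * t :=
        mul_le_mul_of_nonneg_right ((min_le_left _ _).trans hx.1) ht.le
      rw [Complex.neg_re, Complex.add_re, Complex.ofReal_re]
      linarith [neg_abs_le w.re]

/-- Powers of `t` are absorbed by enlarging the argument of `E`, at the cost of `(B L(n))^n`: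
the weights `γ(m + 1)` and `γ(m + n + 1)` differ by `L(m + n + 1)^n` only, and `L` grows slower
than every power. -/
theorem exists_pow_mul_weightE_le {α : ℕ →₀ ℝ} (hα : IsDenjoyIndex α) {q q' : ℝ} (hq : 0 < q)
    (hq' : q < q') :
    ∃ B : ℝ, 0 < B ∧ ∃ C : ℝ, 0 < C ∧ ∀ (n : ℕ) (t : ℝ), 0 < t →
      t ^ n * weightE (denjoyWeight α) (q * t) ≤
        C * (B * denjoyWeight α n) ^ n * weightE (denjoyWeight α) (q' * t) := by
  obtain ⟨κ, hL⟩ := exists_regularWeight hα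
  have hq0 : 0 < q' := hq.trans hq'
  have hp : 0 < Real.log (q' / q) := Real.log_pos ((one_lt_div hq).2 hq')
  set p := Real.log (q' / q)
  have hpq : q * Real.exp p = q' := by
    rw [Real.exp_log (by positivity)]
    field_simp
  obtain ⟨A, hA, hr⟩ := denjoyWeight_ratio_small hα hp
  set L := denjoyWeight α
  have hA0 : 0 < A := by linarith
  refine ⟨Real.exp κ * A / q', by positivity, Real.exp p, Real.exp_pos _, fun n t ht => ?_⟩
  have hqt : 0 ≤ q' * t := by positivity
  rcases Nat.eq_zero_or_pos n with rfl | hn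
  · rw [pow_zero, pow_zero, one_mul, mul_one]
    refine (hL.weightE_mono (by positivity) (by gcongr)).trans
      (le_mul_of_one_le_left (hL.weightE_pos hqt).le (Real.one_le_exp hp.le))
  have hn1 : (1 : ℝ) ≤ n := by exact_mod_cast hn
  have hs := summable_pow_div_gam hL.tendsto (q' * t)
  have hLn := hL.pos (show (0 : ℝ) ≤ n by positivity)
  have htail : ∑' m : ℕ, (q' * t) ^ (m + n) / gam L (((m + n : ℕ) : ℝ) + 1) ≤
      weightE L (q' * t) := by
    rw [weightE, ← hs.sum_add_tsum_nat_add n]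
    refine le_add_of_nonneg_left (Finset.sum_nonneg fun i _ => ?_)
    have := hL.gam_pos (show (0 : ℝ) ≤ i + 1 by positivity)
    positivity
  set D := Real.exp p * (Real.exp κ * A / q' * L n) ^ n
  have hD : 0 ≤ D := by positivity
  refine le_trans ?_ (mul_le_mul_of_nonneg_left htail hD)
  rw [weightE, ← tsum_mul_left, ← tsum_mul_left]
  refine Summable.tsum_le_tsum (fun m => ?_) ((summable_pow_div_gam hL.tendsto _).mul_left _)
    (((summable_nat_add_iff n).2 hs).mul_left D)
  have hg1 := hL.gam_pos (show (0 : ℝ) ≤ (m : ℝ) + 1 by positivity)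
  have hg2 := hL.gam_pos (show (0 : ℝ) ≤ (m : ℝ) + n + 1 by positivity)
  have h1 := hL.gam_add_le m n
  have h2 : L ((m : ℝ) + n + 1) ^ n ≤ (A * L n) ^ n * Real.exp (p * (m + 1)) := by
    have h3 : L ((m : ℝ) + n + 1) ≤ A * L n * Real.exp (p * ((m + 1) / n)) := by
      refine (hr n _ hn1 (by linarith [Nat.cast_nonneg (α := ℝ) m])).trans
        (mul_le_mul_of_nonneg_left ?_ (by positivity))
      rw [show ((m : ℝ) + n + 1) / n = (m + 1) / n + 1 by field_simp; ring, mul_comm p,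
        Real.exp_mul]
      exact Real.rpow_le_rpow (by positivity) (Real.add_one_le_exp _) hp.le
    refine (pow_le_pow_left₀ (hL.pos (by positivity)).le h3 n).trans_eq ?_
    rw [mul_pow, ← Real.exp_nat_mul]
    congr 2
    field_simp
  have h4 : (gam L ((m : ℝ) + 1))⁻¹ ≤ Real.exp (κ * n) *
      ((A * L n) ^ n * Real.exp (p * (m + 1))) * (gam L ((m : ℝ) + n + 1))⁻¹ := by
    rw [inv_le_iff_one_le_mul₀ hg1, mul_assoc, mul_comm (gam L _)⁻¹, ← mul_assoc, ← div_eq_mul_inv,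
      le_div_iff₀ hg2, one_mul]
    refine h1.trans (mul_le_mul_of_nonneg_right ?_ hg1.le)
    exact mul_le_mul_of_nonneg_left h2 (Real.exp_pos _).le
  calc t ^ n * ((q * t) ^ m / gam L ((m : ℝ) + 1))
      = t ^ n * (q * t) ^ m * (gam L ((m : ℝ) + 1))⁻¹ := by ring
    _ ≤ t ^ n * (q * t) ^ m * (Real.exp (κ * n) *
      ((A * L n) ^ n * Real.exp (p * (m + 1))) * (gam L ((m : ℝ) + n + 1))⁻¹) :=
      mul_le_mul_of_nonneg_left h4 (by positivity)
    _ = D * ((q' * t) ^ (m + n) / gam L (((m + n : ℕ) : ℝ) + 1)) := by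
      have h5 : Real.exp (p * (m + 1)) = Real.exp p * Real.exp p ^ m := by
        rw [← Real.exp_nat_mul, ← Real.exp_add]
        congr 1
        ring
      have h6 : Real.exp (κ * n) = Real.exp κ ^ n := by
        rw [← Real.exp_nat_mul, mul_comm]
      have h7 : (q' * t) ^ (m + n) = q ^ m * Real.exp p ^ m * q' ^ n * t ^ (m + n) := by
        rw [mul_pow, pow_add q', ← mul_pow, hpq]
      have h8 : (Real.exp κ * A / q' * L n) ^ n = Real.exp κ ^ n * A ^ n / q' ^ n * L n ^ n := by
        rw [mul_pow, div_pow, mul_pow]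
      rw [h5, h6, h7]
      simp only [D]
      rw [h8, mul_pow q t, mul_pow A, pow_add t]
      push_cast
      field_simp

/-- The integrands of the derivatives of the regular transform satisfy the estimates of the
Beurling class, uniformly up to the integrable factor `E(qt)`. -/
theorem exists_norm_pow_mul_iteratedDeriv_le {α : ℕ →₀ ℝ} (hα : IsDenjoyIndex α) {I : Set ℝ}
    (hIo : IsOpen I) (hI0 : (0 : ℝ) ∈ I) {F : ℂ → ℂ}
    (hF : F ∈ entireClass (denjoyWeight α) I) {a b : ℝ} (hab : Icc a b ⊆ I) :
    ∃ q : ℝ, 0 < q ∧ q < 1 ∧ ∀ δ : ℝ, 0 < δ → ∃ C : ℝ, 0 < C ∧ ∀ n : ℕ, ∀ x ∈ Icc a b,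
      ∀ t : ℝ, 0 < t → ‖(t : ℂ) ^ n * iteratedDeriv n F ((x * t : ℝ) : ℂ)‖ ≤
        C * (δ * n * denjoyWeight α n) ^ n * weightE (denjoyWeight α) (q * t) := by
  obtain ⟨κ, hL⟩ := exists_regularWeight hα
  obtain ⟨q, hq, hq1, h⟩ := exists_norm_le_weightE hL hIo hI0 hF hab
  obtain ⟨B, hB, A, hA, hBA⟩ := exists_pow_mul_weightE_le hα hq (show q < (1 + q) / 2 by linarith)
  refine ⟨(1 + q) / 2, by linarith, by linarith, fun δ hδ => ?_⟩
  -- Cauchy's estimate on circles of radius `B / δ` gains the factor `δ ^ n`.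
  have hY : 0 < B / δ := by positivity
  obtain ⟨C, hC, h⟩ := h (B / δ) hY
  refine ⟨C * A, by positivity, fun n x hx t ht => ?_⟩
  have hE := hL.weightE_pos (show 0 ≤ q * t by positivity)
  have hE' := hL.weightE_pos (show 0 ≤ (1 + q) / 2 * t by positivity)
  have h1 : ‖iteratedDeriv n F ((x * t : ℝ) : ℂ)‖ ≤
      n.factorial * (C * weightE (denjoyWeight α) (q * t)) / (B / δ) ^ n := by
    refine Complex.norm_iteratedDeriv_le_of_forall_mem_sphere_norm_le n hY hF.1.diffContOnCl
      fun z hz => ?_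
    have h2 := h x hx t ht (z - ((x * t : ℝ) : ℂ)) (mem_sphere_iff_norm.1 hz).le
    rwa [add_sub_cancel] at h2
  have h3 : (n.factorial : ℝ) ≤ (n : ℝ) ^ n := by exact_mod_cast Nat.factorial_le_pow n
  have hLn := hL.pos (show (0 : ℝ) ≤ n by positivity)
  rw [norm_mul, norm_pow, Complex.norm_real, Real.norm_of_nonneg ht.le]
  calc _ ≤ t ^ n * ((n : ℝ) ^ n * (C * weightE (denjoyWeight α) (q * t)) / (B / δ) ^ n) := by
        refine mul_le_mul_of_nonneg_left (h1.trans ?_) (by positivity)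
        gcongr
    _ = (n : ℝ) ^ n * C / (B / δ) ^ n * (t ^ n * weightE (denjoyWeight α) (q * t)) := by ring
    _ ≤ (n : ℝ) ^ n * C / (B / δ) ^ n * (A * (B * denjoyWeight α n) ^ n *
        weightE (denjoyWeight α) ((1 + q) / 2 * t)) :=
        mul_le_mul_of_nonneg_left (hBA n t ht) (by positivity)
    _ = _ := by
        rw [mul_pow, mul_pow, mul_pow, div_pow]
        field_simp

theorem contDiffOn_of_hasDerivAt_succ {G : ℕ → ℝ → ℂ} {I : Set ℝ} (hI : IsOpen I)
    (h : ∀ n, ∀ x ∈ I, HasDerivAt (G n) (G (n + 1) x) x) :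
    ContDiffOn ℝ ∞ (G 0) I ∧ ∀ n, ∀ x ∈ I, iteratedDeriv n (G 0) x = G n x := by
  have key : ∀ n, ∀ x ∈ I, iteratedDeriv n (G 0) x = G n x := by
    intro n
    induction n with
    | zero => intro x _; rw [iteratedDeriv_zero]
    | succ n ih =>
      intro x hx
      rw [iteratedDeriv_succ]
      refine (Filter.EventuallyEq.deriv_eq ?_).trans (h n x hx).deriv
      filter_upwards [hI.mem_nhds hx] with y hy using ih y hy
  refine ⟨contDiffOn_of_differentiableOn_deriv fun m _ => ?_, key⟩
  have h1 : EqOn (iteratedDerivWithin m (G 0) I) (G m) I := fun x hx => by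
    rw [iteratedDerivWithin_of_isOpen hI hx, key m x hx]
  exact DifferentiableOn.congr (fun x hx => (h m x hx).differentiableAt.differentiableWithinAt) h1

/-- The integral representing the `n`-th derivative of the regular transform. -/
def regularTransformDeriv (α : ℕ →₀ ℝ) (c : ℝ) (F : ℂ → ℂ) (n : ℕ) (x : ℝ) : ℂ :=
  ∫ t in Ioi (0 : ℝ), (t : ℂ) ^ n * iteratedDeriv n F ((x * t : ℝ) : ℂ) * kernelK α c t

theorem aestronglyMeasurable_regularTransform_integrand {α : ℕ →₀ ℝ} (hα : IsDenjoyIndex α)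
    (h0 : α 0 = 0) {c : ℝ} (hc : 0 < c) {F : ℂ → ℂ} (hF : Differentiable ℂ F) (n : ℕ) (x : ℝ) :
    AEStronglyMeasurable (fun t : ℝ => (t : ℂ) ^ n * iteratedDeriv n F ((x * t : ℝ) : ℂ) *
      kernelK α c t) (volume.restrict (Ioi 0)) := by
  refine ContinuousOn.aestronglyMeasurable ?_ measurableSet_Ioi
  refine ContinuousOn.mul (Continuous.continuousOn ?_) (continuousOn_kernelK hα h0 hc)
  exact (Complex.continuous_ofReal.pow n).mul ((hF.contDiff.continuous_iteratedDeriv n le_top).comp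
    (Complex.continuous_ofReal.comp (continuous_const_mul x)))

theorem integrableOn_regularTransform_integrand {α : ℕ →₀ ℝ} (hα : IsDenjoyIndex α)
    (h0 : α 0 = 0) {c : ℝ} (hc : 0 < c) {I : Set ℝ} (hIo : IsOpen I) (hI0 : (0 : ℝ) ∈ I)
    {F : ℂ → ℂ} (hF : F ∈ entireClass (denjoyWeight α) I) (n : ℕ) {x : ℝ} (hx : x ∈ I) :
    IntegrableOn (fun t : ℝ => (t : ℂ) ^ n * iteratedDeriv n F ((x * t : ℝ) : ℂ) *
      kernelK α c t) (Ioi 0) := by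
  obtain ⟨q, hq, hq1, h⟩ := exists_norm_pow_mul_iteratedDeriv_le hα hIo hI0 hF
    (show Icc x x ⊆ I by simpa using hx)
  obtain ⟨C, hC, h⟩ := h 1 one_pos
  refine ((integrableOn_weightE_mul_kernelK hα h0 hc hq hq1).const_mul
    (C * (1 * n * denjoyWeight α n) ^ n)).mono'
    (aestronglyMeasurable_regularTransform_integrand hα h0 hc hF.1 n x) ?_
  refine (ae_restrict_mem measurableSet_Ioi).mono fun t ht => ?_
  rw [norm_mul, ← mul_assoc]
  exact mul_le_mul_of_nonneg_right (h n x ⟨le_rfl, le_rfl⟩ t ht) (norm_nonneg _)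

theorem hasDerivAt_regularTransformDeriv {α : ℕ →₀ ℝ} (hα : IsDenjoyIndex α)
    (h0 : α 0 = 0) {c : ℝ} (hc : 0 < c) {I : Set ℝ} (hIo : IsOpen I) (hI0 : (0 : ℝ) ∈ I)
    {F : ℂ → ℂ} (hF : F ∈ entireClass (denjoyWeight α) I) (n : ℕ) {x : ℝ} (hx : x ∈ I) :
    HasDerivAt (regularTransformDeriv α c F n) (regularTransformDeriv α c F (n + 1) x) x := by
  obtain ⟨a, b, hxab, hab⟩ : ∃ a b : ℝ, x ∈ Ioo a b ∧ Icc a b ⊆ I := by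
    obtain ⟨r, hr, hsub⟩ := Metric.nhds_basis_closedBall.mem_iff.1 (hIo.mem_nhds hx)
    refine ⟨x - r, x + r, ⟨by linarith, by linarith⟩, ?_⟩
    rwa [← Real.closedBall_eq_Icc]
  obtain ⟨q, hq, hq1, h⟩ := exists_norm_pow_mul_iteratedDeriv_le hα hIo hI0 hF hab
  obtain ⟨C, hC, h⟩ := h 1 one_pos
  refine (hasDerivAt_integral_of_dominated_loc_of_deriv_le (Ioo_mem_nhds hxab.1 hxab.2)
    (Eventually.of_forall fun y =>
      aestronglyMeasurable_regularTransform_integrand hα h0 hc hF.1 n y)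
    (integrableOn_regularTransform_integrand hα h0 hc hIo hI0 hF n hx)
    (F' := fun y t => (t : ℂ) ^ (n + 1) * iteratedDeriv (n + 1) F ((y * t : ℝ) : ℂ) *
      kernelK α c t)
    (aestronglyMeasurable_regularTransform_integrand hα h0 hc hF.1 (n + 1) x)
    ((ae_restrict_mem measurableSet_Ioi).mono fun t ht y hy => ?_)
    ((integrableOn_weightE_mul_kernelK hα h0 hc hq hq1).const_mul
      (C * (1 * (n + 1 : ℕ) * denjoyWeight α (n + 1 : ℕ)) ^ (n + 1)))
    (ae_of_all _ fun t y _ => ?_)).2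
  · rw [norm_mul, ← mul_assoc]
    exact mul_le_mul_of_nonneg_right (h (n + 1) y ⟨hy.1.le, hy.2.le⟩ t ht) (norm_nonneg _)
  · have h1 : HasDerivAt (iteratedDeriv n F) (iteratedDeriv (n + 1) F ((y * t : ℝ) : ℂ))
        ((y * t : ℝ) : ℂ) := by
      rw [iteratedDeriv_succ]
      exact ((hF.1.contDiff.differentiable_iteratedDeriv (n := ω) n
        (WithTop.coe_lt_top _)) _).hasDerivAt
    have h2 : HasDerivAt (fun y : ℝ => ((y * t : ℝ) : ℂ)) (t : ℂ) y := by
      have := ((hasDerivAt_id y).mul_const t).ofReal_comp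
      simpa using this
    have h3 := ((HasDerivAt.comp y h1 h2).const_mul ((t : ℂ) ^ n)).mul_const (kernelK α c t)
    exact h3.congr_deriv (by ring)

theorem regularTransformDeriv_zero (α : ℕ →₀ ℝ) (c : ℝ) (F : ℂ → ℂ) :
    regularTransformDeriv α c F 0 = regularTransform α c F := by
  ext x
  simp [regularTransformDeriv, regularTransform]

theorem regularTransform_mem_beurlingClass {α : ℕ →₀ ℝ} (hα : IsDenjoyIndex α)
    (h0 : α 0 = 0) {c : ℝ} (hc : 0 < c) {I : Set ℝ} (hIo : IsOpen I) (hI0 : (0 : ℝ) ∈ I)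
    {F : ℂ → ℂ} (hF : F ∈ entireClass (denjoyWeight α) I) :
    regularTransform α c F ∈ beurlingClass (denjoyWeight α) I := by
  obtain ⟨h1, h2⟩ := contDiffOn_of_hasDerivAt_succ hIo fun n x hx =>
    hasDerivAt_regularTransformDeriv hα h0 hc hIo hI0 hF n hx
  rw [regularTransformDeriv_zero] at h1 h2
  refine ⟨h1, fun a b hab δ hδ => ?_⟩
  obtain ⟨q, hq, hq1, h⟩ := exists_norm_pow_mul_iteratedDeriv_le hα hIo hI0 hF hab
  obtain ⟨C, hC, h⟩ := h δ hδ
  have hint := integrableOn_weightE_mul_kernelK hα h0 hc hq hq1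
  set J := ∫ t in Ioi (0 : ℝ), weightE (denjoyWeight α) (q * t) * ‖kernelK α c t‖
  obtain ⟨κ, hL⟩ := exists_regularWeight hα
  have hJ : 0 ≤ J := setIntegral_nonneg measurableSet_Ioi fun t ht =>
    mul_nonneg (hL.weightE_pos (mul_nonneg hq.le (mem_Ioi.1 ht).le)).le (norm_nonneg _)
  refine ⟨C * (J + 1), by positivity, fun n x hx => ?_⟩
  have hLn := hL.pos (show (0 : ℝ) ≤ n by positivity)
  set D := C * (δ * n * denjoyWeight α n) ^ n
  have hD : 0 ≤ D := by positivity
  have h3 : ‖regularTransformDeriv α c F n x‖ ≤ D * J := by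
    rw [← integral_const_mul]
    refine norm_integral_le_of_norm_le (hint.const_mul D)
      ((ae_restrict_mem measurableSet_Ioi).mono fun t ht => ?_)
    rw [norm_mul, ← mul_assoc]
    exact mul_le_mul_of_nonneg_right (h n x hx t ht) (norm_nonneg _)
  rw [h2 n x (hab hx)]
  calc _ ≤ D * J := h3
    _ ≤ D * (J + 1) := by nlinarith
    _ = _ := by simp only [D]; ring

/-- The regular transform is a right inverse of the singular transform: the moments of the
kernel cancel the weights `1 / γ(n + 1)`. -/
theorem singularTransform_regularTransform {α : ℕ →₀ ℝ} (hα : IsDenjoyIndex α)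
    (h0 : α 0 = 0) {c : ℝ} (hc : 0 < c) {I : Set ℝ} (hIo : IsOpen I) (hI0 : (0 : ℝ) ∈ I)
    {F : ℂ → ℂ} (hF : F ∈ entireClass (denjoyWeight α) I) :
    singularTransform (denjoyWeight α) (regularTransform α c F) = F := by
  obtain ⟨_, h2⟩ := contDiffOn_of_hasDerivAt_succ hIo fun n x hx =>
    hasDerivAt_regularTransformDeriv hα h0 hc hIo hI0 hF n hx
  rw [regularTransformDeriv_zero] at h2
  obtain ⟨κ, hL⟩ := exists_regularWeight hα
  ext z
  rw [← Complex.taylorSeries_eq_of_entire' 0 z hF.1]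
  refine tsum_congr fun n => ?_
  have h3 : regularTransformDeriv α c F n 0 =
      iteratedDeriv n F 0 * (gam (denjoyWeight α) ((n : ℝ) + 1) : ℂ) := by
    rw [← integral_pow_mul_kernelK hα h0 hc n, regularTransformDeriv, ← integral_const_mul]
    congr 1
    ext t
    rw [zero_mul, Complex.ofReal_zero]
    ring
  have hg : (gam (denjoyWeight α) ((n : ℝ) + 1) : ℂ) ≠ 0 :=
    Complex.ofReal_ne_zero.2 (hL.gam_pos (by positivity)).ne'
  rw [singularTerm, h2 n 0 hI0, h3, sub_zero]
  field_simp

/-! ### Injectivity of the singular transform -/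

theorem iteratedDeriv_zero_eq_of_singularTransform_eq {L : ℝ → ℝ} {κ : ℝ}
    (hL : RegularWeight L κ) {I : Set ℝ} (hI0 : (0 : ℝ) ∈ I) {f g : ℝ → ℂ}
    (hf : f ∈ beurlingClass L I) (hg : g ∈ beurlingClass L I)
    (h : singularTransform L f = singularTransform L g) (n : ℕ) :
    iteratedDeriv n f 0 = iteratedDeriv n g 0 := by
  have hseries : ∀ f ∈ beurlingClass L I, HasFPowerSeriesAt (singularTransform L f)
      (FormalMultilinearSeries.ofScalars ℂ fun n : ℕ =>
        iteratedDeriv n f 0 / (n.factorial : ℂ) / (gam L ((n : ℝ) + 1) : ℂ)) 0 := by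
    intro f hf
    refine hasFPowerSeriesAt_iff.2 (Eventually.of_forall fun z => ?_)
    rw [zero_add]
    refine (summable_singularTerm hL hI0 hf z).hasSum.congr_fun fun n => ?_
    rw [FormalMultilinearSeries.coeff_ofScalars, singularTerm, smul_eq_mul, mul_comm]
  have h1 := (hseries f hf).eq_formalMultilinearSeries (h ▸ hseries g hg)
  have h2 := congrArg (fun p => p.coeff n) h1
  have hg : (gam L ((n : ℝ) + 1) : ℂ) ≠ 0 :=
    Complex.ofReal_ne_zero.2 (hL.gam_pos (by positivity)).ne'
  have hn : (n.factorial : ℂ) ≠ 0 := Nat.cast_ne_zero.2 n.factorial_ne_zero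
  simp only [FormalMultilinearSeries.coeff_ofScalars] at h2
  exact (div_left_inj' hn).1 ((div_left_inj' hg).1 h2)

theorem eq_of_singularTransform_eq_of_nonneg {L : ℝ → ℝ} {κ : ℝ} (hL : RegularWeight L κ)
    (hO : L =O[atTop] Real.log) {I : Set ℝ} (hIo : IsOpen I) (hIc : I.OrdConnected)
    (hI0 : (0 : ℝ) ∈ I) {f g : ℝ → ℂ} (hf : f ∈ beurlingClass L I) (hg : g ∈ beurlingClass L I)
    (h : singularTransform L f = singularTransform L g) {x : ℝ} (hx : x ∈ I) (hx0 : 0 ≤ x) :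
    f x = g x := by
  have hsub : Icc 0 x ⊆ I := hIc.out hI0 hx
  -- With this `δ` the bounds of the Beurling class are below Bang's weights.
  obtain ⟨A, hA, hfA⟩ := hf.2 0 x hsub (Real.exp (-(1 + κ))) (Real.exp_pos _)
  obtain ⟨B, hB, hgB⟩ := hg.2 0 x hsub (Real.exp (-(1 + κ))) (Real.exp_pos _)
  have hAB : 0 < A + B := by positivity
  have hW : ∀ n : ℕ, (Real.exp (-(1 + κ)) * n * L n) ^ n ≤ bangWeight L n := by
    intro n
    rw [mul_assoc, mul_pow]
    calc _ ≤ Real.exp (-(1 + κ)) ^ n * (Real.exp (1 + κ) ^ n * bangWeight L n) :=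
          mul_le_mul_of_nonneg_left (hL.pow_le_bangWeight n) (by positivity)
      _ = bangWeight L n := by
          rw [← mul_assoc, ← mul_pow, ← Real.exp_add, neg_add_cancel, Real.exp_zero, one_pow,
            one_mul]
  have hzero := eq_zero_of_flat hL (not_summable_inv_mul hL hO) (b := x)
    (H := fun n y => (iteratedDeriv n f y - iteratedDeriv n g y) / ((A + B : ℝ) : ℂ))
    (fun n y hy => ((hasDerivAt_iteratedDeriv_of_contDiffOn hIo hf.1 n (hsub hy)).sub
      (hasDerivAt_iteratedDeriv_of_contDiffOn hIo hg.1 n (hsub hy))).div_const _)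
    (fun n y hy => ?_)
    (fun n => by
      simp only [iteratedDeriv_zero_eq_of_singularTransform_eq hL hI0 hf hg h n, sub_self,
        zero_div])
    ⟨hx0, le_rfl⟩
  · simp only [iteratedDeriv_zero] at hzero
    exact sub_eq_zero.1 ((div_eq_zero_iff.1 hzero).resolve_right
      (Complex.ofReal_ne_zero.2 hAB.ne'))
  · rw [norm_div, Complex.norm_real, Real.norm_of_nonneg hAB.le, div_le_iff₀ hAB]
    calc _ ≤ A * _ + B * _ := (norm_sub_le _ _).trans (add_le_add (hfA n y hy) (hgB n y hy))
      _ = (Real.exp (-(1 + κ)) * n * L n) ^ n * (A + B) := by ring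
      _ ≤ _ := mul_le_mul_of_nonneg_right (hW n) hAB.le

/-- The singular transform determines all derivatives at `0`, hence the function, since the
Beurling class is quasianalytic. -/
theorem eqOn_of_singularTransform_eq {L : ℝ → ℝ} {κ : ℝ} (hL : RegularWeight L κ)
    (hO : L =O[atTop] Real.log) {I : Set ℝ} (hIo : IsOpen I) (hIc : I.OrdConnected)
    (hI0 : (0 : ℝ) ∈ I) {f g : ℝ → ℂ} (hf : f ∈ beurlingClass L I) (hg : g ∈ beurlingClass L I)
    (h : singularTransform L f = singularTransform L g) : EqOn f g I := by
  intro x hx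
  rcases le_total 0 x with hx0 | hx0
  · exact eq_of_singularTransform_eq_of_nonneg hL hO hIo hIc hI0 hf hg h hx hx0
  · have h1 := eq_of_singularTransform_eq_of_nonneg hL hO hIo.neg (ordConnected_neg hIc)
      (by simpa using hI0) (comp_neg_mem_beurlingClass hf) (comp_neg_mem_beurlingClass hg)
      (by
        ext z
        rw [singularTransform_comp_neg, singularTransform_comp_neg, h])
      (x := -x) (by simpa using hx) (neg_nonneg.2 hx0)
    simpa using h1

end

end BorelMap

open BorelMap in
theorem corollary1 (α : ℕ →₀ ℝ) (hα : IsDenjoyIndex α)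
    (I : Set ℝ) (hIo : IsOpen I) (hIc : I.OrdConnected) (hI0 : (0 : ℝ) ∈ I) :
    -- the series defining the singular transform converges everywhere
    (∀ f ∈ beurlingClass (denjoyWeight α) I, ∀ z : ℂ,
      Summable (singularTerm (denjoyWeight α) f z)) ∧
    -- at most logarithmic growth
    (denjoyWeight α =O[atTop] Real.log →
      (∀ f ∈ beurlingClass (denjoyWeight α) I,
        singularTransform (denjoyWeight α) f ∈ entireClass (denjoyWeight α) I) ∧
      (∀ f ∈ beurlingClass (denjoyWeight α) I, ∀ g ∈ beurlingClass (denjoyWeight α) I,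
        singularTransform (denjoyWeight α) f = singularTransform (denjoyWeight α) g →
          EqOn f g I) ∧
      (∀ F ∈ entireClass (denjoyWeight α) I, ∃ f ∈ beurlingClass (denjoyWeight α) I,
        singularTransform (denjoyWeight α) f = F) ∧
      (∀ c : ℝ, 0 < c → ∀ f ∈ beurlingClass (denjoyWeight α) I, ∀ x ∈ I,
        IntegrableOn (fun t : ℝ =>
          singularTransform (denjoyWeight α) f ((x * t : ℝ) : ℂ) * kernelK α c t)
          (Ioi (0 : ℝ)) ∧
        regularTransform α c (singularTransform (denjoyWeight α) f) x = f x)) ∧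
    -- super-logarithmic growth
    (Real.log =o[atTop] denjoyWeight α →
      ∀ f ∈ beurlingClass (denjoyWeight α) I,
        singularTransform (denjoyWeight α) f ∈
          entireClass (fun ρ => 1 / eps (denjoyWeight α) ρ) univ) := by
  obtain ⟨κ, hL⟩ := exists_regularWeight hα
  refine ⟨fun f hf z => summable_singularTerm hL hI0 hf z, fun hO => ?_,
    fun ho f hf => singularTransform_mem_entireClass_inv_eps hα ho hIo hIc hI0 hf⟩
  have h0 := index_zero_of_isBigO_log hα hO
  refine ⟨fun f hf => singularTransform_mem_entireClass hα hO hIo hIc hI0 hf,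
    fun f hf g hg h => eqOn_of_singularTransform_eq hL hO hIo hIc hI0 hf hg h,
    fun F hF => ⟨regularTransform α 1 F,
      regularTransform_mem_beurlingClass hα h0 one_pos hIo hI0 hF,
      singularTransform_regularTransform hα h0 one_pos hIo hI0 hF⟩,
    fun c hc f hf x hx => ?_⟩
  have hF := singularTransform_mem_entireClass hα hO hIo hIc hI0 hf
  constructor
  · have h1 := integrableOn_regularTransform_integrand hα h0 hc hIo hI0 hF 0 hx
    simpa only [pow_zero, one_mul, iteratedDeriv_zero] using h1
  · exact eqOn_of_singularTransform_eq hL hO hIo hIc hI0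
      (regularTransform_mem_beurlingClass hα h0 hc hIo hI0 hF) hf
      (singularTransform_regularTransform hα h0 hc hIo hI0 hF) hx
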